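/- **Regret of VO$Q$L for linear MDPs.** **Setting.** An episodic MDP with horizon $H\ge1$, measurable state space $\mathcal X$, compact Polish action space $\mathcal A$, has transition kernels $P^h$, rewards $r^h=r^h(x,a,x')\in[0,1]$ $(1\le h\le H)$ and an initial distribution $\mu_0$. From every level and state, the total reward of the remaining levels is at most $1$ almost surely, whatever actions are taken. $V_\star^h,Q_\star^h$ are the optimal value functions. Put $\mathcal T^hV(x,a)=\mathbb E[r^h+V(x^{h+1})\mid x,a]$ and $\mathcal T_2^hV(x,a)=\mathbb E[(r^h+V(x^{h+1}))^2\mid x,a]$. The MDP is *linear* with features $\phi^h:\mathcal X\times\mathcal A\to\mathbb R^d$ (measurable, continuous in $a$, $\|\phi^h\|\le1$) and radii $B^h$: there are a vector measure $\mu^h$ and $\theta^h\in\mathbb R^d$ with $P^h(S\mid x,a)=\langle\phi^h(x,a),\mu^h(S)\rangle$, $\mathbb E[r^h\mid x,a]=\langle\phi^h(x,a),\theta^h\rangle$ and $\|\mu^h(\mathcal X)\|+\|\theta^h\|\le B^h$. Let $\mathcal F^h_{\rm lin}=\{\langle w,\phi^h\rangle:\|w\|\le B^h\}$. Assume that all members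 of $\mathcal F^h_{\rm lin}$ are bounded by $B$ in absolute value, and that $\mathcal F_{\rm lin}$ is *complete*: for every $h$, $\mathcal F^h_{\rm lin}$ contains $\mathcal T^hV$ for all measurable $V:\mathcal X\to[0,2]$, $\mathcal T_2^hV$ for all measurable $V:\mathcal X\to[0,1]$, and $Q_\star^h$. **Algorithm.** Let $T\ge1$, $0<\epsilon_c\le\frac1{8HT^2}$ and $0<\delta<\frac1{T+H^2+11}$. Let $\mathcal F^h\subseteq\mathcal F^h_{\rm lin}$ be a finite sup-norm $\epsilon_c$-cover of $\mathcal F^h_{\rm lin}$ with $\log|\mathcal F^h|\le C_0\,d\log(1+B^h/\epsilon_c)$. Put $\ell=\log\big(2+\frac{dTH\max_hB^h}{\delta\epsilon_c}\big)$, $\lambda=1$, $\alpha=\sqrt{1/(TH)}$, $\mathcal N=\max_h|\mathcal F^h|$, $\log\mathcal N_b=\kappa d^2\ell$, $\delta'=\frac{\delta}{(T+1)(H+1)}$ and $u_t=\kappa_u\,\ell^2d^3H^{5/2}/\sqrt t$. With $L_\alpha=(2\log\frac{4BT}\alpha+2)(\log\frac{8B}{\alpha^2}+2)$ and $L_m=(2\log(mBT)+2)(\log(mB)+2)$,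 let $$\upsilon=\sqrt{\log\tfrac{\mathcal N^2L_\alpha}{\delta'}},\quad \iota=3\sqrt{\log\tfrac{\mathcal N\mathcal N_bL_\alpha}{\delta'}},\quad \dot\iota=\sqrt{2\log\tfrac{\mathcal N\mathcal N_bL_{18}}{\delta'}},\quad \bar\iota=\sqrt{2\log\tfrac{\mathcal N\mathcal N_bL_{32}}{\delta'}},$$ $$\beta_1=\kappa\Big(\sqrt{6\sqrt\lambda+156}\sqrt{\log\tfrac{\mathcal N^2(T+1)(H+1)L_\alpha}{\delta}}+\sqrt{8TB\epsilon_c/\alpha^2}\Big),$$ $$\beta_2=\kappa\sqrt{2(24B+21)\dot\iota^2+20TB\epsilon_c},\qquad \bar\beta=\kappa\sqrt{8(11B+9)\bar\iota^2+32TB\epsilon_c}.$$ For data $z_1,\dots,z_{t-1}$ and weights $\sigma_s$ at level $h$, let $\Sigma=\frac{\lambda}{4(B^h)^2}I+\sum_{s<t}\sigma_s^{-2}\phi^h(z_s)\phi^h(z_s)^\top$, let the elliptical bonus be $b(z)=\|\phi^h(z)\|_{\Sigma^{-1}}\sqrt{\beta^2+\lambda}$, and let $$D^2(z)=\sup_{f,g\in\mathcal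 F^h}\frac{(f(z)-g(z))^2}{\sum_{s<t}\sigma_s^{-2}(f(z_s)-g(z_s))^2+\lambda}.$$ Write $f(x)=\max_af(x,a)$, and let all functions be $0$ at level $H+1$. Before episode $t$, for $h=H,\dots,1$, VO$Q$L performs least squares over $\mathcal F^h$ on the data $z_s^h=(x_s^h,a_s^h)$, $s<t$, minimizing $\sum_{s<t}w_s(f(z_s^h)-y_s)^2$. It takes $\hat f_{t,1}^h$ (weights $w_s=(\bar\sigma_s^h)^{-2}$, targets $r_s^h+f_{t,1}^{h+1}(x_s^{h+1})$) and, with weights $1$, $\hat f_{t,2}^h$, $\hat f_{t,-2}^h$ (targets $r_s^h+f_{t,2}^{h+1}(x_s^{h+1})$ and $r_s^h+f_{t,-2}^{h+1}(x_s^{h+1})$) and $\hat g_t^h$ (targets $(r_s^h+f_{t,1}^{h+1}(x_s^{h+1}))^2$). With bonuses $b_{t,1}^h$ (weights $\bar\sigma_s^h$, radius $\beta_1$) and $b_{t,2}^h$ (weights $1$, radius $\beta_2$), $$f_{t,1}^h=\min\{\hat f_{t,1}^h+b_{t,1}^h+\epsilon_c,1\},\quad f_{t,2}^h=\min\{\hat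 f_{t,2}^h+2b_{t,1}^h+b_{t,2}^h+3\epsilon_c,2\},\quad f_{t,-2}^h=\max\{\hat f_{t,-2}^h-b_{t,2}^h-\epsilon_c,0\}.$$ In episode $t$, at level $h$, it plays an action maximizing $f_{t,1}^h(x_t^h,\cdot)$ if $f_{t,1}^{k}(x_t^{k})\ge f_{t,2}^{k}(x_t^{k})-u_t$ for all $k\le h$, and one maximizing $f_{t,2}^h(x_t^h,\cdot)$ otherwise; ties, in minimizers and maximizers, are broken in any way that depends measurably on the observed past. Then, with $D$ and $\bar D$ computed at $z_t^h$ from the past data with weights $1$ and $\bar\sigma_s^h$ respectively, $(\sigma_1^h)^2=4$ and, for $t\ge2$, $$(\sigma_t^h)^2=\min\Big\{4,\ \hat g_t^h(z_t^h)-\hat f_{t,-2}^h(z_t^h)^2+D\big(\sqrt{\bar\beta^2+\lambda}+2B\sqrt{\beta_2^2+\lambda}\big)+2(1+B)\epsilon_c\Big\}$$ ($\sigma_t^h:=0$ if the right side is negative), and for $t\ge1$ $$\bar\sigma_t^h=\max\Big\{\sigma_t^h,\ \alpha,\ \sqrt2\,\iota\sqrt{f_{t,2}^h(z_t^h)-f_{t,-2}^h(z_t^h)},\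 2(\sqrt\upsilon+\iota)\sqrt{\bar D}\Big\}.$$ The regret is $R_T=\sum_{t=1}^T\big(\mathbb E_{x\sim\mu_0}V_\star^1(x)-\mathbb E[\sum_hr_t^h\mid\text{history before episode }t]\big)$. **Theorem.** There is an absolute constant $k$ such that, for all $B,C_0$, for every sufficiently large $\kappa$ (depending on $B,C_0$) and every sufficiently large $\kappa_u$ (depending on $B,C_0,\kappa$), there is a constant $C$ depending only on $B,C_0,\kappa,\kappa_u$, such that in every situation as above $$\mathbb E R_T\le C\,\ell^k\big(d\sqrt{HT}+d^6H^5\big),$$ and also $R_T\le C\,\ell^k\big(d\sqrt{HT}+d^6H^5\big)$ with probability at least $1-\delta$. -/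

import Mathlib

open MeasureTheory ProbabilityTheory

open scoped Matrix

namespace VOQL

noncomputable section

/-! ## Episodic Markov decision processes

Levels and episodes are counted from `0`: level `h` runs over `0, …, H - 1` (the state reached after
the last action is the one at level `H`) and episode `t` over `0, …, T - 1`. -/

/-- A reward budget: with `n` steps to go, at level `h`, in state `x`, having collected `s` so far,
the total reward is at most `1` almost surely, whatever actions are taken. -/
def RewardBudget {X A : Type*} [MeasurableSpace X] [MeasurableSpace A]
    (P : ℕ → Kernel (X × A) X) (r : ℕ → X × A → X → ℝ) : ℕ → ℕ → X → ℝ → Prop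
  | 0, _, _, s => s ≤ 1
  | n + 1, h, x, s =>
      ∀ a : A, ∀ᵐ x' ∂(P h (x, a)), RewardBudget P r n (h + 1) x' (s + r h (x, a) x')

/-- A time-inhomogeneous episodic MDP with horizon `H`, transition kernels `P h`, rewards
`r h (x, a) x' ∈ [0, 1]`, initial state distribution `init`, and total reward in `[0, 1]` under
every way of acting. -/
structure MDP (X A : Type*) [MeasurableSpace X] [MeasurableSpace A] where
  H : ℕ
  P : ℕ → Kernel (X × A) X
  markov : ∀ h, IsMarkovKernel (P h)
  r : ℕ → X × A → X → ℝ
  measurable_r : ∀ h, Measurable (Function.uncurry (r h))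
  r_mem : ∀ h z x', r h z x' ∈ Set.Icc (0 : ℝ) 1
  init : Measure X
  prob_init : IsProbabilityMeasure init
  sparse : ∀ h, h ≤ H → ∀ x, RewardBudget P r (H - h) h x 0

section Values

variable {X A : Type*} [MeasurableSpace X] [MeasurableSpace A] (M : MDP X A)

/-- Bellman operator: `(𝒯 V)(x, a) = 𝔼[r + V(x') | x, a]` at level `h`. -/
def bellman (h : ℕ) (V : X → ℝ) (z : X × A) : ℝ :=
  ∫ x', (M.r h z x' + V x') ∂(M.P h z)

/-- Second moment operator: `(𝒯₂ V)(x, a) = 𝔼[(r + V(x'))² | x, a]` at level `h`. -/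
def bellmanSq (h : ℕ) (V : X → ℝ) (z : X × A) : ℝ :=
  ∫ x', (M.r h z x' + V x') ^ 2 ∂(M.P h z)

/-- A (deterministic, measurable, nonstationary) policy. -/
def Policy (X A : Type*) [MeasurableSpace X] [MeasurableSpace A] : Type _ :=
  {π : ℕ → X → A // ∀ h, Measurable (π h)}

/-- Expected reward of the policy `π` over the `n` steps that start at level `h` in state `x`. -/
def policyValue (π : Policy X A) : ℕ → ℕ → X → ℝ
  | 0, _, _ => 0
  | n + 1, h, x => bellman M h (policyValue π n (h + 1)) (x, π.1 h x)

/-- `V_π^h`. -/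
def Vpi (π : Policy X A) (h : ℕ) (x : X) : ℝ := policyValue M π (M.H - h) h x

/-- `Q_π^h`. -/
def Qpi (π : Policy X A) (h : ℕ) (z : X × A) : ℝ := bellman M h (Vpi M π (h + 1)) z

/-- The optimal value function `V_⋆^h = sup_π V_π^h`. -/
def Vstar (h : ℕ) (x : X) : ℝ := ⨆ π : Policy X A, Vpi M π h x

/-- The optimal action value function `Q_⋆^h = sup_π Q_π^h`. -/
def Qstar (h : ℕ) (z : X × A) : ℝ := ⨆ π : Policy X A, Qpi M π h z

/-- `ε`-completeness of the function classes `F h`. The first moment condition ranges over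
`[0, 2]`-valued functions, since the overly optimistic regression targets take values in `[0, 2]`;
the targets of the second moment regression take values in `[0, 1]`. -/
def Complete (F : ℕ → Set (X × A → ℝ)) (ε : ℝ) : Prop :=
  ∀ h < M.H,
    (∀ V : X → ℝ, Measurable V → (∀ x, V x ∈ Set.Icc (0 : ℝ) 2) →
      ∃ f ∈ F h, ∀ z, |f z - bellman M h V z| ≤ ε) ∧
    (∀ V : X → ℝ, Measurable V → (∀ x, V x ∈ Set.Icc (0 : ℝ) 1) →
      ∃ f ∈ F h, ∀ z, |f z - bellmanSq M h V z| ≤ ε) ∧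
    (∃ f ∈ F h, ∀ z, |f z - Qstar M h z| ≤ ε)

end Values

section LinearMDP

variable {X A : Type*} [MeasurableSpace X] [MeasurableSpace A] {d : ℕ}

/-- `M` is a linear MDP for the features `φ`, with norm bounds `Bh h`. -/
structure IsLinear [TopologicalSpace A] (M : MDP X A)
    (φ : ℕ → X × A → EuclideanSpace ℝ (Fin d)) (Bh : ℕ → ℝ) : Prop where
  measurable_φ : ∀ h, Measurable (φ h)
  continuous_φ : ∀ h x, Continuous fun a => φ h (x, a)
  norm_φ : ∀ h z, ‖φ h z‖ ≤ 1
  linear : ∀ h < M.H, ∃ (μ : VectorMeasure X (EuclideanSpace ℝ (Fin d)))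
      (θ : EuclideanSpace ℝ (Fin d)),
    (∀ z (S : Set X), MeasurableSet S → (M.P h z).real S = inner ℝ (φ h z) (μ S)) ∧
    (∀ z, ∫ x', M.r h z x' ∂(M.P h z) = inner ℝ (φ h z) θ) ∧
    ‖μ Set.univ‖ + ‖θ‖ ≤ Bh h

/-- The linear class `{⟨w, φ^h(·)⟩ : ‖w‖ ≤ B^h}`. -/
def linClass (φ : ℕ → X × A → EuclideanSpace ℝ (Fin d)) (Bh : ℕ → ℝ) (h : ℕ) :
    Set (X × A → ℝ) :=
  {f | ∃ w : EuclideanSpace ℝ (Fin d), ‖w‖ ≤ Bh h ∧ ∀ z, f z = inner ℝ w (φ h z)}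

/-- `F` is a finite `ε`-cover, in the sup norm and by members of the class, of `G`. -/
def IsCover (G : Set (X × A → ℝ)) (ε : ℝ) (F : Finset (X × A → ℝ)) : Prop :=
  (F : Set (X × A → ℝ)) ⊆ G ∧ ∀ g ∈ G, ∃ f ∈ F, ∀ z, |g z - f z| ≤ ε

end LinearMDP

/-! ## The algorithm -/

/-- The input of VOQL in the linear case: number of episodes `T`, horizon `H`, features, radii `Bh`,
a bound `B` on the absolute values of the functions, finite classes `F h`, confidence `δ`, covering accuracy `ε`, and the
constants `κ` (in the confidence radii and in the size of the bonus class) and `κu` (in the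
exploration threshold). -/
structure Config (X A : Type*) (d : ℕ) where
  T : ℕ
  H : ℕ
  φ : ℕ → X × A → EuclideanSpace ℝ (Fin d)
  Bh : ℕ → ℝ
  B : ℝ
  F : ℕ → Finset (X × A → ℝ)
  δ : ℝ
  ε : ℝ
  κ : ℝ
  κu : ℝ

namespace Config

variable {X A : Type*} {d : ℕ} (c : Config X A d)

/-- The largest of the radii `B^h`. -/
def maxB : ℝ := ⨆ h : Fin c.H, c.Bh h

/-- The quantity whose powers are the polylogarithmic factors:
`log (2 + d T H max_h B^h / (δ ε))`. -/
def logFactor : ℝ := Real.log (2 + (d * c.T * c.H : ℝ) * c.maxB / (c.δ * c.ε))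

/-- The regularization `λ = 1`. -/
def lam : ℝ := 1

/-- `α = √(1 / (T H))`. -/
def α : ℝ := Real.sqrt (1 / (c.T * c.H))

/-- `𝒩`, the largest cardinality of the classes. -/
def N : ℝ := (((Finset.range c.H).sup fun h => (c.F h).card : ℕ) : ℝ)

/-- `𝒩_b`, the size of the class of bonuses: its logarithm is of order `d²` up to logarithms. -/
def Nb : ℝ := Real.exp (c.κ * d ^ 2 * c.logFactor)

def δ' : ℝ := c.δ / ((c.T + 1) * (c.H + 1))

def υ : ℝ :=
  Real.sqrt (Real.log (c.N ^ 2 * (2 * Real.log (4 * c.B * c.T / c.α) + 2) *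
    (Real.log (8 * c.B / c.α ^ 2) + 2) / c.δ'))

def ι : ℝ :=
  3 * Real.sqrt (Real.log (c.N * c.Nb * (2 * Real.log (4 * c.B * c.T / c.α) + 2) *
    (Real.log (8 * c.B / c.α ^ 2) + 2) / c.δ'))

def ιdot : ℝ :=
  Real.sqrt (2 * Real.log (c.N * c.Nb * (2 * Real.log (18 * c.B * c.T) + 2) *
    (Real.log (18 * c.B) + 2) / c.δ'))

def ιsq : ℝ :=
  Real.sqrt (2 * Real.log (c.N * c.Nb * (2 * Real.log (32 * c.B * c.T) + 2) *
    (Real.log (32 * c.B) + 2) / c.δ'))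

/-- Radius of the weighted regression for the optimistic functions. -/
def β₁ : ℝ :=
  c.κ * (Real.sqrt (6 * Real.sqrt lam + 156) *
    Real.sqrt (Real.log (c.N ^ 2 * (c.T + 1) * (c.H + 1) *
      (2 * Real.log (4 * c.B * c.T / c.α) + 2) * (Real.log (8 * c.B / c.α ^ 2) + 2) / c.δ))
    + Real.sqrt (8 * c.T * c.B / c.α ^ 2 * c.ε))

/-- Radius of the unweighted regressions for the overly optimistic and pessimistic functions. -/
def β₂ : ℝ :=
  c.κ * Real.sqrt (2 * (24 * c.B + 21) * c.ιdot ^ 2 + 20 * c.T * c.B * c.ε)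

/-- Radius of the unweighted second moment regression. -/
def βbar : ℝ :=
  c.κ * Real.sqrt (8 * (11 * c.B + 9) * c.ιsq ^ 2 + 32 * c.T * c.B * c.ε)

/-- Exploration threshold of the episode with index `t`, the `(t + 1)`-st one. -/
def u (t : ℕ) : ℝ :=
  c.κu * c.logFactor ^ 2 * (d : ℝ) ^ 3 * (c.H : ℝ) ^ (5 / 2 : ℝ) /
    Real.sqrt (t + 1)

/-- `Σ = λ / (4 (B^h)²) I + ∑_s σ_s⁻² φ^h(z_s) φ^h(z_s)ᵀ`. -/
def gram (h : ℕ) {n : ℕ} (zs : Fin n → X × A) (σ : Fin n → ℝ) : Matrix (Fin d) (Fin d) ℝ :=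
  (lam / (4 * c.Bh h ^ 2)) • (1 : Matrix (Fin d) (Fin d) ℝ) +
    ∑ s, (1 / σ s ^ 2) •
      Matrix.vecMulVec (WithLp.ofLp (c.φ h (zs s))) (WithLp.ofLp (c.φ h (zs s)))

/-- The elliptical bonus `‖φ^h(z)‖_{Σ⁻¹} √(β² + λ)`. -/
def bonus (h : ℕ) {n : ℕ} (zs : Fin n → X × A) (σ : Fin n → ℝ) (β : ℝ) (z : X × A) : ℝ :=
  Real.sqrt (WithLp.ofLp (c.φ h z) ⬝ᵥ ((c.gram h zs σ)⁻¹ *ᵥ WithLp.ofLp (c.φ h z))) *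
    Real.sqrt (β ^ 2 + lam)

/-- `D_{F^h}(z; z_{[n]}, σ_{[n]})`. -/
def eluderD (h : ℕ) {n : ℕ} (zs : Fin n → X × A) (σ : Fin n → ℝ) (z : X × A) : ℝ :=
  Real.sqrt (⨆ p : c.F h × c.F h, (p.1.1 z - p.2.1 z) ^ 2 /
    (∑ s, 1 / σ s ^ 2 * (p.1.1 (zs s) - p.2.1 (zs s)) ^ 2 + lam))

/-- `f` minimizes over `F^h` the weighted square loss for the inputs `zs` and targets `y`. -/
def IsRegression (h : ℕ) {n : ℕ} (zs : Fin n → X × A) (σ y : Fin n → ℝ) (f : X × A → ℝ) : Prop :=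
  f ∈ c.F h ∧ ∀ g ∈ c.F h,
    ∑ s, 1 / σ s ^ 2 * (f (zs s) - y s) ^ 2 ≤ ∑ s, 1 / σ s ^ 2 * (g (zs s) - y s) ^ 2

end Config

/-- What happens in a run: states `x t h`, actions `a t h`, and the regression solutions computed
before episode `t` (optimistic, overly optimistic, overly pessimistic, second moment). -/
structure Transcript (X A : Type*) where
  x : ℕ → ℕ → X
  a : ℕ → ℕ → A
  fhat₁ : ℕ → ℕ → X × A → ℝ
  fhat₂ : ℕ → ℕ → X × A → ℝ
  fhatNeg : ℕ → ℕ → X × A → ℝ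
  ghat : ℕ → ℕ → X × A → ℝ

namespace Transcript

variable {X A : Type*} {d : ℕ} (c : Config X A d) (D : Transcript X A)

/-- The state-action pair `z_t^h`. -/
def z (t h : ℕ) : X × A := (D.x t h, D.a t h)

/-- The pairs `z_s^h`, `s < t`, seen before episode `t`. -/
def past (t h : ℕ) : Fin t → X × A := fun s => D.z s h

/-- `b_{t,2}^h`, from the unweighted data. -/
def b₂ (t h : ℕ) (z : X × A) : ℝ := c.bonus h (D.past t h) (fun _ => 1) c.β₂ z

/-- `f_{t,-2}^h`. -/
def fNeg (t h : ℕ) (z : X × A) : ℝ := max (D.fhatNeg t h z - D.b₂ c t h z - c.ε) 0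

/-- The variance estimate `σ_t^h`. -/
def sigma (t h : ℕ) : ℝ :=
  if t = 0 then 2 else
    Real.sqrt (min 4 (D.ghat t h (D.z t h) - D.fhatNeg t h (D.z t h) ^ 2
      + c.eluderD h (D.past t h) (fun _ => 1) (D.z t h) *
        (Real.sqrt (c.βbar ^ 2 + Config.lam) + 2 * c.B * Real.sqrt (c.β₂ ^ 2 + Config.lam))
      + 2 * (1 + c.B) * c.ε))

/-- `f_{t,2}^h`, when the weights of the earlier episodes are `w`. -/
def f₂Of (t h : ℕ) (w : Fin t → ℝ) (z : X × A) : ℝ :=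
  min (D.fhat₂ t h z + 2 * c.bonus h (D.past t h) w c.β₁ z + D.b₂ c t h z + 3 * c.ε) 2

/-- `σ̄_t^h`, when the weights of the earlier episodes are `w`. -/
def weightOf (t h : ℕ) (w : Fin t → ℝ) : ℝ :=
  max (max (D.sigma c t h) c.α)
    (max (Real.sqrt 2 * c.ι *
        Real.sqrt (D.f₂Of c t h w (D.z t h) - D.fNeg c t h (D.z t h)))
      (2 * (Real.sqrt c.υ + c.ι) * Real.sqrt (c.eluderD h (D.past t h) w (D.z t h))))

/-- The regression weights `σ̄_t^h`, by recursion on the episode. -/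
def sigmaBar (h t : ℕ) : ℝ :=
  D.weightOf c t h fun s : Fin t => sigmaBar h s
termination_by t
decreasing_by exact s.2

/-- `b_{t,1}^h`, from the weighted data. -/
def b₁ (t h : ℕ) (z : X × A) : ℝ :=
  c.bonus h (D.past t h) (fun s => D.sigmaBar c h s) c.β₁ z

/-- `f_{t,1}^h`. -/
def f₁ (t h : ℕ) (z : X × A) : ℝ := min (D.fhat₁ t h z + D.b₁ c t h z + c.ε) 1

/-- `f_{t,2}^h`. -/
def f₂ (t h : ℕ) (z : X × A) : ℝ := D.f₂Of c t h (fun s => D.sigmaBar c h s) z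

/-- `f(x) = max_a f(x, a)` at the levels below `H`, and `0` at level `H`. -/
def maxVal (f : ℕ → ℕ → X × A → ℝ) (t h : ℕ) (x : X) : ℝ :=
  if h < c.H then ⨆ a, f t h (x, a) else 0

/-- The greedy choice so far follows `f_{t,1}`: the gap between `f_{t,2}` and `f_{t,1}` has been at
most `u_t` at every state visited in episode `t` up to level `h`. -/
def GapSmall (t h : ℕ) : Prop :=
  ∀ k ≤ h, maxVal c (D.f₂ c) t k (D.x t k) - c.u t ≤ maxVal c (D.f₁ c) t k (D.x t k)

/-- The transcript is one of VOQL: the regressions and the actions are those of the algorithm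
(minimizers and maximizers may be chosen in any way). -/
structure IsVOQL [MeasurableSpace X] [MeasurableSpace A] (M : MDP X A) : Prop where
  regression₁ : ∀ t < c.T, ∀ h < c.H,
    c.IsRegression h (D.past t h) (fun s => D.sigmaBar c h s)
      (fun s => M.r h (D.z s h) (D.x s (h + 1)) + maxVal c (D.f₁ c) t (h + 1) (D.x s (h + 1)))
      (D.fhat₁ t h)
  regression₂ : ∀ t < c.T, ∀ h < c.H,
    c.IsRegression h (D.past t h) (fun _ => 1)
      (fun s => M.r h (D.z s h) (D.x s (h + 1)) + maxVal c (D.f₂ c) t (h + 1) (D.x s (h + 1)))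
      (D.fhat₂ t h)
  regressionNeg : ∀ t < c.T, ∀ h < c.H,
    c.IsRegression h (D.past t h) (fun _ => 1)
      (fun s => M.r h (D.z s h) (D.x s (h + 1)) + maxVal c (D.fNeg c) t (h + 1) (D.x s (h + 1)))
      (D.fhatNeg t h)
  regressionSq : ∀ t < c.T, ∀ h < c.H,
    c.IsRegression h (D.past t h) (fun _ => 1)
      (fun s => (M.r h (D.z s h) (D.x s (h + 1)) +
        maxVal c (D.f₁ c) t (h + 1) (D.x s (h + 1))) ^ 2)
      (D.ghat t h)
  greedy₁ : ∀ t < c.T, ∀ h < c.H, D.GapSmall c t h →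
    ∀ a, D.f₁ c t h (D.x t h, a) ≤ D.f₁ c t h (D.z t h)
  greedy₂ : ∀ t < c.T, ∀ h < c.H, ¬ D.GapSmall c t h →
    ∀ a, D.f₂ c t h (D.x t h, a) ≤ D.f₂ c t h (D.z t h)

end Transcript

/-! ## Interaction with the MDP and regret -/

section Interaction

variable {X A Ω : Type*} [MeasurableSpace X] [MeasurableSpace A] {d : ℕ}

/-- The information available before episode `t`: the states of all earlier episodes (actions and
rewards are functions of them). -/
abbrev histBefore (H : ℕ) (D : Ω → Transcript X A) (t : ℕ) : MeasurableSpace Ω :=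
  ⨆ s ∈ Set.Iio t, ⨆ k ∈ Set.Iic H,
    MeasurableSpace.comap (fun ω => (D ω).x s k) inferInstance

/-- The information available in episode `t` when the state at level `h` has been seen. -/
abbrev hist (H : ℕ) (D : Ω → Transcript X A) (t h : ℕ) : MeasurableSpace Ω :=
  histBefore H D t ⊔ ⨆ k ∈ Set.Iic h,
    MeasurableSpace.comap (fun ω => (D ω).x t k) inferInstance

/-- `D` is VOQL, with the configuration `c`, interacting with `M` on the probability space
`(Ω, Pr)`: regressions and actions are functions of the information available, initial states are
fresh samples from `M.init`, and given the past the next state has law `P^h(· | x_t^h, a_t^h)`. -/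
structure IsRun [MeasurableSpace Ω] (M : MDP X A) (c : Config X A d) (Pr : Measure Ω)
    (D : Ω → Transcript X A) : Prop where
  horizon : c.H = M.H
  isVOQL : ∀ ω, (D ω).IsVOQL c M
  measurable_x : ∀ t < c.T, ∀ h ≤ c.H, Measurable fun ω => (D ω).x t h
  adapted_a : ∀ t < c.T, ∀ h < c.H, Measurable[hist c.H D t h] fun ω => (D ω).a t h
  adapted₁ : ∀ t < c.T, ∀ h < c.H, ∀ z, Measurable[histBefore c.H D t] fun ω => (D ω).fhat₁ t h z
  adapted₂ : ∀ t < c.T, ∀ h < c.H, ∀ z, Measurable[histBefore c.H D t] fun ω => (D ω).fhat₂ t h z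
  adaptedNeg : ∀ t < c.T, ∀ h < c.H, ∀ z,
    Measurable[histBefore c.H D t] fun ω => (D ω).fhatNeg t h z
  adaptedSq : ∀ t < c.T, ∀ h < c.H, ∀ z, Measurable[histBefore c.H D t] fun ω => (D ω).ghat t h z
  initial : ∀ t < c.T, ∀ S : Set X, MeasurableSet S →
    condExp (histBefore c.H D t) Pr (fun ω => S.indicator (fun _ => (1 : ℝ)) ((D ω).x t 0))
      =ᵐ[Pr] fun _ => M.init.real S
  transition : ∀ t < c.T, ∀ h < c.H, ∀ S : Set X, MeasurableSet S →
    condExp (hist c.H D t h) Pr (fun ω => S.indicator (fun _ => (1 : ℝ)) ((D ω).x t (h + 1)))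
      =ᵐ[Pr] fun ω => (M.P h ((D ω).z t h)).real S

/-- The regret over `T` episodes: in each episode, the optimal expected reward minus the expected
reward of the exploration rule used, given everything observed before the episode. -/
def regret [MeasurableSpace Ω] (M : MDP X A) (Pr : Measure Ω) (D : Ω → Transcript X A) (T : ℕ) :
    Ω → ℝ := fun ω =>
  ∑ t ∈ Finset.range T, ((∫ x, Vstar M 0 x ∂M.init) -
    condExp (histBefore M.H D t) Pr
      (fun ω' => ∑ h ∈ Finset.range M.H, M.r h ((D ω').z t h) ((D ω').x t (h + 1))) ω)

end Interaction

end

end VOQL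

/-! All randomness is confined to finitely many families of martingale deviation bounds; on the
event where they hold, the rest is deterministic.

Concentration. The targets of the regressions use value functions computed from the same data, so
the deviation bounds are taken uniformly over a finite net of possible value functions. Such a
function is determined by a member of the finite class and two inverse Gram matrices, and rounding
the matrix entries gives a net of logarithmic size `d²` up to logarithms (`exists_cover`). A union
bound over the net costs a squared radius of order `d²` for the unweighted regressions
(`conf_unweighted`). The weighted regression must do better. Its noise is split into the fluctuation
of `r + V⋆`, a fixed function that needs no net, and that of `V - V⋆`, which needs the net but whose
conditional variance is, by the choice of the weights, smaller than the squared weight by a factor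
of order `d²`. The squared radius is then of order `d` (`conf_weighted`).

Optimism. An induction forwards over episodes and backwards over levels (`optimism`) shows that
pessimistic ≤ optimal ≤ optimistic ≤ overly optimistic values, and that the variance estimates
dominate the true variances. The weight of episode `s` must control the regression errors of all
later episodes `t`. This works because the optimistic value of episode `t` lies below the overly
optimistic value of every earlier episode `s`, so the width `f₂ - fNeg` seen at `s` bounds the later
errors.

Regret. Up to a term of order `H`, the regret is at most twice the sum of the gaps `V⋆ - Q⋆` along
the run (`condExp_sum_gap`, `measure_regret_le`). Telescoping bounds this sum by a martingale of
order `√(TH)`, the sum of the bonuses `b₁`, and the sum of the bonuses `b₂` over the steps where the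
overly optimistic functions are followed (`dsum_gap_le`). Up to logarithms and lower order terms:
(1) each episode that switches to the overly optimistic functions pays at least the threshold `u`,
so only a fraction `1/(d²H)` of the episodes switches (`bad_le`, `bad_episodes_le`), and the larger
bonuses `b₂` are affordable there; (2) by Cauchy–Schwarz and the elliptical potential lemma the
bonuses `b₁` sum to `d √(H ∑ σ̄²)`; (3) the true variances sum to `O(T)` rather than `O(TH)`,
because the total reward is at most one (`dsum_varOpt_le`); the other parts of the weights are
widths and eluder quantities, whose sums involve `∑ σ̄²` again, but with a small enough factor to be
absorbed. Hence `∑ σ̄²` is at most `T + d¹⁰H⁷` (`sum_weights_le`), and `sum_gaps_le` concludes.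

The bound in expectation follows from the one in probability because the regret is at most `T` and
`δT ≤ 1`. -/

open scoped ENNReal

namespace VOQL

/-! ## Exponential supermartingales -/

section Supermartingale

variable {Ω X : Type*} {m mΩ : MeasurableSpace Ω} [mX : MeasurableSpace X]

/-- Given the information `m`, the exponential of `Y` has conditional mean at most `1`. -/
def ExpSuper (μ : Measure Ω) (m : MeasurableSpace Ω) (Y : Ω → ℝ) : Prop :=
  ∀ Z : Ω → ℝ≥0∞, Measurable[m] Z →
    ∫⁻ ω, Z ω * ENNReal.ofReal (Real.exp (Y ω)) ∂μ ≤ ∫⁻ ω, Z ω ∂μ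

/-- The exponential of the partial sum is known when the next term is drawn, so it can be absorbed
into the test weight `Z`; this is why `ExpSuper` quantifies over all weights. Working in `ℝ≥0∞`
removes every integrability question. -/
theorem ExpSuper.sum {μ : Measure Ω} {m : ℕ → MeasurableSpace Ω} {Y : ℕ → Ω → ℝ} (n : ℕ)
    (hm : ∀ i < n, m i ≤ m (i + 1)) (hY : ∀ i < n, Measurable[m (i + 1)] (Y i))
    (h : ∀ i < n, ExpSuper μ (m i) (Y i)) :
    Measurable[m n] (fun ω => ∑ i ∈ Finset.range n, Y i ω) ∧
      m 0 ≤ m n ∧ ExpSuper μ (m 0) (fun ω => ∑ i ∈ Finset.range n, Y i ω) := by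
  induction n with
  | zero => exact ⟨by simp, le_rfl, fun Z _ => by simp⟩
  | succ n ih =>
    obtain ⟨h1, h2, h3⟩ := ih (fun i hi => hm i (by omega)) (fun i hi => hY i (by omega))
      (fun i hi => h i (by omega))
    have hmn := hm n (by omega)
    refine ⟨?_, h2.trans hmn, fun Z hZ => ?_⟩
    · simp only [Finset.sum_range_succ]
      exact Measurable.add (h1.mono hmn le_rfl) (hY n (by omega))
    · have hZ' : Measurable[m n]
          (fun ω => Z ω * ENNReal.ofReal (Real.exp (∑ i ∈ Finset.range n, Y i ω))) :=
        (hZ.mono h2 le_rfl).mul (Real.measurable_exp.comp h1).ennreal_ofReal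
      refine le_trans (le_of_eq ?_) ((h n (by omega) _ hZ').trans (h3 Z hZ))
      congr 1; ext ω
      simp only [Finset.sum_range_succ]
      rw [Real.exp_add, ENNReal.ofReal_mul (Real.exp_pos _).le, mul_assoc]

/-- Markov's inequality for the exponential, with the weight `Z = 1`. -/
theorem ExpSuper.measure_le {μ : Measure Ω} [IsProbabilityMeasure μ]
    {Y : Ω → ℝ} (hY : Measurable Y) (h : ExpSuper μ m Y) (L : ℝ) :
    μ {ω | L ≤ Y ω} ≤ ENNReal.ofReal (Real.exp (-L)) := by
  have h1 : ∫⁻ ω, ENNReal.ofReal (Real.exp (Y ω)) ∂μ ≤ 1 := by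
    simpa using h (fun _ => 1) measurable_const
  have h2 := mul_meas_ge_le_lintegral₀ (μ := μ)
    (f := fun ω => ENNReal.ofReal (Real.exp (Y ω))) (Real.measurable_exp.comp hY).ennreal_ofReal.aemeasurable
    (ENNReal.ofReal (Real.exp L))
  have h3 : {ω | L ≤ Y ω} ⊆
      {ω | ENNReal.ofReal (Real.exp L) ≤ ENNReal.ofReal (Real.exp (Y ω))} := fun ω hω =>
    ENNReal.ofReal_le_ofReal (Real.exp_le_exp.2 hω)
  have h4 : ENNReal.ofReal (Real.exp L) * μ {ω | L ≤ Y ω} ≤ 1 :=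
    (mul_le_mul_right (measure_mono h3) _).trans (h2.trans h1)
  rw [Real.exp_neg, ENNReal.ofReal_inv_of_pos (Real.exp_pos _)]
  rw [ENNReal.le_inv_iff_mul_le, mul_comm]
  exact h4

/-- Bernstein's exponential inequality for a bounded centred variable. -/
theorem lintegral_exp_sub_sq_le_one {ν : Measure X} [IsProbabilityMeasure ν] {g : X → ℝ}
    (hg : Measurable g) (hb : ∀ x, |g x| ≤ 1) (h0 : ∫ x, g x ∂ν = 0) {v : ℝ}
    (hv : ∫ x, g x ^ 2 ∂ν ≤ v) :
    ∫⁻ x, ENNReal.ofReal (Real.exp (g x - v)) ∂ν ≤ 1 := by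
  have hi : Integrable g ν := Integrable.of_bound hg.aestronglyMeasurable 1
    (Filter.Eventually.of_forall fun x => by simpa using hb x)
  have hi2 : Integrable (fun x => g x ^ 2) ν := Integrable.of_bound
    (by fun_prop) 1 (Filter.Eventually.of_forall fun x => by
      have := hb x
      rw [Real.norm_eq_abs, abs_pow]
      exact pow_le_one₀ (abs_nonneg _) this)
  -- This is `e^y ≤ 1 + y + y²` for `|y| ≤ 1`: the variance enters the compensator with constant
  -- one.
  have hle : ∀ x, Real.exp (g x - v) ≤ Real.exp (-v) * (1 + g x + g x ^ 2) := fun x => by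
    have := abs_le.1 (Real.abs_exp_sub_one_sub_id_le (hb x))
    rw [sub_eq_neg_add, Real.exp_add]
    exact mul_le_mul_of_nonneg_left (by linarith) (Real.exp_pos _).le
  have hint : Integrable (fun x => Real.exp (-v) * (1 + g x + g x ^ 2)) ν :=
    (((integrable_const 1).add hi).add hi2).const_mul _
  calc ∫⁻ x, ENNReal.ofReal (Real.exp (g x - v)) ∂ν
      ≤ ∫⁻ x, ENNReal.ofReal (Real.exp (-v) * (1 + g x + g x ^ 2)) ∂ν :=
        lintegral_mono fun x => ENNReal.ofReal_le_ofReal (hle x)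
    _ = ENNReal.ofReal (∫ x, Real.exp (-v) * (1 + g x + g x ^ 2) ∂ν) :=
        (ofReal_integral_eq_lintegral_ofReal hint (Filter.Eventually.of_forall fun x =>
          (Real.exp_pos _).le.trans (hle x))).symm
    _ ≤ 1 := by
        have h2 : ∫ x, (1 + g x + g x ^ 2) ∂ν = 1 + ∫ x, g x ^ 2 ∂ν := by
          rw [integral_add (f := fun x => 1 + g x) ((integrable_const 1).add hi) hi2,
            integral_add (integrable_const 1) hi, h0]
          simp
        rw [integral_const_mul, h2]
        rw [← ENNReal.ofReal_one]
        apply ENNReal.ofReal_le_ofReal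
        have h1 : 1 + ∫ x, g x ^ 2 ∂ν ≤ Real.exp v := by
          have := Real.add_one_le_exp v
          linarith
        calc Real.exp (-v) * (1 + ∫ x, g x ^ 2 ∂ν) ≤ Real.exp (-v) * Real.exp v :=
              mul_le_mul_of_nonneg_left h1 (Real.exp_pos _).le
          _ = 1 := by rw [← Real.exp_add]; simp

/-- Rectangles determine the joint law, which is therefore the composition product of the law of `e`
with `κ`. The target `Ω'` is kept separate so that it may be `Ω` itself with a smaller σ-algebra. -/
theorem lintegral_comp_prod_of_rectangles {Ω' : Type*} [MeasurableSpace Ω'] {Pr : Measure Ω}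
    [IsProbabilityMeasure Pr] {e : Ω → Ω'} (he : Measurable e) {ξ : Ω → X} (hξ : Measurable ξ)
    (κ : Kernel Ω' X) [IsMarkovKernel κ]
    (h : ∀ A S, MeasurableSet A → MeasurableSet S →
      Pr (e ⁻¹' A ∩ ξ ⁻¹' S) = ∫⁻ ω in e ⁻¹' A, κ (e ω) S ∂Pr)
    {g : Ω' × X → ℝ≥0∞} (hg : Measurable g) :
    ∫⁻ ω, g (e ω, ξ ω) ∂Pr = ∫⁻ ω, ∫⁻ x, g (e ω, x) ∂κ (e ω) ∂Pr := by
  have hmap : Pr.map (fun ω => (e ω, ξ ω)) = (Pr.map e) ⊗ₘ κ := by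
    have : IsProbabilityMeasure (Pr.map e) := Measure.isProbabilityMeasure_map he.aemeasurable
    have : IsProbabilityMeasure (Pr.map (fun ω => (e ω, ξ ω))) :=
      Measure.isProbabilityMeasure_map (he.prodMk hξ).aemeasurable
    refine Measure.ext_prod fun {A S} hA hS => ?_
    rw [Measure.map_apply (he.prodMk hξ) (hA.prod hS), Measure.compProd_apply_prod hA hS,
      setLIntegral_map hA (κ.measurable_coe hS) he]
    exact h A S hA hS
  rw [← lintegral_map hg (he.prodMk hξ), hmap, Measure.lintegral_compProd hg,
    lintegral_map (hg.lintegral_kernel_prod_right') he]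

/-- Integration of a function of the past and of a fresh variable whose conditional law is `κ`. -/
theorem lintegral_condLaw {Pr : Measure Ω} [IsProbabilityMeasure Pr]
    (hm : m ≤ mΩ) {ξ : Ω → X} (hξ : Measurable ξ) (κ : @Kernel Ω X m _)
    (hκ : @IsMarkovKernel Ω X m _ κ)
    (h : ∀ S, MeasurableSet S →
      condExp m Pr (fun ω => S.indicator (fun _ => (1 : ℝ)) (ξ ω)) =ᵐ[Pr] fun ω => (κ ω).real S)
    {g : Ω × X → ℝ≥0∞} (hg : @Measurable _ _ (m.prod mX) _ g) :
    ∫⁻ ω, g (ω, ξ ω) ∂Pr = ∫⁻ ω, ∫⁻ x, g (ω, x) ∂κ ω ∂Pr := by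
  -- The past is encoded by the identity map, from `Ω` with the full σ-algebra to `Ω` with `m`. The
  -- rectangle identity is the defining property of the conditional expectation, first in `ℝ` and
  -- then transferred to `ℝ≥0∞`.
  refine @lintegral_comp_prod_of_rectangles Ω X mΩ mX Ω m Pr _ id
    (measurable_id'' hm) ξ hξ κ hκ (fun A S hA hS => ?_) g hg
  have hA' : MeasurableSet[mΩ] A := hm _ hA
  have hind : (fun ω => S.indicator (fun _ => (1 : ℝ)) (ξ ω)) =
      (ξ ⁻¹' S).indicator (fun _ => (1 : ℝ)) := rfl
  have hint : Integrable (fun ω => S.indicator (fun _ => (1 : ℝ)) (ξ ω)) Pr := by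
    rw [hind]; exact (integrable_const 1).indicator (hξ hS)
  have h1 := setIntegral_condExp hm hint hA
  have h2 : ∫ ω in A, S.indicator (fun _ => (1 : ℝ)) (ξ ω) ∂Pr = Pr.real (A ∩ ξ ⁻¹' S) := by
    rw [hind]
    rw [setIntegral_indicator (hξ hS)]
    simp
  have h3 : ∫ ω in A, (condExp m Pr (fun ω => S.indicator (fun _ => (1 : ℝ)) (ξ ω))) ω ∂Pr
      = ∫ ω in A, (κ ω).real S ∂Pr :=
    integral_congr_ae (ae_restrict_of_ae (h S hS))
  have hmeas : Measurable[m] fun ω => κ ω S := κ.measurable_coe hS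
  have hp : ∀ ω, IsProbabilityMeasure (κ ω) := fun ω => hκ.isProbabilityMeasure ω
  have h4 : ∫ ω in A, (κ ω).real S ∂Pr = (∫⁻ ω in A, κ ω S ∂Pr).toReal :=
    integral_toReal (hmeas.mono hm le_rfl).aemeasurable
      (Filter.Eventually.of_forall fun ω => measure_lt_top _ _)
  have h5 : ∫⁻ ω in A, κ ω S ∂Pr ≠ ⊤ := by
    refine ne_top_of_le_ne_top (b := Pr A) (measure_ne_top _ _) ?_
    refine (lintegral_mono fun ω => prob_le_one).trans ?_
    simp
  have h6 : (Pr (A ∩ ξ ⁻¹' S)).toReal = (∫⁻ ω in A, κ ω S ∂Pr).toReal := by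
    rw [← h4, ← h3, h1, h2]; rfl
  exact (ENNReal.toReal_eq_toReal_iff' (measure_ne_top _ _) h5).1 h6

/-- One step of an exponential supermartingale: a bounded function of the past and of a fresh
variable, centred given the past and compensated by its conditional variance. -/
theorem expSuper_of_condLaw {Pr : Measure Ω} [IsProbabilityMeasure Pr]
    (hm : m ≤ mΩ) {ξ : Ω → X} (hξ : Measurable ξ) (κ : @Kernel Ω X m _)
    (hκ : @IsMarkovKernel Ω X m _ κ)
    (h : ∀ S, MeasurableSet S →
      condExp m Pr (fun ω => S.indicator (fun _ => (1 : ℝ)) (ξ ω)) =ᵐ[Pr] fun ω => (κ ω).real S)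
    {g : Ω → X → ℝ} (hg : @Measurable _ _ (m.prod mX) _ (Function.uncurry g))
    (hb : ∀ ω x, |g ω x| ≤ 1) (h0 : ∀ ω, ∫ x, g ω x ∂κ ω = 0) {v : Ω → ℝ} (hv : Measurable[m] v)
    (hgv : ∀ ω, ∫ x, g ω x ^ 2 ∂κ ω ≤ v ω) :
    ExpSuper Pr m (fun ω => g ω (ξ ω) - v ω) := by
  intro Z hZ
  have hfst : @Measurable _ _ (m.prod mX) m (Prod.fst : Ω × X → Ω) := @measurable_fst _ _ m _
  have hmeas : @Measurable _ _ (m.prod mX) _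
      (fun p : Ω × X => Z p.1 * ENNReal.ofReal (Real.exp (g p.1 p.2 - v p.1))) :=
    (hZ.comp hfst).mul (Real.measurable_exp.comp (hg.sub (hv.comp hfst))).ennreal_ofReal
  have := lintegral_condLaw hm hξ κ hκ h hmeas
  simp only at this
  rw [this]
  refine lintegral_mono fun ω => ?_
  have hp : IsProbabilityMeasure (κ ω) := hκ.isProbabilityMeasure ω
  have hgω : Measurable (g ω) := hg.comp (@measurable_prodMk_left _ _ m _ ω)
  rw [lintegral_const_mul _ (by fun_prop)]
  calc Z ω * ∫⁻ x, ENNReal.ofReal (Real.exp (g ω x - v ω)) ∂κ ω ≤ Z ω * 1 :=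
        mul_le_mul_right (lintegral_exp_sub_sq_le_one hgω (hb ω) (h0 ω) (hgv ω)) _
    _ = Z ω := mul_one _

end Supermartingale


/-! ## Quadratic forms of regularized Gram matrices -/

section Gram

variable {d : ℕ}

theorem sq_le_mul_of_forall_quadratic {a b c : ℝ} (h : ∀ t : ℝ, 0 ≤ a + 2 * t * b + t ^ 2 * c) :
    b ^ 2 ≤ a * c := by
  have := discrim_le_zero (a := c) (b := 2 * b) (c := a) fun x => by nlinarith [h x]
  rw [discrim] at this
  nlinarith

/-- Cauchy–Schwarz for a positive definite matrix and its inverse. -/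
theorem sq_dotProduct_le {A : Matrix (Fin d) (Fin d) ℝ} (hA : A.PosDef) (x v : Fin d → ℝ) :
    (x ⬝ᵥ v) ^ 2 ≤ (x ⬝ᵥ (A *ᵥ x)) * (v ⬝ᵥ (A⁻¹ *ᵥ v)) := by
  set u := A⁻¹ *ᵥ v with hu
  have hAu : A *ᵥ u = v := by
    rw [hu, Matrix.mulVec_mulVec, Matrix.mul_nonsing_inv _ ((Matrix.isUnit_iff_isUnit_det _).1
      hA.isUnit), Matrix.one_mulVec]
  have hsymm : u ⬝ᵥ (A *ᵥ x) = x ⬝ᵥ v := by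
    have hT : Aᵀ = A := by simpa using hA.isHermitian.eq
    rw [Matrix.dotProduct_mulVec, ← Matrix.mulVec_transpose, hT, hAu, dotProduct_comm]
  -- The polynomial in `t` is the quadratic form of `A` at `x + t A⁻¹ v`.
  refine sq_le_mul_of_forall_quadratic fun t => ?_
  have := hA.posSemidef.dotProduct_mulVec_nonneg (x + t • u)
  simp only [star_trivial, Matrix.mulVec_add, Matrix.mulVec_smul, add_dotProduct, dotProduct_add,
    smul_dotProduct, dotProduct_smul, smul_eq_mul, hAu, hsymm] at this
  rw [dotProduct_comm u v] at this
  nlinarith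

theorem dotProduct_inv_nonneg {A : Matrix (Fin d) (Fin d) ℝ} (hA : A.PosDef) (v : Fin d → ℝ) :
    0 ≤ v ⬝ᵥ (A⁻¹ *ᵥ v) := by
  simpa using hA.inv.posSemidef.dotProduct_mulVec_nonneg v

/-- The inverse is antitone on positive definite matrices. -/
theorem dotProduct_inv_anti {A A' : Matrix (Fin d) (Fin d) ℝ} (hA : A.PosDef) (hA' : A'.PosDef)
    (h : ∀ x, x ⬝ᵥ (A *ᵥ x) ≤ x ⬝ᵥ (A' *ᵥ x)) (v : Fin d → ℝ) :
    v ⬝ᵥ (A'⁻¹ *ᵥ v) ≤ v ⬝ᵥ (A⁻¹ *ᵥ v) := by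
  -- For `u = A'⁻¹ v`, Cauchy–Schwarz bounds `(u ⬝ v)²` by `(u ⬝ A u) (v ⬝ A⁻¹ v)`, and `u ⬝ A u ≤ u
  -- ⬝ A' u = u ⬝ v`; one factor `u ⬝ v` cancels.
  set u := A'⁻¹ *ᵥ v with hu
  have hAu : A' *ᵥ u = v := by
    rw [hu, Matrix.mulVec_mulVec, Matrix.mul_nonsing_inv _ ((Matrix.isUnit_iff_isUnit_det _).1
      hA'.isUnit), Matrix.one_mulVec]
  have h1 := sq_dotProduct_le hA u v
  have h2 := h u
  rw [hAu] at h2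
  have h3 := dotProduct_inv_nonneg hA v
  have h4 := dotProduct_inv_nonneg hA' v
  rw [← hu] at h4
  rw [dotProduct_comm u v] at h1 h2
  rcases h4.eq_or_lt with h5 | h5
  · rw [← h5]; exact h3
  · have : (v ⬝ᵥ u) * (v ⬝ᵥ u) ≤ (v ⬝ᵥ u) * (v ⬝ᵥ (A⁻¹ *ᵥ v)) := by nlinarith
    exact le_of_mul_le_mul_left this h5

/-- `μ I + ∑ u_s u_sᵀ`. -/
noncomputable def gramM (μ : ℝ) {n : ℕ} (u : Fin n → Fin d → ℝ) : Matrix (Fin d) (Fin d) ℝ :=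
  μ • (1 : Matrix (Fin d) (Fin d) ℝ) + ∑ s, Matrix.vecMulVec (u s) (u s)

theorem dotProduct_gramM (μ : ℝ) {n : ℕ} (u : Fin n → Fin d → ℝ) (x : Fin d → ℝ) :
    x ⬝ᵥ (gramM μ u *ᵥ x) = μ * (x ⬝ᵥ x) + ∑ s, (u s ⬝ᵥ x) ^ 2 := by
  have h : ∀ s, x ⬝ᵥ (Matrix.vecMulVec (u s) (u s) *ᵥ x) = (u s ⬝ᵥ x) ^ 2 := fun s => by
    rw [Matrix.vecMulVec_mulVec]
    simp [dotProduct_smul, dotProduct_comm, sq]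
  rw [gramM, Matrix.add_mulVec, dotProduct_add, Matrix.smul_mulVec, Matrix.one_mulVec,
    dotProduct_smul, Matrix.sum_mulVec, dotProduct_sum]
  simp [h]

theorem gramM_posDef {μ : ℝ} (hμ : 0 < μ) {n : ℕ} (u : Fin n → Fin d → ℝ) :
    (gramM μ u).PosDef := by
  refine Matrix.PosDef.of_dotProduct_mulVec_pos ?_ fun {x} hx => ?_
  · rw [Matrix.IsHermitian, gramM]
    simp [Matrix.transpose_add, Matrix.transpose_sum, Matrix.conjTranspose_eq_transpose_of_trivial,
      Matrix.transpose_vecMulVec]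
  · rw [star_trivial, dotProduct_gramM]
    have h1 : 0 < x ⬝ᵥ x := by
      have := Matrix.dotProduct_star_self_pos_iff.2 hx
      simpa using this
    have h2 : 0 ≤ ∑ s, (u s ⬝ᵥ x) ^ 2 := Finset.sum_nonneg fun s _ => sq_nonneg _
    positivity

/-- With `x` the inverse matrix applied to `v`, the form `v ⬝ x` is at least `μ |x|²`, while `(v ⬝
x)² ≤ |v|² |x|²`. -/
theorem dotProduct_gramM_inv_le {μ : ℝ} (hμ : 0 < μ) {n : ℕ} (u : Fin n → Fin d → ℝ)
    (v : Fin d → ℝ) : v ⬝ᵥ ((gramM μ u)⁻¹ *ᵥ v) ≤ (v ⬝ᵥ v) / μ := by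
  have hA := gramM_posDef hμ u
  set x := (gramM μ u)⁻¹ *ᵥ v with hx
  have hAx : gramM μ u *ᵥ x = v := by
    rw [hx, Matrix.mulVec_mulVec, Matrix.mul_nonsing_inv _ ((Matrix.isUnit_iff_isUnit_det _).1
      hA.isUnit), Matrix.one_mulVec]
  have h1 := dotProduct_gramM μ u x
  rw [hAx] at h1
  have h2 : 0 ≤ ∑ s, (u s ⬝ᵥ x) ^ 2 := Finset.sum_nonneg fun s _ => sq_nonneg _
  have h3 : (v ⬝ᵥ x) ^ 2 ≤ (v ⬝ᵥ v) * (x ⬝ᵥ x) := by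
    have := Finset.sum_mul_sq_le_sq_mul_sq Finset.univ v x
    simpa [dotProduct, sq] using this
  have h4 : 0 ≤ v ⬝ᵥ x := by simpa [hx] using dotProduct_inv_nonneg hA v
  have h5 : 0 ≤ v ⬝ᵥ v := Finset.sum_nonneg fun i _ => mul_self_nonneg (v i)
  rw [le_div_iff₀ hμ]
  rw [dotProduct_comm x v] at h1
  rcases h4.eq_or_lt with h6 | h6
  · rw [← h6]; simpa using h5
  · have : (v ⬝ᵥ x) * (v ⬝ᵥ x * μ) ≤ (v ⬝ᵥ x) * (v ⬝ᵥ v) := by nlinarith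
    exact le_of_mul_le_mul_left this h6

/-- Diagonal entries are values of the form at unit vectors; the others follow from the
nonnegativity of the `2 × 2` minors. The bound does not depend on the data or the weights, which
makes the set of possible bonuses totally bounded. -/
theorem abs_gramM_inv_apply_le {μ : ℝ} (hμ : 0 < μ) {n : ℕ} (u : Fin n → Fin d → ℝ)
    (i j : Fin d) : |(gramM μ u)⁻¹ i j| ≤ 1 / μ := by
  have hA := (gramM_posDef hμ u).inv
  have hd : ∀ k : Fin d, (gramM μ u)⁻¹ k k ≤ 1 / μ := fun k => by
    have := dotProduct_gramM_inv_le hμ u (Pi.single k 1)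
    simpa using this
  have hd0 : ∀ k : Fin d, 0 ≤ (gramM μ u)⁻¹ k k := fun k => hA.posSemidef.diag_nonneg
  have hs : (gramM μ u)⁻¹ j i = (gramM μ u)⁻¹ i j := by
    have := congrFun (congrFun hA.isHermitian.eq i) j
    simpa using this
  have hq : ((gramM μ u)⁻¹ i j) ^ 2 ≤ (gramM μ u)⁻¹ i i * (gramM μ u)⁻¹ j j := by
    refine sq_le_mul_of_forall_quadratic fun t => ?_
    have := hA.posSemidef.dotProduct_mulVec_nonneg (Pi.single i 1 + t • Pi.single j 1)
    simp only [star_trivial, Matrix.mulVec_add, Matrix.mulVec_smul, add_dotProduct,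
      dotProduct_add, smul_dotProduct, dotProduct_smul, smul_eq_mul, Matrix.mulVec_single_one,
      single_one_dotProduct, Matrix.col_apply, hs] at this
    nlinarith
  apply abs_le_of_sq_le_sq _ (by positivity)
  calc ((gramM μ u)⁻¹ i j) ^ 2 ≤ (gramM μ u)⁻¹ i i * (gramM μ u)⁻¹ j j := hq
    _ ≤ 1 / μ * (1 / μ) := mul_le_mul (hd i) (hd j) (hd0 j) (by positivity)
    _ = (1 / μ) ^ 2 := (sq _).symm

theorem gramM_succ (μ : ℝ) (u : ℕ → Fin d → ℝ) (n : ℕ) :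
    gramM μ (fun s : Fin (n + 1) => u s) =
      gramM μ (fun s : Fin n => u s) + Matrix.vecMulVec (u n) (u n) := by
  simp [gramM, Fin.sum_univ_castSucc, add_assoc]

/-- The matrix determinant lemma for a rank one update. -/
theorem det_gramM_succ {μ : ℝ} (hμ : 0 < μ) (u : ℕ → Fin d → ℝ) (n : ℕ) :
    (gramM μ (fun s : Fin (n + 1) => u s)).det = (gramM μ (fun s : Fin n => u s)).det *
      (1 + u n ⬝ᵥ ((gramM μ (fun s : Fin n => u s))⁻¹ *ᵥ u n)) := by
  have hA := gramM_posDef hμ (fun s : Fin n => u s)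
  rw [gramM_succ, Matrix.vecMulVec_eq Unit, Matrix.det_add_replicateCol_mul_replicateRow
    ((Matrix.isUnit_iff_isUnit_det _).1 hA.isUnit)]
  congr 1
  rw [Matrix.det_unique, Matrix.add_apply, Matrix.one_apply_eq, Matrix.mul_assoc,
    Matrix.mul_apply']
  congr 1

/-- Every eigenvalue is at most the trace. This is cruder than the inequality of the means, but only
changes the argument of a logarithm. -/
theorem det_le_trace_pow {A : Matrix (Fin d) (Fin d) ℝ} (hA : A.PosDef) :
    A.det ≤ A.trace ^ d := by
  have h0 : ∀ i, 0 ≤ hA.isHermitian.eigenvalues i := fun i => (hA.eigenvalues_pos i).le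
  have ht : A.trace = ∑ i, hA.isHermitian.eigenvalues i := by
    simpa using hA.isHermitian.trace_eq_sum_eigenvalues
  rw [hA.isHermitian.det_eq_prod_eigenvalues]
  calc ∏ i, ((hA.isHermitian.eigenvalues i : ℝ)) ≤ ∏ _i : Fin d, A.trace :=
        Finset.prod_le_prod (fun i _ => h0 i) fun i _ => by
          rw [ht]; exact Finset.single_le_sum (f := hA.isHermitian.eigenvalues)
            (fun j _ => h0 j) (Finset.mem_univ i)
    _ = A.trace ^ d := by simp

/-- The elliptical potential lemma. -/
theorem sum_min_one_le {μ : ℝ} (hμ : 0 < μ) (u : ℕ → Fin d → ℝ) {b : ℝ}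
    (hb : ∀ s, u s ⬝ᵥ u s ≤ b) (n : ℕ) :
    ∑ s ∈ Finset.range n, min 1 (u s ⬝ᵥ ((gramM μ (fun j : Fin s => u j))⁻¹ *ᵥ u s)) ≤
      2 * (d * Real.log (d + n * b / μ)) := by
  set q : ℕ → ℝ := fun s => u s ⬝ᵥ ((gramM μ (fun j : Fin s => u j))⁻¹ *ᵥ u s) with hq
  have hq0 : ∀ s, 0 ≤ q s := fun s => dotProduct_inv_nonneg (gramM_posDef hμ _) _
  -- Both sides are compared with `2 q / (1 + q)`.
  have hstep : ∀ s, min 1 (q s) ≤ 2 * Real.log (1 + q s) := fun s => by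
    have h1 := Real.one_sub_inv_le_log_of_pos (x := 1 + q s) (by linarith [hq0 s])
    have h2 : min 1 (q s) ≤ 2 * (1 - (1 + q s)⁻¹) := by
      have hp : 0 < 1 + q s := by linarith [hq0 s]
      have : 1 - (1 + q s)⁻¹ = q s / (1 + q s) := by field_simp; ring
      rw [this, mul_div_assoc', le_div_iff₀ hp]
      rcases le_total 1 (q s) with h | h
      · rw [min_eq_left h]; linarith
      · rw [min_eq_right h]; nlinarith [hq0 s]
    linarith
  -- The logarithms telescope as ratios of successive determinants, starting from the determinant `μ
  -- ^ d` of the regularizer.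
  have hdet : ∀ m, ∑ s ∈ Finset.range m, Real.log (1 + q s) =
      Real.log (gramM μ (fun s : Fin m => u s)).det - Real.log (μ ^ d) := fun m => by
    induction m with
    | zero => simp [gramM]
    | succ m ih =>
      rw [Finset.sum_range_succ, ih, det_gramM_succ hμ, Real.log_mul
        (gramM_posDef hμ _).det_pos.ne' (by have := hq0 m; simp only [hq] at this; positivity)]
      ring
  have htr : (gramM μ (fun s : Fin n => u s)).trace ≤ d * μ + n * b := by
    rw [gramM, Matrix.trace_add, Matrix.trace_smul, Matrix.trace_one, Matrix.trace_sum]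
    simp only [Matrix.trace_vecMulVec, Fintype.card_fin, smul_eq_mul]
    have : ∑ s : Fin n, u s ⬝ᵥ u s ≤ ∑ _s : Fin n, b := Finset.sum_le_sum fun s _ => hb s
    simp at this
    linarith [mul_comm μ (d : ℝ)]
  calc ∑ s ∈ Finset.range n, min 1 (q s) ≤ ∑ s ∈ Finset.range n, 2 * Real.log (1 + q s) :=
        Finset.sum_le_sum fun s _ => hstep s
    _ = 2 * ∑ s ∈ Finset.range n, Real.log (1 + q s) := by rw [Finset.mul_sum]
    _ ≤ 2 * (d * Real.log (d + n * b / μ)) := by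
        rw [hdet]
        have hPD := gramM_posDef hμ (fun s : Fin n => u s)
        have h1 := Real.log_le_log hPD.det_pos (det_le_trace_pow hPD)
        rcases Nat.eq_zero_or_pos d with hd | hd
        · subst hd; simp
        have htpos : 0 < (gramM μ (fun s : Fin n => u s)).trace := by
          have : Nonempty (Fin d) := ⟨⟨0, hd⟩⟩
          exact hPD.trace_pos
        have h2 : Real.log (gramM μ (fun s : Fin n => u s)).trace ≤
            Real.log (μ * (d + n * b / μ)) := Real.log_le_log htpos (by
          refine htr.trans (le_of_eq ?_); field_simp)
        have hpos : 0 < d + n * b / μ := by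
          have : 0 < μ * (d + n * b / μ) := by
            have : μ * (d + n * b / μ) = d * μ + n * b := by field_simp
            rw [this]; linarith
          exact pos_of_mul_pos_right this hμ.le
        rw [Real.log_mul hμ.ne' hpos.ne'] at h2
        rw [Real.log_pow] at h1 ⊢
        have hd' : (0 : ℝ) ≤ d := by positivity
        nlinarith [mul_le_mul_of_nonneg_left h2 hd']

theorem abs_sqrt_sub_sqrt_le (a b : ℝ) : |√a - √b| ≤ √|a - b| := by
  wlog h : b ≤ a generalizing a b
  · rw [abs_sub_comm, abs_sub_comm a b]; exact this b a (le_of_not_ge h)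
  rw [abs_of_nonneg (sub_nonneg.2 (Real.sqrt_le_sqrt h)), abs_of_nonneg (sub_nonneg.2 h)]
  rw [sub_le_iff_le_add]
  rcases le_total b 0 with hb | hb
  · rw [Real.sqrt_eq_zero_of_nonpos hb, add_zero]
    exact Real.sqrt_le_sqrt (by linarith)
  · apply Real.sqrt_le_iff.2 ⟨by positivity, ?_⟩
    nlinarith [Real.sq_sqrt hb, Real.sq_sqrt (sub_nonneg.2 h), Real.sqrt_nonneg b,
      Real.sqrt_nonneg (a - b), mul_nonneg (Real.sqrt_nonneg b) (Real.sqrt_nonneg (a - b))]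

/-- The quadratic forms differ by at most `η (∑ |v i|)² ≤ η d`, and the square root is Hölder
continuous of exponent `1/2`. Hence the resolution for the matrices must be the square of the one
wanted for the bonuses. -/
theorem abs_sqrt_quadratic_sub_le {A A' : Matrix (Fin d) (Fin d) ℝ} {η : ℝ}
    (h : ∀ i j, |A i j - A' i j| ≤ η) {v : Fin d → ℝ} (hv : v ⬝ᵥ v ≤ 1) (hη : 0 ≤ η) :
    |√(v ⬝ᵥ (A *ᵥ v)) - √(v ⬝ᵥ (A' *ᵥ v))| ≤ √(η * d) := by
  refine (abs_sqrt_sub_sqrt_le _ _).trans (Real.sqrt_le_sqrt ?_)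
  have hsum : v ⬝ᵥ (A *ᵥ v) - v ⬝ᵥ (A' *ᵥ v) = ∑ i, ∑ j, v i * ((A i j - A' i j) * v j) := by
    simp only [dotProduct, Matrix.mulVec, Finset.mul_sum, ← Finset.sum_sub_distrib]
    exact Finset.sum_congr rfl fun i _ => Finset.sum_congr rfl fun j _ => by ring
  have h1 : |v ⬝ᵥ (A *ᵥ v) - v ⬝ᵥ (A' *ᵥ v)| ≤ ∑ i, ∑ j, η * (|v i| * |v j|) := by
    rw [hsum]
    refine (Finset.abs_sum_le_sum_abs _ _).trans (Finset.sum_le_sum fun i _ =>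
      (Finset.abs_sum_le_sum_abs _ _).trans (Finset.sum_le_sum fun j _ => ?_))
    rw [abs_mul, abs_mul]
    have := mul_le_mul_of_nonneg_right (h i j) (mul_nonneg (abs_nonneg (v i)) (abs_nonneg (v j)))
    linarith
  have h2 : ∑ i, ∑ j, η * (|v i| * |v j|) = η * (∑ i, |v i|) ^ 2 := by
    rw [sq, Finset.sum_mul_sum, Finset.mul_sum]
    exact Finset.sum_congr rfl fun i _ => by rw [Finset.mul_sum]
  have h3 : (∑ i, |v i|) ^ 2 ≤ d := by
    have h4 := sq_sum_le_card_mul_sum_sq (s := Finset.univ) (f := fun i => |v i|)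
    have h5 : ∑ i, |v i| ^ 2 = v ⬝ᵥ v := by simp [dotProduct, sq]
    rw [h5] at h4
    simp only [Finset.card_univ, Fintype.card_fin] at h4
    have : (0 : ℝ) ≤ d := by positivity
    nlinarith
  rw [h2] at h1
  exact h1.trans (mul_le_mul_of_nonneg_left h3 hη)

end Gram


/-! ## Bellman operators and optimal values -/

section BellmanBasics

variable {X A : Type*} [MeasurableSpace X] [MeasurableSpace A] (M : MDP X A)

theorem MDP.isProbabilityMeasure_P (h : ℕ) (z : X × A) : IsProbabilityMeasure (M.P h z) :=
  (M.markov h).isProbabilityMeasure z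

theorem MDP.measurable_r_apply (h : ℕ) (z : X × A) : Measurable (M.r h z) :=
  (M.measurable_r h).comp measurable_prodMk_left

variable {M}

theorem integrable_of_bound {ν : Measure X} [IsProbabilityMeasure ν] {V : X → ℝ}
    (hV : Measurable V) {b : ℝ} (hb : ∀ x, |V x| ≤ b) : Integrable V ν :=
  Integrable.of_bound hV.aestronglyMeasurable b (Filter.Eventually.of_forall hb)

theorem integrable_r_add (h : ℕ) (z : X × A) {V : X → ℝ} (hV : Measurable V) {b : ℝ}
    (hb : ∀ x, |V x| ≤ b) : Integrable (fun x' => M.r h z x' + V x') (M.P h z) := by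
  have := M.isProbabilityMeasure_P h z
  refine (integrable_of_bound (M.measurable_r_apply h z) (b := 1) fun x => ?_).add
    (integrable_of_bound hV hb)
  have := M.r_mem h z x
  rw [abs_of_nonneg this.1]; exact this.2

theorem bellman_mono (h : ℕ) (z : X × A) {V W : X → ℝ} (h0 : ∀ x, 0 ≤ V x) (hW : Measurable W)
    {b : ℝ} (hb : ∀ x, |W x| ≤ b) (hVW : ∀ x, V x ≤ W x) : bellman M h V z ≤ bellman M h W z := by
  refine integral_mono_of_nonneg (Filter.Eventually.of_forall fun x => ?_)
    (integrable_r_add h z hW hb) (Filter.Eventually.of_forall fun x => ?_)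
  · exact add_nonneg (M.r_mem h z x).1 (h0 x)
  · exact add_le_add le_rfl (hVW x)

theorem bellman_nonneg (h : ℕ) (z : X × A) {V : X → ℝ} (h0 : ∀ x, 0 ≤ V x) :
    0 ≤ bellman M h V z :=
  integral_nonneg fun x => add_nonneg (M.r_mem h z x).1 (h0 x)

theorem bellmanSq_mono (h : ℕ) (z : X × A) {V W : X → ℝ} (h0 : ∀ x, 0 ≤ V x) (hW : Measurable W)
    {b : ℝ} (hb : ∀ x, |W x| ≤ b) (hVW : ∀ x, V x ≤ W x) :
    bellmanSq M h V z ≤ bellmanSq M h W z := by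
  have := M.isProbabilityMeasure_P h z
  have hr := M.measurable_r_apply h z
  refine integral_mono_of_nonneg (Filter.Eventually.of_forall fun x => sq_nonneg _)
    (integrable_of_bound (b := (1 + b) ^ 2) (by fun_prop) fun x => ?_)
    (Filter.Eventually.of_forall fun x => ?_)
  · rw [abs_pow]
    refine pow_le_pow_left₀ (abs_nonneg _) ((abs_add_le _ _).trans (add_le_add ?_ (hb x))) 2
    rw [abs_of_nonneg (M.r_mem h z x).1]; exact (M.r_mem h z x).2
  · exact pow_le_pow_left₀ (add_nonneg (M.r_mem h z x).1 (h0 x)) (add_le_add le_rfl (hVW x)) 2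

theorem bellman_sub_bellman (h : ℕ) (z : X × A) {V W : X → ℝ} (hV : Measurable V) {b : ℝ}
    (hVb : ∀ x, |V x| ≤ b) (hW : Measurable W) {b' : ℝ} (hWb : ∀ x, |W x| ≤ b') :
    bellman M h V z - bellman M h W z = ∫ x', (V x' - W x') ∂(M.P h z) := by
  rw [bellman, bellman, ← integral_sub (integrable_r_add h z hV hVb) (integrable_r_add h z hW hWb)]
  exact integral_congr_ae (Filter.Eventually.of_forall fun x => by simp)

theorem measurable_integral_P (h : ℕ) {f : (X × A) → X → ℝ}
    (hf : Measurable (Function.uncurry f)) : Measurable fun z => ∫ x', f z x' ∂(M.P h z) := by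
  have := M.markov h
  exact (hf.stronglyMeasurable.integral_kernel_prod_right' (κ := M.P h)).measurable

/-- The optimal value with `n` steps to go, by dynamic programming. -/
noncomputable def optValue (M : MDP X A) : ℕ → ℕ → X → ℝ
  | 0, _, _ => 0
  | n + 1, h, x => ⨆ a, bellman M h (optValue M n (h + 1)) (x, a)

/-- The optimal value by dynamic programming takes the place of the supremum over policies. No
measurable selection of maximizers is then needed, and for the regret it suffices that the mean of
`Vstar` under the initial law is at most that of `Vopt`. -/
noncomputable def Vopt (M : MDP X A) (h : ℕ) (x : X) : ℝ := optValue M (M.H - h) h x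

noncomputable def Qopt (M : MDP X A) (h : ℕ) (z : X × A) : ℝ := bellman M h (Vopt M (h + 1)) z

theorem Vopt_of_le {h : ℕ} (hh : M.H ≤ h) (x : X) : Vopt M h x = 0 := by
  rw [Vopt, Nat.sub_eq_zero_of_le hh, optValue]

theorem Vopt_eq_iSup {h : ℕ} (hh : h < M.H) (x : X) : Vopt M h x = ⨆ a, Qopt M h (x, a) := by
  have h1 : M.H - h = (M.H - (h + 1)) + 1 := by omega
  simp only [Qopt]
  unfold Vopt
  rw [h1, optValue]

end BellmanBasics

section Sup

variable {A Y : Type*} [TopologicalSpace A] [PolishSpace A] [MeasurableSpace Y]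

/-- Continuity in the action allows the supremum to be restricted to a countable dense set. -/
theorem measurable_iSup_of_continuous {F : Y → A → ℝ} (hF : ∀ a, Measurable fun y => F y a)
    (hc : ∀ y, Continuous (F y)) : Measurable fun y => ⨆ a, F y a := by
  obtain ⟨S, hS, hd⟩ := TopologicalSpace.exists_countable_dense A
  have : Countable S := hS.to_subtype
  have h : (fun y => ⨆ a, F y a) = fun y => ⨆ a : S, F y a := by
    ext y; exact (hd.ciSup' (hc y)).symm
  rw [h]
  exact Measurable.iSup fun a => hF a

end Sup

/-- The standing assumptions on the model and on the parameters. -/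
structure LinSetting {X A : Type*} [MeasurableSpace X] [MeasurableSpace A] [TopologicalSpace A]
    {d : ℕ} (M : MDP X A) (c : Config X A d) : Prop where
  horizon : c.H = M.H
  lin : IsLinear M c.φ c.Bh
  complete : Complete M (linClass c.φ c.Bh) 0
  bound : ∀ h < M.H, ∀ f ∈ linClass c.φ c.Bh h, ∀ z, |f z| ≤ c.B
  cover : ∀ h < M.H, IsCover (linClass c.φ c.Bh h) c.ε (c.F h)
  T_pos : 1 ≤ c.T
  H_pos : 1 ≤ M.H
  ε_pos : 0 < c.ε
  ε_le : c.ε ≤ 1 / (8 * M.H * c.T ^ 2)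
  δ_pos : 0 < c.δ
  δ_lt : c.δ < 1 / (c.T + M.H ^ 2 + 11)

namespace LinSetting

variable {X A : Type*} [MeasurableSpace X] [TopologicalSpace A] [MeasurableSpace A]
  {d : ℕ} {M : MDP X A} {c : Config X A d}

theorem exists_bellman (S : LinSetting M c) {h : ℕ} (hh : h < M.H) {V : X → ℝ} (hV : Measurable V)
    (hV0 : ∀ x, 0 ≤ V x) (hV2 : ∀ x, V x ≤ 2) :
    ∃ w : EuclideanSpace ℝ (Fin d), ‖w‖ ≤ c.Bh h ∧
      ∀ z, bellman M h V z = inner ℝ w (c.φ h z) := by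
  obtain ⟨f, ⟨w, hw, hf⟩, hfz⟩ := (S.complete h hh).1 V hV fun x => ⟨hV0 x, hV2 x⟩
  refine ⟨w, hw, fun z => ?_⟩
  have := abs_nonpos_iff.1 (hfz z)
  rw [← hf z]; linarith

theorem exists_cover_bellman (S : LinSetting M c) {h : ℕ} (hh : h < M.H) {V : X → ℝ}
    (hV : Measurable V) (hV0 : ∀ x, 0 ≤ V x) (hV2 : ∀ x, V x ≤ 2) :
    ∃ f ∈ c.F h, ∀ z, |bellman M h V z - f z| ≤ c.ε := by
  obtain ⟨w, hw, hz⟩ := S.exists_bellman hh hV hV0 hV2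
  exact (S.cover h hh).2 _ ⟨w, hw, hz⟩

theorem abs_bellman_le (S : LinSetting M c) {h : ℕ} (hh : h < M.H) {V : X → ℝ}
    (hV : Measurable V) (hV0 : ∀ x, 0 ≤ V x) (hV2 : ∀ x, V x ≤ 2) (z : X × A) :
    |bellman M h V z| ≤ c.B := by
  obtain ⟨w, hw, hz⟩ := S.exists_bellman hh hV hV0 hV2
  exact S.bound h hh _ ⟨w, hw, hz⟩ z

theorem exists_cover_bellmanSq (S : LinSetting M c) {h : ℕ} (hh : h < M.H) {V : X → ℝ}
    (hV : Measurable V) (hV0 : ∀ x, 0 ≤ V x) (hV1 : ∀ x, V x ≤ 1) :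
    ∃ f ∈ c.F h, ∀ z, |bellmanSq M h V z - f z| ≤ c.ε := by
  obtain ⟨f, hf, hfz⟩ := (S.complete h hh).2.1 V hV fun x => ⟨hV0 x, hV1 x⟩
  obtain ⟨g, hg, hgz⟩ := (S.cover h hh).2 f hf
  refine ⟨g, hg, fun z => ?_⟩
  have := abs_nonpos_iff.1 (hfz z)
  have h2 : bellmanSq M h V z = f z := by linarith
  rw [h2]; exact hgz z

theorem abs_le_of_mem (S : LinSetting M c) {h : ℕ} (hh : h < M.H) {f : X × A → ℝ}
    (hf : f ∈ c.F h) (z : X × A) : |f z| ≤ c.B :=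
  S.bound h hh f ((S.cover h hh).1 hf) z

theorem measurable_of_mem (S : LinSetting M c) {h : ℕ} (hh : h < M.H) {f : X × A → ℝ}
    (hf : f ∈ c.F h) : Measurable f := by
  obtain ⟨w, -, hw⟩ := (S.cover h hh).1 hf
  have h1 : f = fun z => inner ℝ w (c.φ h z) := funext hw
  have := S.lin.measurable_φ h
  rw [h1]; fun_prop

theorem continuous_of_mem (S : LinSetting M c) {h : ℕ} (hh : h < M.H) {f : X × A → ℝ}
    (hf : f ∈ c.F h) (x : X) : Continuous fun a => f (x, a) := by
  obtain ⟨w, -, hw⟩ := (S.cover h hh).1 hf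
  have h1 : (fun a => f (x, a)) = fun a => inner ℝ w (c.φ h (x, a)) := funext fun a => hw _
  have := S.lin.continuous_φ h x
  rw [h1]; fun_prop

section Nonempty

variable [Nonempty X] [Nonempty A]

/-- Completeness for constant functions forces lower bounds on the parameters: the Bellman image of
the constant `2` is at least `2` and lies in a class bounded by `B`. In the same way `one_le_Bh` and
`one_le_d` use that a class containing a function that is at least `1` has radius at least `1` and
positive dimension. -/
theorem two_le_B (S : LinSetting M c) : 2 ≤ c.B := by
  obtain ⟨x⟩ := ‹Nonempty X›
  obtain ⟨a⟩ := ‹Nonempty A›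
  have hz := S.abs_bellman_le S.H_pos (V := fun _ => 2) measurable_const (by simp) (by simp) (x, a)
  have := M.isProbabilityMeasure_P 0 (x, a)
  have h1 : (2 : ℝ) ≤ bellman M 0 (fun _ => 2) (x, a) := by
    calc (2 : ℝ) = ∫ _, (2 : ℝ) ∂(M.P 0 (x, a)) := by simp
      _ ≤ bellman M 0 (fun _ => 2) (x, a) := by
        refine integral_mono (integrable_const _)
          (integrable_r_add 0 _ measurable_const (b := 2) (by simp)) fun x' => ?_
        have := (M.r_mem 0 (x, a) x').1
        simp only; linarith
  exact h1.trans ((le_abs_self _).trans hz)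

theorem one_le_Bh (S : LinSetting M c) {h : ℕ} (hh : h < M.H) : 1 ≤ c.Bh h := by
  obtain ⟨x⟩ := ‹Nonempty X›
  obtain ⟨a⟩ := ‹Nonempty A›
  obtain ⟨w, hw, hz⟩ := S.exists_bellman hh (V := fun _ => 1) measurable_const (by simp) (by simp)
  have := M.isProbabilityMeasure_P h (x, a)
  have h1 : (1 : ℝ) ≤ bellman M h (fun _ => 1) (x, a) := by
    calc (1 : ℝ) = ∫ _, (1 : ℝ) ∂(M.P h (x, a)) := by simp
      _ ≤ bellman M h (fun _ => 1) (x, a) := by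
        refine integral_mono (integrable_const _)
          (integrable_r_add h _ measurable_const (b := 1) (by simp)) fun x' => ?_
        have := (M.r_mem h (x, a) x').1
        simp only; linarith
  rw [hz] at h1
  have h2 := real_inner_le_norm w (c.φ h (x, a))
  have h3 := S.lin.norm_φ h (x, a)
  nlinarith [norm_nonneg w]

theorem one_le_d (S : LinSetting M c) : 1 ≤ d := by
  rcases Nat.eq_zero_or_pos d with hd | hd
  · subst hd
    obtain ⟨x⟩ := ‹Nonempty X›
    obtain ⟨a⟩ := ‹Nonempty A›
    obtain ⟨w, hw, hz⟩ := S.exists_bellman S.H_pos (V := fun _ => 1) measurable_const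
      (by simp) (by simp)
    have := M.isProbabilityMeasure_P 0 (x, a)
    have h1 : (1 : ℝ) ≤ bellman M 0 (fun _ => 1) (x, a) := by
      calc (1 : ℝ) = ∫ _, (1 : ℝ) ∂(M.P 0 (x, a)) := by simp
        _ ≤ bellman M 0 (fun _ => 1) (x, a) := by
          refine integral_mono (integrable_const _)
            (integrable_r_add 0 _ measurable_const (b := 1) (by simp)) fun x' => ?_
          have := (M.r_mem 0 (x, a) x').1
          simp only; linarith
    rw [hz, Subsingleton.elim w 0, inner_zero_left] at h1
    linarith
  · exact hd

variable [PolishSpace A]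

/-- Induction on the steps to go. Completeness makes the Bellman image linear in the features, hence
continuous in the action, which gives measurability of the maximum. The last clause carries the
reward `s` collected so far because the budget is a condition along paths. -/
theorem optValue_spec (S : LinSetting M c) (n : ℕ) : ∀ h, n + h = M.H →
    Measurable (optValue M n h) ∧ (∀ x, 0 ≤ optValue M n h x) ∧
      (∀ x s, RewardBudget M.P M.r n h x s → optValue M n h x + s ≤ 1) := by
  induction n with
  | zero =>
    intro h _
    refine ⟨by simp [optValue], fun x => le_rfl, fun x s hs => ?_⟩
    simpa [optValue, RewardBudget] using hs
  | succ n ih =>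
    intro h hn
    obtain ⟨hm, h0, hb⟩ := ih (h + 1) (by omega)
    -- The budget restarted at level `h + 1` with nothing collected bounds the value at every state,
    -- as completeness requires; the budget inherited from level `h` holds only almost surely.
    have h1 : ∀ x, optValue M n (h + 1) x ≤ 1 := fun x => by
      have := hb x 0 (by
        have := M.sparse (h + 1) (by omega) x
        rwa [show M.H - (h + 1) = n by omega] at this)
      linarith
    obtain ⟨w, -, hw⟩ := S.exists_bellman (show h < M.H by omega) hm h0
      (fun x => (h1 x).trans one_le_two)
    have habs : ∀ x, |optValue M n (h + 1) x| ≤ 1 := fun x => by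
      rw [abs_of_nonneg (h0 x)]; exact h1 x
    refine ⟨?_, fun x => ?_, fun x s hs => ?_⟩
    · simp only [optValue, funext hw]
      refine measurable_iSup_of_continuous (fun a => ?_) fun x => ?_
      · have := (S.lin.measurable_φ h).comp (measurable_prodMk_right (y := a) (α := X))
        exact Measurable.const_inner this
      · have := S.lin.continuous_φ h x
        fun_prop
    · exact Real.iSup_nonneg fun a => bellman_nonneg h _ h0
    · have : optValue M (n + 1) h x ≤ 1 - s := by
        refine ciSup_le fun a => ?_
        have hp := M.isProbabilityMeasure_P h (x, a)
        have hs' : ∀ᵐ x' ∂(M.P h (x, a)), M.r h (x, a) x' + optValue M n (h + 1) x' ≤ 1 - s := by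
          filter_upwards [hs a] with x' hx'
          have := hb x' _ hx'
          linarith
        calc bellman M h (optValue M n (h + 1)) (x, a) ≤ ∫ _, (1 - s) ∂(M.P h (x, a)) :=
              integral_mono_ae (integrable_r_add h _ hm habs) (integrable_const _) hs'
          _ = 1 - s := by simp
      linarith

theorem measurable_Vopt (S : LinSetting M c) (h : ℕ) : Measurable (Vopt M h) := by
  rcases le_total h M.H with hh | hh
  · exact (S.optValue_spec (M.H - h) h (by omega)).1
  · have : Vopt M h = fun _ => 0 := funext fun x => Vopt_of_le hh x
    rw [this]; exact measurable_const

theorem Vopt_nonneg (S : LinSetting M c) (h : ℕ) (x : X) : 0 ≤ Vopt M h x := by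
  rcases le_total h M.H with hh | hh
  · exact (S.optValue_spec (M.H - h) h (by omega)).2.1 x
  · rw [Vopt_of_le hh]

theorem Vopt_le_one (S : LinSetting M c) (h : ℕ) (x : X) : Vopt M h x ≤ 1 := by
  rcases le_total h M.H with hh | hh
  · simpa [Vopt] using (S.optValue_spec (M.H - h) h (by omega)).2.2 x 0 (M.sparse h hh x)
  · rw [Vopt_of_le hh]; exact zero_le_one

theorem abs_Vopt_le (S : LinSetting M c) (h : ℕ) (x : X) : |Vopt M h x| ≤ 1 := by
  rw [abs_of_nonneg (S.Vopt_nonneg h x)]; exact S.Vopt_le_one h x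

theorem Qopt_nonneg (S : LinSetting M c) (h : ℕ) (z : X × A) : 0 ≤ Qopt M h z :=
  bellman_nonneg h z (S.Vopt_nonneg _)

theorem measurable_Qopt (S : LinSetting M c) {h : ℕ} (hh : h < M.H) : Measurable (Qopt M h) := by
  obtain ⟨w, -, hw⟩ := S.exists_bellman hh (S.measurable_Vopt (h + 1)) (S.Vopt_nonneg (h + 1))
    (fun x => (S.Vopt_le_one (h + 1) x).trans one_le_two)
  have := S.lin.measurable_φ h
  have h1 : Qopt M h = fun z => inner ℝ w (c.φ h z) := funext hw
  rw [h1]; fun_prop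

theorem Qopt_le_Vopt (S : LinSetting M c) {h : ℕ} (hh : h < M.H) (z : X × A) :
    Qopt M h z ≤ Vopt M h z.1 := by
  rw [Vopt_eq_iSup hh]
  refine le_ciSup (f := fun a => Qopt M h (z.1, a)) ⟨c.B, ?_⟩ z.2
  rintro _ ⟨a, rfl⟩
  exact (le_abs_self _).trans (S.abs_bellman_le hh (S.measurable_Vopt _) (S.Vopt_nonneg _)
    (fun x => (S.Vopt_le_one (h + 1) x).trans one_le_two) _)

theorem Qopt_le_one (S : LinSetting M c) {h : ℕ} (hh : h < M.H) (z : X × A) : Qopt M h z ≤ 1 :=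
  (S.Qopt_le_Vopt hh z).trans (S.Vopt_le_one h _)

theorem policyValue_le (S : LinSetting M c) (π : Policy X A) (n : ℕ) : ∀ h, n + h = M.H →
    ∀ x, 0 ≤ policyValue M π n h x ∧ policyValue M π n h x ≤ Vopt M h x := by
  induction n with
  | zero => intro h hn x; rw [Vopt_of_le (by omega)]; simp [policyValue]
  | succ n ih =>
    intro h hn x
    have ih' := ih (h + 1) (by omega)
    refine ⟨bellman_nonneg h _ fun x => (ih' x).1, ?_⟩
    exact (bellman_mono h _ (fun x => (ih' x).1) (S.measurable_Vopt _) (S.abs_Vopt_le _)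
      fun x => (ih' x).2).trans (S.Qopt_le_Vopt (show h < M.H by omega) _)

/-- Monotonicity of the integral for nonnegative functions asks for integrability of the larger
function only, so the measurability of `Vstar` does not matter. -/
theorem integral_Vstar_le (S : LinSetting M c) :
    ∫ x, Vstar M 0 x ∂M.init ≤ ∫ x, Vopt M 0 x ∂M.init := by
  have hp := M.prob_init
  have hne : Nonempty (Policy X A) :=
    ⟨⟨fun _ _ => Classical.arbitrary A, fun _ => measurable_const⟩⟩
  have h := fun π x => S.policyValue_le π (M.H - 0) 0 (by omega) x
  refine integral_mono_of_nonneg (Filter.Eventually.of_forall fun x => ?_)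
    (integrable_of_bound (S.measurable_Vopt 0) (S.abs_Vopt_le 0))
    (Filter.Eventually.of_forall fun x => ?_)
  · exact Real.iSup_nonneg fun π => (h π x).1
  · exact ciSup_le fun π => (h π x).2

end Nonempty

end LinSetting


/-! ## Measurability of the quantities of the algorithm -/

section FiniteChoice

variable {Ω Y : Type*} [MeasurableSpace Ω] [MeasurableSpace Y]

/-- Two distinct members of the finite class differ at some point, so the event `f ω = g` is decided
by finitely many evaluations; then `f` is a finite sum of indicators times fixed measurable
functions. This upgrades measurability at each point to the joint measurability needed for random
value functions. -/
theorem measurable_of_mem_finset (F : Finset (Y → ℝ)) (hF : ∀ f ∈ F, Measurable f)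
    {f : Ω → Y → ℝ} (hf : ∀ ω, f ω ∈ F) (hm : ∀ y, Measurable fun ω => f ω y) :
    Measurable fun p : Ω × Y => f p.1 p.2 := by
  classical
  rcases isEmpty_or_nonempty Y with hY | hY
  · exact measurable_of_empty _
  have hsep : ∀ g g' : Y → ℝ, g' ≠ g → ∃ y, g' y ≠ g y := fun g g' h => Function.ne_iff.1 h
  choose! y hy using hsep
  have hset : ∀ g ∈ F, MeasurableSet {ω | f ω = g} := by
    intro g hg
    have : {ω | f ω = g} = ⋂ g' ∈ F.erase g, {ω | f ω (y g g') = g (y g g')} := by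
      ext ω
      simp only [Set.mem_setOf_eq, Set.mem_iInter]
      refine ⟨fun h g' _ => by rw [h], fun h => ?_⟩
      by_contra hne
      exact hy g (f ω) hne (h (f ω) (Finset.mem_erase.2 ⟨hne, hf ω⟩))
    rw [this]
    exact Finset.measurableSet_biInter _ fun g' _ =>
      measurableSet_eq_fun (hm _) measurable_const
  have heq : (fun p : Ω × Y => f p.1 p.2) =
      fun p => ∑ g ∈ F, {ω | f ω = g}.indicator (fun _ => (1 : ℝ)) p.1 * g p.2 := by
    ext p
    rw [Finset.sum_eq_single (f p.1)]
    · simp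
    · intro g _ hg
      have : p.1 ∉ {ω | f ω = g} := fun h => hg h.symm
      simp [Set.indicator_of_notMem this]
    · intro h; exact absurd (hf p.1) h
  rw [heq]
  refine Finset.measurable_sum _ fun g hg => ?_
  exact ((measurable_const.indicator (hset g hg)).comp measurable_fst).mul
    ((hF g hg).comp measurable_snd)

end FiniteChoice

section MatrixMeasurability

variable {Ω : Type*} [MeasurableSpace Ω] {d : ℕ}

theorem measurable_det {A : Ω → Matrix (Fin d) (Fin d) ℝ}
    (hA : ∀ i j, Measurable fun ω => A ω i j) : Measurable fun ω => (A ω).det := by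
  simp only [Matrix.det_apply]
  refine Finset.measurable_sum _ fun σ _ => ?_
  exact (Finset.measurable_prod _ fun i _ => hA _ _).const_smul _

theorem measurable_inv_apply {A : Ω → Matrix (Fin d) (Fin d) ℝ}
    (hA : ∀ i j, Measurable fun ω => A ω i j) (i j : Fin d) :
    Measurable fun ω => (A ω)⁻¹ i j := by
  simp only [Matrix.inv_def, Matrix.smul_apply, Ring.inverse_eq_inv', smul_eq_mul,
    Matrix.adjugate_apply]
  refine (measurable_det hA).inv.mul (measurable_det fun k l => ?_)
  simp only [Matrix.updateRow_apply]
  split_ifs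
  · exact measurable_const
  · exact hA k l

end MatrixMeasurability

section Algorithm

variable {X A Ω : Type*} [MeasurableSpace X] [MeasurableSpace A] [MeasurableSpace Ω] {d : ℕ}
  {c : Config X A d} {h : ℕ}

theorem measurable_bonus (hφ : Measurable (c.φ h)) {n : ℕ} {zs : Ω → Fin n → X × A}
    {σ : Ω → Fin n → ℝ} (hz : ∀ s, Measurable fun ω => zs ω s) (hσ : ∀ s, Measurable fun ω => σ ω s)
    (β : ℝ) : Measurable fun p : Ω × (X × A) => c.bonus h (zs p.1) (σ p.1) β p.2 := by
  have hφi : ∀ i, Measurable fun z => (c.φ h z).ofLp i := fun i => by fun_prop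
  have hg : ∀ i j, Measurable fun ω => c.gram h (zs ω) (σ ω) i j := fun i j => by
    simp only [Config.gram, Matrix.add_apply, Matrix.smul_apply, Matrix.sum_apply,
      Matrix.vecMulVec_apply, smul_eq_mul]
    refine measurable_const.add (Finset.measurable_sum _ fun s _ => ?_)
    have h1 := (hφi i).comp (hz s)
    have h2 := (hφi j).comp (hz s)
    have h3 := hσ s
    simp only [Function.comp_def] at h1 h2
    exact (((h3.pow_const 2).const_div 1)).mul (h1.mul h2)
  have hinv := measurable_inv_apply hg
  simp only [Config.bonus, dotProduct, Matrix.mulVec]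
  refine (Measurable.sqrt ?_).mul_const _
  refine Finset.measurable_sum _ fun i _ => ((hφi i).comp measurable_snd).mul
    (Finset.measurable_sum _ fun j _ => ((hinv i j).comp measurable_fst).mul
      ((hφi j).comp measurable_snd))

theorem measurable_eluderD (hF : ∀ f ∈ c.F h, Measurable f) {n : ℕ} {zs : Ω → Fin n → X × A}
    {σ : Ω → Fin n → ℝ} (hz : ∀ s, Measurable fun ω => zs ω s) (hσ : ∀ s, Measurable fun ω => σ ω s)
    {z : Ω → X × A} (hzz : Measurable z) :
    Measurable fun ω => c.eluderD h (zs ω) (σ ω) (z ω) := by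
  simp only [Config.eluderD]
  refine Measurable.sqrt (Measurable.iSup fun p => ?_)
  have h1 := hF _ p.1.2
  have h2 := hF _ p.2.2
  refine (((h1.comp hzz).sub (h2.comp hzz)).pow_const 2).div
    ((Finset.measurable_sum _ fun s _ => ?_).add_const _)
  exact (((hσ s).pow_const 2).const_div 1).mul
    (((h1.comp (hz s)).sub (h2.comp (hz s))).pow_const 2)

theorem continuous_bonus [TopologicalSpace A] {x : X} (hφ : Continuous fun a => c.φ h (x, a))
    {n : ℕ} (zs : Fin n → X × A) (σ : Fin n → ℝ) (β : ℝ) :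
    Continuous fun a => c.bonus h zs σ β (x, a) := by
  simp only [Config.bonus, dotProduct, Matrix.mulVec]
  fun_prop

end Algorithm

/-! ## The information structure of a run -/

section Run

variable {X A Ω : Type*} [MeasurableSpace X] [MeasurableSpace A] {d : ℕ}
  {c : Config X A d} {D : Ω → Transcript X A}

theorem histBefore_le_hist (H t h : ℕ) : histBefore H D t ≤ hist H D t h := le_sup_left

theorem hist_mono (H t : ℕ) {h h' : ℕ} (hh : h ≤ h') : hist H D t h ≤ hist H D t h' :=
  sup_le_sup le_rfl (biSup_mono fun _ hk => le_trans hk hh)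

theorem comap_le_histBefore {H s t k : ℕ} (hs : s < t) (hk : k ≤ H) :
    MeasurableSpace.comap (fun ω => (D ω).x s k) inferInstance ≤ histBefore H D t :=
  le_trans (le_iSup₂_of_le k (Set.mem_Iic.2 hk) le_rfl)
    (le_iSup₂ (f := fun s (_ : s ∈ Set.Iio t) => ⨆ k ∈ Set.Iic H,
      MeasurableSpace.comap (fun ω => (D ω).x s k) inferInstance) s (Set.mem_Iio.2 hs))

theorem histBefore_mono (H : ℕ) {t t' : ℕ} (ht : t ≤ t') : histBefore H D t ≤ histBefore H D t' :=
  iSup₂_le fun _ hs => iSup₂_le fun _ hk => comap_le_histBefore (lt_of_lt_of_le hs ht) hk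

theorem hist_le_histBefore {H t t' h : ℕ} (ht : t < t') (hh : h ≤ H) :
    hist H D t h ≤ histBefore H D t' :=
  sup_le (histBefore_mono H ht.le) (iSup₂_le fun _ hk => comap_le_histBefore ht (le_trans hk hh))

theorem measurable_x_hist (H t : ℕ) {k h : ℕ} (hk : k ≤ h) :
    Measurable[hist H D t h] fun ω => (D ω).x t k := by
  refine Measurable.mono (comap_measurable _) ?_ le_rfl
  exact le_trans (le_iSup₂ (f := fun k (_ : k ∈ Set.Iic h) =>
    MeasurableSpace.comap (fun ω => (D ω).x t k) inferInstance) k (Set.mem_Iic.2 hk)) le_sup_right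

end Run

/-- The standing assumptions together with a run of the algorithm. -/
structure RunSetting {X A Ω : Type*} [MeasurableSpace X] [MeasurableSpace A] [TopologicalSpace A]
    [MeasurableSpace Ω] {d : ℕ} (M : MDP X A) (c : Config X A d) (Pr : Measure Ω)
    (D : Ω → Transcript X A) : Prop extends LinSetting M c where
  run : IsRun M c Pr D

namespace RunSetting

variable {X A Ω : Type*} [MeasurableSpace X] [TopologicalSpace A] [PolishSpace A]
  [MeasurableSpace A] [mΩ : MeasurableSpace Ω] {d : ℕ} {M : MDP X A} {c : Config X A d}
  {Pr : Measure Ω} {D : Ω → Transcript X A}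

theorem histBefore_le (S : RunSetting M c Pr D) {t : ℕ} (ht : t ≤ c.T) :
    histBefore c.H D t ≤ mΩ :=
  iSup₂_le fun _ hs => iSup₂_le fun _ hk =>
    (S.run.measurable_x _ (lt_of_lt_of_le hs ht) _ hk).comap_le

theorem hist_le (S : RunSetting M c Pr D) {t h : ℕ} (ht : t < c.T) (hh : h ≤ c.H) :
    hist c.H D t h ≤ mΩ :=
  (hist_le_histBefore (Nat.lt_succ_self t) hh).trans (S.histBefore_le ht)

theorem measurable_z (S : RunSetting M c Pr D) {t h : ℕ} (ht : t < c.T) (hh : h < c.H) :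
    Measurable[hist c.H D t h] fun ω => (D ω).z t h :=
  Measurable.prodMk (measurable_x_hist c.H t le_rfl) (S.run.adapted_a t ht h hh)

theorem measurable_z_before (S : RunSetting M c Pr D) {s t h : ℕ} (hs : s < t) (ht : t ≤ c.T)
    (hh : h < c.H) : Measurable[histBefore c.H D t] fun ω => (D ω).z s h :=
  (S.measurable_z (hs.trans_le ht) hh).mono (hist_le_histBefore hs hh.le) le_rfl

theorem measurable_mem (S : RunSetting M c Pr D) {h : ℕ} (hh : h < c.H) :
    ∀ f ∈ c.F h, Measurable f := fun _ hf =>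
  S.toLinSetting.measurable_of_mem (S.horizon ▸ hh) hf

theorem measurable_fhat₁ (S : RunSetting M c Pr D) {t h : ℕ} (ht : t < c.T) (hh : h < c.H) :
    @Measurable _ _ ((histBefore c.H D t).prod inferInstance) _
      (fun p : Ω × (X × A) => (D p.1).fhat₁ t h p.2) :=
  @measurable_of_mem_finset _ _ (histBefore c.H D t) _ (c.F h) (S.measurable_mem hh)
    (fun ω => (D ω).fhat₁ t h) (fun ω => ((S.run.isVOQL ω).regression₁ t ht h hh).1)
    (S.run.adapted₁ t ht h hh)

theorem measurable_fhat₂ (S : RunSetting M c Pr D) {t h : ℕ} (ht : t < c.T) (hh : h < c.H) :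
    @Measurable _ _ ((histBefore c.H D t).prod inferInstance) _
      (fun p : Ω × (X × A) => (D p.1).fhat₂ t h p.2) :=
  @measurable_of_mem_finset _ _ (histBefore c.H D t) _ (c.F h) (S.measurable_mem hh)
    (fun ω => (D ω).fhat₂ t h) (fun ω => ((S.run.isVOQL ω).regression₂ t ht h hh).1)
    (S.run.adapted₂ t ht h hh)

theorem measurable_fhatNeg (S : RunSetting M c Pr D) {t h : ℕ} (ht : t < c.T) (hh : h < c.H) :
    @Measurable _ _ ((histBefore c.H D t).prod inferInstance) _
      (fun p : Ω × (X × A) => (D p.1).fhatNeg t h p.2) :=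
  @measurable_of_mem_finset _ _ (histBefore c.H D t) _ (c.F h) (S.measurable_mem hh)
    (fun ω => (D ω).fhatNeg t h) (fun ω => ((S.run.isVOQL ω).regressionNeg t ht h hh).1)
    (S.run.adaptedNeg t ht h hh)

theorem measurable_ghat (S : RunSetting M c Pr D) {t h : ℕ} (ht : t < c.T) (hh : h < c.H) :
    @Measurable _ _ ((histBefore c.H D t).prod inferInstance) _
      (fun p : Ω × (X × A) => (D p.1).ghat t h p.2) :=
  @measurable_of_mem_finset _ _ (histBefore c.H D t) _ (c.F h) (S.measurable_mem hh)
    (fun ω => (D ω).ghat t h) (fun ω => ((S.run.isVOQL ω).regressionSq t ht h hh).1)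
    (S.run.adaptedSq t ht h hh)

theorem measurable_b₂ (S : RunSetting M c Pr D) {t h : ℕ} (ht : t < c.T) (hh : h < c.H) :
    @Measurable _ _ ((histBefore c.H D t).prod inferInstance) _
      (fun p : Ω × (X × A) => (D p.1).b₂ c t h p.2) :=
  @measurable_bonus _ _ _ _ _ (histBefore c.H D t) _ _ _ (S.lin.measurable_φ h) _ _ _
    (fun s => S.measurable_z_before s.2 ht.le hh) (fun _ => measurable_const) _

theorem measurable_fNeg (S : RunSetting M c Pr D) {t h : ℕ} (ht : t < c.T) (hh : h < c.H) :
    @Measurable _ _ ((histBefore c.H D t).prod inferInstance) _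
      (fun p : Ω × (X × A) => (D p.1).fNeg c t h p.2) :=
  (((S.measurable_fhatNeg ht hh).sub (S.measurable_b₂ ht hh)).sub_const _).max measurable_const

theorem measurable_at_z (S : RunSetting M c Pr D) {t h : ℕ} (ht : t < c.T) (hh : h < c.H)
    {f : Ω → X × A → ℝ}
    (hf : @Measurable _ _ ((histBefore c.H D t).prod inferInstance) _ (fun p : Ω × (X × A) => f p.1 p.2)) :
    Measurable[hist c.H D t h] fun ω => f ω ((D ω).z t h) := by
  have h1 : @Measurable Ω (Ω × (X × A)) (hist c.H D t h) ((histBefore c.H D t).prod inferInstance)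
      (fun ω => (ω, (D ω).z t h)) :=
    @Measurable.prodMk _ (hist c.H D t h) _ _ (histBefore c.H D t) _ _ _
      (measurable_id'' (histBefore_le_hist _ _ _)) (S.measurable_z ht hh)
  exact hf.comp h1

theorem measurable_eluderD_z (S : RunSetting M c Pr D) {t h : ℕ} (ht : t < c.T) (hh : h < c.H)
    {σ : Ω → Fin t → ℝ} (hσ : ∀ s, Measurable[histBefore c.H D t] fun ω => σ ω s) :
    Measurable[hist c.H D t h] fun ω =>
      c.eluderD h ((D ω).past t h) (σ ω) ((D ω).z t h) :=
  @measurable_eluderD _ _ _ _ _ (hist c.H D t h) _ _ _ (S.measurable_mem hh) _ _ _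
    (fun s => (S.measurable_z_before s.2 ht.le hh).mono (histBefore_le_hist _ _ _) le_rfl)
    (fun s => (hσ s).mono (histBefore_le_hist _ _ _) le_rfl) _ (S.measurable_z ht hh)

theorem measurable_sigma (S : RunSetting M c Pr D) {t h : ℕ} (ht : t < c.T) (hh : h < c.H) :
    Measurable[hist c.H D t h] fun ω => (D ω).sigma c t h := by
  simp only [Transcript.sigma]
  split_ifs
  · exact measurable_const
  · refine Measurable.sqrt (measurable_const.min (Measurable.add_const (((S.measurable_at_z ht hh
      (S.measurable_ghat ht hh)).sub ((S.measurable_at_z ht hh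
      (S.measurable_fhatNeg ht hh)).pow_const 2)).add (Measurable.mul_const ?_ _)) _))
    exact S.measurable_eluderD_z ht hh fun _ => measurable_const

theorem measurable_f₂Of (S : RunSetting M c Pr D) {t h : ℕ} (ht : t < c.T) (hh : h < c.H)
    {σ : Ω → Fin t → ℝ} (hσ : ∀ s, Measurable[histBefore c.H D t] fun ω => σ ω s) :
    @Measurable _ _ ((histBefore c.H D t).prod inferInstance) _
      (fun p : Ω × (X × A) => (D p.1).f₂Of c t h (σ p.1) p.2) := by
  simp only [Transcript.f₂Of]
  refine Measurable.min ((((S.measurable_fhat₂ ht hh).add (Measurable.const_mul ?_ 2)).add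
    (S.measurable_b₂ ht hh)).add_const _) measurable_const
  exact @measurable_bonus _ _ _ _ _ (histBefore c.H D t) _ _ _ (S.lin.measurable_φ h) _ _ _
    (fun s => S.measurable_z_before s.2 ht.le hh) hσ _

/-- Strong induction along the recursion: the weight of episode `t` at level `h` is known once the
state at level `h` has been seen, and the earlier weights are known before the episode. -/
theorem measurable_sigmaBar (S : RunSetting M c Pr D) {h : ℕ} (hh : h < c.H) (t : ℕ) :
    t < c.T → Measurable[hist c.H D t h] fun ω => (D ω).sigmaBar c h t := by
  induction t using Nat.strong_induction_on with
  | _ t ih =>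
    intro ht
    have hσ : ∀ s : Fin t, Measurable[histBefore c.H D t] fun ω => (D ω).sigmaBar c h s :=
      fun s => (ih s s.2 (s.2.trans ht)).mono (hist_le_histBefore s.2 hh.le) le_rfl
    have heq : (fun ω => (D ω).sigmaBar c h t) =
        fun ω => (D ω).weightOf c t h fun s : Fin t => (D ω).sigmaBar c h s := by
      ext ω; rw [Transcript.sigmaBar]
    rw [heq]
    simp only [Transcript.weightOf]
    refine Measurable.max ((S.measurable_sigma ht hh).max measurable_const)
      (Measurable.max ?_ ?_)
    · exact (Measurable.sqrt ((S.measurable_at_z ht hh (S.measurable_f₂Of ht hh hσ)).sub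
        (S.measurable_at_z ht hh (S.measurable_fNeg ht hh)))).const_mul _
    · exact (Measurable.sqrt (S.measurable_eluderD_z ht hh hσ)).const_mul _

theorem measurable_sigmaBar_before (S : RunSetting M c Pr D) {h s t : ℕ} (hh : h < c.H)
    (hs : s < t) (ht : t ≤ c.T) :
    Measurable[histBefore c.H D t] fun ω => (D ω).sigmaBar c h s :=
  (S.measurable_sigmaBar hh s (hs.trans_le ht)).mono (hist_le_histBefore hs hh.le) le_rfl

theorem measurable_b₁ (S : RunSetting M c Pr D) {t h : ℕ} (ht : t < c.T) (hh : h < c.H) :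
    @Measurable _ _ ((histBefore c.H D t).prod inferInstance) _
      (fun p : Ω × (X × A) => (D p.1).b₁ c t h p.2) :=
  @measurable_bonus _ _ _ _ _ (histBefore c.H D t) _ _ _ (S.lin.measurable_φ h) _ _ _
    (fun s => S.measurable_z_before s.2 ht.le hh)
    (fun s => S.measurable_sigmaBar_before hh s.2 ht.le) _

theorem measurable_f₁ (S : RunSetting M c Pr D) {t h : ℕ} (ht : t < c.T) (hh : h < c.H) :
    @Measurable _ _ ((histBefore c.H D t).prod inferInstance) _
      (fun p : Ω × (X × A) => (D p.1).f₁ c t h p.2) :=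
  (((S.measurable_fhat₁ ht hh).add (S.measurable_b₁ ht hh)).add_const _).min measurable_const

theorem measurable_f₂ (S : RunSetting M c Pr D) {t h : ℕ} (ht : t < c.T) (hh : h < c.H) :
    @Measurable _ _ ((histBefore c.H D t).prod inferInstance) _
      (fun p : Ω × (X × A) => (D p.1).f₂ c t h p.2) :=
  S.measurable_f₂Of ht hh (σ := fun ω s => (D ω).sigmaBar c h s)
    fun s => S.measurable_sigmaBar_before hh s.2 ht.le

theorem continuous_mem (S : RunSetting M c Pr D) {h : ℕ} (hh : h < c.H) {f : X × A → ℝ}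
    (hf : f ∈ c.F h) (x : X) : Continuous fun a => f (x, a) :=
  S.toLinSetting.continuous_of_mem (S.horizon ▸ hh) hf x

theorem continuous_f₁ (S : RunSetting M c Pr D) (ω : Ω) {t h : ℕ} (ht : t < c.T) (hh : h < c.H)
    (x : X) : Continuous fun a => (D ω).f₁ c t h (x, a) := by
  have h1 := S.continuous_mem hh ((S.run.isVOQL ω).regression₁ t ht h hh).1 x
  have h2 := continuous_bonus (S.lin.continuous_φ h x) ((D ω).past t h)
    (fun s => (D ω).sigmaBar c h s) c.β₁
  exact ((h1.add h2).add continuous_const).min continuous_const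

theorem continuous_f₂ (S : RunSetting M c Pr D) (ω : Ω) {t h : ℕ} (ht : t < c.T) (hh : h < c.H)
    (x : X) : Continuous fun a => (D ω).f₂ c t h (x, a) := by
  have h1 := S.continuous_mem hh ((S.run.isVOQL ω).regression₂ t ht h hh).1 x
  have h2 := continuous_bonus (S.lin.continuous_φ h x) ((D ω).past t h)
    (fun s => (D ω).sigmaBar c h s) c.β₁
  have h3 := continuous_bonus (S.lin.continuous_φ h x) ((D ω).past t h) (fun _ => 1) c.β₂
  exact (((h1.add (continuous_const.mul h2)).add h3).add continuous_const).min continuous_const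

theorem continuous_fNeg (S : RunSetting M c Pr D) (ω : Ω) {t h : ℕ} (ht : t < c.T) (hh : h < c.H)
    (x : X) : Continuous fun a => (D ω).fNeg c t h (x, a) := by
  have h1 := S.continuous_mem hh ((S.run.isVOQL ω).regressionNeg t ht h hh).1 x
  have h3 := continuous_bonus (S.lin.continuous_φ h x) ((D ω).past t h) (fun _ => 1) c.β₂
  exact ((h1.sub h3).sub continuous_const).max continuous_const

theorem measurable_maxVal {m : MeasurableSpace Ω} {f : Ω → ℕ → ℕ → X × A → ℝ} {t h : ℕ}
    (hf : h < c.H → @Measurable _ _ (m.prod inferInstance) _ (fun p : Ω × (X × A) => f p.1 t h p.2))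
    (hc : h < c.H → ∀ ω x, Continuous fun a => f ω t h (x, a)) :
    @Measurable _ _ (m.prod inferInstance) _ (fun p : Ω × X => Transcript.maxVal c (f p.1) t h p.2) := by
  unfold Transcript.maxVal
  by_cases hh : h < c.H
  · simp only [hh, if_true]
    refine @measurable_iSup_of_continuous _ _ _ _ (m.prod inferInstance)
      (fun (p : Ω × X) a => f p.1 t h (p.2, a)) (fun a => ?_) fun p => hc hh p.1 p.2
    have h1 : @Measurable (Ω × X) (Ω × (X × A)) (m.prod inferInstance) (m.prod inferInstance)
        (fun p => (p.1, (p.2, a))) :=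
      @Measurable.prodMk _ (m.prod inferInstance) _ _ m _ _ _ (@measurable_fst _ _ m _)
        (Measurable.prodMk (@measurable_snd _ _ m _) measurable_const)
    exact (hf hh).comp h1
  · simp only [hh, if_false]; exact measurable_const

theorem measurable_V₁ (S : RunSetting M c Pr D) {t : ℕ} (ht : t < c.T) (h : ℕ) :
    @Measurable _ _ ((histBefore c.H D t).prod inferInstance) _
      (fun p : Ω × X => Transcript.maxVal c ((D p.1).f₁ c) t h p.2) :=
  measurable_maxVal (f := fun ω => (D ω).f₁ c) (S.measurable_f₁ ht)
    fun hh ω x => S.continuous_f₁ ω ht hh x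

theorem measurable_V₂ (S : RunSetting M c Pr D) {t : ℕ} (ht : t < c.T) (h : ℕ) :
    @Measurable _ _ ((histBefore c.H D t).prod inferInstance) _
      (fun p : Ω × X => Transcript.maxVal c ((D p.1).f₂ c) t h p.2) :=
  measurable_maxVal (f := fun ω => (D ω).f₂ c) (S.measurable_f₂ ht)
    fun hh ω x => S.continuous_f₂ ω ht hh x

theorem measurable_VNeg (S : RunSetting M c Pr D) {t : ℕ} (ht : t < c.T) (h : ℕ) :
    @Measurable _ _ ((histBefore c.H D t).prod inferInstance) _
      (fun p : Ω × X => Transcript.maxVal c ((D p.1).fNeg c) t h p.2) :=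
  measurable_maxVal (f := fun ω => (D ω).fNeg c) (S.measurable_fNeg ht)
    fun hh ω x => S.continuous_fNeg ω ht hh x

theorem measurable_at_x (S : RunSetting M c Pr D) {t h k : ℕ} (hk : k ≤ h)
    {f : Ω → X → ℝ}
    (hf : @Measurable _ _ ((histBefore c.H D t).prod inferInstance) _ (fun p : Ω × X => f p.1 p.2)) :
    Measurable[hist c.H D t h] fun ω => f ω ((D ω).x t k) := by
  have h1 : @Measurable Ω (Ω × X) (hist c.H D t h) ((histBefore c.H D t).prod inferInstance)
      (fun ω => (ω, (D ω).x t k)) :=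
    @Measurable.prodMk _ (hist c.H D t h) _ _ (histBefore c.H D t) _ _ _
      (measurable_id'' (histBefore_le_hist _ _ _)) (measurable_x_hist c.H t hk)
  exact hf.comp h1

theorem measurableSet_gapSmall (S : RunSetting M c Pr D) {t h : ℕ} (ht : t < c.T) :
    MeasurableSet[hist c.H D t h] {ω | (D ω).GapSmall c t h} := by
  have : {ω | (D ω).GapSmall c t h} = ⋂ k ∈ Finset.Iic h,
      {ω | Transcript.maxVal c ((D ω).f₂ c) t k ((D ω).x t k) - c.u t ≤
        Transcript.maxVal c ((D ω).f₁ c) t k ((D ω).x t k)} := by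
    ext ω; simp [Transcript.GapSmall]
  rw [this]
  refine @Finset.measurableSet_biInter _ _ (hist c.H D t h) _ _ fun k hk => ?_
  have hk' := Finset.mem_Iic.1 hk
  exact @measurableSet_le _ _ _ _ _ (hist c.H D t h) _ _ _ _ _
    ((S.measurable_at_x hk' (S.measurable_V₂ ht k)).sub_const _)
    (S.measurable_at_x hk' (S.measurable_V₁ ht k))

end RunSetting


/-! ## Elliptical bonuses and a finite cover of the value functions -/

section BonusBasics

variable {X A : Type*} {d : ℕ} (c : Config X A d)

theorem Config.gram_eq (h : ℕ) {n : ℕ} (zs : Fin n → X × A) (σ : Fin n → ℝ) :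
    c.gram h zs σ = gramM (1 / (4 * c.Bh h ^ 2))
      (fun s => (1 / σ s) • WithLp.ofLp (c.φ h (zs s))) := by
  simp only [Config.gram, gramM, Config.lam]
  congr 1
  refine Finset.sum_congr rfl fun s _ => ?_
  rw [Matrix.smul_vecMulVec, Matrix.vecMulVec_smul, smul_smul]
  congr 1
  ring

/-- `‖φ^h(z)‖_{Σ⁻¹}²`. -/
noncomputable def Config.ellSq (h : ℕ) {n : ℕ} (zs : Fin n → X × A) (σ : Fin n → ℝ) (z : X × A) :
    ℝ :=
  WithLp.ofLp (c.φ h z) ⬝ᵥ ((c.gram h zs σ)⁻¹ *ᵥ WithLp.ofLp (c.φ h z))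

theorem Config.bonus_eq (h : ℕ) {n : ℕ} (zs : Fin n → X × A) (σ : Fin n → ℝ) (β : ℝ) (z : X × A) :
    c.bonus h zs σ β z = √(c.ellSq h zs σ z) * √(β ^ 2 + 1) := rfl

theorem Config.bonus_nonneg (h : ℕ) {n : ℕ} (zs : Fin n → X × A) (σ : Fin n → ℝ) (β : ℝ)
    (z : X × A) : 0 ≤ c.bonus h zs σ β z := by
  rw [c.bonus_eq]; positivity

variable {c}

theorem reg_pos {b : ℝ} (hB : 1 ≤ b) : 0 < 1 / (4 * b ^ 2) := by
  have : 0 < b := by linarith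
  positivity

theorem Config.ellSq_nonneg {h : ℕ} (hB : 1 ≤ c.Bh h) {n : ℕ} (zs : Fin n → X × A)
    (σ : Fin n → ℝ) (z : X × A) : 0 ≤ c.ellSq h zs σ z := by
  rw [Config.ellSq, c.gram_eq]
  exact dotProduct_inv_nonneg (gramM_posDef (reg_pos hB) _) _

theorem Config.dotProduct_gram {h : ℕ} {n : ℕ} (zs : Fin n → X × A) (σ : Fin n → ℝ)
    (x : Fin d → ℝ) : x ⬝ᵥ (c.gram h zs σ *ᵥ x) = 1 / (4 * c.Bh h ^ 2) * (x ⬝ᵥ x) +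
      ∑ s, 1 / σ s ^ 2 * (x ⬝ᵥ WithLp.ofLp (c.φ h (zs s))) ^ 2 := by
  rw [c.gram_eq, dotProduct_gramM]
  congr 1
  refine Finset.sum_congr rfl fun s _ => ?_
  rw [smul_dotProduct, smul_eq_mul, dotProduct_comm]
  ring

/-- Differences of members of the linear class are controlled by the elliptical norm. -/
theorem Config.sq_sub_le_ellSq {h : ℕ} (hB : 1 ≤ c.Bh h) {n : ℕ} (zs : Fin n → X × A)
    (σ : Fin n → ℝ) (z : X × A) {f g : X × A → ℝ} (hf : f ∈ linClass c.φ c.Bh h)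
    (hg : g ∈ linClass c.φ c.Bh h) :
    (f z - g z) ^ 2 ≤
      c.ellSq h zs σ z * (∑ s, 1 / σ s ^ 2 * (f (zs s) - g (zs s)) ^ 2 + 1) := by
  obtain ⟨w, hw, hf⟩ := hf
  obtain ⟨v, hv, hg⟩ := hg
  have hd : ∀ z, f z - g z = WithLp.ofLp (w - v) ⬝ᵥ WithLp.ofLp (c.φ h z) := fun z => by
    rw [hf, hg, ← inner_sub_left, EuclideanSpace.inner_eq_star_dotProduct, dotProduct_comm]
    simp
  have hA : (c.gram h zs σ).PosDef := by rw [c.gram_eq]; exact gramM_posDef (reg_pos hB) _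
  have h1 := sq_dotProduct_le hA (WithLp.ofLp (w - v)) (WithLp.ofLp (c.φ h z))
  rw [← hd, Config.dotProduct_gram] at h1
  have hn : WithLp.ofLp (w - v) ⬝ᵥ WithLp.ofLp (w - v) = ‖w - v‖ ^ 2 := by
    rw [EuclideanSpace.real_norm_sq_eq]; simp [dotProduct, sq]
  -- The regularization is calibrated here: two weight vectors of the class are at distance at most
  -- `2 B^h`, so the regularizer contributes at most `λ = 1`.
  have h2 : 1 / (4 * c.Bh h ^ 2) * (WithLp.ofLp (w - v) ⬝ᵥ WithLp.ofLp (w - v)) ≤ 1 := by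
    rw [hn]
    have h3 : ‖w - v‖ ≤ 2 * c.Bh h := (norm_sub_le _ _).trans (by linarith)
    have h4 : ‖w - v‖ ^ 2 ≤ (2 * c.Bh h) ^ 2 := pow_le_pow_left₀ (norm_nonneg _) h3 2
    rw [one_div_mul_eq_div, div_le_one (by positivity)]
    linarith
  have h5 := Config.ellSq_nonneg hB zs σ z
  have h6 : ∑ s, 1 / σ s ^ 2 * (WithLp.ofLp (w - v) ⬝ᵥ WithLp.ofLp (c.φ h (zs s))) ^ 2 =
      ∑ s, 1 / σ s ^ 2 * (f (zs s) - g (zs s)) ^ 2 :=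
    Finset.sum_congr rfl fun s _ => by rw [hd]
  rw [h6] at h1
  calc (f z - g z) ^ 2 ≤ _ := h1
    _ ≤ (∑ s, 1 / σ s ^ 2 * (f (zs s) - g (zs s)) ^ 2 + 1) * c.ellSq h zs σ z :=
        mul_le_mul_of_nonneg_right (by linarith) h5
    _ = _ := mul_comm _ _

theorem Config.abs_sub_le_bonus {h : ℕ} (hB : 1 ≤ c.Bh h) {n : ℕ} (zs : Fin n → X × A)
    (σ : Fin n → ℝ) (z : X × A) {f g : X × A → ℝ} (hf : f ∈ linClass c.φ c.Bh h)
    (hg : g ∈ linClass c.φ c.Bh h) {β : ℝ}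
    (hS : ∑ s, 1 / σ s ^ 2 * (f (zs s) - g (zs s)) ^ 2 ≤ β ^ 2) :
    |f z - g z| ≤ c.bonus h zs σ β z := by
  rw [c.bonus_eq, ← Real.sqrt_mul (Config.ellSq_nonneg hB zs σ z)]
  refine Real.abs_le_sqrt ((Config.sq_sub_le_ellSq hB zs σ z hf hg).trans ?_)
  exact mul_le_mul_of_nonneg_left (by linarith) (Config.ellSq_nonneg hB zs σ z)

theorem Config.eluderD_sq_ge {h : ℕ} {n : ℕ} (zs : Fin n → X × A)
    (σ : Fin n → ℝ) (z : X × A) {f g : X × A → ℝ} (hf : f ∈ c.F h) (hg : g ∈ c.F h) :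
    (f z - g z) ^ 2 ≤ c.eluderD h zs σ z ^ 2 *
      (∑ s, 1 / σ s ^ 2 * (f (zs s) - g (zs s)) ^ 2 + 1) := by
  have hS : 0 ≤ ∑ s, 1 / σ s ^ 2 * (f (zs s) - g (zs s)) ^ 2 :=
    Finset.sum_nonneg fun s _ => by positivity
  rw [Config.eluderD, Real.sq_sqrt (Real.iSup_nonneg fun p => div_nonneg (sq_nonneg _) (by
    have : 0 ≤ ∑ s, 1 / σ s ^ 2 * (p.1.1 (zs s) - p.2.1 (zs s)) ^ 2 :=
      Finset.sum_nonneg fun s _ => by positivity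
    rw [Config.lam]; linarith)), ← div_le_iff₀ (by linarith)]
  exact le_ciSup (f := fun p : c.F h × c.F h => (p.1.1 z - p.2.1 z) ^ 2 /
    (∑ s, 1 / σ s ^ 2 * (p.1.1 (zs s) - p.2.1 (zs s)) ^ 2 + Config.lam))
    (Set.finite_range _).bddAbove (⟨f, hf⟩, ⟨g, hg⟩)

theorem Config.eluderD_nonneg (h : ℕ) {n : ℕ} (zs : Fin n → X × A)
    (σ : Fin n → ℝ) (z : X × A) : 0 ≤ c.eluderD h zs σ z := Real.sqrt_nonneg _

theorem Config.abs_sub_le_eluderD {h : ℕ} {n : ℕ} (zs : Fin n → X × A)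
    (σ : Fin n → ℝ) (z : X × A) {f g : X × A → ℝ} (hf : f ∈ c.F h) (hg : g ∈ c.F h) {β : ℝ}
    (hS : ∑ s, 1 / σ s ^ 2 * (f (zs s) - g (zs s)) ^ 2 ≤ β ^ 2) :
    |f z - g z| ≤ c.eluderD h zs σ z * √(β ^ 2 + 1) := by
  rw [← Real.sqrt_sq (c.eluderD_nonneg h zs σ z), ← Real.sqrt_mul (sq_nonneg _)]
  refine Real.abs_le_sqrt ((Config.eluderD_sq_ge zs σ z hf hg).trans ?_)
  exact mul_le_mul_of_nonneg_left (by linarith) (sq_nonneg _)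

/-- The cover lies in the linear class, so the eluder quantities are dominated by elliptical norms
and their sums are controlled by the elliptical potential. -/
theorem Config.eluderD_le_sqrt_ellSq {h : ℕ} (hB : 1 ≤ c.Bh h)
    (hF : (c.F h : Set (X × A → ℝ)) ⊆ linClass c.φ c.Bh h) {n : ℕ} (zs : Fin n → X × A)
    (σ : Fin n → ℝ) (z : X × A) : c.eluderD h zs σ z ≤ √(c.ellSq h zs σ z) := by
  refine Real.sqrt_le_sqrt (Real.iSup_le (fun p => ?_) (Config.ellSq_nonneg hB zs σ z))
  have hS : 0 ≤ ∑ s, 1 / σ s ^ 2 * (p.1.1 (zs s) - p.2.1 (zs s)) ^ 2 :=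
    Finset.sum_nonneg fun s _ => by positivity
  rw [Config.lam, div_le_iff₀ (by linarith)]
  exact Config.sq_sub_le_ellSq hB zs σ z (hF p.1.2) (hF p.2.2)

theorem Config.eluderD_le {h : ℕ} {b : ℝ} (hb : ∀ f ∈ c.F h, ∀ z, |f z| ≤ b) (hb0 : 0 ≤ b)
    {n : ℕ} (zs : Fin n → X × A) (σ : Fin n → ℝ) (z : X × A) :
    c.eluderD h zs σ z ≤ 2 * b := by
  rw [Config.eluderD]
  refine Real.sqrt_le_iff.2 ⟨by linarith, Real.iSup_le (fun p => ?_) (by positivity)⟩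
  have hS : 0 ≤ ∑ s, 1 / σ s ^ 2 * (p.1.1 (zs s) - p.2.1 (zs s)) ^ 2 :=
    Finset.sum_nonneg fun s _ => by positivity
  have h1 : (p.1.1 z - p.2.1 z) ^ 2 ≤ (2 * b) ^ 2 := by
    refine sq_le_sq' ?_ ?_ <;>
    linarith [abs_le.1 (hb _ p.1.2 z), abs_le.1 (hb _ p.2.2 z), (abs_le.1 (hb _ p.1.2 z)).1,
      (abs_le.1 (hb _ p.2.2 z)).1, (abs_le.1 (hb _ p.1.2 z)).2, (abs_le.1 (hb _ p.2.2 z)).2]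
  rw [Config.lam, div_le_iff₀ (by linarith)]
  nlinarith [sq_nonneg (2 * b)]

/-- Elliptical bonuses decrease as data come in. -/
theorem Config.ellSq_anti {h : ℕ} (hB : 1 ≤ c.Bh h) (zs : ℕ → X × A) (σ : ℕ → ℝ) (z : X × A)
    {s t : ℕ} (hst : s ≤ t) : c.ellSq h (fun j : Fin t => zs j) (fun j => σ j) z ≤
      c.ellSq h (fun j : Fin s => zs j) (fun j => σ j) z := by
  have hA : ∀ t, (c.gram h (fun j : Fin t => zs j) (fun j => σ j)).PosDef := fun t => by
    rw [c.gram_eq]; exact gramM_posDef (reg_pos hB) _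
  refine dotProduct_inv_anti (hA s) (hA t) (fun x => ?_) _
  rw [Config.dotProduct_gram, Config.dotProduct_gram]
  refine add_le_add le_rfl ?_
  rw [Fin.sum_univ_eq_sum_range
    (fun j => 1 / σ j ^ 2 * (x ⬝ᵥ WithLp.ofLp (c.φ h (zs j))) ^ 2) s,
    Fin.sum_univ_eq_sum_range (fun j => 1 / σ j ^ 2 * (x ⬝ᵥ WithLp.ofLp (c.φ h (zs j))) ^ 2) t]
  exact Finset.sum_le_sum_of_subset_of_nonneg (Finset.range_mono hst)
    fun j _ _ => by positivity

end BonusBasics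

section Clip

/-- Truncation to `[0, 2]`. -/
noncomputable def clip (x : ℝ) : ℝ := max 0 (min x 2)

theorem clip_nonneg (x : ℝ) : 0 ≤ clip x := le_max_left _ _

theorem clip_le_two (x : ℝ) : clip x ≤ 2 := max_le zero_le_two (min_le_right _ _)

theorem clip_of_mem {x : ℝ} (h0 : 0 ≤ x) (h2 : x ≤ 2) : clip x = x := by
  rw [clip, min_eq_left h2, max_eq_right h0]

theorem abs_clip_sub_clip_le (x y : ℝ) : |clip x - clip y| ≤ |x - y| := by
  rw [clip, clip]
  refine (abs_max_sub_max_le_max _ _ _ _).trans ?_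
  rw [sub_self, abs_zero, max_eq_right (abs_nonneg _)]
  refine (abs_min_sub_min_le_max _ _ _ _).trans ?_
  rw [sub_self, abs_zero, max_eq_left (abs_nonneg _)]

theorem measurable_clip : Measurable clip := measurable_const.max (measurable_id.min measurable_const)

theorem abs_iSup_sub_iSup_le {ι : Type*} [Nonempty ι] {f g : ι → ℝ} {e : ℝ}
    (hf : BddAbove (Set.range f)) (hg : BddAbove (Set.range g)) (h : ∀ i, |f i - g i| ≤ e) :
    |(⨆ i, f i) - ⨆ i, g i| ≤ e := by
  rw [abs_sub_le_iff]
  constructor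
  · rw [sub_le_iff_le_add]
    exact ciSup_le fun i => by linarith [(abs_le.1 (h i)).2, le_ciSup hg i]
  · rw [sub_le_iff_le_add]
    exact ciSup_le fun i => by linarith [(abs_le.1 (h i)).1, le_ciSup hf i]

end Clip

section Shape

variable {X A : Type*} [MeasurableSpace X] [MeasurableSpace A] {d : ℕ} (c : Config X A d)

/-- The three kinds of value functions of the algorithm, as functions of the regression solution
and of the inverses of the Gram matrices. -/
noncomputable def Config.shape (h : ℕ) (j : Fin 3) (f : X × A → ℝ)
    (G₁ G₂ : Matrix (Fin d) (Fin d) ℝ) (z : X × A) : ℝ :=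
  let q := fun G : Matrix (Fin d) (Fin d) ℝ =>
    √(WithLp.ofLp (c.φ h z) ⬝ᵥ (G *ᵥ WithLp.ofLp (c.φ h z)))
  ![min (f z + q G₁ * √(c.β₁ ^ 2 + Config.lam) + c.ε) 1,
    min (f z + 2 * (q G₁ * √(c.β₁ ^ 2 + Config.lam)) + q G₂ * √(c.β₂ ^ 2 + Config.lam) + 3 * c.ε) 2,
    max (f z - q G₂ * √(c.β₂ ^ 2 + Config.lam) - c.ε) 0] j

theorem Config.measurable_shape {h : ℕ} (hφ : Measurable (c.φ h)) (j : Fin 3) {f : X × A → ℝ}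
    (hf : Measurable f) (G₁ G₂ : Matrix (Fin d) (Fin d) ℝ) : Measurable (c.shape h j f G₁ G₂) := by
  have hφi : ∀ i, Measurable fun z => (c.φ h z).ofLp i := fun i => by fun_prop
  have hq : ∀ G : Matrix (Fin d) (Fin d) ℝ, Measurable fun z =>
      √(WithLp.ofLp (c.φ h z) ⬝ᵥ (G *ᵥ WithLp.ofLp (c.φ h z))) := fun G => by
    simp only [dotProduct, Matrix.mulVec]
    exact (Finset.measurable_sum _ fun i _ => (hφi i).mul
      (Finset.measurable_sum _ fun k _ => (hφi k).const_mul _)).sqrt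
  have h1 := hq G₁
  have h2 := hq G₂
  unfold Config.shape
  fin_cases j
  · exact ((hf.add (h1.mul_const _)).add_const _).min measurable_const
  · exact (((hf.add ((h1.mul_const _).const_mul 2)).add (h2.mul_const _)).add_const _).min
      measurable_const
  · exact ((hf.sub (h2.mul_const _)).sub_const _).max measurable_const

theorem Config.continuous_shape [TopologicalSpace A] {h : ℕ} {x : X}
    (hφ : Continuous fun a => c.φ h (x, a)) (j : Fin 3) {f : X × A → ℝ}
    (hf : Continuous fun a => f (x, a)) (G₁ G₂ : Matrix (Fin d) (Fin d) ℝ) :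
    Continuous fun a => c.shape h j f G₁ G₂ (x, a) := by
  have hq : ∀ G : Matrix (Fin d) (Fin d) ℝ, Continuous fun a =>
      √(WithLp.ofLp (c.φ h (x, a)) ⬝ᵥ (G *ᵥ WithLp.ofLp (c.φ h (x, a)))) := fun G => by
    simp only [dotProduct, Matrix.mulVec]
    fun_prop
  have h1 := hq G₁
  have h2 := hq G₂
  unfold Config.shape
  fin_cases j
  · exact ((hf.add (h1.mul continuous_const)).add continuous_const).min continuous_const
  · exact (((hf.add (continuous_const.mul (h1.mul continuous_const))).add
      (h2.mul continuous_const)).add continuous_const).min continuous_const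
  · exact ((hf.sub (h2.mul continuous_const)).sub continuous_const).max continuous_const

/-- Truncations do not increase distances. The regression solution is the same on both sides because
it already ranges over a finite class; only the matrices are approximated. -/
theorem Config.abs_shape_sub_le {h : ℕ} {z : X × A} (hφ : ‖c.φ h z‖ ≤ 1) (j : Fin 3)
    (f : X × A → ℝ) {G₁ G₂ G₁' G₂' : Matrix (Fin d) (Fin d) ℝ} {η : ℝ} (hη : 0 ≤ η)
    (h₁ : ∀ i k, |G₁ i k - G₁' i k| ≤ η) (h₂ : ∀ i k, |G₂ i k - G₂' i k| ≤ η) :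
    |c.shape h j f G₁ G₂ z - c.shape h j f G₁' G₂' z| ≤
      √(η * d) * (2 * √(c.β₁ ^ 2 + Config.lam) + √(c.β₂ ^ 2 + Config.lam)) := by
  have hv : WithLp.ofLp (c.φ h z) ⬝ᵥ WithLp.ofLp (c.φ h z) ≤ 1 := by
    have : WithLp.ofLp (c.φ h z) ⬝ᵥ WithLp.ofLp (c.φ h z) = ‖c.φ h z‖ ^ 2 := by
      rw [EuclideanSpace.real_norm_sq_eq]; simp [dotProduct, sq]
    rw [this]
    exact pow_le_one₀ (norm_nonneg _) hφ
  have q₁ := abs_le.1 (abs_sqrt_quadratic_sub_le h₁ hv hη)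
  have q₂ := abs_le.1 (abs_sqrt_quadratic_sub_le h₂ hv hη)
  unfold Config.shape
  set s₁ := √(c.β₁ ^ 2 + Config.lam)
  set s₂ := √(c.β₂ ^ 2 + Config.lam)
  have hs₁ : 0 ≤ s₁ := Real.sqrt_nonneg _
  have hs₂ : 0 ≤ s₂ := Real.sqrt_nonneg _
  have hr : 0 ≤ √(η * d) := Real.sqrt_nonneg _
  set a := √(WithLp.ofLp (c.φ h z) ⬝ᵥ (G₁ *ᵥ WithLp.ofLp (c.φ h z)))
  set a' := √(WithLp.ofLp (c.φ h z) ⬝ᵥ (G₁' *ᵥ WithLp.ofLp (c.φ h z)))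
  set b := √(WithLp.ofLp (c.φ h z) ⬝ᵥ (G₂ *ᵥ WithLp.ofLp (c.φ h z)))
  set b' := √(WithLp.ofLp (c.φ h z) ⬝ᵥ (G₂' *ᵥ WithLp.ofLp (c.φ h z)))
  have e1 := mul_le_mul_of_nonneg_right q₁.1 hs₁
  have e2 := mul_le_mul_of_nonneg_right q₁.2 hs₁
  have e3 := mul_le_mul_of_nonneg_right q₂.1 hs₂
  have e4 := mul_le_mul_of_nonneg_right q₂.2 hs₂
  have e5 := mul_nonneg hr hs₁
  have e6 := mul_nonneg hr hs₂
  fin_cases j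
  · refine (abs_min_sub_min_le_max _ _ _ _).trans (max_le (abs_le.2 ⟨?_, ?_⟩) ?_)
    · nlinarith
    · nlinarith
    · rw [sub_self, abs_zero]; positivity
  · refine (abs_min_sub_min_le_max _ _ _ _).trans (max_le (abs_le.2 ⟨?_, ?_⟩) ?_)
    · nlinarith
    · nlinarith
    · rw [sub_self, abs_zero]; positivity
  · refine (abs_max_sub_max_le_max _ _ _ _).trans (max_le (abs_le.2 ⟨?_, ?_⟩) ?_)
    · nlinarith
    · nlinarith
    · rw [sub_self, abs_zero]; positivity

theorem Config.shape_le (hε : 0 ≤ c.ε) {h : ℕ} (j : Fin 3) {f : X × A → ℝ} {b : ℝ} (hb : 2 ≤ b)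
    (hf : ∀ z, |f z| ≤ b) (G₁ G₂ : Matrix (Fin d) (Fin d) ℝ) (z : X × A) :
    c.shape h j f G₁ G₂ z ≤ b := by
  unfold Config.shape
  fin_cases j
  · exact (min_le_right _ _).trans (by linarith)
  · exact (min_le_right _ _).trans hb
  · refine max_le ?_ (by linarith)
    have : 0 ≤ √(WithLp.ofLp (c.φ h z) ⬝ᵥ (G₂ *ᵥ WithLp.ofLp (c.φ h z))) *
      √(c.β₂ ^ 2 + Config.lam) := by positivity
    simp only
    linarith [(abs_le.1 (hf z)).2]

theorem Config.card_le_N {h : ℕ} (hh : h < c.H) : ((c.F h).card : ℝ) ≤ c.N := by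
  rw [Config.N]
  exact_mod_cast Finset.le_sup (f := fun h => (c.F h).card) (Finset.mem_range.2 hh)

end Shape

namespace RunSetting

variable {X A Ω : Type*} [MeasurableSpace X] [TopologicalSpace A] [PolishSpace A]
  [MeasurableSpace A] [mΩ : MeasurableSpace Ω] {d : ℕ} {M : MDP X A} {c : Config X A d}
  {Pr : Measure Ω} {D : Ω → Transcript X A} [Nonempty X] [Nonempty A]

/-- The value functions of the algorithm at one state: optimistic, overly optimistic and overly
pessimistic. -/
noncomputable def val (c : Config X A d) (D : Transcript X A) (j : Fin 3) (t h : ℕ) (x : X) : ℝ :=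
  Transcript.maxVal c (![D.f₁ c, D.f₂ c, D.fNeg c] j) t h x

/-- A value function is given by its kind, a member of `F h`, and two inverse Gram matrices whose
entries are at most `4 (B^h)²`; the entries are rounded to multiples of `η`. The exponent `2 d²` is
the reason for the `d²` in `log 𝒩_b`. The net has to serve every outcome, including those where the
estimates are wrong and leave `[0, 2]`, hence the truncation `clip`. -/
theorem exists_cover (S : RunSetting M c Pr D) {η : ℝ} (hη : 0 < η) {k : ℕ}
    (hk : ∀ h < c.H, 4 * c.Bh h ^ 2 / η + 1 ≤ k) (hN : 1 ≤ c.N) (h : ℕ) :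
    ∃ 𝒱 : Finset (X → ℝ), (𝒱.card : ℝ) ≤ 3 * c.N * (2 * k + 1) ^ (2 * d ^ 2) ∧
      (∀ V ∈ 𝒱, Measurable V ∧ ∀ x, 0 ≤ V x ∧ V x ≤ 2) ∧
      ∀ ω, ∀ t < c.T, ∀ j, ∃ V ∈ 𝒱, ∀ x, |clip (val c (D ω) j t h x) - V x| ≤
        √(η * d) * (2 * √(c.β₁ ^ 2 + Config.lam) + √(c.β₂ ^ 2 + Config.lam)) := by
  classical
  by_cases hh : h < c.H
  swap
  · refine ⟨{fun _ => 0}, ?_, fun V hV => ?_, fun ω t ht j => ⟨_, Finset.mem_singleton_self _, ?_⟩⟩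
    · have : (1 : ℝ) ≤ (2 * k + 1) ^ (2 * d ^ 2) := one_le_pow₀ (by
        have : (0 : ℝ) ≤ k := by positivity
        linarith)
      simp only [Finset.card_singleton, Nat.cast_one]
      nlinarith
    · rw [Finset.mem_singleton.1 hV]
      exact ⟨measurable_const, fun _ => ⟨le_rfl, zero_le_two⟩⟩
    · intro x
      have : val c (D ω) j t h x = 0 := by simp [val, Transcript.maxVal, hh]
      rw [this, clip_of_mem le_rfl zero_le_two, sub_zero, abs_zero]
      positivity
  have hhM : h < M.H := S.horizon ▸ hh
  have hB := S.toLinSetting.two_le_B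
  let I := Fin d → Fin d → ↥(Finset.Icc (-(k : ℤ)) k)
  let mat : I → Matrix (Fin d) (Fin d) ℝ := fun i => Matrix.of fun a b => η * ((i a b : ℤ) : ℝ)
  let W : (Fin 3 × ↥(c.F h)) × (I × I) → X → ℝ := fun p x =>
    clip (⨆ a, c.shape h p.1.1 p.1.2.1 (mat p.2.1) (mat p.2.2) (x, a))
  refine ⟨Finset.univ.image W, ?_, fun V hV => ?_, fun ω t ht j => ?_⟩
  · have h1 : (Finset.univ.image W).card ≤
        (3 * (c.F h).card) * ((2 * k + 1) ^ d ^ 2 * (2 * k + 1) ^ d ^ 2) := by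
      refine Finset.card_image_le.trans (le_of_eq ?_)
      have hc : Fintype.card ↥(Finset.Icc (-(k : ℤ)) k) = 2 * k + 1 := by
        rw [Fintype.card_coe, Int.card_Icc]; omega
      have hI : Fintype.card I = (2 * k + 1) ^ d ^ 2 := by
        simp only [I, Fintype.card_fun, hc, Fintype.card_fin, ← pow_mul, sq]
      rw [Finset.card_univ, Fintype.card_prod, Fintype.card_prod, Fintype.card_prod, hI,
        Fintype.card_fin, Fintype.card_coe]
    have h2 : ((Finset.univ.image W).card : ℝ) ≤
        (3 * (c.F h).card) * ((2 * k + 1) ^ d ^ 2 * (2 * k + 1) ^ d ^ 2) := by exact_mod_cast h1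
    refine h2.trans ?_
    rw [← pow_add, ← two_mul]
    have h3 := c.card_le_N hh
    gcongr
  · obtain ⟨p, -, rfl⟩ := Finset.mem_image.1 hV
    refine ⟨measurable_clip.comp (measurable_iSup_of_continuous
      (F := fun x a => c.shape h p.1.1 p.1.2.1 (mat p.2.1) (mat p.2.2) (x, a))
      (fun a => ?_) fun x => ?_), fun x => ⟨clip_nonneg _, clip_le_two _⟩⟩
    · exact (c.measurable_shape (S.lin.measurable_φ h) _ (S.measurable_mem hh _ p.1.2.2) _ _).comp
        measurable_prodMk_right
    · exact c.continuous_shape (S.lin.continuous_φ h x) _ (S.continuous_mem hh p.1.2.2 x) _ _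
  · have hround : ∀ G : Matrix (Fin d) (Fin d) ℝ, (∀ a b, |G a b| ≤ 4 * c.Bh h ^ 2) →
        ∃ i : I, ∀ a b, |G a b - mat i a b| ≤ η := by
      intro G hG
      have hmem : ∀ a b, round (G a b / η) ∈ Finset.Icc (-(k : ℤ)) k := fun a b => by
        have h1 := abs_le.1 (abs_sub_round (G a b / η))
        have h2 : |G a b / η| ≤ 4 * c.Bh h ^ 2 / η := by
          rw [abs_div, abs_of_pos hη]; gcongr; exact hG a b
        have h3 := abs_le.1 h2
        have h4 := hk h hh
        rw [Finset.mem_Icc]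
        constructor
        · have : (-(k : ℝ)) ≤ (round (G a b / η) : ℝ) := by linarith
          exact_mod_cast this
        · have : (round (G a b / η) : ℝ) ≤ (k : ℝ) := by linarith
          exact_mod_cast this
      refine ⟨fun a b => ⟨_, hmem a b⟩, fun a b => ?_⟩
      have h1 := abs_sub_round (G a b / η)
      have h2 : G a b - mat (fun a b => ⟨_, hmem a b⟩) a b = η * (G a b / η - round (G a b / η)) := by
        simp only [mat, Matrix.of_apply]; field_simp
      rw [h2, abs_mul, abs_of_pos hη]
      nlinarith
    have hBh := S.toLinSetting.one_le_Bh hhM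
    have hgr : ∀ σ : Fin t → ℝ, ∀ a b, |(c.gram h ((D ω).past t h) σ)⁻¹ a b| ≤ 4 * c.Bh h ^ 2 := by
      intro σ a b
      have := abs_gramM_inv_apply_le (reg_pos hBh)
        (fun s => (1 / σ s) • WithLp.ofLp (c.φ h ((D ω).past t h s))) a b
      rwa [← c.gram_eq, one_div_one_div] at this
    obtain ⟨i₁, hi₁⟩ := hround _ (hgr fun s => (D ω).sigmaBar c h s)
    obtain ⟨i₂, hi₂⟩ := hround _ (hgr fun _ => 1)
    have hR := S.run.isVOQL ω
    obtain ⟨f, hf, hval⟩ : ∃ f ∈ c.F h, ∀ x, val c (D ω) j t h x = ⨆ a, c.shape h j f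
        (c.gram h ((D ω).past t h) fun s => (D ω).sigmaBar c h s)⁻¹
        (c.gram h ((D ω).past t h) fun _ => 1)⁻¹ (x, a) := by
      fin_cases j
      · exact ⟨_, (hR.regression₁ t ht h hh).1, fun x => by
          simp only [val, Transcript.maxVal, hh, if_true]; rfl⟩
      · exact ⟨_, (hR.regression₂ t ht h hh).1, fun x => by
          simp only [val, Transcript.maxVal, hh, if_true]; rfl⟩
      · exact ⟨_, (hR.regressionNeg t ht h hh).1, fun x => by
          simp only [val, Transcript.maxVal, hh, if_true]; rfl⟩
    refine ⟨W ((j, ⟨f, hf⟩), (i₁, i₂)), Finset.mem_image_of_mem _ (Finset.mem_univ _), fun x => ?_⟩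
    rw [hval x]
    refine (abs_clip_sub_clip_le _ _).trans (abs_iSup_sub_iSup_le ⟨c.B, ?_⟩ ⟨c.B, ?_⟩ fun a => ?_)
    · rintro _ ⟨a, rfl⟩
      exact c.shape_le S.ε_pos.le j hB (S.toLinSetting.abs_le_of_mem hhM hf) _ _ _
    · rintro _ ⟨a, rfl⟩
      exact c.shape_le S.ε_pos.le j hB (S.toLinSetting.abs_le_of_mem hhM hf) _ _ _
    · exact c.abs_shape_sub_le (S.lin.norm_φ h _) j f hη.le hi₁ hi₂

end RunSetting


/-! ## Concentration along a run -/

namespace RunSetting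

variable {X A Ω : Type*} [MeasurableSpace X] [TopologicalSpace A] [PolishSpace A]
  [MeasurableSpace A] [mΩ : MeasurableSpace Ω] {d : ℕ} {M : MDP X A} {c : Config X A d}
  {Pr : Measure Ω} {D : Ω → Transcript X A}

/-- The conditional law of the next state. -/
noncomputable def stepKernel (S : RunSetting M c Pr D) {t h : ℕ} (ht : t < c.T) (hh : h < c.H) :
    @Kernel Ω X (hist c.H D t h) _ :=
  @Kernel.comap (X × A) X _ _ Ω (hist c.H D t h) (M.P h) (fun ω => (D ω).z t h) (S.measurable_z ht hh)

theorem stepKernel_apply (S : RunSetting M c Pr D) {t h : ℕ} (ht : t < c.T) (hh : h < c.H)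
    (ω : Ω) : S.stepKernel ht hh ω = M.P h ((D ω).z t h) := rfl

theorem isMarkovKernel_stepKernel (S : RunSetting M c Pr D) {t h : ℕ} (ht : t < c.T)
    (hh : h < c.H) : @IsMarkovKernel Ω X (hist c.H D t h) _ (S.stepKernel ht hh) :=
  @IsMarkovKernel.mk Ω X (hist c.H D t h) _ _ fun ω => M.isProbabilityMeasure_P h ((D ω).z t h)

theorem abs_integral_le {ν : Measure X} [IsProbabilityMeasure ν] {V : X → ℝ} {b : ℝ}
    (hb : ∀ x, |V x| ≤ b) : |∫ x, V x ∂ν| ≤ b := by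
  have := norm_integral_le_of_norm_le_const (μ := ν) (f := V) (C := b)
    (Filter.Eventually.of_forall fun x => by rw [Real.norm_eq_abs]; exact hb x)
  simpa using this

theorem isSFiniteKernel_of_isMarkovKernel {α β : Type*} {mα : MeasurableSpace α}
    {mβ : MeasurableSpace β} (κ : Kernel α β) (h : IsMarkovKernel κ) : IsSFiniteKernel κ :=
  inferInstance

theorem measurable_integral_step (S : RunSetting M c Pr D) {t h : ℕ} (ht : t < c.T) (hh : h < c.H)
    {g : Ω → X → ℝ}
    (hg : @Measurable _ _ ((hist c.H D t h).prod inferInstance) _ (fun p : Ω × X => g p.1 p.2)) :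
    Measurable[hist c.H D t h] fun ω => ∫ x, g ω x ∂(M.P h ((D ω).z t h)) := by
  have hM := S.isMarkovKernel_stepKernel ht hh
  have hs := @Measurable.stronglyMeasurable _ _ _ ((hist c.H D t h).prod inferInstance) _ _ _ _ _ hg
  have hfin := isSFiniteKernel_of_isMarkovKernel _ hM
  exact (@StronglyMeasurable.integral_kernel_prod_right' _ _ (hist c.H D t h) _
    (S.stepKernel ht hh) _ _ hfin _ _ hs).measurable

variable [IsProbabilityMeasure Pr]

theorem expSuper_step (S : RunSetting M c Pr D) {t h : ℕ} (ht : t < c.T) (hh : h < c.H)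
    {g : Ω → X → ℝ}
    (hg : @Measurable _ _ ((hist c.H D t h).prod inferInstance) _ (fun p : Ω × X => g p.1 p.2))
    {b : ℝ} (hgb : ∀ ω x, |g ω x| ≤ b)
    (hb : ∀ ω x, |g ω x - ∫ y, g ω y ∂(M.P h ((D ω).z t h))| ≤ 1) {v : Ω → ℝ}
    (hv : Measurable[hist c.H D t h] v)
    (hgv : ∀ ω, ∫ x, (g ω x - ∫ y, g ω y ∂(M.P h ((D ω).z t h))) ^ 2
      ∂(M.P h ((D ω).z t h)) ≤ v ω) :
    ExpSuper Pr (hist c.H D t h) (fun ω => g ω ((D ω).x t (h + 1)) -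
      ∫ y, g ω y ∂(M.P h ((D ω).z t h)) - v ω) ∧
    Measurable[hist c.H D t (h + 1)] (fun ω => g ω ((D ω).x t (h + 1)) -
      ∫ y, g ω y ∂(M.P h ((D ω).z t h)) - v ω) := by
  have hi := S.measurable_integral_step ht hh hg
  have hfst : @Measurable (Ω × X) Ω ((hist c.H D t h).prod inferInstance) (hist c.H D t h)
    Prod.fst := @measurable_fst _ _ (hist c.H D t h) _
  constructor
  · refine expSuper_of_condLaw (S.hist_le ht hh.le) (S.run.measurable_x t ht (h + 1) hh)
      (S.stepKernel ht hh) (S.isMarkovKernel_stepKernel ht hh) (fun A hA => ?_)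
      (g := fun ω x => g ω x - ∫ y, g ω y ∂(M.P h ((D ω).z t h))) ?_ hb (fun ω => ?_) hv hgv
    · exact S.run.transition t ht h hh A hA
    · exact hg.sub (hi.comp hfst)
    · have := M.isProbabilityMeasure_P h ((D ω).z t h)
      have hgω : Measurable (g ω) := hg.comp (@measurable_prodMk_left _ _ (hist c.H D t h) _ ω)
      rw [stepKernel_apply, integral_sub (integrable_of_bound hgω (hgb ω)) (integrable_const _)]
      simp
  · have h1 : @Measurable Ω (Ω × X) (hist c.H D t (h + 1)) ((hist c.H D t h).prod inferInstance)
        (fun ω => (ω, (D ω).x t (h + 1))) :=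
      @Measurable.prodMk _ (hist c.H D t (h + 1)) _ _ (hist c.H D t h) _ _ _
        (measurable_id'' (hist_mono _ _ (Nat.le_succ h))) (measurable_x_hist c.H t le_rfl)
    exact ((hg.comp h1).sub (hi.mono (hist_mono _ _ (Nat.le_succ h)) le_rfl)).sub
      (hv.mono (hist_mono _ _ (Nat.le_succ h)) le_rfl)

theorem measure_sum_level_le (S : RunSetting M c Pr D) {h n : ℕ} (hh : h < c.H) (hn : n ≤ c.T)
    {Y : ℕ → Ω → ℝ} (hY : ∀ t < n, Measurable[hist c.H D t (h + 1)] (Y t))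
    (hE : ∀ t < n, ExpSuper Pr (hist c.H D t h) (Y t)) (L : ℝ) :
    Pr {ω | L ≤ ∑ t ∈ Finset.range n, Y t ω} ≤ ENNReal.ofReal (Real.exp (-L)) := by
  have hs := ExpSuper.sum (m := fun t => hist c.H D t h) n
    (fun t _ => (hist_le_histBefore (Nat.lt_succ_self t) hh.le).trans (histBefore_le_hist _ _ _))
    (fun t ht => (hY t ht).mono
      ((hist_le_histBefore (Nat.lt_succ_self t) hh).trans (histBefore_le_hist _ _ _)) le_rfl) hE
  refine ExpSuper.measure_le ?_ hs.2.2 L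
  exact Finset.measurable_sum _ fun t ht =>
    (hY t (Finset.mem_range.1 ht)).mono (S.hist_le ((Finset.mem_range.1 ht).trans_le hn) hh) le_rfl

/-- The filtration runs through the levels of an episode and then on to the next episode.
`ExpSuper.sum` is applied twice: the inner sum over an episode is known when the next one starts. -/
theorem measure_sum_run_le (S : RunSetting M c Pr D) {Y : ℕ → ℕ → Ω → ℝ}
    (hY : ∀ t < c.T, ∀ h < c.H, Measurable[hist c.H D t (h + 1)] (Y t h))
    (hE : ∀ t < c.T, ∀ h < c.H, ExpSuper Pr (hist c.H D t h) (Y t h)) (L : ℝ) :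
    Pr {ω | L ≤ ∑ t ∈ Finset.range c.T, ∑ h ∈ Finset.range c.H, Y t h ω} ≤
      ENNReal.ofReal (Real.exp (-L)) := by
  have hin := fun t (ht : t < c.T) => ExpSuper.sum (m := fun h => hist c.H D t h) (Y := Y t) c.H
    (fun h _ => hist_mono _ _ (Nat.le_succ h)) (hY t ht) (hE t ht)
  have hs := ExpSuper.sum (m := fun t => hist c.H D t 0)
    (Y := fun t ω => ∑ h ∈ Finset.range c.H, Y t h ω) c.T
    (fun t _ => (hist_le_histBefore (Nat.lt_succ_self t) (Nat.zero_le _)).trans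
      (histBefore_le_hist _ _ _))
    (fun t ht => (hin t ht).1.mono
      ((hist_le_histBefore (Nat.lt_succ_self t) le_rfl).trans (histBefore_le_hist _ _ _)) le_rfl)
    (fun t ht => (hin t ht).2.2)
  refine ExpSuper.measure_le ?_ hs.2.2 L
  exact Finset.measurable_sum _ fun t ht => (hin t (Finset.mem_range.1 ht)).1.mono
    (S.hist_le (Finset.mem_range.1 ht) le_rfl) le_rfl

/-- Martingale concentration over the whole run. -/
theorem run_concentration (S : RunSetting M c Pr D) {g : ℕ → ℕ → Ω → X → ℝ} {v : ℕ → ℕ → Ω → ℝ}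
    (hg : ∀ t < c.T, ∀ h < c.H, @Measurable _ _ ((hist c.H D t h).prod inferInstance) _
      (fun p : Ω × X => g t h p.1 p.2))
    {b : ℝ} (hgb : ∀ t < c.T, ∀ h < c.H, ∀ ω x, |g t h ω x| ≤ b) (hb : 2 * b ≤ 1)
    (hv : ∀ t < c.T, ∀ h < c.H, Measurable[hist c.H D t h] (v t h))
    (hgv : ∀ t < c.T, ∀ h < c.H, ∀ ω, ∫ x, (g t h ω x -
      ∫ y, g t h ω y ∂(M.P h ((D ω).z t h))) ^ 2 ∂(M.P h ((D ω).z t h)) ≤ v t h ω) (L : ℝ) :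
    Pr {ω | L ≤ ∑ t ∈ Finset.range c.T, ∑ h ∈ Finset.range c.H, (g t h ω ((D ω).x t (h + 1)) -
      ∫ y, g t h ω y ∂(M.P h ((D ω).z t h)) - v t h ω)} ≤ ENNReal.ofReal (Real.exp (-L)) := by
  have h1 : ∀ t (ht : t < c.T) h (hh : h < c.H), _ := fun t ht h hh =>
    S.expSuper_step ht hh (hg t ht h hh) (hgb t ht h hh) (fun ω x => by
      have := M.isProbabilityMeasure_P h ((D ω).z t h)
      have h2 := abs_le.1 (hgb t ht h hh ω x)
      have h3 : |∫ y, g t h ω y ∂(M.P h ((D ω).z t h))| ≤ b := abs_integral_le (hgb t ht h hh ω)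
      have h4 := abs_le.1 h3
      exact abs_le.2 ⟨by linarith, by linarith⟩) (hv t ht h hh) (hgv t ht h hh)
  exact S.measure_sum_run_le (fun t ht h hh => (h1 t ht h hh).2) (fun t ht h hh => (h1 t ht h hh).1) L

open Classical in
/-- Martingale concentration for the noise of a weighted regression. -/
theorem regression_concentration (S : RunSetting M c Pr D) {h n : ℕ} (hh : h < c.H) (hn : n ≤ c.T)
    {σ : ℕ → Ω → ℝ} (hσ : ∀ s < n, Measurable[hist c.H D s h] (σ s)) {e : X × A → ℝ}
    (he : Measurable e) {Y : X × A → X → ℝ} (hY : Measurable (Function.uncurry Y)) {b : ℝ}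
    (hYb : ∀ z x, |Y z x| ≤ b) {ρ R θ : ℝ} (hρ : 0 ≤ ρ) (hR : 0 ≤ R) (hθ : 0 < θ) (hθR : θ * R * (2 * b) ≤ 1)
    (L : ℝ) :
    Pr {ω | θ * ρ * ∑ s ∈ Finset.range n, 1 / σ s ω ^ 2 * e ((D ω).z s h) ^ 2 + L / θ ≤
      ∑ s ∈ Finset.range n,
        if ∫ x, (Y ((D ω).z s h) x - ∫ y, Y ((D ω).z s h) y ∂(M.P h ((D ω).z s h))) ^ 2
            ∂(M.P h ((D ω).z s h)) ≤ ρ * σ s ω ^ 2 ∧ |1 / σ s ω ^ 2 * e ((D ω).z s h)| ≤ R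
        then 1 / σ s ω ^ 2 * e ((D ω).z s h) * (Y ((D ω).z s h) ((D ω).x s (h + 1)) -
          ∫ y, Y ((D ω).z s h) y ∂(M.P h ((D ω).z s h))) else 0} ≤
      ENNReal.ofReal (Real.exp (-L)) := by
  set m : X × A → ℝ := fun z => ∫ y, Y z y ∂(M.P h z) with hm
  have hmm : Measurable m := measurable_integral_P h hY
  have hYi : ∀ z, Integrable (Y z) (M.P h z) := fun z => by
    have := M.isProbabilityMeasure_P h z
    exact integrable_of_bound (hY.comp measurable_prodMk_left) (hYb z)
  have hmb : ∀ z, |m z| ≤ b := fun z => by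
    have := M.isProbabilityMeasure_P h z
    exact abs_integral_le (hYb z)
  have hYm : ∀ z x, |Y z x - m z| ≤ 2 * b := fun z x => by
    have h1 := abs_le.1 (hYb z x)
    have h2 := abs_le.1 (hmb z)
    exact abs_le.2 ⟨by linarith, by linarith⟩
  have hvar : Measurable fun z => ∫ x, (Y z x - m z) ^ 2 ∂(M.P h z) :=
    measurable_integral_P h (f := fun z x => (Y z x - m z) ^ 2)
      ((hY.sub (hmm.comp measurable_fst)).pow_const 2)
  -- The condition `C` is decided before the next state is drawn. Switching the coefficient off
  -- where it fails keeps the increments bounded by `θ R (2 b) ≤ 1` on every outcome, as the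
  -- exponential inequality demands.
  let C : ℕ → Ω → Prop := fun s ω => ∫ x, (Y ((D ω).z s h) x - m ((D ω).z s h)) ^ 2
    ∂(M.P h ((D ω).z s h)) ≤ ρ * σ s ω ^ 2 ∧ |1 / σ s ω ^ 2 * e ((D ω).z s h)| ≤ R
  let q : ℕ → Ω → ℝ := fun s ω => if C s ω then θ * (1 / σ s ω ^ 2 * e ((D ω).z s h)) else 0
  let v : ℕ → Ω → ℝ := fun s ω => θ ^ 2 * ρ * (1 / σ s ω ^ 2 * e ((D ω).z s h) ^ 2)
  have key : ∀ s (hs : s < n), ExpSuper Pr (hist c.H D s h) (fun ω =>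
        q s ω * Y ((D ω).z s h) ((D ω).x s (h + 1)) -
        ∫ y, q s ω * Y ((D ω).z s h) y ∂(M.P h ((D ω).z s h)) -
          (if C s ω then v s ω else 0)) ∧
      Measurable[hist c.H D s (h + 1)] (fun ω =>
        q s ω * Y ((D ω).z s h) ((D ω).x s (h + 1)) -
        ∫ y, q s ω * Y ((D ω).z s h) y ∂(M.P h ((D ω).z s h)) -
          (if C s ω then v s ω else 0)) := by
    intro s hs
    have hsT := hs.trans_le hn
    have hz := S.measurable_z hsT hh
    have hez : Measurable[hist c.H D s h] fun ω => e ((D ω).z s h) := he.comp hz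
    have hσs := hσ s hs
    have hw : Measurable[hist c.H D s h] fun ω => 1 / σ s ω ^ 2 := (hσs.pow_const 2).const_div 1
    have hC : MeasurableSet[hist c.H D s h] {ω | C s ω} := by
      refine @MeasurableSet.inter _ (hist c.H D s h) _ _ ?_ ?_
      · exact @measurableSet_le _ _ _ _ _ (hist c.H D s h) _ _ _ _ _ (hvar.comp hz)
          ((hσs.pow_const 2).const_mul ρ)
      · exact @measurableSet_le _ _ _ _ _ (hist c.H D s h) _ _ _ _ _
          (measurable_norm.comp (hw.mul hez)) (@measurable_const _ _ _ (hist c.H D s h) _)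
    have hq : Measurable[hist c.H D s h]
        (fun ω => if C s ω then θ * (1 / σ s ω ^ 2 * e ((D ω).z s h)) else 0) :=
      by
        refine Measurable.ite hC ?_ (@measurable_const _ _ _ (hist c.H D s h) _)
        exact (hw.mul hez).const_mul θ
    have hv : Measurable[hist c.H D s h] (fun ω => if C s ω then v s ω else 0) :=
      Measurable.ite hC ((hw.mul (hez.pow_const 2)).const_mul _)
        (@measurable_const _ _ _ (hist c.H D s h) _)
    have hfst : @Measurable (Ω × X) Ω ((hist c.H D s h).prod inferInstance) (hist c.H D s h)
      Prod.fst := @measurable_fst _ _ (hist c.H D s h) _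
    have hsnd : @Measurable (Ω × X) X ((hist c.H D s h).prod inferInstance) _
      Prod.snd := @measurable_snd _ _ (hist c.H D s h) _
    have hqb : ∀ ω, |q s ω| ≤ θ * R := fun ω => by
      simp only [q]
      split_ifs with hc
      · rw [abs_mul, abs_of_pos hθ]; exact mul_le_mul_of_nonneg_left hc.2 hθ.le
      · rw [abs_zero]; positivity
    have hcent : ∀ ω x, q s ω * Y ((D ω).z s h) x -
        ∫ y, q s ω * Y ((D ω).z s h) y ∂(M.P h ((D ω).z s h)) =
        q s ω * (Y ((D ω).z s h) x - m ((D ω).z s h)) := fun ω x => by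
      rw [integral_const_mul]; simp only [m]; ring
    refine S.expSuper_step hsT hh (g := fun ω x => q s ω * Y ((D ω).z s h) x)
      (b := θ * R * b) ?_ (fun ω x => ?_) (fun ω x => ?_) hv (fun ω => ?_)
    · refine (hq.comp hfst).mul ?_
      exact hY.comp (@Measurable.prodMk _ ((hist c.H D s h).prod inferInstance) _ _ _ _ _ _
        (hz.comp hfst) hsnd)
    · rw [abs_mul]
      exact mul_le_mul (hqb ω) (hYb _ _) (abs_nonneg _) (by positivity)
    · rw [hcent, abs_mul]
      exact (mul_le_mul (hqb ω) (hYm _ _) (abs_nonneg _) (by positivity)).trans hθR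
    · simp only [hcent, mul_pow]
      rw [integral_const_mul]
      simp only [q]
      split_ifs with hc
      · have h1 := mul_le_mul_of_nonneg_left hc.1
          (sq_nonneg (θ * (1 / σ s ω ^ 2 * e ((D ω).z s h))))
        refine h1.trans (le_of_eq ?_)
        simp only [v]
        -- For a zero weight the convention `1 / 0 = 0` makes both sides vanish.
        by_cases h0 : σ s ω = 0
        · simp [h0]
        · field_simp
      · simp
  have hfin := S.measure_sum_level_le hh hn (fun t ht => (key t ht).2) (fun t ht => (key t ht).1) L
  refine le_trans (measure_mono fun ω hω => ?_) hfin
  simp only [Set.mem_setOf_eq] at hω ⊢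
  -- Dropping the condition from the compensator only enlarges it.
  have hsum : ∑ s ∈ Finset.range n, (if C s ω then v s ω else 0) ≤
      ∑ s ∈ Finset.range n, θ * ρ * (1 / σ s ω ^ 2 * e ((D ω).z s h) ^ 2) * θ := by
    refine Finset.sum_le_sum fun s _ => ?_
    have h2 : θ * ρ * (1 / σ s ω ^ 2 * e ((D ω).z s h) ^ 2) * θ = v s ω := by simp only [v]; ring
    rw [h2]
    split_ifs
    · exact le_rfl
    · simp only [v]; positivity
  have hterm : ∀ s, q s ω * Y ((D ω).z s h) ((D ω).x s (h + 1)) -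
        ∫ y, q s ω * Y ((D ω).z s h) y ∂(M.P h ((D ω).z s h)) =
      θ * (if C s ω then 1 / σ s ω ^ 2 * e ((D ω).z s h) * (Y ((D ω).z s h) ((D ω).x s (h + 1)) -
        m ((D ω).z s h)) else 0) := fun s => by
    rw [integral_const_mul]
    simp only [q, m]
    split_ifs <;> ring
  rw [Finset.sum_sub_distrib]
  simp only [hterm]
  rw [← Finset.sum_mul, ← Finset.mul_sum] at hsum
  rw [← Finset.mul_sum]
  have hω' := mul_le_mul_of_nonneg_left hω hθ.le
  have h1 : θ * (L / θ) = L := by field_simp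
  rw [mul_add, h1] at hω'
  refine le_trans ?_ (sub_le_sub_left hsum _)
  rw [le_sub_iff_add_le]
  refine le_trans (le_of_eq ?_) hω'
  ring

end RunSetting


/-! ## Confidence bounds for the regressions -/

section Deterministic

variable {X A : Type*} [MeasurableSpace X] [MeasurableSpace A] {d : ℕ}

/-- Comparison of the losses of the minimizer and of `f`. Here `m` stands for the conditional means
of the targets, which `f` approximates within `ε`; the cross terms `(fhat - f)(m - f)` cost at most
`2 b ε` each before weighting. -/
theorem Config.regression_error (c : Config X A d) {h n : ℕ} {zs : Fin n → X × A} {σ y m : Fin n → ℝ}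
    {fhat f : X × A → ℝ} (hreg : c.IsRegression h zs σ y fhat) (hf : f ∈ c.F h) {b ε w : ℝ}
    (hb : ∀ g ∈ c.F h, ∀ z, |g z| ≤ b) (hm : ∀ s, |m s - f (zs s)| ≤ ε)
    (hw : ∀ s, 1 / σ s ^ 2 ≤ w) (hε : 0 ≤ ε) :
    ∑ s, 1 / σ s ^ 2 * (fhat (zs s) - f (zs s)) ^ 2 ≤
      2 * ∑ s, 1 / σ s ^ 2 * (fhat (zs s) - f (zs s)) * (y s - m s) + 4 * b * ε * (n * w) := by
  have h1 := hreg.2 f hf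
  have h2 : ∀ s, 1 / σ s ^ 2 * (fhat (zs s) - f (zs s)) ^ 2 ≤
      1 / σ s ^ 2 * (fhat (zs s) - y s) ^ 2 - 1 / σ s ^ 2 * (f (zs s) - y s) ^ 2 +
      (2 * (1 / σ s ^ 2 * (fhat (zs s) - f (zs s)) * (y s - m s)) + 4 * b * ε * w) := fun s => by
    have hw0 : 0 ≤ 1 / σ s ^ 2 := by positivity
    have e1 := abs_le.1 (hb _ hreg.1 (zs s))
    have e2 := abs_le.1 (hb _ hf (zs s))
    have hb0 : 0 ≤ b := by linarith
    have e3 : (fhat (zs s) - f (zs s)) * (m s - f (zs s)) ≤ 2 * b * ε := by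
      have h5 : |fhat (zs s) - f (zs s)| ≤ 2 * b := abs_le.2 ⟨by linarith, by linarith⟩
      calc (fhat (zs s) - f (zs s)) * (m s - f (zs s)) ≤
          |(fhat (zs s) - f (zs s)) * (m s - f (zs s))| := le_abs_self _
        _ = |fhat (zs s) - f (zs s)| * |m s - f (zs s)| := abs_mul _ _
        _ ≤ 2 * b * ε := mul_le_mul h5 (hm s) (abs_nonneg _) (by linarith)
    have e4 : 1 / σ s ^ 2 * ((fhat (zs s) - f (zs s)) * (m s - f (zs s))) ≤ w * (2 * b * ε) :=
      (mul_le_mul_of_nonneg_left e3 hw0).trans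
        (mul_le_mul_of_nonneg_right (hw s) (by positivity))
    nlinarith
  have h3 := Finset.sum_le_sum fun s (_ : s ∈ Finset.univ) => h2 s
  rw [Finset.sum_add_distrib, Finset.sum_add_distrib, Finset.sum_sub_distrib, ← Finset.mul_sum] at h3
  simp only [Finset.sum_const, Finset.card_univ, Fintype.card_fin, nsmul_eq_mul] at h3
  linarith [mul_left_comm (4 * b * ε) (n : ℝ) w]

/-- A one-sided deviation bound for the noise of a regression at level `h` over the first `n`
episodes, in case the conditional variances and the coefficients are small. -/
def RegBound (M : MDP X A) (D : Transcript X A) (h n : ℕ) (σ : ℕ → ℝ) (e : X × A → ℝ)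
    (Y : X × A → X → ℝ) (ρ R θ L : ℝ) : Prop :=
  (∀ s < n, ∫ x, (Y (D.z s h) x - ∫ y, Y (D.z s h) y ∂(M.P h (D.z s h))) ^ 2
      ∂(M.P h (D.z s h)) ≤ ρ * σ s ^ 2 ∧ |1 / σ s ^ 2 * e (D.z s h)| ≤ R) →
    ∑ s ∈ Finset.range n, 1 / σ s ^ 2 * e (D.z s h) *
      (Y (D.z s h) (D.x s (h + 1)) - ∫ y, Y (D.z s h) y ∂(M.P h (D.z s h))) ≤
    θ * ρ * ∑ s ∈ Finset.range n, 1 / σ s ^ 2 * e (D.z s h) ^ 2 + L / θ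

/-- The deviation bounds under which all regressions of the algorithm are accurate. -/
structure GoodRegression (M : MDP X A) (c : Config X A d) (D : Transcript X A)
    (𝒱 : ℕ → Finset (X → ℝ)) (Lb La : ℝ) (K : ℕ) : Prop where
  unweighted : ∀ h < c.H, ∀ n < c.T, ∀ f ∈ c.F h, ∀ f' ∈ c.F h, ∀ V ∈ 𝒱 (h + 1),
    ∀ p ∈ ({1, 2} : Finset ℕ), RegBound M D h n (fun _ => 1) (fun z => f z - f' z)
      (fun z x => (M.r h z x + V x) ^ p) 81 (2 * c.B) (1 / (324 * c.B)) Lb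
  optimal : ∀ h < c.H, ∀ n < c.T, ∀ f ∈ c.F h, ∀ f' ∈ c.F h, ∀ k ∈ Finset.range (K + 1),
    RegBound M D h n (D.sigmaBar c h) (fun z => f z - f' z)
      (fun z x => M.r h z x + Vopt M (h + 1) x) 1 (2 ^ k / (4 * c.ι ^ 2)) (√La / 2 ^ k) La
  excess : ∀ h < c.H, ∀ n < c.T, ∀ f ∈ c.F h, ∀ f' ∈ c.F h, ∀ V ∈ 𝒱 (h + 1),
    ∀ k ∈ Finset.range (K + 1), RegBound M D h n (D.sigmaBar c h) (fun z => f z - f' z)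
      (fun _ x => V x - Vopt M (h + 1) x) (2 / c.ι ^ 2) (2 ^ k / (4 * c.ι ^ 2))
      (c.ι ^ 2 / 2 ^ k) Lb

end Deterministic

section Variance

variable {X : Type*} [MeasurableSpace X] {ν : Measure X} [IsProbabilityMeasure ν]

theorem integral_sub_mean_sq {Y : X → ℝ} (hY : Measurable Y) {b : ℝ} (hb : ∀ x, |Y x| ≤ b) :
    ∫ x, (Y x - ∫ y, Y y ∂ν) ^ 2 ∂ν = ∫ x, Y x ^ 2 ∂ν - (∫ y, Y y ∂ν) ^ 2 := by
  set m := ∫ y, Y y ∂ν with hm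
  have h1 : Integrable Y ν := integrable_of_bound hY hb
  have h2 : Integrable (fun x => Y x ^ 2) ν := integrable_of_bound (b := b ^ 2) (by fun_prop)
    fun x => by rw [abs_pow]; exact pow_le_pow_left₀ (abs_nonneg _) (hb x) 2
  have h3 : ∀ x, (Y x - m) ^ 2 = Y x ^ 2 - 2 * m * Y x + m ^ 2 := fun x => by ring
  simp only [h3]
  rw [integral_add (f := fun x => Y x ^ 2 - 2 * m * Y x) (h2.sub (h1.const_mul _))
    (integrable_const _), integral_sub h2 (h1.const_mul _), integral_const_mul, ← hm]
  simp only [integral_const, probReal_univ, one_smul]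
  ring

theorem integral_sub_mean_sq_le {Y : X → ℝ} (hY : Measurable Y) {b : ℝ} (hb : ∀ x, |Y x| ≤ b) :
    ∫ x, (Y x - ∫ y, Y y ∂ν) ^ 2 ∂ν ≤ ∫ x, Y x ^ 2 ∂ν := by
  rw [integral_sub_mean_sq hY hb]
  linarith [sq_nonneg (∫ y, Y y ∂ν)]

end Variance

/-- Relations between the tuning parameters used in the analysis of the regressions. -/
structure Tuned {X A : Type*} {d : ℕ} (c : Config X A d) (ε' Lb La cb : ℝ) (K : ℕ) : Prop where
  ε'_nonneg : 0 ≤ ε'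
  one_le_Lb : 1 ≤ Lb
  one_le_La : 1 ≤ La
  one_le_cb : 1 ≤ cb
  one_le_ι : 1 ≤ c.ι
  ε'_le : 16 * ε' * (c.T ^ 2 * c.H) ≤ 1
  ε'_ι : 2 * ε' ^ 2 * c.ι ^ 2 ≤ c.α ^ 2
  Lb_le : Lb ≤ cb * c.ι ^ 2
  K_le : 4 * c.B ^ 2 * (c.T ^ 2 * c.H) + 1 ≤ 4 ^ K
  β₁_ge : (10 + 4 * cb) ^ 2 * La + 2 * c.B + 2 ≤ c.β₁ ^ 2
  β₂_ge : 1000 * c.B * Lb ≤ c.β₂ ^ 2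
  βbar_ge : 1000 * c.B * Lb ≤ c.βbar ^ 2

namespace RunSetting

variable {X A Ω : Type*} [MeasurableSpace X] [TopologicalSpace A] [PolishSpace A]
  [MeasurableSpace A] [mΩ : MeasurableSpace Ω] {d : ℕ} {M : MDP X A} {c : Config X A d}
  {Pr : Measure Ω} {D : Ω → Transcript X A} [Nonempty X] [Nonempty A]
  {𝒱 : ℕ → Finset (X → ℝ)} {ε' Lb La cb : ℝ} {K : ℕ}

theorem TH_cast (S : RunSetting M c Pr D) : (1 : ℝ) ≤ c.T ∧ (1 : ℝ) ≤ c.H ∧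
    8 * c.ε * (c.T ^ 2 * c.H) ≤ 1 := by
  have h1 : (1 : ℝ) ≤ c.T := by exact_mod_cast S.T_pos
  have h2 : (1 : ℝ) ≤ c.H := by rw [S.horizon]; exact_mod_cast S.H_pos
  refine ⟨h1, h2, ?_⟩
  have h3 := S.ε_le
  rw [← S.horizon, le_div_iff₀ (by positivity)] at h3
  linarith

theorem alpha_sq (S : RunSetting M c Pr D) : c.α ^ 2 = 1 / (c.T * c.H) := by
  obtain ⟨h1, h2, -⟩ := S.TH_cast
  rw [Config.α, Real.sq_sqrt (by positivity)]

theorem alpha_pos (S : RunSetting M c Pr D) : 0 < c.α := by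
  obtain ⟨h1, h2, -⟩ := S.TH_cast
  exact Real.sqrt_pos.2 (by positivity)

theorem alpha_le_sigmaBar (ω : Ω) (h t : ℕ) : c.α ≤ (D ω).sigmaBar c h t := by
  rw [Transcript.sigmaBar, Transcript.weightOf]
  exact (le_max_right _ _).trans (le_max_left _ _)

theorem weight_le (S : RunSetting M c Pr D) (ω : Ω) (h t : ℕ) :
    1 / (D ω).sigmaBar c h t ^ 2 ≤ c.T * c.H := by
  have h0 := S.alpha_pos
  have h1 := pow_le_pow_left₀ h0.le (alpha_le_sigmaBar (c := c) (D := D) ω h t) 2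
  have h2 := S.alpha_sq
  calc 1 / (D ω).sigmaBar c h t ^ 2 ≤ 1 / c.α ^ 2 := by gcongr
    _ = (c.T : ℝ) * c.H := by rw [h2, one_div_one_div]

theorem val_zero (D : Transcript X A) (t h : ℕ) (x : X) :
    val c D 0 t h x = Transcript.maxVal c (D.f₁ c) t h x := rfl

theorem val_one (D : Transcript X A) (t h : ℕ) (x : X) :
    val c D 1 t h x = Transcript.maxVal c (D.f₂ c) t h x := rfl

theorem val_two (D : Transcript X A) (t h : ℕ) (x : X) :
    val c D 2 t h x = Transcript.maxVal c (D.fNeg c) t h x := rfl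

theorem measurable_val_prod (S : RunSetting M c Pr D) (j : Fin 3) {t : ℕ} (ht : t < c.T)
    (h : ℕ) : @Measurable _ _ ((histBefore c.H D t).prod inferInstance) _
      (fun p : Ω × X => val c (D p.1) j t h p.2) := by
  match j with
  | 0 => simpa only [val_zero] using S.measurable_V₁ ht h
  | 1 => simpa only [val_one] using S.measurable_V₂ ht h
  | 2 => simpa only [val_two] using S.measurable_VNeg ht h

theorem measurable_val (S : RunSetting M c Pr D) (ω : Ω) (j : Fin 3) {t : ℕ} (ht : t < c.T)
    (h : ℕ) : Measurable fun x => val c (D ω) j t h x := by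
  have hp := @measurable_prodMk_left Ω X (histBefore c.H D t) inferInstance ω
  have := (S.measurable_val_prod j ht h).comp hp
  simpa only [Function.comp_def] using this

/-- The targets are at most `9`, so their variance is at most `81`. With `θ = 1/(324 B)` the
compensator is at most an eighth of the squared error and is absorbed, after doubling, by the
left-hand side. What remains is `2 · 324 B Lb` plus discretization errors of order `B`. The exponent
`p` treats the first and second moment regressions together. -/
theorem conf_unweighted (S : RunSetting M c Pr D) (P : Tuned c ε' Lb La cb K) {ω : Ω}
    (G : GoodRegression M c (D ω) 𝒱 Lb La K)
    (h𝒱 : ∀ h, ∀ V ∈ 𝒱 h, Measurable V ∧ ∀ x, 0 ≤ V x ∧ V x ≤ 2) {t h : ℕ} (ht : t < c.T)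
    (hh : h < c.H) {V : X → ℝ} (hVm : Measurable V) (hV0 : ∀ x, 0 ≤ V x) (hV2 : ∀ x, V x ≤ 2)
    (hcov : ∃ V' ∈ 𝒱 (h + 1), ∀ x, |V x - V' x| ≤ ε') {p : ℕ} (hp : p ∈ ({1, 2} : Finset ℕ))
    {fhat f : X × A → ℝ} (hreg : c.IsRegression h ((D ω).past t h) (fun _ => 1)
      (fun s => (M.r h ((D ω).z s h) ((D ω).x s (h + 1)) + V ((D ω).x s (h + 1))) ^ p) fhat)
    (hf : f ∈ c.F h)
    (hfV : ∀ z, |(∫ x', (M.r h z x' + V x') ^ p ∂(M.P h z)) - f z| ≤ c.ε) :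
    ∑ s : Fin t, 1 / (1 : ℝ) ^ 2 * (fhat ((D ω).past t h s) - f ((D ω).past t h s)) ^ 2 ≤
      1000 * c.B * Lb := by
  obtain ⟨V', hV', hVV'⟩ := hcov
  obtain ⟨hV'm, hV'b⟩ := h𝒱 _ _ hV'
  have hhM : h < M.H := S.horizon ▸ hh
  obtain ⟨hT1, hH1, hε⟩ := S.TH_cast
  have hB := S.toLinSetting.two_le_B
  have hFb := fun g (hg : g ∈ c.F h) z => S.toLinSetting.abs_le_of_mem hhM hg z
  have hpow : ∀ z x, |(M.r h z x + V x) ^ p - (M.r h z x + V' x) ^ p| ≤ 6 * ε' := fun z x => by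
    have h1 := M.r_mem h z x
    have h2 := hV'b x
    have h3 := hV0 x
    have h4 := hV2 x
    have h5 := abs_le.1 (hVV' x)
    have h6 := P.ε'_nonneg
    simp only [Finset.mem_insert, Finset.mem_singleton] at hp
    rcases hp with rfl | rfl
    · rw [pow_one, pow_one, abs_le]; constructor <;> linarith
    · have h7 : |(M.r h z x + V x) ^ 2 - (M.r h z x + V' x) ^ 2| =
          |V x - V' x| * |2 * M.r h z x + V x + V' x| := by rw [← abs_mul]; congr 1; ring
      rw [h7, mul_comm]
      refine mul_le_mul ?_ (hVV' x) (abs_nonneg _) (by norm_num)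
      rw [abs_le]; constructor <;> linarith [h1.1, h1.2]
  have hpowb : ∀ (W : X → ℝ), (∀ x, 0 ≤ W x) → (∀ x, W x ≤ 2) → ∀ z x,
      |(M.r h z x + W x) ^ p| ≤ 9 := fun W hW0 hW2 z x => by
    have h1 := M.r_mem h z x
    have h3 := hW0 x
    have h4 := hW2 x
    have h5 : |M.r h z x + W x| ≤ 3 := by rw [abs_le]; constructor <;> linarith [h1.1, h1.2]
    rw [abs_pow]
    simp only [Finset.mem_insert, Finset.mem_singleton] at hp
    rcases hp with rfl | rfl
    · rw [pow_one]; linarith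
    · nlinarith [abs_nonneg (M.r h z x + W x)]
  have hmeas : ∀ (W : X → ℝ), Measurable W → ∀ z, Measurable fun x => (M.r h z x + W x) ^ p :=
    fun W hW z => ((M.measurable_r_apply h z).add hW).pow_const p
  have hmean : ∀ z, |∫ x, (M.r h z x + V x) ^ p ∂(M.P h z) -
      ∫ x, (M.r h z x + V' x) ^ p ∂(M.P h z)| ≤ 6 * ε' := fun z => by
    have := M.isProbabilityMeasure_P h z
    rw [← integral_sub (integrable_of_bound (hmeas V hVm z) (hpowb V hV0 hV2 z))
      (integrable_of_bound (hmeas V' hV'm z) (hpowb V' (fun x => (hV'b x).1)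
        (fun x => (hV'b x).2) z))]
    exact abs_integral_le (hpow z)
  have hgood := G.unweighted h hh t ht fhat hreg.1 f hf V' hV' p hp fun s _ => by
    have := M.isProbabilityMeasure_P h ((D ω).z s h)
    have hb := hpowb V' (fun x => (hV'b x).1) (fun x => (hV'b x).2) ((D ω).z s h)
    constructor
    · refine (integral_sub_mean_sq_le (hmeas V' hV'm _) hb).trans ?_
      have h1 : ∀ x, |((M.r h ((D ω).z s h) x + V' x) ^ p) ^ 2| ≤ 81 := fun x => by
        rw [abs_pow]
        have := pow_le_pow_left₀ (abs_nonneg _) (hb x) 2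
        linarith
      have h2 := (abs_le.1 (abs_integral_le (ν := M.P h ((D ω).z s h)) h1)).2
      linarith
    · have e1 := abs_le.1 (hFb _ hreg.1 ((D ω).z s h))
      have e2 := abs_le.1 (hFb _ hf ((D ω).z s h))
      rw [abs_le]; constructor <;> linarith
  have hre := c.regression_error hreg hf (m := fun s => ∫ x', (M.r h ((D ω).past t h s) x' +
    V x') ^ p ∂(M.P h ((D ω).past t h s))) hFb (fun s => hfV _) (w := 1) (fun s => by simp)
    S.ε_pos.le
  have hcast : ∑ s : Fin t, 1 / (1 : ℝ) ^ 2 * (fhat ((D ω).past t h s) - f ((D ω).past t h s)) ^ 2 =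
    ∑ s ∈ Finset.range t, 1 / (1 : ℝ) ^ 2 * (fhat ((D ω).z s h) - f ((D ω).z s h)) ^ 2 :=
    Fin.sum_univ_eq_sum_range (fun s => 1 / (1 : ℝ) ^ 2 * (fhat ((D ω).z s h) -
    f ((D ω).z s h)) ^ 2) t
  have hcast2 : ∑ s : Fin t, 1 / (1 : ℝ) ^ 2 * (fhat ((D ω).past t h s) - f ((D ω).past t h s)) *
      ((M.r h ((D ω).z s h) ((D ω).x s (h + 1)) + V ((D ω).x s (h + 1))) ^ p -
        ∫ x', (M.r h ((D ω).past t h s) x' + V x') ^ p ∂(M.P h ((D ω).past t h s))) =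
    ∑ s ∈ Finset.range t, 1 / (1 : ℝ) ^ 2 * (fhat ((D ω).z s h) - f ((D ω).z s h)) *
      ((M.r h ((D ω).z s h) ((D ω).x s (h + 1)) + V ((D ω).x s (h + 1))) ^ p -
        ∫ x', (M.r h ((D ω).z s h) x' + V x') ^ p ∂(M.P h ((D ω).z s h))) :=
    Fin.sum_univ_eq_sum_range (fun s => 1 / (1 : ℝ) ^ 2 * (fhat ((D ω).z s h) - f ((D ω).z s h)) *
      ((M.r h ((D ω).z s h) ((D ω).x s (h + 1)) + V ((D ω).x s (h + 1))) ^ p -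
        ∫ x', (M.r h ((D ω).z s h) x' + V x') ^ p ∂(M.P h ((D ω).z s h)))) t
  rw [hcast, hcast2] at hre
  rw [hcast]
  have hterm : ∀ s ∈ Finset.range t, 1 / (1 : ℝ) ^ 2 * (fhat ((D ω).z s h) - f ((D ω).z s h)) *
      ((M.r h ((D ω).z s h) ((D ω).x s (h + 1)) + V ((D ω).x s (h + 1))) ^ p -
        ∫ x', (M.r h ((D ω).z s h) x' + V x') ^ p ∂(M.P h ((D ω).z s h))) ≤
      1 / (1 : ℝ) ^ 2 * (fhat ((D ω).z s h) - f ((D ω).z s h)) *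
      ((M.r h ((D ω).z s h) ((D ω).x s (h + 1)) + V' ((D ω).x s (h + 1))) ^ p -
        ∫ x', (M.r h ((D ω).z s h) x' + V' x') ^ p ∂(M.P h ((D ω).z s h))) +
      24 * c.B * ε' := fun s _ => by
    have e1 := abs_le.1 (hFb _ hreg.1 ((D ω).z s h))
    have e2 := abs_le.1 (hFb _ hf ((D ω).z s h))
    have e3 := abs_le.1 (hpow ((D ω).z s h) ((D ω).x s (h + 1)))
    have e4 := abs_le.1 (hmean ((D ω).z s h))
    set a := fhat ((D ω).z s h) - f ((D ω).z s h)
    have ha : |a| ≤ 2 * c.B := abs_le.2 ⟨by simp only [a]; linarith, by simp only [a]; linarith⟩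
    rw [one_pow, div_one, one_mul, ← sub_le_iff_le_add', ← mul_sub]
    refine (le_abs_self _).trans ?_
    rw [abs_mul]
    calc _ ≤ (2 * c.B) * (12 * ε') :=
          mul_le_mul ha (abs_le.2 ⟨by linarith, by linarith⟩) (abs_nonneg _) (by linarith)
      _ = 24 * c.B * ε' := by ring
  have hsum := Finset.sum_le_sum hterm
  rw [Finset.sum_add_distrib, Finset.sum_const, Finset.card_range, nsmul_eq_mul] at hsum
  set Sq := ∑ s ∈ Finset.range t, 1 / (1 : ℝ) ^ 2 * (fhat ((D ω).z s h) - f ((D ω).z s h)) ^ 2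
  have hSq : 0 ≤ Sq := Finset.sum_nonneg fun s _ => by positivity
  have htT : (t : ℝ) ≤ c.T := by exact_mod_cast ht.le
  -- The factor is `1/(4B)`, and `B ≥ 2`.
  have h1 : 1 / (324 * c.B) * 81 * Sq ≤ 1 / 8 * Sq := by
    refine mul_le_mul_of_nonneg_right ?_ hSq
    rw [div_mul_eq_mul_div, div_le_div_iff₀ (by linarith) (by norm_num)]
    linarith
  have h2 : Lb / (1 / (324 * c.B)) = 324 * c.B * Lb := by field_simp
  rw [h2] at hgood
  have hTT : (c.T : ℝ) ≤ c.T ^ 2 * c.H := by nlinarith [mul_le_mul hT1 hH1 (by norm_num) (by linarith)]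
  have h3 : (t : ℝ) * (24 * c.B * ε') ≤ 2 * c.B := by
    have h5 : 16 * ε' * t ≤ 1 := by nlinarith [P.ε'_le, P.ε'_nonneg]
    nlinarith
  have h4 : 4 * c.B * c.ε * (t * 1) ≤ c.B := by
    have h5 : 8 * c.ε * t ≤ 1 := by nlinarith [S.ε_pos]
    nlinarith
  nlinarith [P.one_le_Lb]

end RunSetting


namespace RunSetting

variable {X A Ω : Type*} [MeasurableSpace X] [TopologicalSpace A] [PolishSpace A]
  [MeasurableSpace A] [mΩ : MeasurableSpace Ω] {d : ℕ} {M : MDP X A} {c : Config X A d}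
  {Pr : Measure Ω} {D : Ω → Transcript X A} [Nonempty X] [Nonempty A]
  {𝒱 : ℕ → Finset (X → ℝ)} {ε' Lb La cb : ℝ} {K : ℕ}

/-- Solves the self-bounding inequality: `√(S + 1) q ≤ ((S + 1) + q²) / 2`. -/
theorem le_of_le_sqrt_mul_add {S q b : ℝ} (hS : 0 ≤ S) (h : S ≤ √(S + 1) * q + b) :
    S ≤ q ^ 2 + 2 * b + 1 := by
  have h1 := Real.sq_sqrt (show 0 ≤ S + 1 by linarith)
  nlinarith [sq_nonneg (√(S + 1) - q)]

/-- The least power of four above `S + 1`, for peeling over dyadic scales of the random squared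
error. -/
theorem exists_pow_four_ge {S : ℝ} {K : ℕ} (hS : 0 ≤ S) (hK : S + 1 ≤ 4 ^ K) :
    ∃ k ≤ K, √(S + 1) ≤ 2 ^ k ∧ (2 : ℝ) ^ k ≤ 2 * √(S + 1) := by
  classical
  have hex : ∃ k : ℕ, S + 1 ≤ 4 ^ k := ⟨K, hK⟩
  have hpow : ∀ k : ℕ, ((2 : ℝ) ^ k) ^ 2 = 4 ^ k := fun k => by
    rw [← pow_mul, mul_comm, pow_mul]; norm_num
  refine ⟨Nat.find hex, Nat.find_min' hex hK, ?_, ?_⟩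
  · rw [Real.sqrt_le_left (by positivity), hpow]
    exact Nat.find_spec hex
  · rcases Nat.eq_zero_or_pos (Nat.find hex) with h0 | h0
    · rw [h0, pow_zero]
      have : 1 ≤ √(S + 1) := Real.one_le_sqrt.2 (by linarith)
      linarith
    · obtain ⟨k, hk⟩ := Nat.exists_eq_succ_of_ne_zero h0.ne'
      have hlt := Nat.find_min hex (show k < Nat.find hex by omega)
      rw [hk, Nat.succ_eq_add_one, pow_succ, mul_comm]
      refine mul_le_mul_of_nonneg_left (Real.le_sqrt_of_sq_le ?_) (by norm_num)
      rw [hpow]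
      exact (not_le.1 hlt).le

theorem eluderD_le_sigmaBar_sq (P : Tuned c ε' Lb La cb K) (D : Transcript X A) (h t : ℕ) :
    4 * c.ι ^ 2 * c.eluderD h (D.past t h) (fun s => D.sigmaBar c h s) (D.z t h) ≤
      D.sigmaBar c h t ^ 2 := by
  have h0 := c.eluderD_nonneg h (D.past t h) (fun s => D.sigmaBar c h s) (D.z t h)
  have h1 : 2 * (√c.υ + c.ι) * √(c.eluderD h (D.past t h) (fun s => D.sigmaBar c h s) (D.z t h)) ≤
      D.sigmaBar c h t := by
    conv_rhs => rw [Transcript.sigmaBar, Transcript.weightOf]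
    exact (le_max_right _ _).trans (le_max_right _ _)
  have hι := P.one_le_ι
  have h2 : 2 * c.ι * √(c.eluderD h (D.past t h) (fun s => D.sigmaBar c h s) (D.z t h)) ≤
      D.sigmaBar c h t :=
    le_trans (mul_le_mul_of_nonneg_right (by linarith [Real.sqrt_nonneg c.υ])
      (Real.sqrt_nonneg _)) h1
  have h3 := pow_le_pow_left₀ (by positivity) h2 2
  rw [mul_pow, Real.sq_sqrt h0] at h3
  linarith

-- The noise of the targets is that of `r + V⋆` plus that of `V - V⋆`. The former involves one fixed
-- function and pays `La`, free of the net. The latter pays the cost `Lb` of the net, but its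
-- variance is at most `2 σ̄² / ι²`, and `Lb` is at most a multiple of `ι²`; so it contributes only
-- a bounded multiple of the square root of the squared error. The squared radius is therefore of
-- order `La`, not `Lb`.
set_option maxHeartbeats 1600000 in
theorem conf_weighted (S : RunSetting M c Pr D) (P : Tuned c ε' Lb La cb K) {ω : Ω}
    (G : GoodRegression M c (D ω) 𝒱 Lb La K)
    (h𝒱 : ∀ h, ∀ V ∈ 𝒱 h, Measurable V ∧ ∀ x, 0 ≤ V x ∧ V x ≤ 2) {t h : ℕ} (ht : t < c.T)
    (hh : h < c.H) {V : X → ℝ} (hVm : Measurable V) (hV0 : ∀ x, 0 ≤ V x) (hV1 : ∀ x, V x ≤ 1)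
    (hcov : ∃ V' ∈ 𝒱 (h + 1), ∀ x, |V x - V' x| ≤ ε')
    (hvar : ∀ s < t, ∫ x, (M.r h ((D ω).z s h) x + Vopt M (h + 1) x -
      ∫ y, (M.r h ((D ω).z s h) y + Vopt M (h + 1) y) ∂(M.P h ((D ω).z s h))) ^ 2
      ∂(M.P h ((D ω).z s h)) ≤ (D ω).sigmaBar c h s ^ 2)
    (hexc : ∀ s < t, 2 * c.ι ^ 2 * ∫ x, (V x - Vopt M (h + 1) x) ^ 2 ∂(M.P h ((D ω).z s h)) ≤
      (D ω).sigmaBar c h s ^ 2)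
    {fhat f : X × A → ℝ} (hreg : c.IsRegression h ((D ω).past t h)
      (fun s => (D ω).sigmaBar c h s)
      (fun s => M.r h ((D ω).z s h) ((D ω).x s (h + 1)) + V ((D ω).x s (h + 1))) fhat)
    (hf : f ∈ c.F h) (hfV : ∀ z, |bellman M h V z - f z| ≤ c.ε) :
    ∑ s : Fin t, 1 / (D ω).sigmaBar c h s ^ 2 *
      (fhat ((D ω).past t h s) - f ((D ω).past t h s)) ^ 2 ≤ c.β₁ ^ 2 := by
  obtain ⟨V', hV', hVV'⟩ := hcov
  obtain ⟨hV'm, hV'b⟩ := h𝒱 _ _ hV'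
  have hhM : h < M.H := S.horizon ▸ hh
  obtain ⟨hT1, hH1, hε⟩ := S.TH_cast
  have hB := S.toLinSetting.two_le_B
  have hFb := fun g (hg : g ∈ c.F h) z => S.toLinSetting.abs_le_of_mem hhM hg z
  have hVo := S.toLinSetting.measurable_Vopt (h + 1)
  have hVo0 := S.toLinSetting.Vopt_nonneg (h + 1)
  have hVo1 := S.toLinSetting.Vopt_le_one (h + 1)
  have hι := P.one_le_ι
  have hι2 : 0 < c.ι ^ 2 := by positivity
  have hα := S.alpha_pos
  have hσ : ∀ s, 0 < (D ω).sigmaBar c h s := fun s =>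
    hα.trans_le (alpha_le_sigmaBar (c := c) (D := D) ω h s)
  have hasq : ∀ s, c.α ^ 2 ≤ (D ω).sigmaBar c h s ^ 2 := fun s =>
    pow_le_pow_left₀ hα.le (alpha_le_sigmaBar (c := c) (D := D) ω h s) 2
  have hLa : 1 ≤ √La := Real.one_le_sqrt.2 P.one_le_La
  have hLa2 := Real.sq_sqrt (show 0 ≤ La by linarith [P.one_le_La])
  have hre := c.regression_error hreg hf (m := fun s => bellman M h V ((D ω).past t h s)) hFb
    (fun s => hfV _) (w := c.T * c.H) (fun s => S.weight_le ω h s) S.ε_pos.le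
  have hcast : ∑ s : Fin t, 1 / (D ω).sigmaBar c h s ^ 2 *
      (fhat ((D ω).past t h s) - f ((D ω).past t h s)) ^ 2 =
    ∑ s ∈ Finset.range t, 1 / (D ω).sigmaBar c h s ^ 2 *
      (fhat ((D ω).z s h) - f ((D ω).z s h)) ^ 2 :=
    Fin.sum_univ_eq_sum_range (fun s => 1 / (D ω).sigmaBar c h s ^ 2 *
      (fhat ((D ω).z s h) - f ((D ω).z s h)) ^ 2) t
  have hcast2 : ∑ s : Fin t, 1 / (D ω).sigmaBar c h s ^ 2 *
      (fhat ((D ω).past t h s) - f ((D ω).past t h s)) *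
      (M.r h ((D ω).z s h) ((D ω).x s (h + 1)) + V ((D ω).x s (h + 1)) -
        bellman M h V ((D ω).past t h s)) =
    ∑ s ∈ Finset.range t, 1 / (D ω).sigmaBar c h s ^ 2 *
      (fhat ((D ω).z s h) - f ((D ω).z s h)) *
      (M.r h ((D ω).z s h) ((D ω).x s (h + 1)) + V ((D ω).x s (h + 1)) -
        bellman M h V ((D ω).z s h)) :=
    Fin.sum_univ_eq_sum_range (fun s => 1 / (D ω).sigmaBar c h s ^ 2 *
      (fhat ((D ω).z s h) - f ((D ω).z s h)) *
      (M.r h ((D ω).z s h) ((D ω).x s (h + 1)) + V ((D ω).x s (h + 1)) -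
        bellman M h V ((D ω).z s h))) t
  rw [hcast, hcast2] at hre
  rw [hcast]
  set e : ℕ → ℝ := fun s => fhat ((D ω).z s h) - f ((D ω).z s h) with he
  set w : ℕ → ℝ := fun s => 1 / (D ω).sigmaBar c h s ^ 2 with hw
  have hw0 : ∀ s, 0 ≤ w s := fun s => by simp only [hw]; positivity
  have hwle : ∀ s, w s ≤ c.T * c.H := fun s => S.weight_le ω h s
  have heb : ∀ s, |e s| ≤ 2 * c.B := fun s => by
    have e1 := abs_le.1 (hFb _ hreg.1 ((D ω).z s h))
    have e2 := abs_le.1 (hFb _ hf ((D ω).z s h))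
    simp only [he]
    rw [abs_le]; constructor <;> linarith
  set Sq := ∑ s ∈ Finset.range t, w s * e s ^ 2 with hSqdef
  have hSq : 0 ≤ Sq := Finset.sum_nonneg fun s _ => mul_nonneg (hw0 s) (sq_nonneg _)
  have htT : (t : ℝ) ≤ c.T := by exact_mod_cast ht.le
  have hTH0 : (0 : ℝ) ≤ c.T * c.H := by positivity
  have htTH : (t : ℝ) * (c.T * c.H) ≤ c.T ^ 2 * c.H := by
    rw [sq, mul_assoc]; exact mul_le_mul_of_nonneg_right htT hTH0
  have hSqK : Sq + 1 ≤ 4 ^ K := by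
    have h1 : Sq ≤ ∑ s ∈ Finset.range t, c.T * c.H * (4 * c.B ^ 2) :=
      Finset.sum_le_sum fun s _ => mul_le_mul (hwle s) (by
        have := pow_le_pow_left₀ (abs_nonneg _) (heb s) 2
        rw [sq_abs] at this; linarith) (sq_nonneg _) hTH0
    rw [Finset.sum_const, Finset.card_range, nsmul_eq_mul] at h1
    have h2 : (t : ℝ) * (c.T * c.H * (4 * c.B ^ 2)) ≤ 4 * c.B ^ 2 * (c.T ^ 2 * c.H) := by
      nlinarith [mul_le_mul_of_nonneg_left htTH (show 0 ≤ 4 * c.B ^ 2 by positivity)]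
    linarith [P.K_le]
  -- The best scale in the exponential inequality depends on the random error `q = √(Sq + 1)`. It is
  -- replaced by a dyadic approximation `2 ^ k`, for which a deviation bound was reserved in
  -- advance.
  obtain ⟨k, hkK, hk1, hk2⟩ := exists_pow_four_ge hSq hSqK
  have hkmem : k ∈ Finset.range (K + 1) := Finset.mem_range.2 (by omega)
  set q := √(Sq + 1) with hq
  have hq1 : 1 ≤ q := Real.one_le_sqrt.2 (by linarith)
  have hq2 : q ^ 2 = Sq + 1 := Real.sq_sqrt (by linarith)
  have h2k : (0 : ℝ) < 2 ^ k := by positivity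
  -- The errors at the data before `s` sum to at most `q² - 1`, so `|e s|` is at most `q` times the
  -- eluder quantity, of which `σ̄²` is at least `4 ι²` times. This is the purpose of the last term
  -- in the definition of the weights.
  have hcoef : ∀ s < t, |w s * e s| ≤ 2 ^ k / (4 * c.ι ^ 2) := fun s hs => by
    have hD0 := c.eluderD_nonneg h ((D ω).past s h) (fun j => (D ω).sigmaBar c h j) ((D ω).z s h)
    have hpart : ∑ j : Fin s, 1 / (D ω).sigmaBar c h j ^ 2 *
        (fhat ((D ω).past s h j) - f ((D ω).past s h j)) ^ 2 ≤ q ^ 2 - 1 := by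
      have h1 : ∑ j : Fin s, 1 / (D ω).sigmaBar c h j ^ 2 *
          (fhat ((D ω).past s h j) - f ((D ω).past s h j)) ^ 2 =
        ∑ j ∈ Finset.range s, w j * e j ^ 2 := Fin.sum_univ_eq_sum_range (fun j => w j * e j ^ 2) s
      rw [h1, hq2, add_sub_cancel_right]
      exact Finset.sum_le_sum_of_subset_of_nonneg
        (Finset.range_subset_range.2 hs.le) fun i _ _ => mul_nonneg (hw0 i) (sq_nonneg _)
    have h2 : |e s| ≤ c.eluderD h ((D ω).past s h) (fun j => (D ω).sigmaBar c h j)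
        ((D ω).z s h) * q := by
      have h3 := c.eluderD_sq_ge ((D ω).past s h) (fun j => (D ω).sigmaBar c h j)
        ((D ω).z s h) hreg.1 hf
      refine abs_le_of_sq_le_sq (h3.trans ?_) (by positivity)
      rw [mul_pow]
      exact mul_le_mul_of_nonneg_left (by linarith) (sq_nonneg _)
    have h4 := eluderD_le_sigmaBar_sq P (D ω) h s
    rw [abs_mul, abs_of_nonneg (hw0 s)]
    simp only [hw]
    rw [one_div, inv_mul_eq_div, div_le_div_iff₀ (pow_pos (hσ s) 2) (by positivity)]
    calc |e s| * (4 * c.ι ^ 2) ≤ (c.eluderD h ((D ω).past s h) (fun j => (D ω).sigmaBar c h j)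
          ((D ω).z s h) * q) * (4 * c.ι ^ 2) := by gcongr
      _ = (4 * c.ι ^ 2 * c.eluderD h ((D ω).past s h) (fun j => (D ω).sigmaBar c h j)
          ((D ω).z s h)) * q := by ring
      _ ≤ (D ω).sigmaBar c h s ^ 2 * 2 ^ k := mul_le_mul h4 hk1 (by positivity) (sq_nonneg _)
      _ = _ := mul_comm _ _
  have hA1 := G.optimal h hh t ht fhat hreg.1 f hf k hkmem fun s hs =>
    ⟨by rw [one_mul]; exact hvar s hs, hcoef s hs⟩
  have hA2 := G.excess h hh t ht fhat hreg.1 f hf V' hV' k hkmem fun s hs => by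
    refine ⟨?_, hcoef s hs⟩
    have := M.isProbabilityMeasure_P h ((D ω).z s h)
    have hb1 : ∀ x, |V' x - Vopt M (h + 1) x| ≤ 3 := fun x => by
      have := hV'b x; have := hVo0 x; have := hVo1 x
      rw [abs_le]; constructor <;> linarith
    refine (integral_sub_mean_sq_le (hV'm.sub hVo) hb1).trans ?_
    have hi1 : Integrable (fun x => (V x - Vopt M (h + 1) x) ^ 2) (M.P h ((D ω).z s h)) :=
      integrable_of_bound (b := 1) ((hVm.sub hVo).pow_const 2) fun x => by
        have := hV0 x; have := hV1 x; have := hVo0 x; have := hVo1 x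
        rw [abs_pow]
        exact pow_le_one₀ (abs_nonneg _) (by rw [abs_le]; constructor <;> linarith)
    have hi2 : Integrable (fun x => (V' x - Vopt M (h + 1) x) ^ 2) (M.P h ((D ω).z s h)) :=
      integrable_of_bound (b := 3 ^ 2) ((hV'm.sub hVo).pow_const 2) fun x => by
        rw [abs_pow]; exact pow_le_pow_left₀ (abs_nonneg _) (hb1 x) 2
    -- Replacing `V` by its neighbour in the net costs a factor two and `2 ε'²`; the latter is paid
    -- by the part `α²` of the squared weight.
    have h1 : ∫ x, (V' x - Vopt M (h + 1) x) ^ 2 ∂(M.P h ((D ω).z s h)) ≤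
        ∫ x, (2 * (V x - Vopt M (h + 1) x) ^ 2 + 2 * ε' ^ 2) ∂(M.P h ((D ω).z s h)) := by
      refine integral_mono hi2 ((hi1.const_mul 2).add (integrable_const _)) fun x => ?_
      have h2 := pow_le_pow_left₀ (abs_nonneg _) (hVV' x) 2
      rw [sq_abs] at h2
      dsimp only
      nlinarith [sq_nonneg ((V x - Vopt M (h + 1) x) + (V x - V' x))]
    rw [integral_add (hi1.const_mul 2) (integrable_const _), integral_const_mul] at h1
    simp only [integral_const, probReal_univ, one_smul] at h1
    refine h1.trans ?_
    rw [div_mul_eq_mul_div, le_div_iff₀ hι2]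
    nlinarith [hexc s hs, P.ε'_ι, hasq s]
  change ∑ s ∈ Finset.range t, w s * e s * _ ≤ √La / 2 ^ k * 1 * Sq + La / (√La / 2 ^ k) at hA1
  change ∑ s ∈ Finset.range t, w s * e s * _ ≤
    c.ι ^ 2 / 2 ^ k * (2 / c.ι ^ 2) * Sq + Lb / (c.ι ^ 2 / 2 ^ k) at hA2
  have hSk : Sq / 2 ^ k ≤ q := by
    rw [div_le_iff₀ h2k]
    have := mul_le_mul_of_nonneg_left hk1 (show 0 ≤ q by linarith)
    linarith
  have hA1' : √La / 2 ^ k * 1 * Sq + La / (√La / 2 ^ k) ≤ 3 * √La * q := by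
    have h1 : √La / 2 ^ k * 1 * Sq = √La * (Sq / 2 ^ k) := by ring
    have h2 : La / (√La / 2 ^ k) = √La * 2 ^ k := by
      nth_rewrite 1 [← hLa2]
      field_simp
    rw [h1, h2]
    have h3 := mul_le_mul_of_nonneg_left hSk (show 0 ≤ √La by linarith)
    have h4 := mul_le_mul_of_nonneg_left hk2 (show 0 ≤ √La by linarith)
    linarith
  have hA2' : c.ι ^ 2 / 2 ^ k * (2 / c.ι ^ 2) * Sq + Lb / (c.ι ^ 2 / 2 ^ k) ≤
      2 * q + 2 * cb * q := by
    have h1 : c.ι ^ 2 / 2 ^ k * (2 / c.ι ^ 2) * Sq = 2 * (Sq / 2 ^ k) := by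
      field_simp
    have h2 : Lb / (c.ι ^ 2 / 2 ^ k) ≤ cb * 2 ^ k := by
      rw [div_div_eq_mul_div, div_le_iff₀ hι2]
      have := mul_le_mul_of_nonneg_right P.Lb_le h2k.le
      linarith
    rw [h1]
    have h3 := mul_le_mul_of_nonneg_left hk2 (show 0 ≤ cb by linarith [P.one_le_cb])
    linarith
  have hterm : ∀ s ∈ Finset.range t, w s * e s *
      (M.r h ((D ω).z s h) ((D ω).x s (h + 1)) + V ((D ω).x s (h + 1)) -
        bellman M h V ((D ω).z s h)) ≤
      w s * e s * (M.r h ((D ω).z s h) ((D ω).x s (h + 1)) + Vopt M (h + 1) ((D ω).x s (h + 1)) -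
        ∫ y, (M.r h ((D ω).z s h) y + Vopt M (h + 1) y) ∂(M.P h ((D ω).z s h))) +
      w s * e s * (V' ((D ω).x s (h + 1)) - Vopt M (h + 1) ((D ω).x s (h + 1)) -
        ∫ y, (V' y - Vopt M (h + 1) y) ∂(M.P h ((D ω).z s h))) +
      (c.T * c.H) * (2 * c.B) * (2 * ε') := fun s _ => by
    have hp := M.isProbabilityMeasure_P h ((D ω).z s h)
    have hVb : ∀ x, |V x| ≤ 2 := fun x => by
      have := hV0 x; have := hV1 x
      rw [abs_le]; constructor <;> linarith
    have hV'b2 : ∀ x, |V' x| ≤ 2 := fun x => by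
      have := hV'b x
      rw [abs_le]; constructor <;> linarith
    have hVob := S.toLinSetting.abs_Vopt_le (h + 1)
    have hi0 : Integrable (M.r h ((D ω).z s h)) (M.P h ((D ω).z s h)) :=
      integrable_of_bound (b := 1) (M.measurable_r_apply h _) fun x => by
        have := M.r_mem h ((D ω).z s h) x
        rw [abs_le]; constructor <;> linarith [this.1, this.2]
    have hi1 := integrable_of_bound (ν := M.P h ((D ω).z s h)) hVm hVb
    have hi2 := integrable_of_bound (ν := M.P h ((D ω).z s h)) hVo hVob
    have hi3 := integrable_of_bound (ν := M.P h ((D ω).z s h)) hV'm hV'b2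
    have e3 := abs_le.1 (hVV' ((D ω).x s (h + 1)))
    have e4 := abs_le.1 (abs_integral_le (ν := M.P h ((D ω).z s h)) hVV')
    rw [integral_sub hi1 hi3] at e4
    rw [bellman, integral_add hi0 hi1, integral_add hi0 hi2, integral_sub hi3 hi2]
    rw [← sub_le_iff_le_add', ← mul_add, ← mul_sub]
    refine (le_abs_self _).trans ?_
    rw [abs_mul, abs_mul, abs_of_nonneg (hw0 s)]
    refine mul_le_mul (mul_le_mul (hwle s) (heb s) (abs_nonneg _) hTH0) ?_ (abs_nonneg _)
      (by positivity)
    rw [abs_le]; constructor <;> linarith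
  have hsum := Finset.sum_le_sum hterm
  rw [Finset.sum_add_distrib, Finset.sum_add_distrib, Finset.sum_const, Finset.card_range,
    nsmul_eq_mul] at hsum
  have h3 : (t : ℝ) * (c.T * c.H * (2 * c.B) * (2 * ε')) ≤ c.B / 4 := by
    have h5 : 16 * ε' * (t * (c.T * c.H)) ≤ 1 :=
      (mul_le_mul_of_nonneg_left htTH (by linarith [P.ε'_nonneg])).trans P.ε'_le
    nlinarith
  have h4 : 4 * c.B * c.ε * (t * (c.T * c.H)) ≤ c.B / 2 := by
    have h5 : 8 * c.ε * (t * (c.T * c.H)) ≤ 1 :=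
      (mul_le_mul_of_nonneg_left htTH (by linarith [S.ε_pos])).trans hε
    nlinarith
  have hcb := P.one_le_cb
  -- Twice `3 √La + (2 + 2 cb)`, with `1 ≤ √La`; the discretization errors add up to `B`.
  have hfin : Sq ≤ q * ((10 + 4 * cb) * √La) + c.B := by
    have hx : q * (4 + 4 * cb) ≤ q * ((4 + 4 * cb) * √La) :=
      mul_le_mul_of_nonneg_left (le_mul_of_one_le_right (by linarith) hLa) (by linarith)
    nlinarith
  have := le_of_le_sqrt_mul_add hSq hfin
  rw [mul_pow, hLa2] at this
  linarith [P.β₁_ge]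

end RunSetting


/-! ### Optimism, pessimism and variance estimates on the good event. -/

/-- The regressions of a run are accurate, relative to a net of the value functions. -/
structure GoodEvent {X A : Type*} [MeasurableSpace X] [MeasurableSpace A] {d : ℕ} (M : MDP X A)
    (c : Config X A d) (D : Transcript X A) (𝒱 : ℕ → Finset (X → ℝ)) (ε' Lb La : ℝ) (K : ℕ) :
    Prop extends GoodRegression M c D 𝒱 Lb La K where
  net_spec : ∀ h, ∀ V ∈ 𝒱 h, Measurable V ∧ ∀ x, 0 ≤ V x ∧ V x ≤ 2
  net_close : ∀ h, ∀ t < c.T, ∀ j, ∃ V ∈ 𝒱 h, ∀ x, |clip (RunSetting.val c D j t h x) - V x| ≤ ε'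

section MaxVal

variable {X A : Type*} {d : ℕ} {c : Config X A d}

theorem maxVal_of_le {f : ℕ → ℕ → X × A → ℝ} {t h : ℕ} (hh : c.H ≤ h) (x : X) :
    Transcript.maxVal c f t h x = 0 := if_neg (not_lt.2 hh)

theorem le_maxVal {f : ℕ → ℕ → X × A → ℝ} {t h : ℕ} (hh : h < c.H) {b : ℝ}
    (hb : ∀ z, f t h z ≤ b) (z : X × A) : f t h z ≤ Transcript.maxVal c f t h z.1 := by
  rw [Transcript.maxVal, if_pos hh]
  exact le_ciSup (f := fun a => f t h (z.1, a)) ⟨b, by rintro _ ⟨a, rfl⟩; exact hb _⟩ z.2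

theorem maxVal_le [Nonempty A] {f : ℕ → ℕ → X × A → ℝ} {t h : ℕ} (hh : h < c.H) {b : ℝ} {x : X}
    (hb : ∀ a, f t h (x, a) ≤ b) : Transcript.maxVal c f t h x ≤ b := by
  rw [Transcript.maxVal, if_pos hh]
  exact ciSup_le hb

end MaxVal

namespace RunSetting

variable {X A Ω : Type*} [MeasurableSpace X] [TopologicalSpace A] [PolishSpace A]
  [MeasurableSpace A] [mΩ : MeasurableSpace Ω] {d : ℕ} {M : MDP X A} {c : Config X A d}
  {Pr : Measure Ω} {D : Ω → Transcript X A} [Nonempty X] [Nonempty A]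
  {𝒱 : ℕ → Finset (X → ℝ)} {ε' Lb La cb : ℝ} {K : ℕ}

theorem f₁_le_one (D : Transcript X A) (t h : ℕ) (z : X × A) : D.f₁ c t h z ≤ 1 := min_le_right _ _

theorem f₂_le_two (D : Transcript X A) (t h : ℕ) (z : X × A) : D.f₂ c t h z ≤ 2 := min_le_right _ _

theorem fNeg_nonneg (D : Transcript X A) (t h : ℕ) (z : X × A) : 0 ≤ D.fNeg c t h z :=
  le_max_right _ _

theorem fNeg_le (S : RunSetting M c Pr D) (ω : Ω) {t h : ℕ} (ht : t < c.T) (hh : h < c.H)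
    (z : X × A) : (D ω).fNeg c t h z ≤ c.B := by
  have hhM : h < M.H := S.horizon ▸ hh
  have h1 := (abs_le.1 (S.toLinSetting.abs_le_of_mem hhM
    ((S.run.isVOQL ω).regressionNeg t ht h hh).1 z)).2
  have h2 : 0 ≤ (D ω).b₂ c t h z := c.bonus_nonneg _ _ _ _ _
  exact max_le (by linarith [S.ε_pos]) (by linarith [S.toLinSetting.two_le_B])

theorem V₁_le_one (D : Transcript X A) (t h : ℕ) (x : X) : val c D 0 t h x ≤ 1 := by
  rw [val_zero]
  by_cases hh : h < c.H
  · exact maxVal_le hh fun a => f₁_le_one D t h _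
  · rw [maxVal_of_le (not_lt.1 hh)]; exact zero_le_one

theorem V₂_le_two (D : Transcript X A) (t h : ℕ) (x : X) : val c D 1 t h x ≤ 2 := by
  rw [val_one]
  by_cases hh : h < c.H
  · exact maxVal_le hh fun a => f₂_le_two D t h _
  · rw [maxVal_of_le (not_lt.1 hh)]; norm_num

theorem VNeg_nonneg (S : RunSetting M c Pr D) (ω : Ω) {t : ℕ} (ht : t < c.T) (h : ℕ) (x : X) :
    0 ≤ val c (D ω) 2 t h x := by
  rw [val_two]
  by_cases hh : h < c.H
  · exact (fNeg_nonneg (D ω) t h (x, Classical.arbitrary A)).trans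
      (le_maxVal hh (S.fNeg_le ω ht hh) _)
  · rw [maxVal_of_le (not_lt.1 hh)]

theorem Vopt_le_of_Qopt_le (S : RunSetting M c Pr D) {h : ℕ} (hh : h < c.H) {x : X} {b : ℝ}
    (hb : ∀ a, Qopt M h (x, a) ≤ b) : Vopt M h x ≤ b := by
  rw [Vopt_eq_iSup (S.horizon ▸ hh)]
  exact ciSup_le hb

theorem exists_close_of_mem (G : GoodEvent M c (D ω) 𝒱 ε' Lb La K) {t h : ℕ} (ht : t < c.T)
    (j : Fin 3) (h0 : ∀ x, 0 ≤ val c (D ω) j t h x) (h2 : ∀ x, val c (D ω) j t h x ≤ 2) :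
    ∃ V ∈ 𝒱 h, ∀ x, |val c (D ω) j t h x - V x| ≤ ε' := by
  obtain ⟨V, hV, hVx⟩ := G.net_close h t ht j
  refine ⟨V, hV, fun x => ?_⟩
  have := hVx x
  rwa [clip_of_mem (h0 x) (h2 x)] at this

theorem b₁_nonneg (D : Transcript X A) (t h : ℕ) (z : X × A) : 0 ≤ D.b₁ c t h z :=
  c.bonus_nonneg _ _ _ _ _

theorem b₂_nonneg (D : Transcript X A) (t h : ℕ) (z : X × A) : 0 ≤ D.b₂ c t h z :=
  c.bonus_nonneg _ _ _ _ _

/-- An unweighted regression for the targets `r + V` is accurate. -/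
theorem unweighted_error (S : RunSetting M c Pr D) (P : Tuned c ε' Lb La cb K) {ω : Ω}
    (G : GoodEvent M c (D ω) 𝒱 ε' Lb La K) {t h : ℕ} (ht : t < c.T) (hh : h < c.H) (j : Fin 3)
    (h0 : ∀ x, 0 ≤ val c (D ω) j t (h + 1) x) (h2 : ∀ x, val c (D ω) j t (h + 1) x ≤ 2)
    {fhat : X × A → ℝ} (hreg : c.IsRegression h ((D ω).past t h) (fun _ => 1)
      (fun s => M.r h ((D ω).z s h) ((D ω).x s (h + 1)) +
        val c (D ω) j t (h + 1) ((D ω).x s (h + 1))) fhat) (z : X × A) :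
    |fhat z - bellman M h (val c (D ω) j t (h + 1)) z| ≤ (D ω).b₂ c t h z + c.ε ∧
    |fhat z - bellman M h (val c (D ω) j t (h + 1)) z| ≤
      c.eluderD h ((D ω).past t h) (fun _ => 1) z * √(c.β₂ ^ 2 + 1) + c.ε := by
  have hhM : h < M.H := S.horizon ▸ hh
  have hVm := S.measurable_val ω j ht (h + 1)
  obtain ⟨f, hf, hfV⟩ := S.toLinSetting.exists_cover_bellman hhM hVm h0 h2
  have hconf := S.conf_unweighted P G.toGoodRegression G.net_spec ht hh hVm h0 h2
    (exists_close_of_mem G ht j h0 h2) (p := 1) (by simp) (fhat := fhat) (f := f)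
    (by simpa only [pow_one] using hreg) hf (by simpa only [pow_one, bellman] using hfV)
  have hconf' := hconf.trans P.β₂_ge
  have hlin := (S.cover h hhM).1
  have h3 := c.abs_sub_le_bonus (S.toLinSetting.one_le_Bh hhM) ((D ω).past t h) (fun _ => 1) z
    (hlin hreg.1) (hlin hf) hconf'
  have h4 := c.abs_sub_le_eluderD ((D ω).past t h) (fun _ => 1) z hreg.1 hf hconf'
  have h5 := abs_le.1 (hfV z)
  have h3' := abs_le.1 h3
  have h4' := abs_le.1 h4
  constructor
  · rw [Transcript.b₂, abs_le]; constructor <;> linarith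
  · rw [abs_le]; constructor <;> linarith

/-- Backward induction: the function subtracts exactly the allowed regression error. The regression
at level `h` is known to be accurate only if the next values lie in `[0, 2]`; nonnegativity is built
in, and the upper bound is the induction hypothesis together with `V⋆ ≤ 1`. In `overoptimism` the
roles are exchanged. -/
theorem pessimism (S : RunSetting M c Pr D) (P : Tuned c ε' Lb La cb K) {ω : Ω}
    (G : GoodEvent M c (D ω) 𝒱 ε' Lb La K) {t : ℕ} (ht : t < c.T) (h : ℕ) (x : X) :
    val c (D ω) 2 t h x ≤ Vopt M h x := by
  by_cases hh : c.H ≤ h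
  · rw [val_two, maxVal_of_le hh, Vopt_of_le (S.horizon ▸ hh)]
  replace hh := not_le.1 hh
  obtain ⟨n, hn⟩ : ∃ n, h + n = c.H := ⟨c.H - h, by omega⟩
  induction n generalizing h x with
  | zero => omega
  | succ n ih =>
    have hle : ∀ x, val c (D ω) 2 t (h + 1) x ≤ Vopt M (h + 1) x := fun x => by
      by_cases hh' : h + 1 < c.H
      · exact ih _ _ hh' (by omega)
      · rw [val_two, maxVal_of_le (not_lt.1 hh'), Vopt_of_le (S.horizon ▸ not_lt.1 hh')]
    have hVo1 := S.toLinSetting.Vopt_le_one (h + 1)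
    rw [val_two]
    refine maxVal_le hh fun a => ?_
    have herr := (abs_le.1 (S.unweighted_error P G ht hh 2 (S.VNeg_nonneg ω ht (h + 1))
      (fun x => by linarith [hle x, hVo1 x]) ((S.run.isVOQL ω).regressionNeg t ht h hh) (x, a)).1).2
    have hmono := bellman_mono (M := M) h (x, a) (S.VNeg_nonneg ω ht (h + 1))
      (S.toLinSetting.measurable_Vopt (h + 1)) (S.toLinSetting.abs_Vopt_le (h + 1)) hle
    have hQ := S.toLinSetting.Qopt_le_Vopt (S.horizon ▸ hh) (x, a)
    have hQ0 := S.toLinSetting.Qopt_nonneg h (x, a)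
    change bellman M h (val c (D ω) 2 t (h + 1)) (x, a) ≤ Qopt M h (x, a) at hmono
    refine max_le ?_ ?_ <;> dsimp only at hQ <;> linarith

theorem overoptimism (S : RunSetting M c Pr D) (P : Tuned c ε' Lb La cb K) {ω : Ω}
    (G : GoodEvent M c (D ω) 𝒱 ε' Lb La K) {t : ℕ} (ht : t < c.T) (h : ℕ) (x : X) :
    Vopt M h x ≤ val c (D ω) 1 t h x := by
  by_cases hh : c.H ≤ h
  · rw [val_one, maxVal_of_le hh, Vopt_of_le (S.horizon ▸ hh)]
  replace hh := not_le.1 hh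
  obtain ⟨n, hn⟩ : ∃ n, h + n = c.H := ⟨c.H - h, by omega⟩
  induction n generalizing h x with
  | zero => omega
  | succ n ih =>
    have hle : ∀ x, Vopt M (h + 1) x ≤ val c (D ω) 1 t (h + 1) x := fun x => by
      by_cases hh' : h + 1 < c.H
      · exact ih _ _ hh' (by omega)
      · rw [val_one, maxVal_of_le (not_lt.1 hh'), Vopt_of_le (S.horizon ▸ not_lt.1 hh')]
    have hVo0 := S.toLinSetting.Vopt_nonneg (h + 1)
    have h0 : ∀ x, 0 ≤ val c (D ω) 1 t (h + 1) x := fun x => (hVo0 x).trans (hle x)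
    have h2 := V₂_le_two (c := c) (D ω) t (h + 1)
    rw [val_one]
    refine S.Vopt_le_of_Qopt_le hh fun a => le_trans ?_ (le_maxVal hh (f₂_le_two (D ω) t h) (x, a))
    have herr := (abs_le.1 (S.unweighted_error P G ht hh 1 h0 h2
      ((S.run.isVOQL ω).regression₂ t ht h hh) (x, a)).1).1
    have hmono := bellman_mono (M := M) h (x, a) hVo0 (S.measurable_val ω 1 ht (h + 1))
      (fun x => abs_le.2 ⟨by linarith [h0 x], h2 x⟩) hle
    have hQ1 := S.toLinSetting.Qopt_le_one (S.horizon ▸ hh) (x, a)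
    have hb := b₁_nonneg (c := c) (D ω) t h (x, a)
    change Qopt M h (x, a) ≤ bellman M h (val c (D ω) 1 t (h + 1)) (x, a) at hmono
    refine le_min ?_ (by linarith)
    change _ ≤ (D ω).fhat₂ t h (x, a) + 2 * (D ω).b₁ c t h (x, a) + (D ω).b₂ c t h (x, a) + 3 * c.ε
    linarith [S.ε_pos]

theorem fNeg_le_bellman (S : RunSetting M c Pr D) (P : Tuned c ε' Lb La cb K) {ω : Ω}
    (G : GoodEvent M c (D ω) 𝒱 ε' Lb La K) {t h : ℕ} (ht : t < c.T) (hh : h < c.H) (z : X × A) :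
    (D ω).fNeg c t h z ≤ bellman M h (val c (D ω) 2 t (h + 1)) z ∧
    bellman M h (val c (D ω) 2 t (h + 1)) z ≤ (D ω).fNeg c t h z + 2 * (D ω).b₂ c t h z + 2 * c.ε ∧
    |(D ω).fhatNeg t h z - bellman M h (val c (D ω) 2 t (h + 1)) z| ≤
      c.eluderD h ((D ω).past t h) (fun _ => 1) z * √(c.β₂ ^ 2 + 1) + c.ε := by
  have h0 := S.VNeg_nonneg ω ht (h + 1)
  have herr := S.unweighted_error P G ht hh 2 h0 (fun x =>
    (S.pessimism P G ht (h + 1) x).trans (by linarith [S.toLinSetting.Vopt_le_one (h + 1) x]))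
    ((S.run.isVOQL ω).regressionNeg t ht h hh) z
  have h1 := abs_le.1 herr.1
  refine ⟨max_le (by linarith) (bellman_nonneg h z h0), ?_, herr.2⟩
  have := le_max_left ((D ω).fhatNeg t h z - (D ω).b₂ c t h z - c.ε) 0
  rw [Transcript.fNeg]
  linarith

theorem f₂_bounds (S : RunSetting M c Pr D) (P : Tuned c ε' Lb La cb K) {ω : Ω}
    (G : GoodEvent M c (D ω) 𝒱 ε' Lb La K) {t h : ℕ} (ht : t < c.T) (hh : h < c.H) (z : X × A) :
    min (bellman M h (val c (D ω) 1 t (h + 1)) z + 2 * (D ω).b₁ c t h z + 2 * c.ε) 2 ≤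
      (D ω).f₂ c t h z ∧
    (D ω).f₂ c t h z ≤ bellman M h (val c (D ω) 1 t (h + 1)) z + 2 * (D ω).b₁ c t h z +
      2 * (D ω).b₂ c t h z + 4 * c.ε := by
  have h0 : ∀ x, 0 ≤ val c (D ω) 1 t (h + 1) x := fun x =>
    (S.toLinSetting.Vopt_nonneg (h + 1) x).trans (S.overoptimism P G ht (h + 1) x)
  have herr := abs_le.1 (S.unweighted_error P G ht hh 1 h0 (V₂_le_two (c := c) (D ω) t (h + 1))
    ((S.run.isVOQL ω).regression₂ t ht h hh) z).1
  constructor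
  · refine min_le_min ?_ le_rfl
    change _ ≤ (D ω).fhat₂ t h z + 2 * (D ω).b₁ c t h z + (D ω).b₂ c t h z + 3 * c.ε
    linarith
  · have : (D ω).f₂ c t h z ≤ (D ω).fhat₂ t h z + 2 * (D ω).b₁ c t h z + (D ω).b₂ c t h z +
      3 * c.ε := min_le_left _ _
    linarith

theorem le_sigmaBar_sq_of_le {b : ℝ} (D : Transcript X A) (h t : ℕ) (hι : 0 ≤ c.ι)
    (hb0 : 0 ≤ b) (hb : b ≤ D.f₂ c t h (D.z t h) - D.fNeg c t h (D.z t h)) :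
    2 * c.ι ^ 2 * b ≤ D.sigmaBar c h t ^ 2 := by
  have h1 : √2 * c.ι * √(D.f₂ c t h (D.z t h) - D.fNeg c t h (D.z t h)) ≤ D.sigmaBar c h t := by
    conv_rhs => rw [Transcript.sigmaBar, Transcript.weightOf]
    exact (le_max_left _ _).trans (le_max_right _ _)
  have h2 := pow_le_pow_left₀ (by positivity) h1 2
  rw [mul_pow, mul_pow, Real.sq_sqrt (by norm_num), Real.sq_sqrt (hb0.trans hb)] at h2
  exact (mul_le_mul_of_nonneg_left hb (by positivity)).trans h2

theorem sigma_nonneg (D : Transcript X A) (h t : ℕ) : 0 ≤ D.sigma c t h := by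
  rw [Transcript.sigma]
  split_ifs
  · norm_num
  · exact Real.sqrt_nonneg _

theorem sigma_le_sigmaBar (D : Transcript X A) (h t : ℕ) : D.sigma c t h ≤ D.sigmaBar c h t := by
  rw [Transcript.sigmaBar, Transcript.weightOf]
  exact (le_max_left _ _).trans (le_max_left _ _)

/-- The conditional variance of `r + V_⋆(x')`. -/
noncomputable def varOpt (M : MDP X A) (h : ℕ) (z : X × A) : ℝ :=
  bellmanSq M h (Vopt M (h + 1)) z - Qopt M h z ^ 2

theorem abs_r_add_Vopt_le (S : RunSetting M c Pr D) (h : ℕ) (z : X × A) (x : X) :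
    |M.r h z x + Vopt M (h + 1) x| ≤ 2 := by
  have h1 := M.r_mem h z x
  have h2 := S.toLinSetting.Vopt_nonneg (h + 1) x
  have h3 := S.toLinSetting.Vopt_le_one (h + 1) x
  rw [abs_le]; constructor <;> linarith [h1.1, h1.2]

theorem integral_sq_eq_varOpt (S : RunSetting M c Pr D) (h : ℕ) (z : X × A) :
    ∫ x, (M.r h z x + Vopt M (h + 1) x - ∫ y, (M.r h z y + Vopt M (h + 1) y) ∂(M.P h z)) ^ 2
      ∂(M.P h z) = varOpt M h z := by
  have := M.isProbabilityMeasure_P h z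
  rw [integral_sub_mean_sq (Y := fun x => M.r h z x + Vopt M (h + 1) x)
    ((M.measurable_r_apply h z).add (S.toLinSetting.measurable_Vopt (h + 1)))
    (S.abs_r_add_Vopt_le h z)]
  rfl

theorem varOpt_nonneg (S : RunSetting M c Pr D) (h : ℕ) (z : X × A) : 0 ≤ varOpt M h z := by
  rw [← S.integral_sq_eq_varOpt]
  exact integral_nonneg fun x => sq_nonneg _

theorem varOpt_le_four (S : RunSetting M c Pr D) (h : ℕ) (z : X × A) : varOpt M h z ≤ 4 := by
  have := M.isProbabilityMeasure_P h z
  have h1 : bellmanSq M h (Vopt M (h + 1)) z ≤ 2 ^ 2 :=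
    (le_abs_self _).trans (abs_integral_le fun x => by
      rw [abs_pow]; exact pow_le_pow_left₀ (abs_nonneg _) (S.abs_r_add_Vopt_le h z x) 2)
  rw [varOpt]
  nlinarith [sq_nonneg (Qopt M h z)]

/-- The optimistic values at level `h` in episode `t` lie between the optimal values and the overly
optimistic values of the episodes up to `t`. -/
def Optimistic (M : MDP X A) (c : Config X A d) (D : Transcript X A) (t h : ℕ) : Prop :=
  ∀ x, Vopt M h x ≤ val c D 0 t h x ∧ ∀ s ≤ t, val c D 0 t h x ≤ val c D 1 s h x

/-- The link between episodes: the width `f₂ - fNeg` of episode `s` bounds how far the optimistic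
value of any later episode `t` can be above the pessimistic value of episode `s`, on average over
the next state. -/
theorem bellman_excess_le (S : RunSetting M c Pr D) (P : Tuned c ε' Lb La cb K) {ω : Ω}
    (G : GoodEvent M c (D ω) 𝒱 ε' Lb La K) {s t h : ℕ} (hs : s ≤ t) (ht : t < c.T) (hh : h < c.H)
    (hO : Optimistic M c (D ω) t (h + 1)) (z : X × A) :
    bellman M h (val c (D ω) 0 t (h + 1)) z - bellman M h (val c (D ω) 2 s (h + 1)) z ≤
      (D ω).f₂ c s h z - (D ω).fNeg c s h z := by
  have hsT := hs.trans_lt ht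
  have h0 : ∀ x, 0 ≤ val c (D ω) 0 t (h + 1) x := fun x =>
    (S.toLinSetting.Vopt_nonneg (h + 1) x).trans (hO x).1
  have h1 := V₁_le_one (c := c) (D ω) t (h + 1)
  have h20 : ∀ x, 0 ≤ val c (D ω) 1 s (h + 1) x := fun x =>
    (S.toLinSetting.Vopt_nonneg (h + 1) x).trans (S.overoptimism P G hsT (h + 1) x)
  have e1 := (S.fNeg_le_bellman P G hsT hh z).1
  have e2 := (S.f₂_bounds P G hsT hh z).1
  have e3 := bellman_mono (M := M) h z h0 (S.measurable_val ω 1 hsT (h + 1))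
    (fun x => abs_le.2 ⟨by linarith [h20 x], V₂_le_two (c := c) (D ω) s (h + 1) x⟩)
    fun x => (hO x).2 s hs
  have := M.isProbabilityMeasure_P h z
  -- The truncation of `f₂` at `2` does no harm: reward and optimistic value are each at most one.
  have e4 : bellman M h (val c (D ω) 0 t (h + 1)) z ≤ 2 :=
    (le_abs_self _).trans (abs_integral_le fun x => by
      have := M.r_mem h z x
      rw [abs_le]; constructor <;> linarith [h0 x, h1 x, this.1, this.2])
  have e5 : bellman M h (val c (D ω) 0 t (h + 1)) z ≤
    min (bellman M h (val c (D ω) 1 s (h + 1)) z + 2 * (D ω).b₁ c s h z + 2 * c.ε) 2 :=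
    le_min (by linarith [b₁_nonneg (c := c) (D ω) s h z, S.ε_pos]) e4
  linarith

theorem Optimistic.spec (S : RunSetting M c Pr D) {ω : Ω} {t h : ℕ}
    (hO : Optimistic M c (D ω) t h) :
    (∀ x, 0 ≤ val c (D ω) 0 t h x) ∧ (∀ x, val c (D ω) 0 t h x ≤ 1) ∧
      ∀ x, |val c (D ω) 0 t h x| ≤ 1 := by
  have h0 : ∀ x, 0 ≤ val c (D ω) 0 t h x := fun x =>
    (S.toLinSetting.Vopt_nonneg h x).trans (hO x).1
  have h1 := V₁_le_one (c := c) (D ω) t h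
  exact ⟨h0, h1, fun x => abs_le.2 ⟨by linarith [h0 x], h1 x⟩⟩

/-- Verifies the two weight conditions of `conf_weighted`. The variance of `r + V⋆` is covered by
the estimates of earlier episodes. For the excess, both values lie in `[0, 1]`, so `(V₁ - V⋆)²` is
at most `V₁ - V⋆`, hence at most `V₁` minus the pessimistic value of episode `s`, and
`bellman_excess_le` applies. -/
theorem optimistic_error (S : RunSetting M c Pr D) (P : Tuned c ε' Lb La cb K) {ω : Ω}
    (G : GoodEvent M c (D ω) 𝒱 ε' Lb La K) {t h : ℕ} (ht : t < c.T) (hh : h < c.H)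
    (hO : Optimistic M c (D ω) t (h + 1))
    (hvar : ∀ s < t, varOpt M h ((D ω).z s h) ≤ (D ω).sigma c s h ^ 2) (z : X × A) :
    |(D ω).fhat₁ t h z - bellman M h (val c (D ω) 0 t (h + 1)) z| ≤ (D ω).b₁ c t h z + c.ε := by
  have hhM : h < M.H := S.horizon ▸ hh
  have hVm := S.measurable_val ω 0 ht (h + 1)
  obtain ⟨h0, h1, hab⟩ := hO.spec S
  have h2 : ∀ x, val c (D ω) 0 t (h + 1) x ≤ 2 := fun x => (h1 x).trans (by norm_num)
  have hVo := S.toLinSetting.measurable_Vopt (h + 1)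
  obtain ⟨f, hf, hfV⟩ := S.toLinSetting.exists_cover_bellman hhM hVm h0 h2
  have hreg := (S.run.isVOQL ω).regression₁ t ht h hh
  have hconf := S.conf_weighted P G.toGoodRegression G.net_spec ht hh hVm h0 h1
    (exists_close_of_mem G ht 0 h0 h2) (fun s hs => by
      rw [S.integral_sq_eq_varOpt]
      exact (hvar s hs).trans (pow_le_pow_left₀ (sigma_nonneg _ _ _) (sigma_le_sigmaBar _ _ _) 2))
    (fun s hs => le_sigmaBar_sq_of_le (D ω) h s (by linarith [P.one_le_ι])
      (integral_nonneg fun x => sq_nonneg _) ?_) hreg hf hfV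
  · have hlin := (S.cover h hhM).1
    have h3 := abs_le.1 (c.abs_sub_le_bonus (S.toLinSetting.one_le_Bh hhM) ((D ω).past t h)
      (fun s => (D ω).sigmaBar c h s) z (hlin hreg.1) (hlin hf) hconf)
    have h5 := abs_le.1 (hfV z)
    rw [Transcript.b₁, abs_le]; constructor <;> linarith
  · have := M.isProbabilityMeasure_P h ((D ω).z s h)
    have hsT := hs.trans ht
    refine le_trans ?_ (S.bellman_excess_le P G hs.le ht hh hO _)
    have hN0 := S.VNeg_nonneg ω hsT (h + 1)
    have hN := S.pessimism P G hsT (h + 1)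
    have hVo1 := S.toLinSetting.Vopt_le_one (h + 1)
    have hVo0 := S.toLinSetting.Vopt_nonneg (h + 1)
    have hNm := S.measurable_val ω 2 hsT (h + 1)
    have hNb : ∀ x, |val c (D ω) 2 s (h + 1) x| ≤ 1 := fun x =>
      abs_le.2 ⟨by linarith [hN0 x], (hN x).trans (hVo1 x)⟩
    rw [bellman_sub_bellman h _ hVm hab hNm hNb]
    refine integral_mono (integrable_of_bound (b := 1) ((hVm.sub hVo).pow_const 2) fun x => ?_)
      ((integrable_of_bound hVm hab).sub (integrable_of_bound hNm hNb)) fun x => ?_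
    · rw [abs_pow]
      exact pow_le_one₀ (abs_nonneg _)
        (by rw [abs_le]; constructor <;> linarith [h0 x, h1 x, hVo0 x, hVo1 x])
    · dsimp only
      nlinarith [h0 x, h1 x, hVo0 x, hVo1 x, (hO x).1, hN x]

theorem f₁_bounds (S : RunSetting M c Pr D) {ω : Ω} {t h : ℕ}
    (hO : Optimistic M c (D ω) t (h + 1)) {z : X × A}
    (herr : |(D ω).fhat₁ t h z - bellman M h (val c (D ω) 0 t (h + 1)) z| ≤
      (D ω).b₁ c t h z + c.ε) :
    min (bellman M h (val c (D ω) 0 t (h + 1)) z) 1 ≤ (D ω).f₁ c t h z ∧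
    (D ω).f₁ c t h z ≤ bellman M h (val c (D ω) 0 t (h + 1)) z + 2 * (D ω).b₁ c t h z +
      2 * c.ε := by
  have h1 := abs_le.1 herr
  constructor
  · exact min_le_min (by linarith) le_rfl
  · have : (D ω).f₁ c t h z ≤ (D ω).fhat₁ t h z + (D ω).b₁ c t h z + c.ε := min_le_left _ _
    linarith

theorem b₁_anti (S : RunSetting M c Pr D) (D : Transcript X A) {s t h : ℕ} (hs : s ≤ t)
    (hh : h < c.H) (z : X × A) : D.b₁ c t h z ≤ D.b₁ c s h z := by
  rw [Transcript.b₁, Transcript.b₁, c.bonus_eq, c.bonus_eq]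
  exact mul_le_mul_of_nonneg_right (Real.sqrt_le_sqrt
    (c.ellSq_anti (S.toLinSetting.one_le_Bh (S.horizon ▸ hh)) (fun j => D.z j h)
      (D.sigmaBar c h) z hs)) (Real.sqrt_nonneg _)

theorem optimistic_of_le (S : RunSetting M c Pr D) (ω : Ω) (t : ℕ) {h : ℕ} (hh : c.H ≤ h) :
    Optimistic M c (D ω) t h := fun x => by
  rw [val_zero, maxVal_of_le hh, Vopt_of_le (S.horizon ▸ hh)]
  exact ⟨le_rfl, fun s _ => by rw [val_one, maxVal_of_le hh]⟩

/-- Shows why `f₂` contains `2 b₁`: the optimistic function of episode `t` exceeds its Bellman image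
by at most `2 b₁ + 2 ε`. The weighted bonus of the earlier episode `s` is at least that of episode
`t`, because the weights of past data never change, so `f₂` of episode `s` is above it. -/
theorem optimistic_step (S : RunSetting M c Pr D) (P : Tuned c ε' Lb La cb K) {ω : Ω}
    (G : GoodEvent M c (D ω) 𝒱 ε' Lb La K) {t h : ℕ} (ht : t < c.T) (hh : h < c.H)
    (hO : Optimistic M c (D ω) t (h + 1))
    (hvar : ∀ s < t, varOpt M h ((D ω).z s h) ≤ (D ω).sigma c s h ^ 2) :
    Optimistic M c (D ω) t h := fun x => by
  obtain ⟨h0, h1, hab⟩ := hO.spec S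
  rw [val_zero]
  constructor
  · refine S.Vopt_le_of_Qopt_le hh fun a => le_trans ?_ (le_maxVal hh (f₁_le_one (D ω) t h) (x, a))
    refine le_trans (le_min ?_ (S.toLinSetting.Qopt_le_one (S.horizon ▸ hh) (x, a)))
      (S.f₁_bounds hO (S.optimistic_error P G ht hh hO hvar (x, a))).1
    exact bellman_mono (M := M) h (x, a) (S.toLinSetting.Vopt_nonneg (h + 1))
      (S.measurable_val ω 0 ht (h + 1)) hab fun y => (hO y).1
  · intro s hs
    have hsT := hs.trans_lt ht
    rw [val_one]
    refine maxVal_le hh fun a => le_trans ?_ (le_maxVal hh (f₂_le_two (D ω) s h) (x, a))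
    refine le_trans (le_min ?_ ((f₁_le_one (D ω) t h (x, a)).trans (by norm_num)))
      (S.f₂_bounds P G hsT hh (x, a)).1
    have e1 := (S.f₁_bounds hO (S.optimistic_error P G ht hh hO hvar (x, a))).2
    have h20 : ∀ x, 0 ≤ val c (D ω) 1 s (h + 1) x := fun x =>
      (S.toLinSetting.Vopt_nonneg (h + 1) x).trans (S.overoptimism P G hsT (h + 1) x)
    have e3 := bellman_mono (M := M) h (x, a) h0 (S.measurable_val ω 1 hsT (h + 1))
      (fun x => abs_le.2 ⟨by linarith [h20 x], V₂_le_two (c := c) (D ω) s (h + 1) x⟩)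
      fun x => (hO x).2 s hs
    have e4 := S.b₁_anti (D ω) hs hh (x, a)
    change (D ω).f₁ c t h (x, a) ≤ _
    change bellman M h (val c (D ω) 0 t (h + 1)) (x, a) ≤
      bellman M h (val c (D ω) 1 s (h + 1)) (x, a) at e3
    linarith

/-- The error allowed for in the variance estimates. -/
noncomputable def sigmaSlack (c : Config X A d) (D : Transcript X A) (t h : ℕ) : ℝ :=
  c.eluderD h (D.past t h) (fun _ => 1) (D.z t h) *
    (√(c.βbar ^ 2 + 1) + 2 * c.B * √(c.β₂ ^ 2 + 1)) + 2 * (1 + c.B) * c.ε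

/-- The square root of a negative number is `0`, which is the convention for a negative variance
estimate. -/
theorem sigma_sq_eq (D : Transcript X A) {t h : ℕ} (ht : t ≠ 0) :
    D.sigma c t h ^ 2 = max (min 4 (D.ghat t h (D.z t h) - D.fhatNeg t h (D.z t h) ^ 2 +
      sigmaSlack c D t h)) 0 := by
  rw [Transcript.sigma, if_neg ht, Real.sq_sqrt', sigmaSlack, ← add_assoc]
  rfl

theorem sq_error (S : RunSetting M c Pr D) (P : Tuned c ε' Lb La cb K) {ω : Ω}
    (G : GoodEvent M c (D ω) 𝒱 ε' Lb La K) {t h : ℕ} (ht : t < c.T) (hh : h < c.H)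
    (hO : Optimistic M c (D ω) t (h + 1)) (z : X × A) :
    |(D ω).ghat t h z - bellmanSq M h (val c (D ω) 0 t (h + 1)) z| ≤
      c.eluderD h ((D ω).past t h) (fun _ => 1) z * √(c.βbar ^ 2 + 1) + c.ε := by
  have hhM : h < M.H := S.horizon ▸ hh
  have hVm := S.measurable_val ω 0 ht (h + 1)
  obtain ⟨h0, h1, hab⟩ := hO.spec S
  have h2 : ∀ x, val c (D ω) 0 t (h + 1) x ≤ 2 := fun x => (h1 x).trans (by norm_num)
  obtain ⟨f, hf, hfV⟩ := S.toLinSetting.exists_cover_bellmanSq hhM hVm h0 h1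
  have hreg := (S.run.isVOQL ω).regressionSq t ht h hh
  have hconf := S.conf_unweighted P G.toGoodRegression G.net_spec ht hh hVm h0 h2
    (exists_close_of_mem G ht 0 h0 h2) (p := 2) (by simp) hreg hf hfV
  have h4 := abs_le.1 (c.abs_sub_le_eluderD ((D ω).past t h) (fun _ => 1) z hreg.1 hf
    (hconf.trans P.βbar_ge))
  have h5 := abs_le.1 (hfV z)
  rw [abs_le]; constructor <;> linarith

/-- The second moment is estimated with the optimistic values and the squared mean with the
pessimistic ones, so the difference overestimates the variance once the regression errors are added.
For the converse, the bias is at most four times the mean of optimistic minus pessimistic values,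
which `bellman_excess_le` with `s = t` bounds by `f₂ - fNeg`. -/
theorem sigma_sq_bounds (S : RunSetting M c Pr D) (P : Tuned c ε' Lb La cb K) {ω : Ω}
    (G : GoodEvent M c (D ω) 𝒱 ε' Lb La K) {t h : ℕ} (ht : t < c.T) (hh : h < c.H)
    (hO : Optimistic M c (D ω) t (h + 1)) :
    varOpt M h ((D ω).z t h) ≤ (D ω).sigma c t h ^ 2 ∧
    (t ≠ 0 → (D ω).sigma c t h ^ 2 ≤ varOpt M h ((D ω).z t h) +
      4 * ((D ω).f₂ c t h ((D ω).z t h) - (D ω).fNeg c t h ((D ω).z t h)) +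
      2 * sigmaSlack c (D ω) t h) := by
  by_cases ht0 : t = 0
  · refine ⟨?_, fun h => absurd ht0 h⟩
    rw [Transcript.sigma, if_pos ht0]
    exact (S.varOpt_le_four h _).trans (by norm_num)
  have hhM : h < M.H := S.horizon ▸ hh
  set z := (D ω).z t h with hz
  have hp := M.isProbabilityMeasure_P h z
  obtain ⟨h0, h1, hab⟩ := hO.spec S
  have hVm := S.measurable_val ω 0 ht (h + 1)
  have hVo := S.toLinSetting.measurable_Vopt (h + 1)
  have hVo0 := S.toLinSetting.Vopt_nonneg (h + 1)
  have hVo1 := S.toLinSetting.Vopt_le_one (h + 1)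
  have hN0 := S.VNeg_nonneg ω ht (h + 1)
  have hN := S.pessimism P G ht (h + 1)
  have eG := abs_le.1 (S.sq_error P G ht hh hO z)
  have eN := abs_le.1 (S.fNeg_le_bellman P G ht hh z).2.2
  have eB := abs_le.1 (S.toLinSetting.abs_bellman_le hhM (S.measurable_val ω 2 ht (h + 1)) hN0
    (fun x => (hN x).trans ((hVo1 x).trans (by norm_num))) z)
  have eF := abs_le.1 (S.toLinSetting.abs_le_of_mem hhM
    ((S.run.isVOQL ω).regressionNeg t ht h hh).1 z)
  have eQ : bellman M h (val c (D ω) 2 t (h + 1)) z ≤ Qopt M h z :=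
    bellman_mono h z hN0 hVo (S.toLinSetting.abs_Vopt_le (h + 1)) hN
  have eN0 : 0 ≤ bellman M h (val c (D ω) 2 t (h + 1)) z := bellman_nonneg h z hN0
  have eQ1 := S.toLinSetting.Qopt_le_one hhM z
  have eSq : bellmanSq M h (Vopt M (h + 1)) z ≤ bellmanSq M h (val c (D ω) 0 t (h + 1)) z :=
    bellmanSq_mono h z hVo0 hVm hab fun x => (hO x).1
  have eX := S.bellman_excess_le P G le_rfl ht hh hO z
  have hD0 := c.eluderD_nonneg h ((D ω).past t h) (fun _ => 1) z
  -- The function `y ↦ y² - 4 y` decreases on `[0, 2]`, where `r + V` takes its values.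
  have eSq2 : bellmanSq M h (val c (D ω) 0 t (h + 1)) z - bellmanSq M h (Vopt M (h + 1)) z ≤
      4 * (bellman M h (val c (D ω) 0 t (h + 1)) z - Qopt M h z) := by
    have hi : ∀ V : X → ℝ, Measurable V → (∀ x, 0 ≤ V x) → (∀ x, V x ≤ 1) →
        Integrable (fun x => (M.r h z x + V x) ^ 2) (M.P h z) ∧
        Integrable (fun x => M.r h z x + V x) (M.P h z) := fun V hV hV0 hV1 => by
      have hb : ∀ x, |M.r h z x + V x| ≤ 2 := fun x => by
        have := M.r_mem h z x
        rw [abs_le]; constructor <;> linarith [hV0 x, hV1 x, this.1, this.2]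
      exact ⟨integrable_of_bound (b := 2 ^ 2) (((M.measurable_r_apply h z).add hV).pow_const 2)
        fun x => by rw [abs_pow]; exact pow_le_pow_left₀ (abs_nonneg _) (hb x) 2,
        integrable_of_bound ((M.measurable_r_apply h z).add hV) hb⟩
    obtain ⟨i1, i2⟩ := hi _ hVm h0 h1
    obtain ⟨i3, i4⟩ := hi _ hVo hVo0 hVo1
    have hm := integral_mono (i1.sub (i2.const_mul 4)) (i3.sub (i4.const_mul 4)) fun x => by
      have := M.r_mem h z x
      simp only [Pi.sub_apply]
      nlinarith [(hO x).1, h1 x, hVo1 x, this.2]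
    rw [integral_sub' i1 (i2.const_mul 4), integral_sub' i3 (i4.const_mul 4),
      integral_const_mul, integral_const_mul] at hm
    change bellmanSq M h (val c (D ω) 0 t (h + 1)) z - 4 * bellman M h (val c (D ω) 0 t (h + 1)) z ≤
      bellmanSq M h (Vopt M (h + 1)) z - 4 * Qopt M h z at hm
    linarith
  have hB := S.toLinSetting.two_le_B
  have hε := S.ε_pos
  set x := (D ω).fhatNeg t h z
  set y := bellman M h (val c (D ω) 2 t (h + 1)) z
  set q := c.eluderD h ((D ω).past t h) (fun _ => 1) z
  have hxy : |x ^ 2 - y ^ 2| ≤ 2 * c.B * (q * √(c.β₂ ^ 2 + 1) + c.ε) := by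
    rw [show x ^ 2 - y ^ 2 = (x + y) * (x - y) by ring, abs_mul]
    exact mul_le_mul (abs_le.2 ⟨by linarith, by linarith⟩) (abs_le.2 eN) (abs_nonneg _)
      (by linarith)
  have hxy' := abs_le.1 hxy
  have hslack : sigmaSlack c (D ω) t h = q * √(c.βbar ^ 2 + 1) +
    2 * c.B * (q * √(c.β₂ ^ 2 + 1)) + 2 * (1 + c.B) * c.ε := by
    rw [sigmaSlack]; ring
  have hs0 : 0 ≤ q * √(c.βbar ^ 2 + 1) := by positivity
  have hs1 : 0 ≤ 2 * c.B * (q * √(c.β₂ ^ 2 + 1)) := by positivity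
  have hvdef : varOpt M h z = bellmanSq M h (Vopt M (h + 1)) z - Qopt M h z ^ 2 := rfl
  have hv0 := S.varOpt_nonneg h z
  rw [sigma_sq_eq _ ht0]
  constructor
  · refine le_max_of_le_left (le_min (S.varOpt_le_four h z) ?_)
    have : y ^ 2 ≤ Qopt M h z ^ 2 := pow_le_pow_left₀ eN0 eQ 2
    rw [hslack]
    nlinarith
  · intro _
    have hΓ : 0 ≤ (D ω).f₂ c t h z - (D ω).fNeg c t h z := by
      have : y ≤ bellman M h (val c (D ω) 0 t (h + 1)) z :=
        bellman_mono h z hN0 hVm hab fun x => (hN x).trans (hO x).1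
      linarith
    have hy2 : Qopt M h z ^ 2 - y ^ 2 ≤ 2 * (Qopt M h z - y) := by nlinarith
    refine max_le ((min_le_right _ _).trans ?_) ?_
    · rw [hslack]
      nlinarith
    · rw [hslack]
      nlinarith

/-- Strong induction on episodes, and inside it backward induction on levels. The step at episode
`t` uses the variance estimates of earlier episodes only; its own estimates follow afterwards from
its optimism. -/
theorem optimism (S : RunSetting M c Pr D) (P : Tuned c ε' Lb La cb K) {ω : Ω}
    (G : GoodEvent M c (D ω) 𝒱 ε' Lb La K) (t : ℕ) : t < c.T →
    (∀ h, Optimistic M c (D ω) t h) ∧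
      ∀ h < c.H, varOpt M h ((D ω).z t h) ≤ (D ω).sigma c t h ^ 2 := by
  induction t using Nat.strong_induction_on with
  | _ t ih =>
    intro ht
    have hO : ∀ n h, h + n = c.H → Optimistic M c (D ω) t h := fun n => by
      induction n with
      | zero => exact fun h hn => S.optimistic_of_le ω t (by omega)
      | succ n ihn =>
        exact fun h hn => S.optimistic_step P G ht (by omega) (ihn (h + 1) (by omega))
          fun s hs => (ih s hs (hs.trans ht)).2 h (by omega)
    have hO' : ∀ h, Optimistic M c (D ω) t h := fun h => by
      by_cases hh : c.H ≤ h
      · exact S.optimistic_of_le ω t hh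
      · exact hO (c.H - h) h (by omega)
    exact ⟨hO', fun h hh => (S.sigma_sq_bounds P G ht hh (hO' (h + 1))).1⟩

end RunSetting

/-- The value estimates of a run are accurate. -/
structure Accurate {X A : Type*} [MeasurableSpace X] [MeasurableSpace A] {d : ℕ} (M : MDP X A)
    (c : Config X A d) (D : Transcript X A) : Prop where
  VNeg_nonneg : ∀ t < c.T, ∀ h x, 0 ≤ RunSetting.val c D 2 t h x
  VNeg_le : ∀ t < c.T, ∀ h x, RunSetting.val c D 2 t h x ≤ Vopt M h x
  le_V₁ : ∀ t < c.T, ∀ h x, Vopt M h x ≤ RunSetting.val c D 0 t h x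
  V₁_le_V₂ : ∀ t < c.T, ∀ h x, RunSetting.val c D 0 t h x ≤ RunSetting.val c D 1 t h x
  f₁_le : ∀ t < c.T, ∀ h < c.H, ∀ z, D.f₁ c t h z ≤
    bellman M h (RunSetting.val c D 0 t (h + 1)) z + 2 * D.b₁ c t h z + 2 * c.ε
  f₂_le : ∀ t < c.T, ∀ h < c.H, ∀ z, D.f₂ c t h z ≤
    bellman M h (RunSetting.val c D 1 t (h + 1)) z + 2 * D.b₁ c t h z + 2 * D.b₂ c t h z + 4 * c.ε
  le_fNeg : ∀ t < c.T, ∀ h < c.H, ∀ z, bellman M h (RunSetting.val c D 2 t (h + 1)) z ≤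
    D.fNeg c t h z + 2 * D.b₂ c t h z + 2 * c.ε
  fNeg_le : ∀ t < c.T, ∀ h < c.H, ∀ z, D.fNeg c t h z ≤ Qopt M h z
  le_f₁ : ∀ t < c.T, ∀ h < c.H, ∀ z, Qopt M h z ≤ D.f₁ c t h z
  f₁_le_f₂ : ∀ t < c.T, ∀ h < c.H, ∀ z, D.f₁ c t h z ≤ D.f₂ c t h z
  sigma_le : ∀ t < c.T, t ≠ 0 → ∀ h < c.H, D.sigma c t h ^ 2 ≤ RunSetting.varOpt M h (D.z t h) +
    4 * (D.f₂ c t h (D.z t h) - D.fNeg c t h (D.z t h)) + 2 * RunSetting.sigmaSlack c D t h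

namespace RunSetting

variable {X A Ω : Type*} [MeasurableSpace X] [TopologicalSpace A] [PolishSpace A]
  [MeasurableSpace A] [mΩ : MeasurableSpace Ω] {d : ℕ} {M : MDP X A} {c : Config X A d}
  {Pr : Measure Ω} {D : Ω → Transcript X A} [Nonempty X] [Nonempty A]
  {𝒱 : ℕ → Finset (X → ℝ)} {ε' Lb La cb : ℝ} {K : ℕ}

theorem accurate (S : RunSetting M c Pr D) (P : Tuned c ε' Lb La cb K) {ω : Ω}
    (G : GoodEvent M c (D ω) 𝒱 ε' Lb La K) : Accurate M c (D ω) := by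
  have hO : ∀ t < c.T, ∀ h, Optimistic M c (D ω) t h := fun t ht => (S.optimism P G t ht).1
  have herr : ∀ t (ht : t < c.T) h (hh : h < c.H) z, _ := fun t ht h hh z =>
    S.optimistic_error P G ht hh (hO t ht (h + 1))
      (fun s hs => (S.optimism P G s (hs.trans ht)).2 h hh) z
  refine ⟨fun t ht h => S.VNeg_nonneg ω ht h, fun t ht h => S.pessimism P G ht h,
    fun t ht h x => (hO t ht h x).1, fun t ht h x => (hO t ht h x).2 t le_rfl,
    fun t ht h hh z => (S.f₁_bounds (hO t ht (h + 1)) (herr t ht h hh z)).2,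
    fun t ht h hh z => (S.f₂_bounds P G ht hh z).2,
    fun t ht h hh z => (S.fNeg_le_bellman P G ht hh z).2.1, fun t ht h hh z => ?_,
    fun t ht h hh z => ?_, fun t ht h hh z => ?_,
    fun t ht ht0 h hh => (S.sigma_sq_bounds P G ht hh (hO t ht (h + 1))).2 ht0⟩
  · exact (S.fNeg_le_bellman P G ht hh z).1.trans (bellman_mono h z (S.VNeg_nonneg ω ht (h + 1))
      (S.toLinSetting.measurable_Vopt (h + 1)) (S.toLinSetting.abs_Vopt_le (h + 1))
      (S.pessimism P G ht (h + 1)))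
  · refine le_trans (le_min ?_ (S.toLinSetting.Qopt_le_one (S.horizon ▸ hh) z))
      (S.f₁_bounds (hO t ht (h + 1)) (herr t ht h hh z)).1
    exact bellman_mono (M := M) h z (S.toLinSetting.Vopt_nonneg (h + 1))
      (S.measurable_val ω 0 ht (h + 1)) ((hO t ht (h + 1)).spec S).2.2
      fun y => (hO t ht (h + 1) y).1
  · refine le_trans (le_min ?_ ((f₁_le_one (D ω) t h z).trans (by norm_num)))
      (S.f₂_bounds P G ht hh z).1
    have h20 : ∀ x, 0 ≤ val c (D ω) 1 t (h + 1) x := fun x =>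
      (S.toLinSetting.Vopt_nonneg (h + 1) x).trans (S.overoptimism P G ht (h + 1) x)
    have e3 := bellman_mono (M := M) h z ((hO t ht (h + 1)).spec S).1
      (S.measurable_val ω 1 ht (h + 1))
      (fun x => abs_le.2 ⟨by linarith [h20 x], V₂_le_two (c := c) (D ω) t (h + 1) x⟩)
      fun x => (hO t ht (h + 1) x).2 t le_rfl
    have e1 := (S.f₁_bounds (hO t ht (h + 1)) (herr t ht h hh z)).2
    change (D ω).f₁ c t h z ≤ _
    linarith

end RunSetting


/-! ## Arithmetic of the regret bound -/

section Arithmetic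

variable {T H d K : ℝ}

-- Here `n` counts the episodes that switch to the overly optimistic functions, each paying at least
-- `u`. The hypotheses valid for all `η` are Cauchy–Schwarz bounds before optimizing. The three
-- scales are chosen so that each linear term equals or is below `n u / 8`; five eighths of `n u`
-- remain. The lower bounds `hu1` and `hu2` on the threshold turn the result into `n d² H ≤ T` up to
-- powers of `K`.
set_option maxHeartbeats 400000 in
theorem bad_episodes_le (hT : 1 ≤ T) (hH : 1 ≤ H) (hd : 1 ≤ d) (hK : 1 ≤ K) {n u X S₁ S₂ θ : ℝ}
    (hn : 0 ≤ n) (hu : 0 < u) (hu1 : d ^ 3 * H ^ 2 ≤ u * T) (hu2 : d ^ 6 * H ^ 5 ≤ u ^ 2 * T)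
    (hθ : θ = min (u / (32 * H)) (1 / 8)) (hnu : n * u ≤ X + S₁ + S₂ + 1)
    (hX : X ≤ 4 * θ * (n * H) + K / θ)
    (hS₁ : ∀ η > 0, S₁ ≤ η * (K * d ^ 2 * (n * H)) + K ^ 2 * d ^ 2 * H / η + 2 * (H * K * d))
    (hS₂ : ∀ η > 0, S₂ ≤ η * (n * H) + K ^ 2 * d ^ 3 * H / η + 2 * (H * K * d)) :
    n * (d ^ 2 * H) ≤ 150 * K ^ 3 * T := by
  have h1 := hS₁ (u / (8 * K * d ^ 2 * H)) (by positivity)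
  have h2 := hS₂ (u / (8 * H)) (by positivity)
  have e1 : u / (8 * K * d ^ 2 * H) * (K * d ^ 2 * (n * H)) = n * u / 8 := by field_simp
  have e2 : K ^ 2 * d ^ 2 * H / (u / (8 * K * d ^ 2 * H)) = 8 * K ^ 3 * d ^ 4 * H ^ 2 / u := by
    field_simp
  have e3 : u / (8 * H) * (n * H) = n * u / 8 := by field_simp
  have e4 : K ^ 2 * d ^ 3 * H / (u / (8 * H)) = 8 * K ^ 2 * d ^ 3 * H ^ 2 / u := by field_simp
  rw [e1, e2] at h1
  rw [e3, e4] at h2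
  have hθ0 : 0 < θ := by rw [hθ]; exact lt_min (by positivity) (by norm_num)
  have h3 : 4 * θ * (n * H) ≤ n * u / 8 := by
    have : θ ≤ u / (32 * H) := hθ ▸ min_le_left _ _
    calc 4 * θ * (n * H) ≤ 4 * (u / (32 * H)) * (n * H) := by gcongr
      _ = n * u / 8 := by field_simp; ring
  have h4 : K / θ ≤ 32 * H * K / u + 8 * K := by
    rcases min_choice (u / (32 * H)) (1 / 8) with h | h <;> rw [hθ, h]
    · have : K / (u / (32 * H)) = 32 * H * K / u := by field_simp
      rw [this]; linarith
    · have : 0 ≤ 32 * H * K / u := by positivity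
      linarith
  have h5 : n * u * (5 / 8) ≤ (8 * K ^ 3 * d ^ 4 * H ^ 2 + 8 * K ^ 2 * d ^ 3 * H ^ 2 + 32 * H * K) / u +
      (4 * (H * K * d) + 8 * K + 1) := by
    rw [add_div, add_div]; linarith
  have hK2 : K ≤ K ^ 2 := by nlinarith
  have hK3 : K ^ 2 ≤ K ^ 3 := pow_le_pow_right₀ hK (by norm_num)
  have h6 : 8 * K ^ 3 * d ^ 4 * H ^ 2 + 8 * K ^ 2 * d ^ 3 * H ^ 2 + 32 * H * K ≤
      48 * K ^ 3 * (d ^ 4 * H ^ 2) := by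
    have a1 : K ^ 2 * (d ^ 3 * H ^ 2) ≤ K ^ 3 * (d ^ 4 * H ^ 2) := by gcongr <;> norm_num
    have a2 : H * K ≤ K ^ 3 * (d ^ 4 * H ^ 2) := by
      have b1 : H ≤ d ^ 4 * H ^ 2 := by
        have : 1 ≤ d ^ 4 := one_le_pow₀ hd
        nlinarith
      calc H * K = K * H := mul_comm _ _
        _ ≤ K ^ 3 * (d ^ 4 * H ^ 2) := mul_le_mul (by linarith) b1 (by linarith) (by positivity)
    linarith
  have h7 : 4 * (H * K * d) + 8 * K + 1 ≤ 13 * K ^ 3 * (d * H) := by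
    have a0 : 1 ≤ d * H := by nlinarith
    have a1 : K * (d * H) ≤ K ^ 3 * (d * H) := by gcongr; linarith
    have a2 : K ≤ K * (d * H) := by nlinarith
    nlinarith
  have h8 : n * u * (5 / 8) ≤ 48 * K ^ 3 * (d ^ 4 * H ^ 2) / u + 13 * K ^ 3 * (d * H) := by
    refine h5.trans (add_le_add ?_ h7)
    gcongr
  have h9 : n * (d ^ 2 * H) * (5 / 8) ≤
      48 * K ^ 3 * (d ^ 6 * H ^ 3 / u ^ 2) + 13 * K ^ 3 * (d ^ 3 * H ^ 2 / u) := by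
    have := mul_le_mul_of_nonneg_right h8 (show 0 ≤ d ^ 2 * H / u by positivity)
    calc n * (d ^ 2 * H) * (5 / 8) = n * (u / u) * (5 / 8) * (d ^ 2 * H) := by
          rw [div_self hu.ne', mul_one]; ring
      _ = n * u * (5 / 8) * (d ^ 2 * H / u) := by ring
      _ ≤ _ := this
      _ = _ := by ring
  have h10 : d ^ 6 * H ^ 3 / u ^ 2 ≤ T := by
    rw [div_le_iff₀ (by positivity)]
    have : d ^ 6 * H ^ 3 ≤ d ^ 6 * H ^ 5 := by gcongr <;> norm_num
    linarith
  have h11 : d ^ 3 * H ^ 2 / u ≤ T := by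
    rw [div_le_iff₀ hu]; linarith
  have hK0 : 0 ≤ K ^ 3 := by positivity
  linarith [mul_le_mul_of_nonneg_left h10 hK0, mul_le_mul_of_nonneg_left h11 hK0,
    mul_nonneg hK0 (show 0 ≤ T by linarith)]

/-- `SS`, the sum of the squared weights, occurs on both sides: the bonuses and the eluder
quantities are bounded in terms of it. The scales `η` are chosen so that these two occurrences cost
`SS / 8` each. The term `d¹⁰ H⁷` comes from the thresholds: `d⁵ H^(7/2) √T` is split by the
inequality between the means. -/
theorem sum_weights_le (hT : 1 ≤ T) (hH : 1 ≤ H) (hd : 1 ≤ d) (hK : 1 ≤ K)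
    {n SS SV SΓ Su X S₁ S₂ SD SDb : ℝ} (hn : n * (d ^ 2 * H) ≤ 150 * K ^ 3 * T)
    (hSS : SS ≤ 4 * H + SV + 1 + K * d ^ 2 * SΓ + (2 * K * d * SD + 2 * K) + K * d ^ 2 * SDb)
    (hSV : SV ≤ 6 * T + 200 * K)
    (hSΓ : SΓ ≤ 3 * (n * H) + Su + X + H * (S₁ + S₂ + 1))
    (hSu : Su ≤ 2 * K ^ 2 * d ^ 3 * (H ^ 3 * √H) * √T)
    (hX : X ≤ T / (4 * d ^ 2) + 16 * K * d ^ 2 * H ^ 3)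
    (hS₁ : ∀ η > 0, S₁ ≤ η * SS + K ^ 2 * d ^ 2 * H / η + 2 * (H * K * d))
    (hS₂ : ∀ η > 0, S₂ ≤ η * (T * H) + K ^ 2 * d ^ 3 * H / η + 2 * (H * K * d))
    (hD : ∀ η > 0, SD ≤ η * (T * H) + H * K * d / η + 2 * K * (H * K * d))
    (hDb : ∀ η > 0, SDb ≤ η * SS + H * K * d / η + 2 * K * (H * K * d)) :
    SS ≤ 2000 * K ^ 6 * (T + d ^ 10 * H ^ 7) := by
  have hKd : 0 < K * d ^ 2 := by positivity
  have m : ∀ a b : ℕ, a ≤ 10 → b ≤ 7 → d ^ a * H ^ b ≤ d ^ 10 * H ^ 7 := fun a b ha hb =>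
    mul_le_mul (pow_le_pow_right₀ hd ha) (pow_le_pow_right₀ hH hb) (by positivity) (by positivity)
  have mk : ∀ a b e : ℕ, a ≤ 10 → b ≤ 7 → e ≤ 6 →
      K ^ e * (d ^ a * H ^ b) ≤ K ^ 6 * (d ^ 10 * H ^ 7) := fun a b e ha hb he =>
    mul_le_mul (pow_le_pow_right₀ hK he) (m a b ha hb) (by positivity) (by positivity)
  have mT : ∀ e : ℕ, e ≤ 6 → K ^ e * T ≤ K ^ 6 * T := fun e he =>
    mul_le_mul_of_nonneg_right (pow_le_pow_right₀ hK he) (by linarith)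
  have g1 : K * d ^ 2 * S₁ * H ≤ SS / 8 + 8 * (K ^ 4 * (d ^ 6 * H ^ 3)) +
      2 * (K ^ 2 * (d ^ 3 * H ^ 2)) := by
    have := mul_le_mul_of_nonneg_left (hS₁ (1 / (8 * K * H * d ^ 2)) (by positivity))
      (show 0 ≤ K * d ^ 2 * H by positivity)
    calc K * d ^ 2 * S₁ * H = K * d ^ 2 * H * S₁ := by ring
      _ ≤ _ := this
      _ = _ := by field_simp
  have g2 : K * d ^ 2 * S₂ * H ≤ T + K ^ 4 * (d ^ 7 * H ^ 4) + 2 * (K ^ 2 * (d ^ 3 * H ^ 2)) := by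
    have := mul_le_mul_of_nonneg_left (hS₂ (1 / (K * d ^ 2 * H ^ 2)) (by positivity))
      (show 0 ≤ K * d ^ 2 * H by positivity)
    calc K * d ^ 2 * S₂ * H = K * d ^ 2 * H * S₂ := by ring
      _ ≤ _ := this
      _ = _ := by field_simp
  have g3 : 2 * K * d * SD ≤ 2 * T + 2 * (K ^ 3 * (d ^ 3 * H ^ 2)) + 4 * (K ^ 3 * (d ^ 2 * H ^ 1)) := by
    have := mul_le_mul_of_nonneg_left (hD (1 / (K * d * H)) (by positivity))
      (show 0 ≤ 2 * K * d by positivity)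
    refine this.trans (le_of_eq ?_)
    field_simp
    ring
  have g4 : K * d ^ 2 * SDb ≤ SS / 8 + 8 * (K ^ 3 * (d ^ 5 * H ^ 1)) + 2 * (K ^ 3 * (d ^ 3 * H ^ 1)) := by
    have := mul_le_mul_of_nonneg_left (hDb (1 / (8 * K * d ^ 2)) (by positivity)) hKd.le
    refine this.trans (le_of_eq ?_)
    field_simp
  have g5 : K * d ^ 2 * Su ≤ K ^ 3 * (d ^ 10 * H ^ 7) + K ^ 3 * T := by
    have h1 := mul_le_mul_of_nonneg_left hSu hKd.le
    have h2 : (d ^ 5 * (H ^ 3 * √H)) ^ 2 = d ^ 10 * H ^ 7 := by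
      rw [mul_pow, mul_pow, Real.sq_sqrt (by linarith)]; ring
    have h3 := Real.sq_sqrt (show 0 ≤ T by linarith)
    have h4 : 2 * (d ^ 5 * (H ^ 3 * √H)) * √T ≤ d ^ 10 * H ^ 7 + T := by
      have := two_mul_le_add_sq (d ^ 5 * (H ^ 3 * √H)) (√T)
      linarith
    have h5 := mul_le_mul_of_nonneg_left h4 (show 0 ≤ K ^ 3 by positivity)
    calc K * d ^ 2 * Su ≤ _ := h1
      _ = K ^ 3 * (2 * (d ^ 5 * (H ^ 3 * √H)) * √T) := by ring
      _ ≤ _ := h5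
      _ = _ := by ring
  have g6 : K * d ^ 2 * X ≤ K ^ 1 * T / 4 + 16 * (K ^ 2 * (d ^ 4 * H ^ 3)) := by
    have := mul_le_mul_of_nonneg_left hX hKd.le
    refine this.trans (le_of_eq ?_)
    field_simp
    try ring
  have g7 : K * d ^ 2 * (3 * (n * H)) ≤ 450 * (K ^ 4 * T) := by
    have := mul_le_mul_of_nonneg_left hn (show 0 ≤ 3 * K by positivity)
    linarith
  have g8 : K * d ^ 2 * SΓ ≤ K * d ^ 2 * (3 * (n * H)) + K * d ^ 2 * Su + K * d ^ 2 * X +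
      (K * d ^ 2 * S₁ * H + K * d ^ 2 * S₂ * H + K ^ 1 * (d ^ 2 * H ^ 1)) := by
    have := mul_le_mul_of_nonneg_left hSΓ hKd.le
    refine this.trans (le_of_eq ?_)
    ring
  have k0 : 0 ≤ K ^ 6 * T := by positivity
  have k1 := mT 0 (by norm_num)
  have k2 := mT 1 (by norm_num)
  have k3 := mT 3 (by norm_num)
  have k4 := mT 4 (by norm_num)
  have j0 := mk 0 0 0 (by norm_num) (by norm_num) (by norm_num)
  have j1 := mk 0 0 1 (by norm_num) (by norm_num) (by norm_num)
  have j2 := mk 0 1 0 (by norm_num) (by norm_num) (by norm_num)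
  have j3 := mk 6 3 4 (by norm_num) (by norm_num) (by norm_num)
  have j4 := mk 3 2 2 (by norm_num) (by norm_num) (by norm_num)
  have j5 := mk 7 4 4 (by norm_num) (by norm_num) (by norm_num)
  have j6 := mk 3 2 3 (by norm_num) (by norm_num) (by norm_num)
  have j7 := mk 2 1 3 (by norm_num) (by norm_num) (by norm_num)
  have j8 := mk 5 1 3 (by norm_num) (by norm_num) (by norm_num)
  have j9 := mk 3 1 3 (by norm_num) (by norm_num) (by norm_num)
  have j10 := mk 10 7 3 (by norm_num) (by norm_num) (by norm_num)
  have j11 := mk 4 3 2 (by norm_num) (by norm_num) (by norm_num)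
  have j12 := mk 2 1 1 (by norm_num) (by norm_num) (by norm_num)
  rw [pow_zero, one_mul] at k1
  simp only [pow_zero, pow_one, one_mul, mul_one] at j0 j1 j2 j7 j8 j9 j12 g3 g4 g8 g6 k2
  have : SS * (3 / 4) ≤ 1500 * (K ^ 6 * T) + 1500 * (K ^ 6 * (d ^ 10 * H ^ 7)) := by
    linarith
  linarith

/-- The scale `d √H / √W` balances the bonuses `b₁` against `SS`. For `b₂`, whose squared radius is
larger by a factor `d`, only the switching episodes count, and by `hn` they are few enough for `d
√(HT)`. -/
theorem sum_gaps_le (hT : 1 ≤ T) (hH : 1 ≤ H) (hd : 1 ≤ d) (hK : 1 ≤ K) {n SS G X S₁ S₂ : ℝ}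
    (hn : n * (d ^ 2 * H) ≤ 150 * K ^ 3 * T) (hSS : SS ≤ 2000 * K ^ 6 * (T + d ^ 10 * H ^ 7))
    (hG : G ≤ X + S₁ + S₂ + 1) (hX : X ≤ √(T * H) * (1 + 4 * K))
    (hS₁ : ∀ η > 0, S₁ ≤ η * SS + K ^ 2 * d ^ 2 * H / η + 2 * (H * K * d))
    (hS₂ : ∀ η > 0, S₂ ≤ η * (n * H) + K ^ 2 * d ^ 3 * H / η + 2 * (H * K * d)) :
    G ≤ 3000 * K ^ 6 * (d * √(H * T) + d ^ 6 * H ^ 5) := by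
  set W := T + d ^ 10 * H ^ 7 with hW
  have hW0 : 0 < W := by positivity
  have hsW : 0 < √W := Real.sqrt_pos.2 hW0
  have hsW2 := Real.sq_sqrt hW0.le
  have hsH : 0 < √H := Real.sqrt_pos.2 (by linarith)
  have hsH2 := Real.sq_sqrt (show 0 ≤ H by linarith)
  have hsT : 0 < √T := Real.sqrt_pos.2 (by linarith)
  have hsT2 := Real.sq_sqrt (show 0 ≤ T by linarith)
  have hHT : √(H * T) = √H * √T := Real.sqrt_mul (by linarith) _
  have hTH : √(T * H) = √H * √T := by rw [mul_comm, hHT]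
  have hWle : √W ≤ √T + d ^ 5 * (H ^ 3 * √H) := by
    rw [Real.sqrt_le_left (by positivity)]
    have : (d ^ 5 * (H ^ 3 * √H)) ^ 2 = d ^ 10 * H ^ 7 := by
      rw [mul_pow, mul_pow, hsH2]; ring
    nlinarith [show 0 ≤ √T * (d ^ 5 * (H ^ 3 * √H)) by positivity]
  have hK1 : K ^ 1 ≤ K ^ 6 := pow_le_pow_right₀ hK (by norm_num)
  have hK2 : K ^ 2 ≤ K ^ 6 := pow_le_pow_right₀ hK (by norm_num)
  have hK3 : K ^ 3 ≤ K ^ 6 := pow_le_pow_right₀ hK (by norm_num)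
  rw [pow_one] at hK1
  have hK6 : 1 ≤ K ^ 6 := one_le_pow₀ hK
  have h1 : S₁ ≤ 2001 * K ^ 6 * (d * √H * √W) + 2 * (H * K * d) := by
    refine (hS₁ (d * √H / √W) (by positivity)).trans ?_
    have e1 : d * √H / √W * SS ≤ 2000 * K ^ 6 * (d * √H * √W) := by
      calc d * √H / √W * SS ≤ d * √H / √W * (2000 * K ^ 6 * W) := by gcongr
        _ = d * √H / √W * (2000 * K ^ 6 * √W ^ 2) := by rw [hsW2]
        _ = _ := by field_simp
    have e2 : K ^ 2 * d ^ 2 * H / (d * √H / √W) ≤ K ^ 6 * (d * √H * √W) := by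
      calc K ^ 2 * d ^ 2 * H / (d * √H / √W) = K ^ 2 * d ^ 2 * √H ^ 2 / (d * √H / √W) := by rw [hsH2]
        _ = K ^ 2 * (d * √H * √W) := by field_simp
        _ ≤ _ := by gcongr
    linarith
  have h2 : S₂ ≤ 151 * K ^ 6 * (d * (√H * √T)) + 2 * (H * K * d) := by
    refine (hS₂ (d ^ 3 * √H / √T) (by positivity)).trans ?_
    have e1 : d ^ 3 * √H / √T * (n * H) ≤ 150 * K ^ 6 * (d * (√H * √T)) := by
      calc d ^ 3 * √H / √T * (n * H) = d * √H / √T * (n * (d ^ 2 * H)) := by ring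
        _ ≤ d * √H / √T * (150 * K ^ 3 * T) := by gcongr
        _ = d * √H / √T * (150 * K ^ 3 * √T ^ 2) := by rw [hsT2]
        _ = 150 * K ^ 3 * (d * (√H * √T)) := by field_simp
        _ ≤ _ := by gcongr
    have e2 : K ^ 2 * d ^ 3 * H / (d ^ 3 * √H / √T) ≤ K ^ 6 * (d * (√H * √T)) := by
      calc K ^ 2 * d ^ 3 * H / (d ^ 3 * √H / √T) = K ^ 2 * d ^ 3 * √H ^ 2 / (d ^ 3 * √H / √T) := by
            rw [hsH2]
        _ = K ^ 2 * (1 * (√H * √T)) := by field_simp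
        _ ≤ _ := by gcongr
    linarith
  have h3 : d * √H * √W ≤ d * (√H * √T) + d ^ 6 * H ^ 5 := by
    have a1 : d * √H * (d ^ 5 * (H ^ 3 * √H)) = d ^ 6 * H ^ 3 * √H ^ 2 := by ring
    have a2 : d ^ 6 * H ^ 4 ≤ d ^ 6 * H ^ 5 := by gcongr <;> norm_num
    rw [hsH2] at a1
    calc d * √H * √W ≤ d * √H * (√T + d ^ 5 * (H ^ 3 * √H)) := by gcongr
      _ = d * (√H * √T) + d * √H * (d ^ 5 * (H ^ 3 * √H)) := by ring
      _ ≤ _ := by rw [a1]; linarith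
  have h4 : H * K * d ≤ K ^ 6 * (d ^ 6 * H ^ 5) := by
    have a1 : d ≤ d ^ 6 := le_self_pow₀ hd (by norm_num)
    have a2 : H ≤ H ^ 5 := le_self_pow₀ hH (by norm_num)
    calc H * K * d = K * (d * H) := by ring
      _ ≤ _ := by gcongr
  have h5 : √(T * H) * (1 + 4 * K) ≤ 5 * K ^ 6 * (d * (√H * √T)) := by
    rw [hTH]
    have a1 : √H * √T ≤ d * (√H * √T) := le_mul_of_one_le_left (by positivity) hd
    calc √H * √T * (1 + 4 * K) ≤ d * (√H * √T) * (5 * K ^ 6) := by gcongr; linarith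
      _ = _ := by ring
  have h6 : 1 ≤ K ^ 6 * (d ^ 6 * H ^ 5) := by
    have := one_le_mul_of_one_le_of_one_le (one_le_pow₀ hd (n := 6)) (one_le_pow₀ hH (n := 5))
    exact one_le_mul_of_one_le_of_one_le hK6 this
  rw [hHT]
  have h7 := mul_le_mul_of_nonneg_left h3 (show 0 ≤ 2001 * K ^ 6 by positivity)
  have h8 : 0 ≤ K ^ 6 * (d * (√H * √T)) := by positivity
  linarith

end Arithmetic


/-! ## Sums along a run -/

section DoubleSum

variable {X A : Type*} {d : ℕ} (c : Config X A d)

/-- Sum over all episodes and levels. -/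
noncomputable def dsum (f : ℕ → ℕ → ℝ) : ℝ :=
  ∑ t ∈ Finset.range c.T, ∑ h ∈ Finset.range c.H, f t h

variable {c}

theorem dsum_le {f g : ℕ → ℕ → ℝ} (h : ∀ t < c.T, ∀ k < c.H, f t k ≤ g t k) :
    dsum c f ≤ dsum c g :=
  Finset.sum_le_sum fun t ht => Finset.sum_le_sum fun k hk =>
    h t (Finset.mem_range.1 ht) k (Finset.mem_range.1 hk)

theorem dsum_congr {f g : ℕ → ℕ → ℝ} (h : ∀ t < c.T, ∀ k < c.H, f t k = g t k) :
    dsum c f = dsum c g :=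
  Finset.sum_congr rfl fun t ht => Finset.sum_congr rfl fun k hk =>
    h t (Finset.mem_range.1 ht) k (Finset.mem_range.1 hk)

theorem dsum_add (f g : ℕ → ℕ → ℝ) :
    dsum c (fun t h => f t h + g t h) = dsum c f + dsum c g := by
  simp only [dsum, Finset.sum_add_distrib]

theorem dsum_sub (f g : ℕ → ℕ → ℝ) :
    dsum c (fun t h => f t h - g t h) = dsum c f - dsum c g := by
  simp only [dsum, Finset.sum_sub_distrib]

theorem dsum_mul (a : ℝ) (f : ℕ → ℕ → ℝ) : dsum c (fun t h => a * f t h) = a * dsum c f := by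
  simp only [dsum, Finset.mul_sum]

theorem dsum_const (a : ℝ) : dsum c (fun _ _ => a) = a * (c.T * c.H) := by
  simp only [dsum, Finset.sum_const, Finset.card_range, nsmul_eq_mul]
  ring

end DoubleSum

/-- Each value is unrolled to the last level, so the increment at level `h` is counted once for
every level up to `h`, that is `h + 1` times. -/
theorem sum_le_sum_weighted {a s : ℕ → ℝ} (n : ℕ) (hs : ∀ h < n, a h ≤ a (h + 1) + s h) :
    ∑ h ∈ Finset.range n, a h ≤ n * a n + ∑ h ∈ Finset.range n, (h + 1 : ℝ) * s h := by
  induction n with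
  | zero => simp
  | succ n ih =>
    rw [Finset.sum_range_succ, Finset.sum_range_succ]
    have h1 := ih fun h hh => hs h (by omega)
    have h2 := hs n (by omega)
    have h3 := mul_le_mul_of_nonneg_left h2 (show (0 : ℝ) ≤ n + 1 by positivity)
    push_cast
    linarith

/-- If the potential term `e / σ²` is at most one, this is the inequality between the means;
otherwise the truncation at `2` is charged to the potential term itself. Keeping `η` free lets the
sum of the squared weights be absorbed later. `le_of_le_sqrt_of_le` is the analogue for eluder
quantities, which are bounded by `2 B`. -/
theorem min_two_bonus_le {e σ b η : ℝ} (he : 0 ≤ e) (hσ : 0 < σ) (hη : 0 < η) :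
    min 2 (2 * (√e * b)) ≤ η * σ ^ 2 + b ^ 2 * min 1 (e / σ ^ 2) / η + 2 * min 1 (e / σ ^ 2) := by
  have hs := Real.sq_sqrt he
  rcases le_total (e / σ ^ 2) 1 with h | h
  · rw [min_eq_right h]
    refine (min_le_right _ _).trans ?_
    have h1 : 0 ≤ (η * σ ^ 2 - √e * b) ^ 2 / (η * σ ^ 2) := by positivity
    have h2 : (η * σ ^ 2 - √e * b) ^ 2 / (η * σ ^ 2) =
        η * σ ^ 2 - 2 * (√e * b) + b ^ 2 * (e / σ ^ 2) / η := by
      field_simp; ring_nf; rw [hs]; try ring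
    have h3 : 0 ≤ e / σ ^ 2 := by positivity
    linarith
  · rw [min_eq_left h]
    refine (min_le_left _ _).trans ?_
    have : 0 ≤ η * σ ^ 2 + b ^ 2 * 1 / η := by positivity
    linarith

theorem le_of_le_sqrt_of_le {x e σ b η : ℝ} (he : 0 ≤ e) (hσ : 0 < σ) (hη : 0 < η)
    (hx : x ≤ √e) (hxb : x ≤ 2 * b) (hb : 0 ≤ b) :
    x ≤ η * σ ^ 2 + min 1 (e / σ ^ 2) / η + 2 * b * min 1 (e / σ ^ 2) := by
  rcases le_total (e / σ ^ 2) 1 with h | h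
  · have hs := Real.sq_sqrt he
    rw [min_eq_right h]
    have h1 : 0 ≤ (η * σ ^ 2 - √e) ^ 2 / (η * σ ^ 2) := by positivity
    have h2 : (η * σ ^ 2 - √e) ^ 2 / (η * σ ^ 2) = η * σ ^ 2 - 2 * √e + (e / σ ^ 2) / η := by
      field_simp; ring_nf; rw [hs]; try ring
    have h3 : 0 ≤ e / σ ^ 2 := by positivity
    have h4 : 0 ≤ 2 * b * (e / σ ^ 2) := by positivity
    linarith [Real.sqrt_nonneg e]
  · rw [min_eq_left h]
    have : 0 ≤ η * σ ^ 2 + 1 / η := by positivity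
    linarith

/-- Upper bounds on the tuning parameters, up to a factor `K`. -/
structure Rates {X A : Type*} {d : ℕ} (c : Config X A d) (K L : ℝ) : Prop where
  one_le_K : 1 ≤ K
  L_nonneg : 0 ≤ L
  L_le : L ≤ K
  B_le : 4 * (1 + c.B) ≤ K
  β₁_le : c.β₁ ^ 2 + 1 ≤ K * d
  β₂_le : c.β₂ ^ 2 + 1 ≤ K * d ^ 2
  slack_le : √(c.βbar ^ 2 + 1) + 2 * c.B * √(c.β₂ ^ 2 + 1) ≤ K * d
  ι_nonneg : 0 ≤ c.ι
  ι_le : 2 * c.ι ^ 2 + 4 ≤ K * d ^ 2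
  υι_le : 8 * c.B * (√c.υ + c.ι) ^ 2 ≤ K * d ^ 2
  potential_le : ∀ h < c.H,
    2 * (d * Real.log (d + c.T * (c.T * c.H) / (1 / (4 * c.Bh h ^ 2)))) ≤ K * d
  κu_ge : 1 ≤ c.κu * c.logFactor ^ 2
  κu_le : c.κu * c.logFactor ^ 2 ≤ K ^ 2

namespace RunSetting

variable {X A Ω : Type*} [MeasurableSpace X] [TopologicalSpace A] [PolishSpace A]
  [MeasurableSpace A] [mΩ : MeasurableSpace Ω] {d : ℕ} {M : MDP X A} {c : Config X A d}
  {Pr : Measure Ω} {D : Ω → Transcript X A} [Nonempty X] [Nonempty A] {K L : ℝ}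

/-- `‖φ(z_t)‖²` in the norm of the inverse Gram matrix of the earlier episodes. -/
noncomputable def ell (c : Config X A d) (D : Transcript X A) (σ : ℕ → ℕ → ℝ) (t h : ℕ) : ℝ :=
  c.ellSq h (D.past t h) (fun s => σ h s) (D.z t h)

theorem ell_nonneg (S : RunSetting M c Pr D) (D : Transcript X A) (σ : ℕ → ℕ → ℝ) {h : ℕ}
    (hh : h < c.H) (t : ℕ) : 0 ≤ ell c D σ t h :=
  c.ellSq_nonneg (S.toLinSetting.one_le_Bh (S.horizon ▸ hh)) _ _ _

/-- The elliptical potential lemma for the vectors `φ / σ`, at every level. -/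
theorem dsum_ell_le (S : RunSetting M c Pr D) (R : Rates c K L) (D : Transcript X A)
    {σ : ℕ → ℕ → ℝ} (hσ : ∀ h t, 1 / σ h t ^ 2 ≤ c.T * c.H) :
    dsum c (fun t h => min 1 (ell c D σ t h / σ h t ^ 2)) ≤ c.H * K * d := by
  rw [dsum, Finset.sum_comm]
  have hlev : ∀ h ∈ Finset.range c.H,
      ∑ t ∈ Finset.range c.T, min 1 (ell c D σ t h / σ h t ^ 2) ≤ K * d := fun h hh => by
    have hh' := Finset.mem_range.1 hh
    have hhM : h < M.H := S.horizon ▸ hh'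
    have hφ : ∀ z, WithLp.ofLp (c.φ h z) ⬝ᵥ WithLp.ofLp (c.φ h z) ≤ 1 := fun z => by
      have h1 := S.lin.norm_φ h z
      have h2 : WithLp.ofLp (c.φ h z) ⬝ᵥ WithLp.ofLp (c.φ h z) = ‖c.φ h z‖ ^ 2 := by
        rw [EuclideanSpace.real_norm_sq_eq]
        exact Finset.sum_congr rfl fun i _ => (sq _).symm
      rw [h2]
      exact pow_le_one₀ (norm_nonneg _) h1
    have h1 := sum_min_one_le (reg_pos (S.toLinSetting.one_le_Bh hhM))
      (fun t => (1 / σ h t) • WithLp.ofLp (c.φ h (D.z t h))) (b := c.T * c.H) (fun t => by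
        rw [smul_dotProduct, dotProduct_smul, smul_eq_mul, smul_eq_mul, ← mul_assoc]
        have h0 : 1 / σ h t * (1 / σ h t) = 1 / σ h t ^ 2 := by ring
        rw [h0]
        calc _ ≤ 1 / σ h t ^ 2 * 1 := by gcongr; exact hφ _
          _ ≤ _ := by rw [mul_one]; exact hσ h t) c.T
    refine le_trans (le_of_eq (Finset.sum_congr rfl fun t _ => ?_)) (h1.trans (R.potential_le h hh'))
    rw [ell, Config.ellSq, c.gram_eq, Matrix.mulVec_smul, smul_dotProduct, dotProduct_smul,
      smul_eq_mul, smul_eq_mul]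
    congr 1
    rw [← mul_assoc, div_eq_mul_inv, mul_comm]
    congr 1
    ring
  refine (Finset.sum_le_sum hlev).trans (le_of_eq ?_)
  rw [Finset.sum_const, Finset.card_range, nsmul_eq_mul, mul_assoc]

/-- The factor `w` restricts the sum to a part of the steps, for instance those where the overly
optimistic functions are followed. -/
theorem dsum_bonus_le (S : RunSetting M c Pr D) (R : Rates c K L) (D : Transcript X A)
    {σ : ℕ → ℕ → ℝ} (hσ0 : ∀ h t, 0 < σ h t) (hσ : ∀ h t, 1 / σ h t ^ 2 ≤ c.T * c.H)
    {w : ℕ → ℕ → ℝ} (hw0 : ∀ t h, 0 ≤ w t h) (hw1 : ∀ t h, w t h ≤ 1) (b : ℝ) {η : ℝ}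
    (hη : 0 < η) :
    dsum c (fun t h => w t h * min 2 (2 * (√(ell c D σ t h) * b))) ≤
      η * dsum c (fun t h => w t h * σ h t ^ 2) + b ^ 2 * (c.H * K * d) / η +
        2 * (c.H * K * d) := by
  have h1 : dsum c (fun t h => w t h * min 2 (2 * (√(ell c D σ t h) * b))) ≤
      dsum c (fun t h => η * (w t h * σ h t ^ 2) +
        (b ^ 2 / η + 2) * min 1 (ell c D σ t h / σ h t ^ 2)) :=
    dsum_le fun t _ h hh => by
      have e0 := S.ell_nonneg D σ hh t
      have e1 := mul_le_mul_of_nonneg_left (min_two_bonus_le (b := b) e0 (hσ0 h t) hη) (hw0 t h)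
      have e2 : 0 ≤ min 1 (ell c D σ t h / σ h t ^ 2) :=
        le_min zero_le_one (by have := hσ0 h t; positivity)
      have e3 : 0 ≤ (b ^ 2 / η + 2) * min 1 (ell c D σ t h / σ h t ^ 2) := by positivity
      have e4 := mul_le_mul_of_nonneg_right (hw1 t h) e3
      refine e1.trans (le_of_eq_of_le ?_ (add_le_add_right e4 (η * (w t h * σ h t ^ 2))) |>.trans ?_)
      · ring
      · rw [one_mul]
  rw [dsum_add, dsum_mul, dsum_mul] at h1
  have h2 := mul_le_mul_of_nonneg_left (S.dsum_ell_le R D hσ) (show 0 ≤ b ^ 2 / η + 2 by positivity)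
  refine h1.trans ((add_le_add_right h2 _).trans (le_of_eq ?_))
  ring

theorem dsum_eluderD_le (S : RunSetting M c Pr D) (R : Rates c K L) (D : Transcript X A)
    {σ : ℕ → ℕ → ℝ} (hσ0 : ∀ h t, 0 < σ h t) (hσ : ∀ h t, 1 / σ h t ^ 2 ≤ c.T * c.H) {η : ℝ}
    (hη : 0 < η) :
    dsum c (fun t h => c.eluderD h (D.past t h) (fun s => σ h s) (D.z t h)) ≤
      η * dsum c (fun t h => σ h t ^ 2) + c.H * K * d / η + 2 * K * (c.H * K * d) := by
  have hB := S.toLinSetting.two_le_B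
  have h1 : dsum c (fun t h => c.eluderD h (D.past t h) (fun s => σ h s) (D.z t h)) ≤
      dsum c (fun t h => η * σ h t ^ 2 +
        (1 / η + 2 * c.B) * min 1 (ell c D σ t h / σ h t ^ 2)) :=
    dsum_le fun t _ h hh => by
      have hhM : h < M.H := S.horizon ▸ hh
      have e1 := le_of_le_sqrt_of_le (S.ell_nonneg D σ hh t) (hσ0 h t) hη
        (c.eluderD_le_sqrt_ellSq (S.toLinSetting.one_le_Bh hhM) (S.cover h hhM).1 (D.past t h)
          (fun s => σ h s) (D.z t h))
        (c.eluderD_le (fun f hf z => S.toLinSetting.abs_le_of_mem hhM hf z) (by linarith)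
          (D.past t h) (fun s => σ h s) (D.z t h)) (by linarith)
      refine e1.trans (le_of_eq ?_)
      ring
  rw [dsum_add, dsum_mul, dsum_mul] at h1
  have h2 := mul_le_mul_of_nonneg_left (S.dsum_ell_le R D hσ)
    (show 0 ≤ 1 / η + 2 * c.B by have : 0 < 1 / η := by positivity
                                 linarith)
  have h3 : 0 ≤ c.H * K * d := by have := R.one_le_K; positivity
  have h4 := mul_le_mul_of_nonneg_right (show 2 * c.B ≤ 2 * K by linarith [R.B_le]) h3
  refine h1.trans ((add_le_add_right h2 _).trans ?_)
  have h5 : (1 / η + 2 * c.B) * (c.H * K * d) = c.H * K * d / η + 2 * c.B * (c.H * K * d) := by ring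
  rw [h5]
  linarith

end RunSetting


/-! ## Regret along a run -/

namespace RunSetting

variable {X A Ω : Type*} [MeasurableSpace X] [TopologicalSpace A] [PolishSpace A]
  [MeasurableSpace A] [mΩ : MeasurableSpace Ω] {d : ℕ} {M : MDP X A} {c : Config X A d}
  {Pr : Measure Ω} {D : Ω → Transcript X A} [Nonempty X] [Nonempty A] {K L : ℝ}

open Classical in
/-- Indicator of following the optimistic functions. -/
noncomputable def small (c : Config X A d) (D : Transcript X A) (t h : ℕ) : ℝ :=
  if D.GapSmall c t h then 1 else 0

open Classical in
/-- The value function, at level `k`, that is followed at level `h` of episode `t`. -/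
noncomputable def valSel (c : Config X A d) (D : Transcript X A) (t h k : ℕ) (x : X) : ℝ :=
  if D.GapSmall c t h then val c D 0 t k x else val c D 1 t k x

/-- The expected value of `Y(x')` minus its realization. -/
noncomputable def dev (M : MDP X A) (D : Transcript X A) (t h : ℕ) (Y : X → ℝ) : ℝ :=
  ∫ x, Y x ∂(M.P h (D.z t h)) - Y (D.x t (h + 1))

/-- The suboptimality of the action taken. -/
noncomputable def gap (M : MDP X A) (D : Transcript X A) (t h : ℕ) : ℝ :=
  Vopt M h (D.x t h) - Qopt M h (D.z t h)

noncomputable def xiSel (M : MDP X A) (c : Config X A d) (D : Transcript X A) (t h : ℕ) : ℝ :=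
  dev M D t h fun x => clip (valSel c D t h (h + 1) x) - Vopt M (h + 1) x

noncomputable def xiWidth (M : MDP X A) (c : Config X A d) (D : Transcript X A) (t h : ℕ) : ℝ :=
  dev M D t h fun x => clip (val c D 0 t (h + 1) x) - clip (val c D 2 t (h + 1) x)

/-- Truncated bonuses. -/
noncomputable def bon₁ (c : Config X A d) (D : Transcript X A) (t h : ℕ) : ℝ :=
  min 2 (2 * D.b₁ c t h (D.z t h))

noncomputable def bon₂ (c : Config X A d) (D : Transcript X A) (t h : ℕ) : ℝ :=
  min 2 (2 * D.b₂ c t h (D.z t h))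

/-- Deviation bounds for the sums of martingale differences along the run. -/
structure GoodRun (M : MDP X A) (c : Config X A d) (D : Transcript X A) (L θ₁ θ₂ θ₃ : ℝ) :
    Prop where
  sel : dsum c (fun t h => θ₁ * xiSel M c D t h) ≤ dsum c (fun _ _ => 4 * θ₁ ^ 2) + L
  bad : dsum c (fun t h => (1 - small c D t h) * (θ₂ * xiSel M c D t h)) ≤
    dsum c (fun t h => (1 - small c D t h) * (4 * θ₂ ^ 2)) + L
  width : dsum c (fun t h => small c D t h * (θ₃ * (h + 1) * xiWidth M c D t h)) ≤
    dsum c (fun _ _ => 4 * (θ₃ * c.H) ^ 2) + L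
  ret : dsum c (fun t h => 1 / 24 * (M.r h (D.z t h) (D.x t (h + 1)) +
    Vopt M (h + 1) (D.x t (h + 1)) - Qopt M h (D.z t h))) ≤
    dsum c (fun t h => (1 / 24) ^ 2 * varOpt M h (D.z t h)) + L
  sq : dsum c (fun t h => 1 / 24 * (bellmanSq M h (Vopt M (h + 1)) (D.z t h) -
    (M.r h (D.z t h) (D.x t (h + 1)) + Vopt M (h + 1) (D.x t (h + 1))) ^ 2)) ≤
    dsum c (fun t h => (1 / 24) ^ 2 * (9 * varOpt M h (D.z t h))) + L

theorem small_nonneg (D : Transcript X A) (t h : ℕ) : 0 ≤ small c D t h := by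
  rw [small]; split_ifs <;> norm_num

theorem small_le_one (D : Transcript X A) (t h : ℕ) : small c D t h ≤ 1 := by
  rw [small]; split_ifs <;> norm_num

theorem small_anti (D : Transcript X A) (t : ℕ) {h k : ℕ} (hk : h ≤ k) :
    small c D t k ≤ small c D t h := by
  by_cases h1 : D.GapSmall c t k
  · have h2 : D.GapSmall c t h := fun j hj => h1 j (hj.trans hk)
    rw [small, small, if_pos h1, if_pos h2]
  · rw [small, if_neg h1]; exact small_nonneg _ _ _

theorem bon₁_nonneg (D : Transcript X A) (t h : ℕ) : 0 ≤ bon₁ c D t h :=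
  le_min (by norm_num) (mul_nonneg (by norm_num) (b₁_nonneg _ _ _ _))

theorem bon₂_nonneg (D : Transcript X A) (t h : ℕ) : 0 ≤ bon₂ c D t h :=
  le_min (by norm_num) (mul_nonneg (by norm_num) (b₂_nonneg _ _ _ _))

/-- A quantity that is at most `2` may be compared with bonuses truncated at `2`, as long as `E` is
nonnegative. The factor `a` tells whether the unweighted bonus is present. -/
theorem le_bon {x E : ℝ} (D : Transcript X A) (t h : ℕ) {a b : ℝ} (ha : 0 ≤ a) (hE : 0 ≤ E)
    (hb : 0 ≤ b) (hx2 : x ≤ 2)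
    (hx : x ≤ E + 2 * D.b₁ c t h (D.z t h) + a * (2 * D.b₂ c t h (D.z t h)) + b)
    (ha1 : a = 0 ∨ a = 1) : x ≤ E + bon₁ c D t h + a * bon₂ c D t h + b := by
  have e1 := bon₁_nonneg (c := c) D t h
  have e2 := bon₂_nonneg (c := c) D t h
  have e3 : 0 ≤ a * bon₂ c D t h := mul_nonneg ha e2
  rcases min_choice 2 (2 * D.b₁ c t h (D.z t h)) with h1 | h1
  · have : bon₁ c D t h = 2 := h1
    linarith
  · have e4 : bon₁ c D t h = 2 * D.b₁ c t h (D.z t h) := h1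
    rcases ha1 with rfl | rfl
    · linarith
    · rcases min_choice 2 (2 * D.b₂ c t h (D.z t h)) with h2 | h2
      · have : bon₂ c D t h = 2 := h2
        linarith
      · have : bon₂ c D t h = 2 * D.b₂ c t h (D.z t h) := h2
        linarith

section Accurate

variable {ω : Ω}

theorem val_mem (S : RunSetting M c Pr D) (Acc : Accurate M c (D ω)) {t : ℕ} (ht : t < c.T) (h : ℕ)
    (j : Fin 3) (x : X) : 0 ≤ val c (D ω) j t h x ∧ val c (D ω) j t h x ≤ 2 := by
  have h1 := S.toLinSetting.Vopt_nonneg h x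
  have h2 := S.toLinSetting.Vopt_le_one h x
  have h3 := Acc.le_V₁ t ht h x
  have h4 := Acc.V₁_le_V₂ t ht h x
  have h5 := Acc.VNeg_nonneg t ht h x
  have h6 := Acc.VNeg_le t ht h x
  have h7 := V₁_le_one (c := c) (D ω) t h x
  have h8 := V₂_le_two (c := c) (D ω) t h x
  match j with
  | 0 => exact ⟨by linarith, by linarith⟩
  | 1 => exact ⟨by linarith, by linarith⟩
  | 2 => exact ⟨by linarith, by linarith⟩

theorem clip_val (S : RunSetting M c Pr D) (Acc : Accurate M c (D ω)) {t : ℕ} (ht : t < c.T) (h : ℕ)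
    (j : Fin 3) (x : X) : clip (val c (D ω) j t h x) = val c (D ω) j t h x :=
  clip_of_mem (S.val_mem Acc ht h j x).1 (S.val_mem Acc ht h j x).2

theorem gap_nonneg (S : RunSetting M c Pr D) (ω : Ω) {h : ℕ} (hh : h < c.H) (t : ℕ) :
    0 ≤ gap M (D ω) t h :=
  sub_nonneg.2 (S.toLinSetting.Qopt_le_Vopt (S.horizon ▸ hh) _)

theorem integral_val_sub (S : RunSetting M c Pr D) (Acc : Accurate M c (D ω)) {t : ℕ}
    (ht : t < c.T) (h : ℕ) (j : Fin 3) {W : X → ℝ} (hW : Measurable W) {b : ℝ}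
    (hWb : ∀ x, |W x| ≤ b) (z : X × A) :
    ∫ x, (clip (val c (D ω) j t (h + 1) x) - W x) ∂(M.P h z) =
      bellman M h (val c (D ω) j t (h + 1)) z - bellman M h W z := by
  simp only [S.clip_val Acc ht (h + 1) j]
  exact (bellman_sub_bellman h z (S.measurable_val ω j ht (h + 1)) (fun x => abs_le.2
    ⟨by linarith [(S.val_mem Acc ht (h + 1) j x).1], (S.val_mem Acc ht (h + 1) j x).2⟩) hW hWb).symm

/-- The followed function is greedy at the visited state, so its maximum is attained at the chosen
action and is at most its Bellman image plus bonuses. Subtracting `V⋆ = Q⋆ + gap` and replacing the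
mean over the next state by its realization gives one step of a telescoping sum. -/
theorem sel_step (S : RunSetting M c Pr D) (Acc : Accurate M c (D ω)) {t h : ℕ} (ht : t < c.T)
    (hh : h < c.H) :
    valSel c (D ω) t h h ((D ω).x t h) - Vopt M h ((D ω).x t h) + gap M (D ω) t h ≤
      valSel c (D ω) t (h + 1) (h + 1) ((D ω).x t (h + 1)) - Vopt M (h + 1) ((D ω).x t (h + 1)) +
      xiSel M c (D ω) t h +
      (bon₁ c (D ω) t h + (1 - small c (D ω) t h) * bon₂ c (D ω) t h + 4 * c.ε) := by
  have hVo := S.toLinSetting.measurable_Vopt (h + 1)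
  have hVob := S.toLinSetting.abs_Vopt_le (h + 1)
  have hVo0 := S.toLinSetting.Vopt_nonneg (h + 1)
  have hQ0 := S.toLinSetting.Qopt_nonneg h ((D ω).z t h)
  have hε := S.ε_pos
  by_cases hg : (D ω).GapSmall c t h
  · have e1 : val c (D ω) 0 t h ((D ω).x t h) ≤ (D ω).f₁ c t h ((D ω).z t h) :=
      maxVal_le hh ((S.run.isVOQL ω).greedy₁ t ht h hh hg)
    have e2 := Acc.f₁_le t ht h hh ((D ω).z t h)
    have hmono : Qopt M h ((D ω).z t h) ≤ bellman M h (val c (D ω) 0 t (h + 1)) ((D ω).z t h) :=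
      bellman_mono h _ hVo0 (S.measurable_val ω 0 ht (h + 1)) (fun x => abs_le.2
        ⟨by linarith [(S.val_mem Acc ht (h + 1) 0 x).1], (S.val_mem Acc ht (h + 1) 0 x).2⟩)
        (Acc.le_V₁ t ht (h + 1))
    have e3 := le_bon (c := c) (D ω) t h (x := (D ω).f₁ c t h ((D ω).z t h) - Qopt M h ((D ω).z t h))
      (E := bellman M h (val c (D ω) 0 t (h + 1)) ((D ω).z t h) - Qopt M h ((D ω).z t h)) (a := 0)
      (b := 4 * c.ε) le_rfl (by linarith) (by linarith)
      (by linarith [f₁_le_one (c := c) (D ω) t h ((D ω).z t h)]) (by linarith) (Or.inl rfl)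
    have e4 := S.integral_val_sub Acc ht h 0 hVo hVob ((D ω).z t h)
    have e5 := S.clip_val Acc ht (h + 1) 0 ((D ω).x t (h + 1))
    have e6 := Acc.V₁_le_V₂ t ht (h + 1) ((D ω).x t (h + 1))
    -- A switch at the next level only raises the followed value.
    have e7 : val c (D ω) 0 t (h + 1) ((D ω).x t (h + 1)) ≤
        valSel c (D ω) t (h + 1) (h + 1) ((D ω).x t (h + 1)) := by
      rw [valSel]; split_ifs
      · exact le_rfl
      · exact e6
    simp only [xiSel, dev, valSel, if_pos hg, small, gap] at *
    rw [e4, e5]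
    change _ ≤ _ + (bellman M h (val c (D ω) 0 t (h + 1)) _ - Qopt M h _ - _) + _
    linarith
  · have e1 : val c (D ω) 1 t h ((D ω).x t h) ≤ (D ω).f₂ c t h ((D ω).z t h) :=
      maxVal_le hh ((S.run.isVOQL ω).greedy₂ t ht h hh hg)
    -- After a switch the overly optimistic functions are followed to the end of the episode.
    have hg' : ¬ (D ω).GapSmall c t (h + 1) := fun h1 => hg fun j hj => h1 j (by omega)
    have e2 := Acc.f₂_le t ht h hh ((D ω).z t h)
    have hmono : Qopt M h ((D ω).z t h) ≤ bellman M h (val c (D ω) 1 t (h + 1)) ((D ω).z t h) :=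
      bellman_mono h _ hVo0 (S.measurable_val ω 1 ht (h + 1)) (fun x => abs_le.2
        ⟨by linarith [(S.val_mem Acc ht (h + 1) 1 x).1], (S.val_mem Acc ht (h + 1) 1 x).2⟩)
        fun x => (Acc.le_V₁ t ht (h + 1) x).trans (Acc.V₁_le_V₂ t ht (h + 1) x)
    have e3 := le_bon (c := c) (D ω) t h (x := (D ω).f₂ c t h ((D ω).z t h) - Qopt M h ((D ω).z t h))
      (E := bellman M h (val c (D ω) 1 t (h + 1)) ((D ω).z t h) - Qopt M h ((D ω).z t h)) (a := 1)
      (b := 4 * c.ε) zero_le_one (by linarith) (by linarith)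
      (by linarith [f₂_le_two (c := c) (D ω) t h ((D ω).z t h)]) (by linarith) (Or.inr rfl)
    have e4 := S.integral_val_sub Acc ht h 1 hVo hVob ((D ω).z t h)
    have e5 := S.clip_val Acc ht (h + 1) 1 ((D ω).x t (h + 1))
    simp only [xiSel, dev, valSel, if_neg hg, if_neg hg', small, gap] at *
    rw [e4, e5]
    change _ ≤ _ + (bellman M h (val c (D ω) 1 t (h + 1)) _ - Qopt M h _ - _) + _
    linarith

theorem valSel_sub_nonneg (S : RunSetting M c Pr D) (Acc : Accurate M c (D ω)) {t : ℕ} (ht : t < c.T)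
    (h k : ℕ) (x : X) : 0 ≤ valSel c (D ω) t h k x - Vopt M k x := by
  have h3 := Acc.le_V₁ t ht k x
  have h4 := Acc.V₁_le_V₂ t ht k x
  rw [valSel]; split_ifs <;> linarith

theorem valSel_last (S : RunSetting M c Pr D) (ω : Ω) (t h : ℕ) (x : X) :
    valSel c (D ω) t h c.H x - Vopt M c.H x = 0 := by
  rw [valSel, val_zero, val_one, maxVal_of_le le_rfl, maxVal_of_le le_rfl,
    Vopt_of_le (S.horizon ▸ le_rfl)]
  simp

theorem telescope_le {a s g : ℕ → ℝ} (n : ℕ) (h : ∀ k < n, a k + g k ≤ a (k + 1) + s k) :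
    a 0 + ∑ k ∈ Finset.range n, g k ≤ a n + ∑ k ∈ Finset.range n, s k := by
  induction n with
  | zero => simp
  | succ n ih =>
    rw [Finset.sum_range_succ, Finset.sum_range_succ]
    linarith [ih fun k hk => h k (by omega), h n (by omega)]

/-- Telescoping of `sel_step` over the levels: the followed value minus `V⋆` is nonnegative at the
first level and zero at the last. -/
theorem dsum_gap_le (S : RunSetting M c Pr D) (Acc : Accurate M c (D ω)) :
    dsum c (gap M (D ω)) ≤ dsum c (xiSel M c (D ω)) + dsum c (bon₁ c (D ω)) +
      dsum c (fun t h => (1 - small c (D ω) t h) * bon₂ c (D ω) t h) + 4 * c.ε * (c.T * c.H) := by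
  rw [← dsum_const, ← dsum_add, ← dsum_add, ← dsum_add]
  refine Finset.sum_le_sum fun t ht => ?_
  replace ht := Finset.mem_range.1 ht
  have h1 := telescope_le (a := fun h => valSel c (D ω) t h h ((D ω).x t h) - Vopt M h ((D ω).x t h))
    (g := gap M (D ω) t) (s := fun h => xiSel M c (D ω) t h + bon₁ c (D ω) t h +
      (1 - small c (D ω) t h) * bon₂ c (D ω) t h + 4 * c.ε) c.H fun h hh => by
        linarith [S.sel_step Acc ht hh]
  have h2 := S.valSel_sub_nonneg Acc ht 0 0 ((D ω).x t 0)
  have h3 := S.valSel_last ω t c.H ((D ω).x t c.H)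
  linarith

/-- Telescoping of `sel_step` restricted to the steps after the switch. At the switch the overly
optimistic value exceeds the optimistic one, hence `V⋆`, by at least `u`, and this excess has to be
used up by the bonuses and the noise of the remaining levels. -/
theorem bad_le (S : RunSetting M c Pr D) (Acc : Accurate M c (D ω)) {u : ℝ}
    (hu : ∀ t < c.T, u ≤ c.u t) :
    (∑ t ∈ Finset.range c.T, (1 - small c (D ω) t c.H)) * u ≤
      dsum c (fun t h => (1 - small c (D ω) t h) * xiSel M c (D ω) t h) +
      dsum c (fun t h => (1 - small c (D ω) t h) * bon₁ c (D ω) t h) +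
      dsum c (fun t h => (1 - small c (D ω) t h) * bon₂ c (D ω) t h) + 4 * c.ε * (c.T * c.H) := by
  rw [← dsum_const, ← dsum_add, ← dsum_add, ← dsum_add, Finset.sum_mul]
  refine Finset.sum_le_sum fun t ht => ?_
  replace ht := Finset.mem_range.1 ht
  set U : ℕ → ℝ := fun h => valSel c (D ω) t h h ((D ω).x t h) - Vopt M h ((D ω).x t h) with hU
  have hU0 : ∀ h, 0 ≤ U h := fun h => S.valSel_sub_nonneg Acc ht h h _
  set g : ℕ → ℝ := small c (D ω) t with hg
  have hg0 : ∀ h, 0 ≤ g h := small_nonneg (D ω) t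
  have hg1 : ∀ h, g h ≤ 1 := small_le_one (D ω) t
  have hcase : ∀ h, (D ω).GapSmall c t h ∧ g h = 1 ∨ ¬ (D ω).GapSmall c t h ∧ g h = 0 := fun h => by
    by_cases h1 : (D ω).GapSmall c t h
    · exact Or.inl ⟨h1, by rw [hg, small, if_pos h1]⟩
    · exact Or.inr ⟨h1, by rw [hg, small, if_neg h1]⟩
  -- If the gap exceeds the threshold at level `h` itself, the value then followed is at least `u`
  -- above `V⋆`.
  have hfirst : ∀ h, ¬ (D ω).GapSmall c t h →
      ¬ (Transcript.maxVal c ((D ω).f₂ c) t h ((D ω).x t h) - c.u t ≤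
        Transcript.maxVal c ((D ω).f₁ c) t h ((D ω).x t h)) → u ≤ U h := fun h h1 h2 => by
    have h3 := Acc.le_V₁ t ht h ((D ω).x t h)
    simp only [hU, valSel, if_neg h1]
    rw [val_zero] at h3
    rw [val_one]
    linarith [hu t ht]
  have h0 : u * (1 - g 0) ≤ (1 - g 0) * U 0 := by
    rcases hcase 0 with ⟨h1, h2⟩ | ⟨h1, h2⟩
    · rw [h2]; simp
    · rw [h2]
      have := hfirst 0 h1 fun h3 => h1 fun k hk => by
        obtain rfl : k = 0 := by omega
        exact h3
      linarith
  have h1 := telescope_le (a := fun h => (1 - g h) * U h) (g := fun h => u * (g h - g (h + 1)))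
    (s := fun h => (1 - g h) * xiSel M c (D ω) t h + (1 - g h) * bon₁ c (D ω) t h +
      (1 - g h) * bon₂ c (D ω) t h + 4 * c.ε) c.H fun h hh => by
    rcases hcase h with ⟨h1, h2⟩ | ⟨h1, h2⟩
    · have h4 := S.ε_pos
      rcases hcase (h + 1) with ⟨h1', h2'⟩ | ⟨h1', h2'⟩
      · simp only [h2, h2']; linarith
      · have := hfirst (h + 1) h1' fun h3 => h1' fun k hk => by
          rcases Nat.lt_or_ge k (h + 1) with h5 | h5
          · exact h1 k (by omega)
          · obtain rfl : k = h + 1 := by omega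
            exact h3
        simp only [h2, h2']; linarith
    · have h2' : g (h + 1) = 0 := le_antisymm (h2 ▸ small_anti (D ω) t (by omega)) (hg0 _)
      have h4 := S.sel_step Acc ht hh
      have h5 := S.gap_nonneg ω hh t
      simp only [h2, h2']
      have h6 : small c (D ω) t h = 0 := h2
      rw [h6] at h4
      simp only [hU]
      linarith
  have h3 : U c.H = 0 := S.valSel_last ω t c.H ((D ω).x t c.H)
  have h4 : ∑ h ∈ Finset.range c.H, u * (g h - g (h + 1)) = u * (g 0 - g c.H) := by
    rw [← Finset.mul_sum, Finset.sum_range_sub']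
  rw [h4] at h1
  rw [h3] at h1
  linarith

end Accurate

end RunSetting


/-! ### Sums of widths, of variances and of squared weights along a run. -/

namespace RunSetting

variable {X A Ω : Type*} [MeasurableSpace X] [TopologicalSpace A] [PolishSpace A]
  [MeasurableSpace A] [mΩ : MeasurableSpace Ω] {d : ℕ} {M : MDP X A} {c : Config X A d}
  {Pr : Measure Ω} {D : Ω → Transcript X A} [Nonempty X] [Nonempty A] {K L : ℝ} {ω : Ω}

/-- The width of the interval between the optimistic and the pessimistic estimate, while the
optimistic functions are followed. -/
noncomputable def width (c : Config X A d) (D : Transcript X A) (t h : ℕ) : ℝ :=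
  if h < c.H then small c D t h * (D.f₁ c t h (D.z t h) - D.fNeg c t h (D.z t h)) else 0

theorem small_eq (D : Transcript X A) (t h : ℕ) :
    D.GapSmall c t h ∧ small c D t h = 1 ∨ ¬ D.GapSmall c t h ∧ small c D t h = 0 := by
  by_cases h1 : D.GapSmall c t h
  · exact Or.inl ⟨h1, by rw [small, if_pos h1]⟩
  · exact Or.inr ⟨h1, by rw [small, if_neg h1]⟩

/-- While `f₁` is followed, its width at the chosen action is propagated to the next state, where it
is attained at the greedy action. If the switch occurs at the next level, the lost width is at most
one and is paid by the decrease of the indicator. -/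
theorem width_step (S : RunSetting M c Pr D) (Acc : Accurate M c (D ω)) {t h : ℕ} (ht : t < c.T)
    (hh : h < c.H) :
    width c (D ω) t h ≤ width c (D ω) t (h + 1) + (small c (D ω) t h * xiWidth M c (D ω) t h +
      (bon₁ c (D ω) t h + bon₂ c (D ω) t h + 4 * c.ε) +
      (small c (D ω) t h - small c (D ω) t (h + 1))) := by
  have hε := S.ε_pos
  have hb1 := bon₁_nonneg (c := c) (D ω) t h
  have hb2 := bon₂_nonneg (c := c) (D ω) t h
  have hle : ∀ k < c.H, ∀ z, (D ω).fNeg c t k z ≤ (D ω).f₁ c t k z := fun k hk z =>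
    (Acc.fNeg_le t ht k hk z).trans (Acc.le_f₁ t ht k hk z)
  have hw0 : 0 ≤ width c (D ω) t (h + 1) := by
    rw [width]; split_ifs with h1
    · exact mul_nonneg (small_nonneg _ _ _) (sub_nonneg.2 (hle _ h1 _))
    · exact le_rfl
  rcases small_eq (c := c) (D ω) t h with ⟨hg, hg1⟩ | ⟨hg, hg1⟩
  · have hN := fun x => (Acc.VNeg_le t ht (h + 1) x).trans (Acc.le_V₁ t ht (h + 1) x)
    have hb : ∀ j x, |val c (D ω) j t (h + 1) x| ≤ 2 := fun j x => abs_le.2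
      ⟨by linarith [(S.val_mem Acc ht (h + 1) j x).1], (S.val_mem Acc ht (h + 1) j x).2⟩
    have e1 := Acc.f₁_le t ht h hh ((D ω).z t h)
    have e2 := Acc.le_fNeg t ht h hh ((D ω).z t h)
    have hmono := bellman_mono (M := M) h ((D ω).z t h) (Acc.VNeg_nonneg t ht (h + 1))
      (S.measurable_val ω 0 ht (h + 1)) (hb 0) hN
    have hf1 := f₁_le_one (c := c) (D ω) t h ((D ω).z t h)
    have hfN := fNeg_nonneg (c := c) (D ω) t h ((D ω).z t h)
    have e3 := le_bon (c := c) (D ω) t h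
      (x := (D ω).f₁ c t h ((D ω).z t h) - (D ω).fNeg c t h ((D ω).z t h))
      (E := bellman M h (val c (D ω) 0 t (h + 1)) ((D ω).z t h) -
        bellman M h (val c (D ω) 2 t (h + 1)) ((D ω).z t h)) (a := 1) (b := 4 * c.ε) zero_le_one
      (sub_nonneg.2 hmono) (by linarith) (by linarith) (by linarith) (Or.inr rfl)
    have e4 := S.integral_val_sub Acc ht h 0 (S.measurable_val ω 2 ht (h + 1)) (hb 2) ((D ω).z t h)
    have e5 := S.clip_val Acc ht (h + 1) 0
    have e6 := S.clip_val Acc ht (h + 1) 2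
    have e7 : val c (D ω) 0 t (h + 1) ((D ω).x t (h + 1)) -
        val c (D ω) 2 t (h + 1) ((D ω).x t (h + 1)) ≤
        width c (D ω) t (h + 1) + (1 - small c (D ω) t (h + 1)) := by
      rcases small_eq (c := c) (D ω) t (h + 1) with ⟨hg', hg1'⟩ | ⟨hg', hg1'⟩
      · by_cases hh' : h + 1 < c.H
        · have a1 : val c (D ω) 0 t (h + 1) ((D ω).x t (h + 1)) ≤
            (D ω).f₁ c t (h + 1) ((D ω).z t (h + 1)) :=
            maxVal_le hh' ((S.run.isVOQL ω).greedy₁ t ht _ hh' hg')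
          have a2 : (D ω).fNeg c t (h + 1) ((D ω).z t (h + 1)) ≤
            val c (D ω) 2 t (h + 1) ((D ω).x t (h + 1)) :=
            le_maxVal hh' (S.fNeg_le ω ht hh') ((D ω).z t (h + 1))
          rw [width, if_pos hh', hg1']
          linarith
        · rw [hg1', val_zero, val_two, maxVal_of_le (not_lt.1 hh'), maxVal_of_le (not_lt.1 hh')]
          linarith
      · rw [hg1']
        linarith [V₁_le_one (c := c) (D ω) t (h + 1) ((D ω).x t (h + 1)),
          Acc.VNeg_nonneg t ht (h + 1) ((D ω).x t (h + 1))]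
    have e8 : xiWidth M c (D ω) t h = bellman M h (val c (D ω) 0 t (h + 1)) ((D ω).z t h) -
        bellman M h (val c (D ω) 2 t (h + 1)) ((D ω).z t h) -
        (val c (D ω) 0 t (h + 1) ((D ω).x t (h + 1)) -
          val c (D ω) 2 t (h + 1) ((D ω).x t (h + 1))) := by
      simp only [xiWidth, dev, e6]
      rw [e4, e5]
    conv_lhs => rw [width, if_pos hh]
    rw [e8, hg1]
    linarith
  · have hg' : small c (D ω) t (h + 1) = 0 :=
      le_antisymm (hg1 ▸ small_anti (D ω) t (by omega)) (small_nonneg _ _ _)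
    conv_lhs => rw [width, if_pos hh]
    rw [hg1, hg']
    linarith

/-- Summing the unrolled widths over all levels counts each one-step error at most `H` times; the
decreases of the indicator telescope. -/
theorem dsum_width_le (S : RunSetting M c Pr D) (Acc : Accurate M c (D ω)) :
    dsum c (width c (D ω)) ≤
      dsum c (fun t h => small c (D ω) t h * ((h + 1) * xiWidth M c (D ω) t h)) +
      c.H * (dsum c (bon₁ c (D ω)) + dsum c (bon₂ c (D ω)) + 4 * c.ε * (c.T * c.H)) +
      c.H * ∑ t ∈ Finset.range c.T, (1 - small c (D ω) t c.H) := by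
  have hε := S.ε_pos
  have h1 : dsum c (width c (D ω)) ≤ ∑ t ∈ Finset.range c.T, (∑ h ∈ Finset.range c.H,
      (small c (D ω) t h * ((h + 1) * xiWidth M c (D ω) t h) + c.H * (bon₁ c (D ω) t h +
        bon₂ c (D ω) t h + 4 * c.ε)) + c.H * (1 - small c (D ω) t c.H)) := by
    refine Finset.sum_le_sum fun t ht => ?_
    replace ht := Finset.mem_range.1 ht
    have h2 := sum_le_sum_weighted (a := width c (D ω) t) c.H fun h hh => S.width_step Acc ht hh
    have h3 : width c (D ω) t c.H = 0 := by rw [width, if_neg (lt_irrefl _)]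
    rw [h3, mul_zero, zero_add] at h2
    refine h2.trans ?_
    have h4 : ∀ h ∈ Finset.range c.H, ((h : ℝ) + 1) * (small c (D ω) t h * xiWidth M c (D ω) t h +
        (bon₁ c (D ω) t h + bon₂ c (D ω) t h + 4 * c.ε) +
        (small c (D ω) t h - small c (D ω) t (h + 1))) ≤
        small c (D ω) t h * ((h + 1) * xiWidth M c (D ω) t h) + c.H * (bon₁ c (D ω) t h +
        bon₂ c (D ω) t h + 4 * c.ε) + c.H * (small c (D ω) t h - small c (D ω) t (h + 1)) :=
      fun h hh => by
        have hH : (h : ℝ) + 1 ≤ c.H := by exact_mod_cast Finset.mem_range.1 hh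
        have hb : 0 ≤ bon₁ c (D ω) t h + bon₂ c (D ω) t h + 4 * c.ε := by
          have := bon₁_nonneg (c := c) (D ω) t h
          have := bon₂_nonneg (c := c) (D ω) t h
          linarith
        have hs : 0 ≤ small c (D ω) t h - small c (D ω) t (h + 1) :=
          sub_nonneg.2 (small_anti _ _ (by omega))
        have a1 := mul_le_mul_of_nonneg_right hH hb
        have a2 := mul_le_mul_of_nonneg_right hH hs
        linarith
    refine (Finset.sum_le_sum h4).trans ?_
    rw [Finset.sum_add_distrib, ← Finset.mul_sum (s := Finset.range c.H)
      (f := fun h => small c (D ω) t h - small c (D ω) t (h + 1)), Finset.sum_range_sub']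
    have h5 : (c.H : ℝ) * (small c (D ω) t 0 - small c (D ω) t c.H) ≤
        c.H * (1 - small c (D ω) t c.H) := by
      gcongr; exact small_le_one _ _ _
    linarith
  refine h1.trans (le_of_eq ?_)
  rw [Finset.sum_add_distrib, ← Finset.mul_sum]
  congr 1
  rw [← dsum_const, ← dsum_add, ← dsum_add, ← dsum_mul, ← dsum_add]
  rfl

theorem one_sub_small_le (D : Transcript X A) {t h : ℕ} (hh : h ≤ c.H) :
    1 - small c D t h ≤ 1 - small c D t c.H := sub_le_sub_left (small_anti _ _ hh) _

theorem dsum_one_sub_small_le (D : Transcript X A) {b : ℝ} (hb : 0 ≤ b) :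
    dsum c (fun t h => (1 - small c D t h) * b) ≤
      b * ((∑ t ∈ Finset.range c.T, (1 - small c D t c.H)) * c.H) := by
  have h1 : dsum c (fun t h => (1 - small c D t h) * b) ≤
      dsum c (fun t _ => (1 - small c D t c.H) * b) := dsum_le fun t _ h hh =>
    mul_le_mul_of_nonneg_right (one_sub_small_le D hh.le) hb
  refine h1.trans (le_of_eq ?_)
  simp only [dsum, Finset.sum_const, Finset.card_range, nsmul_eq_mul]
  rw [Finset.sum_mul, Finset.mul_sum]
  exact Finset.sum_congr rfl fun t _ => by ring

theorem f₂_sub_fNeg_nonneg (Acc : Accurate M c (D ω)) {t h : ℕ} (ht : t < c.T) (hh : h < c.H)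
    (z : X × A) : 0 ≤ (D ω).f₂ c t h z - (D ω).fNeg c t h z :=
  sub_nonneg.2 ((Acc.fNeg_le t ht h hh z).trans
    ((Acc.le_f₁ t ht h hh z).trans (Acc.f₁_le_f₂ t ht h hh z)))

/-- Before the switch, `f₂` exceeds `f₁` by at most the threshold, so the width is that of `f₁` plus
`u`; after it, the trivial bound `2` is used. -/
theorem dsum_f₂_sub_fNeg_le (S : RunSetting M c Pr D) (Acc : Accurate M c (D ω))
    (hu : ∀ t < c.T, 0 ≤ c.u t) :
    dsum c (fun t h => (D ω).f₂ c t h ((D ω).z t h) - (D ω).fNeg c t h ((D ω).z t h)) ≤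
      2 * ((∑ t ∈ Finset.range c.T, (1 - small c (D ω) t c.H)) * c.H) +
      dsum c (fun t _ => c.u t) + dsum c (width c (D ω)) := by
  refine le_trans ?_ (add_le_add_left (add_le_add_left
    (dsum_one_sub_small_le (c := c) (D ω) (b := 2) (by norm_num)) _) _)
  rw [← dsum_add, ← dsum_add]
  refine dsum_le fun t ht h hh => ?_
  rw [width, if_pos hh]
  rcases small_eq (c := c) (D ω) t h with ⟨hg, hg1⟩ | ⟨hg, hg1⟩
  · have a1 : (D ω).f₂ c t h ((D ω).z t h) ≤ val c (D ω) 1 t h ((D ω).x t h) :=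
      le_maxVal hh (f₂_le_two (D ω) t h) ((D ω).z t h)
    have a2 : val c (D ω) 0 t h ((D ω).x t h) ≤ (D ω).f₁ c t h ((D ω).z t h) :=
      maxVal_le hh ((S.run.isVOQL ω).greedy₁ t ht _ hh hg)
    have a3 := hg h le_rfl
    rw [val_one] at a1
    rw [val_zero] at a2
    rw [hg1]
    linarith
  · rw [hg1]
    linarith [f₂_le_two (c := c) (D ω) t h ((D ω).z t h),
      fNeg_nonneg (c := c) (D ω) t h ((D ω).z t h), hu t ht]

/-- The law of total variance, pathwise. Telescoping `V⋆²` over an episode bounds the sum of the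
variances by the noise of the squared returns plus three times the gaps and rewards. Since `V⋆ ≤ 1`,
gaps plus rewards sum to at most one per episode, up to the noise of the returns. The compensators
of the two noise sums return `9/24 + 3/24 = 1/2` of the sum of the variances, which is absorbed. -/
theorem dsum_varOpt_le (S : RunSetting M c Pr D) {θ₁ θ₂ θ₃ : ℝ}
    (Gr : GoodRun M c (D ω) L θ₁ θ₂ θ₃) (hL : L ≤ K) (hL0 : 0 ≤ L) :
    dsum c (fun t h => varOpt M h ((D ω).z t h)) ≤ 6 * c.T + 200 * K := by
  have h1 := Gr.ret
  have h2 := Gr.sq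
  rw [dsum_mul, dsum_mul] at h1
  rw [dsum_mul, dsum_mul, dsum_mul] at h2
  set R := dsum c (fun t h => M.r h ((D ω).z t h) ((D ω).x t (h + 1)) +
    Vopt M (h + 1) ((D ω).x t (h + 1)) - Qopt M h ((D ω).z t h)) with hR
  have hVo0 := S.toLinSetting.Vopt_nonneg
  have hVo1 := S.toLinSetting.Vopt_le_one
  have hlast : ∀ t, Vopt M c.H ((D ω).x t c.H) = 0 := fun t => Vopt_of_le (S.horizon ▸ le_rfl) _
  have h3 : dsum c (fun t h => gap M (D ω) t h + M.r h ((D ω).z t h) ((D ω).x t (h + 1))) ≤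
      R + c.T := by
    have : R + c.T = ∑ t ∈ Finset.range c.T, (∑ h ∈ Finset.range c.H,
        (M.r h ((D ω).z t h) ((D ω).x t (h + 1)) +
        Vopt M (h + 1) ((D ω).x t (h + 1)) - Qopt M h ((D ω).z t h)) + 1) := by
      rw [Finset.sum_add_distrib]; simp [hR, dsum]
    rw [this]
    refine Finset.sum_le_sum fun t _ => ?_
    have := telescope_le (a := fun h => Vopt M h ((D ω).x t h) - 1)
      (g := fun h => M.r h ((D ω).z t h) ((D ω).x t (h + 1)) +
        Vopt M (h + 1) ((D ω).x t (h + 1)) - Qopt M h ((D ω).z t h))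
      (s := fun h => gap M (D ω) t h + M.r h ((D ω).z t h) ((D ω).x t (h + 1))) c.H
    have h4 : ∑ h ∈ Finset.range c.H, (gap M (D ω) t h + M.r h ((D ω).z t h) ((D ω).x t (h + 1))) =
        ∑ h ∈ Finset.range c.H, ((M.r h ((D ω).z t h) ((D ω).x t (h + 1)) +
        Vopt M (h + 1) ((D ω).x t (h + 1)) - Qopt M h ((D ω).z t h)) +
        (Vopt M h ((D ω).x t h) - Vopt M (h + 1) ((D ω).x t (h + 1)))) :=
      Finset.sum_congr rfl fun h _ => by rw [gap]; ring
    rw [h4, Finset.sum_add_distrib, Finset.sum_range_sub' (fun h => Vopt M h ((D ω).x t h)), hlast]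
    linarith [hVo1 0 ((D ω).x t 0)]
  have h5 : dsum c (fun t h => varOpt M h ((D ω).z t h)) ≤
      dsum c (fun t h => bellmanSq M h (Vopt M (h + 1)) ((D ω).z t h) -
        (M.r h ((D ω).z t h) ((D ω).x t (h + 1)) + Vopt M (h + 1) ((D ω).x t (h + 1))) ^ 2) +
      3 * dsum c (fun t h => gap M (D ω) t h + M.r h ((D ω).z t h) ((D ω).x t (h + 1))) := by
    rw [← dsum_mul, ← dsum_add]
    refine Finset.sum_le_sum fun t _ => ?_
    have h6 := telescope_le (a := fun h => Vopt M h ((D ω).x t h) ^ 2)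
      (g := fun h => varOpt M h ((D ω).z t h))
      (s := fun h => bellmanSq M h (Vopt M (h + 1)) ((D ω).z t h) -
        (M.r h ((D ω).z t h) ((D ω).x t (h + 1)) + Vopt M (h + 1) ((D ω).x t (h + 1))) ^ 2 +
        3 * (gap M (D ω) t h + M.r h ((D ω).z t h) ((D ω).x t (h + 1)))) c.H fun h hh => by
      have hr := M.r_mem h ((D ω).z t h) ((D ω).x t (h + 1))
      have hq0 := S.toLinSetting.Qopt_nonneg h ((D ω).z t h)
      have hq1 := S.toLinSetting.Qopt_le_Vopt (S.horizon ▸ hh) ((D ω).z t h)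
      have hv1 := hVo1 h ((D ω).x t h)
      have hv2 := hVo1 (h + 1) ((D ω).x t (h + 1))
      have hv3 := hVo0 (h + 1) ((D ω).x t (h + 1))
      change Qopt M h ((D ω).z t h) ≤ Vopt M h ((D ω).x t h) at hq1
      rw [varOpt, gap]
      set r := M.r h ((D ω).z t h) ((D ω).x t (h + 1))
      set V := Vopt M h ((D ω).x t h)
      set V' := Vopt M (h + 1) ((D ω).x t (h + 1))
      set Q := Qopt M h ((D ω).z t h)
      -- The terms `V² - Q²` and `(r + V')² - V'²` are charged to the gap and to the reward, with
      -- factors `2` and `3`.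
      have a1 : V ^ 2 - Q ^ 2 ≤ 2 * (V - Q) := by
        have : (V - Q) * (V + Q) ≤ (V - Q) * 2 :=
          mul_le_mul_of_nonneg_left (by linarith) (by linarith)
        linarith
      have a2 : r * (r + 2 * V') ≤ r * 3 := mul_le_mul_of_nonneg_left (by linarith [hr.2]) hr.1
      linarith
    rw [hlast] at h6
    linarith [sq_nonneg (Vopt M 0 ((D ω).x t 0))]
  linarith

theorem sigma_sq_le_four (D : Transcript X A) (t h : ℕ) : D.sigma c t h ^ 2 ≤ 4 := by
  by_cases ht : t = 0
  · rw [Transcript.sigma, if_pos ht]; norm_num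
  · rw [sigma_sq_eq D ht]
    exact max_le (min_le_left _ _) (by norm_num)

theorem sq_max_le {a b e : ℝ} (ha : a ^ 2 ≤ e) (hb : b ^ 2 ≤ e) : max a b ^ 2 ≤ e := by
  rcases max_choice a b with h | h <;> rw [h] <;> assumption

theorem sigmaBar_sq_le (D : Transcript X A) {t h : ℕ} {e : ℝ} (h1 : D.sigma c t h ^ 2 ≤ e)
    (h2 : c.α ^ 2 ≤ e) (hΓ : 0 ≤ D.f₂ c t h (D.z t h) - D.fNeg c t h (D.z t h))
    (h3 : 2 * c.ι ^ 2 * (D.f₂ c t h (D.z t h) - D.fNeg c t h (D.z t h)) ≤ e)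
    (h4 : 4 * (√c.υ + c.ι) ^ 2 * c.eluderD h (D.past t h) (fun s => D.sigmaBar c h s) (D.z t h) ≤ e) :
    D.sigmaBar c h t ^ 2 ≤ e := by
  have h0 := c.eluderD_nonneg h (D.past t h) (fun s => D.sigmaBar c h s) (D.z t h)
  rw [Transcript.sigmaBar, Transcript.weightOf]
  refine sq_max_le (sq_max_le h1 h2) (sq_max_le ?_ ?_)
  · rw [mul_pow, mul_pow, Real.sq_sqrt (by norm_num)]
    change 2 * c.ι ^ 2 * √(D.f₂ c t h (D.z t h) - D.fNeg c t h (D.z t h)) ^ 2 ≤ e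
    rwa [Real.sq_sqrt hΓ]
  · rw [mul_pow, mul_pow, Real.sq_sqrt h0]
    linarith

theorem sigmaBar_pos (S : RunSetting M c Pr D) (ω : Ω) (h t : ℕ) : 0 < (D ω).sigmaBar c h t :=
  S.alpha_pos.trans_le (alpha_le_sigmaBar (c := c) (D := D) ω h t)

/-- A crude bound, used only on the few episodes that switch. -/
theorem sigmaBar_sq_le_const (S : RunSetting M c Pr D) (R : Rates c K L) (Acc : Accurate M c (D ω))
    {t h : ℕ} (ht : t < c.T) (hh : h < c.H) : (D ω).sigmaBar c h t ^ 2 ≤ K * d ^ 2 := by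
  have hhM : h < M.H := S.horizon ▸ hh
  obtain ⟨hT, hH, -⟩ := S.TH_cast
  have hι := R.ι_le
  have hα : c.α ^ 2 ≤ 1 := by
    rw [S.alpha_sq, div_le_one (by positivity)]
    exact one_le_mul_of_one_le_of_one_le hT hH
  have hB := S.toLinSetting.two_le_B
  have hυ : (√c.υ + c.ι) ^ 2 ≥ c.ι ^ 2 :=
    pow_le_pow_left₀ R.ι_nonneg (by linarith [Real.sqrt_nonneg c.υ]) 2
  have hυι := R.υι_le
  have hι2 := sq_nonneg c.ι
  refine sigmaBar_sq_le (D ω) ((sigma_sq_le_four _ _ _).trans (by linarith)) (by linarith)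
    (f₂_sub_fNeg_nonneg Acc ht hh _) ?_ ?_
  · have h1 : (D ω).f₂ c t h ((D ω).z t h) - (D ω).fNeg c t h ((D ω).z t h) ≤ 2 := by
      linarith [f₂_le_two (c := c) (D ω) t h ((D ω).z t h),
        fNeg_nonneg (c := c) (D ω) t h ((D ω).z t h)]
    have h2 := mul_le_mul_of_nonneg_left h1 (show 0 ≤ 2 * c.ι ^ 2 by linarith)
    have h3 : 2 * (√c.υ + c.ι) ^ 2 ≤ c.B * (√c.υ + c.ι) ^ 2 :=
      mul_le_mul_of_nonneg_right hB (by linarith)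
    linarith
  · have h1 := c.eluderD_le (fun f hf z => S.toLinSetting.abs_le_of_mem hhM hf z) (by linarith)
      ((D ω).past t h) (fun s => (D ω).sigmaBar c h s) ((D ω).z t h)
    have h2 := mul_le_mul_of_nonneg_left h1 (show 0 ≤ 4 * (√c.υ + c.ι) ^ 2 by positivity)
    linarith

theorem sum_one_div_sqrt_le (n : ℕ) : ∑ t ∈ Finset.range n, 1 / √((t : ℝ) + 1) ≤ 2 * √n := by
  induction n with
  | zero => simp
  | succ n ih =>
    rw [Finset.sum_range_succ]
    have h0 : 0 < √((n : ℝ) + 1) := Real.sqrt_pos.2 (by positivity)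
    have h1 := Real.sq_sqrt (show (0 : ℝ) ≤ n + 1 by positivity)
    have h2 := Real.sq_sqrt (show (0 : ℝ) ≤ n by positivity)
    have h3 : 1 / √((n : ℝ) + 1) ≤ 2 * (√((n : ℝ) + 1) - √n) := by
      rw [div_le_iff₀ h0]
      nlinarith [sq_nonneg (√((n : ℝ) + 1) - √n)]
    push_cast
    linarith

theorem rpow_five_halves {x : ℝ} (hx : 0 < x) : x ^ (5 / 2 : ℝ) = x ^ 2 * √x := by
  rw [show (5 / 2 : ℝ) = (2 : ℕ) + 1 / 2 by norm_num, Real.rpow_add hx, Real.rpow_natCast,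
    Real.sqrt_eq_rpow]

end RunSetting


/-- A lower bound on the exploration thresholds. -/
noncomputable def Config.uMin {X A : Type*} {d : ℕ} (c : Config X A d) : ℝ :=
  c.κu * c.logFactor ^ 2 * (d : ℝ) ^ 3 * ((c.H : ℝ) ^ 2 * √c.H) / √c.T

/-- The scales at which the three families of martingale differences are controlled. -/
noncomputable def Config.θsel {X A : Type*} {d : ℕ} (c : Config X A d) : ℝ :=
  1 / (4 * √(c.T * c.H))

noncomputable def Config.θbad {X A : Type*} {d : ℕ} (c : Config X A d) : ℝ :=
  min (c.uMin / (32 * c.H)) (1 / 8)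

noncomputable def Config.θwidth {X A : Type*} {d : ℕ} (c : Config X A d) : ℝ :=
  1 / (16 * (d : ℝ) ^ 2 * (c.H : ℝ) ^ 3)

namespace RunSetting

variable {X A Ω : Type*} [MeasurableSpace X] [TopologicalSpace A] [PolishSpace A]
  [MeasurableSpace A] [mΩ : MeasurableSpace Ω] {d : ℕ} {M : MDP X A} {c : Config X A d}
  {Pr : Measure Ω} {D : Ω → Transcript X A} [Nonempty X] [Nonempty A] {K L : ℝ} {ω : Ω}

/-- The requirements of `bad_episodes_le` on the threshold hold because `κu ℓ² ≥ 1`; its sum over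
the run uses `∑ 1/√t ≤ 2 √T`. -/
theorem u_bounds (S : RunSetting M c Pr D) (R : Rates c K L) :
    0 < c.uMin ∧ (∀ t < c.T, c.uMin ≤ c.u t) ∧ (d : ℝ) ^ 3 * (c.H : ℝ) ^ 2 ≤ c.uMin * c.T ∧
    (d : ℝ) ^ 6 * (c.H : ℝ) ^ 5 ≤ c.uMin ^ 2 * c.T ∧
    dsum c (fun t _ => c.u t) ≤ 2 * K ^ 2 * (d : ℝ) ^ 3 * ((c.H : ℝ) ^ 3 * √c.H) * √c.T := by
  obtain ⟨hT, hH, -⟩ := S.TH_cast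
  have hd : (1 : ℝ) ≤ d := by exact_mod_cast S.toLinSetting.one_le_d
  have hκ := R.κu_ge
  have hκ' := R.κu_le
  have hsT : 0 < √(c.T : ℝ) := Real.sqrt_pos.2 (by linarith)
  have hsT1 : 1 ≤ √(c.T : ℝ) := Real.one_le_sqrt.2 hT
  have hsT2 := Real.sq_sqrt (show (0 : ℝ) ≤ c.T by linarith)
  have hsH1 : 1 ≤ √(c.H : ℝ) := Real.one_le_sqrt.2 hH
  have hsH2 := Real.sq_sqrt (show (0 : ℝ) ≤ c.H by linarith)
  set q := c.κu * c.logFactor ^ 2 with hq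
  have hq0 : 0 < q := by linarith
  have hu : ∀ t, c.u t = q * (d : ℝ) ^ 3 * ((c.H : ℝ) ^ 2 * √c.H) / √((t : ℝ) + 1) := fun t => by
    rw [Config.u, rpow_five_halves (by linarith)]
  have hmin : c.uMin = q * (d : ℝ) ^ 3 * ((c.H : ℝ) ^ 2 * √c.H) / √c.T := rfl
  refine ⟨by rw [hmin]; positivity, fun t ht => ?_, ?_, ?_, ?_⟩
  · rw [hu, hmin]
    have ht' : (t : ℝ) + 1 ≤ c.T := by exact_mod_cast ht
    gcongr
  · have e1 : c.uMin * c.T = q * √c.H * √c.T * ((d : ℝ) ^ 3 * (c.H : ℝ) ^ 2) := by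
      rw [hmin]; nth_rewrite 2 [← hsT2]; field_simp
    rw [e1]
    refine le_mul_of_one_le_left (by positivity) ?_
    exact one_le_mul_of_one_le_of_one_le (one_le_mul_of_one_le_of_one_le hκ hsH1) hsT1
  · have e1 : c.uMin ^ 2 * c.T = q ^ 2 * ((d : ℝ) ^ 6 * (c.H : ℝ) ^ 5) := by
      have e2 : ((c.H : ℝ) ^ 2 * √c.H) ^ 2 = (c.H : ℝ) ^ 5 := by rw [mul_pow, hsH2]; ring
      rw [hmin, div_pow, hsT2, mul_pow _ ((c.H : ℝ) ^ 2 * √c.H), e2]; field_simp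
    rw [e1]
    exact le_mul_of_one_le_left (by positivity) (one_le_pow₀ hκ)
  · have e1 : dsum c (fun t _ => c.u t) = c.H * (q * (d : ℝ) ^ 3 * ((c.H : ℝ) ^ 2 * √c.H)) *
        ∑ t ∈ Finset.range c.T, 1 / √((t : ℝ) + 1) := by
      simp only [dsum, Finset.sum_const, Finset.card_range, nsmul_eq_mul, hu, Finset.mul_sum]
      exact Finset.sum_congr rfl fun t _ => by ring
    rw [e1]
    calc _ ≤ c.H * (K ^ 2 * (d : ℝ) ^ 3 * ((c.H : ℝ) ^ 2 * √c.H)) * (2 * √c.T) := by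
          gcongr; exact sum_one_div_sqrt_le c.T
      _ = _ := by ring

/-- Feeds the sums along the run into the three arithmetic lemmas. Each martingale bound `θ X ≤ 4 θ²
(…) + L` is divided by its scale: `θsel` balances the two terms at `√(TH)`, `θbad` makes the first a
fraction of `n u`, and `θwidth` makes it `T / (4 d²)`, so that it survives multiplication by `K d²`.
-/
theorem dsum_gap_le_of_goodRun (S : RunSetting M c Pr D) (R : Rates c K L)
    (Acc : Accurate M c (D ω)) (Gr : GoodRun M c (D ω) L c.θsel c.θbad c.θwidth) :
    dsum c (gap M (D ω)) ≤
      3000 * K ^ 6 * (d * √(c.H * c.T) + (d : ℝ) ^ 6 * (c.H : ℝ) ^ 5) := by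
  obtain ⟨hT, hH, hε⟩ := S.TH_cast
  have hd : (1 : ℝ) ≤ d := by exact_mod_cast S.toLinSetting.one_le_d
  have hK := R.one_le_K
  have hε0 := S.ε_pos
  obtain ⟨hu0, huT, hu1, hu2, hSu⟩ := S.u_bounds R
  have hTH : (1 : ℝ) ≤ c.T * c.H := one_le_mul_of_one_le_of_one_le hT hH
  have hεTH : 8 * c.ε * (c.T * c.H) ≤ 1 := by
    refine le_trans ?_ hε
    have : (c.T : ℝ) * c.H ≤ c.T ^ 2 * c.H := by
      rw [sq, mul_assoc]; exact le_mul_of_one_le_left (by positivity) hT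
    gcongr
  set n : ℝ := ∑ t ∈ Finset.range c.T, (1 - small c (D ω) t c.H) with hn
  have hn0 : 0 ≤ n := Finset.sum_nonneg fun t _ => sub_nonneg.2 (small_le_one _ _ _)
  have hs0 : ∀ t h, 0 ≤ 1 - small c (D ω) t h := fun t h => sub_nonneg.2 (small_le_one _ _ _)
  have hs1 : ∀ t h, 1 - small c (D ω) t h ≤ 1 := fun t h => by linarith [small_nonneg (c := c) (D ω) t h]
  set σ₁ : ℕ → ℕ → ℝ := fun h t => (D ω).sigmaBar c h t
  set σ₂ : ℕ → ℕ → ℝ := fun _ _ => 1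
  have hσ₁ : ∀ h t, 0 < σ₁ h t := fun h t => S.sigmaBar_pos ω h t
  have hσ₁' : ∀ h t, 1 / σ₁ h t ^ 2 ≤ c.T * c.H := fun h t => S.weight_le ω h t
  have hσ₂ : ∀ h t, 0 < σ₂ h t := fun h t => zero_lt_one
  have hσ₂' : ∀ h t, 1 / σ₂ h t ^ 2 ≤ c.T * c.H := fun h t => by simpa [σ₂] using hTH
  have hβ₁ : √(c.β₁ ^ 2 + 1) ^ 2 ≤ K * d := by rw [Real.sq_sqrt (by positivity)]; exact R.β₁_le
  have hβ₂ : √(c.β₂ ^ 2 + 1) ^ 2 ≤ K * d ^ 2 := by rw [Real.sq_sqrt (by positivity)]; exact R.β₂_le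
  have hbon₁ : ∀ t h, bon₁ c (D ω) t h = min 2 (2 * (√(ell c (D ω) σ₁ t h) * √(c.β₁ ^ 2 + 1))) :=
    fun t h => by rw [bon₁, Transcript.b₁, c.bonus_eq]; rfl
  have hbon₂ : ∀ t h, bon₂ c (D ω) t h = min 2 (2 * (√(ell c (D ω) σ₂ t h) * √(c.β₂ ^ 2 + 1))) :=
    fun t h => by rw [bon₂, Transcript.b₂, c.bonus_eq]; rfl
  have hP0 : (0 : ℝ) ≤ c.H * K * d := by positivity
  set SS := dsum c (fun t h => σ₁ h t ^ 2) with hSSdef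
  -- sums of bonuses
  have hB₁ : ∀ w : ℕ → ℕ → ℝ, (∀ t h, 0 ≤ w t h) → (∀ t h, w t h ≤ 1) → ∀ η > 0,
      dsum c (fun t h => w t h * bon₁ c (D ω) t h) ≤ η * dsum c (fun t h => w t h * σ₁ h t ^ 2) +
        K ^ 2 * d ^ 2 * c.H / η + 2 * (c.H * K * d) := fun w hw0 hw1 η hη => by
    simp only [hbon₁]
    refine (S.dsum_bonus_le R (D ω) hσ₁ hσ₁' hw0 hw1 (√(c.β₁ ^ 2 + 1)) hη).trans ?_
    have : √(c.β₁ ^ 2 + 1) ^ 2 * (c.H * K * d) / η ≤ K ^ 2 * d ^ 2 * c.H / η := by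
      refine div_le_div_of_nonneg_right ?_ hη.le
      calc _ ≤ K * d * (c.H * K * d) := mul_le_mul_of_nonneg_right hβ₁ hP0
        _ = _ := by ring
    linarith
  have hB₂ : ∀ w : ℕ → ℕ → ℝ, (∀ t h, 0 ≤ w t h) → (∀ t h, w t h ≤ 1) → ∀ η > 0,
      dsum c (fun t h => w t h * bon₂ c (D ω) t h) ≤ η * dsum c (fun t h => w t h * σ₂ h t ^ 2) +
        K ^ 2 * d ^ 3 * c.H / η + 2 * (c.H * K * d) := fun w hw0 hw1 η hη => by
    simp only [hbon₂]
    refine (S.dsum_bonus_le R (D ω) hσ₂ hσ₂' hw0 hw1 (√(c.β₂ ^ 2 + 1)) hη).trans ?_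
    have : √(c.β₂ ^ 2 + 1) ^ 2 * (c.H * K * d) / η ≤ K ^ 2 * d ^ 3 * c.H / η := by
      refine div_le_div_of_nonneg_right ?_ hη.le
      calc _ ≤ K * d ^ 2 * (c.H * K * d) := mul_le_mul_of_nonneg_right hβ₂ hP0
        _ = _ := by ring
    linarith
  have hB₁all : ∀ η > 0, dsum c (bon₁ c (D ω)) ≤ η * SS + K ^ 2 * d ^ 2 * c.H / η +
      2 * (c.H * K * d) := fun η hη => by
    have := hB₁ (fun _ _ => 1) (fun _ _ => zero_le_one) (fun _ _ => le_rfl) η hη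
    simpa only [one_mul] using this
  have hB₂all : ∀ η > 0, dsum c (bon₂ c (D ω)) ≤ η * (c.T * c.H) + K ^ 2 * d ^ 3 * c.H / η +
      2 * (c.H * K * d) := fun η hη => by
    have := hB₂ (fun _ _ => 1) (fun _ _ => zero_le_one) (fun _ _ => le_rfl) η hη
    simpa only [one_mul, σ₂, one_pow, dsum_const] using this
  have hB₁bad : ∀ η > 0, dsum c (fun t h => (1 - small c (D ω) t h) * bon₁ c (D ω) t h) ≤
      η * (K * d ^ 2 * (n * c.H)) + K ^ 2 * d ^ 2 * c.H / η + 2 * (c.H * K * d) := fun η hη => by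
    refine (hB₁ _ hs0 hs1 η hη).trans ?_
    have h1 : dsum c (fun t h => (1 - small c (D ω) t h) * σ₁ h t ^ 2) ≤ K * d ^ 2 * (n * c.H) :=
      (dsum_le fun t ht h hh => mul_le_mul_of_nonneg_left (S.sigmaBar_sq_le_const R Acc ht hh)
        (hs0 t h)).trans (dsum_one_sub_small_le (D ω) (by positivity))
    have := mul_le_mul_of_nonneg_left h1 hη.le
    linarith
  have hB₂bad : ∀ η > 0, dsum c (fun t h => (1 - small c (D ω) t h) * bon₂ c (D ω) t h) ≤
      η * (n * c.H) + K ^ 2 * d ^ 3 * c.H / η + 2 * (c.H * K * d) := fun η hη => by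
    refine (hB₂ _ hs0 hs1 η hη).trans ?_
    have h1 : dsum c (fun t h => (1 - small c (D ω) t h) * σ₂ h t ^ 2) ≤ n * c.H := by
      simp only [σ₂, one_pow]
      refine (dsum_one_sub_small_le (c := c) (D ω) zero_le_one).trans ?_
      rw [one_mul]
    exact add_le_add_left (add_le_add_left (mul_le_mul_of_nonneg_left h1 hη.le) _) _
  -- episodes in which the overly optimistic functions are followed
  have hθ : 0 < c.θbad := lt_min (by positivity) (by norm_num)
  have hnd : n * ((d : ℝ) ^ 2 * c.H) ≤ 150 * K ^ 3 * c.T := by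
    refine bad_episodes_le hT hH hd hK hn0 hu0 hu1 hu2 (rfl : c.θbad = _)
      (X := dsum c (fun t h => (1 - small c (D ω) t h) * xiSel M c (D ω) t h))
      ((S.bad_le Acc huT).trans (by linarith)) ?_ hB₁bad hB₂bad
    have h1 := Gr.bad
    have h2 := dsum_one_sub_small_le (c := c) (D ω) (b := 4 * c.θbad ^ 2) (by positivity)
    have h3 : dsum c (fun t h => (1 - small c (D ω) t h) * (c.θbad * xiSel M c (D ω) t h)) =
        c.θbad * dsum c (fun t h => (1 - small c (D ω) t h) * xiSel M c (D ω) t h) := by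
      rw [← dsum_mul]; exact dsum_congr fun t _ h _ => by ring
    rw [h3] at h1
    have h4 : c.θbad * dsum c (fun t h => (1 - small c (D ω) t h) * xiSel M c (D ω) t h) ≤
        c.θbad * (4 * c.θbad * (n * c.H) + K / c.θbad) := by
      have h5 : c.θbad * (4 * c.θbad * (n * c.H) + K / c.θbad) =
          4 * c.θbad ^ 2 * (n * c.H) + K := by field_simp
      rw [h5]
      linarith [R.L_le]
    exact le_of_mul_le_mul_left h4 hθ
  -- the sum of the squared weights
  have hSS : SS ≤ 2000 * K ^ 6 * (c.T + (d : ℝ) ^ 10 * (c.H : ℝ) ^ 7) := by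
    have hθw : 0 < c.θwidth := by rw [Config.θwidth]; positivity
    have hXw : dsum c (fun t h => small c (D ω) t h * ((h + 1) * xiWidth M c (D ω) t h)) ≤
        c.T / (4 * d ^ 2) + 16 * K * d ^ 2 * (c.H : ℝ) ^ 3 := by
      have h1 := Gr.width
      rw [dsum_const] at h1
      have h3 : dsum c (fun t h => small c (D ω) t h * (c.θwidth * (h + 1) * xiWidth M c (D ω) t h)) =
          c.θwidth * dsum c (fun t h => small c (D ω) t h * ((h + 1) * xiWidth M c (D ω) t h)) := by
        rw [← dsum_mul]; exact dsum_congr fun t _ h _ => by ring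
      rw [h3] at h1
      refine le_of_mul_le_mul_left (h1.trans ?_) hθw
      have h4 : c.θwidth * (c.T / (4 * d ^ 2) + 16 * K * d ^ 2 * (c.H : ℝ) ^ 3) =
          4 * (c.θwidth * c.H) ^ 2 * (c.T * c.H) + K := by
        rw [Config.θwidth]; field_simp; ring
      rw [h4]
      linarith [R.L_le]
    have hSV := S.dsum_varOpt_le Gr R.L_le R.L_nonneg
    have hu00 : ∀ t < c.T, 0 ≤ c.u t := fun t ht => hu0.le.trans (huT t ht)
    refine sum_weights_le hT hH hd hK hnd (S₁ := dsum c (bon₁ c (D ω)))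
      (S₂ := dsum c (bon₂ c (D ω)))
      (SD := dsum c (fun t h => c.eluderD h ((D ω).past t h) (fun s => σ₂ h s) ((D ω).z t h)))
      (SDb := dsum c (fun t h => c.eluderD h ((D ω).past t h) (fun s => σ₁ h s) ((D ω).z t h)))
      (SΓ := dsum c (fun t h => (D ω).f₂ c t h ((D ω).z t h) - (D ω).fNeg c t h ((D ω).z t h)))
      ?_ hSV ?_ hSu hXw hB₁all hB₂all (fun η hη => ?_) (fun η hη => ?_)
    · have hpt : ∀ t < c.T, ∀ h < c.H, σ₁ h t ^ 2 ≤ (if t = 0 then 4 else 0) +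
          varOpt M h ((D ω).z t h) + c.α ^ 2 + K * d ^ 2 * ((D ω).f₂ c t h ((D ω).z t h) -
          (D ω).fNeg c t h ((D ω).z t h)) + (2 * (K * d) * c.eluderD h ((D ω).past t h)
          (fun s => σ₂ h s) ((D ω).z t h) + 4 * (1 + c.B) * c.ε) +
          K * d ^ 2 * c.eluderD h ((D ω).past t h) (fun s => σ₁ h s) ((D ω).z t h) :=
        fun t ht h hh => by
          have hB := S.toLinSetting.two_le_B
          have hΓ := f₂_sub_fNeg_nonneg Acc ht hh ((D ω).z t h)
          have hD₂ := c.eluderD_nonneg h ((D ω).past t h) (fun s => σ₂ h s) ((D ω).z t h)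
          have hD₁ := c.eluderD_nonneg h ((D ω).past t h) (fun s => σ₁ h s) ((D ω).z t h)
          have hv := S.varOpt_nonneg h ((D ω).z t h)
          have hι := R.ι_le
          have hι2 := sq_nonneg c.ι
          have a1 : (2 * c.ι ^ 2 + 4) * ((D ω).f₂ c t h ((D ω).z t h) -
              (D ω).fNeg c t h ((D ω).z t h)) ≤ K * d ^ 2 * ((D ω).f₂ c t h ((D ω).z t h) -
              (D ω).fNeg c t h ((D ω).z t h)) := mul_le_mul_of_nonneg_right hι hΓ
          have a2 : 4 * (√c.υ + c.ι) ^ 2 * c.eluderD h ((D ω).past t h) (fun s => σ₁ h s)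
              ((D ω).z t h) ≤ K * d ^ 2 * c.eluderD h ((D ω).past t h) (fun s => σ₁ h s)
              ((D ω).z t h) := by
            refine mul_le_mul_of_nonneg_right (le_trans ?_ R.υι_le) hD₁
            refine mul_le_mul_of_nonneg_right (by linarith) (sq_nonneg _)
          have a3 : c.eluderD h ((D ω).past t h) (fun s => σ₂ h s) ((D ω).z t h) *
              (√(c.βbar ^ 2 + 1) + 2 * c.B * √(c.β₂ ^ 2 + 1)) ≤
              c.eluderD h ((D ω).past t h) (fun s => σ₂ h s) ((D ω).z t h) * (K * d) :=
            mul_le_mul_of_nonneg_left R.slack_le hD₂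
          have a4 : 0 ≤ K * d * c.eluderD h ((D ω).past t h) (fun s => σ₂ h s) ((D ω).z t h) := by
            positivity
          have a5 : 0 ≤ 2 * c.ι ^ 2 * ((D ω).f₂ c t h ((D ω).z t h) -
              (D ω).fNeg c t h ((D ω).z t h)) := by positivity
          have a6 : 0 ≤ 4 * (1 + c.B) * c.ε := by positivity
          have a7 : 0 ≤ 4 * (√c.υ + c.ι) ^ 2 * c.eluderD h ((D ω).past t h) (fun s => σ₁ h s)
              ((D ω).z t h) := by positivity
          have a8 := sq_nonneg c.α
          have hsig : (D ω).sigma c t h ^ 2 ≤ (if t = 0 then 4 else 0) +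
              varOpt M h ((D ω).z t h) + 4 * ((D ω).f₂ c t h ((D ω).z t h) -
              (D ω).fNeg c t h ((D ω).z t h)) + (2 * (K * d) * c.eluderD h ((D ω).past t h)
              (fun s => σ₂ h s) ((D ω).z t h) + 4 * (1 + c.B) * c.ε) := by
            split_ifs with ht0
            · linarith [sigma_sq_le_four (c := c) (D ω) t h]
            · have := Acc.sigma_le t ht ht0 h hh
              rw [sigmaSlack] at this
              linarith
          have a9 : (0 : ℝ) ≤ if t = 0 then 4 else 0 := by split_ifs <;> norm_num
          exact sigmaBar_sq_le (D ω) (by linarith) (by linarith) hΓ (by linarith)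
            (a2.trans (by linarith))
      have h1 := dsum_le hpt
      simp only [dsum_add, dsum_mul, dsum_const] at h1
      have h2 : dsum c (fun t _ => if t = 0 then (4 : ℝ) else 0) = 4 * c.H := by
        simp only [dsum, Finset.sum_const, Finset.card_range, nsmul_eq_mul]
        rw [← Finset.mul_sum, Finset.sum_ite_eq' (Finset.range c.T) 0 (fun _ => (4 : ℝ)),
          if_pos (Finset.mem_range.2 S.T_pos)]
        ring
      have h3 : c.α ^ 2 * (c.T * c.H) = 1 := by rw [S.alpha_sq]; field_simp
      have h4 : 4 * (1 + c.B) * c.ε * (c.T * c.H) ≤ 2 * K := by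
        have h5 := R.B_le
        have h6 : 0 ≤ c.ε * (c.T * c.H) := by positivity
        have h7 := mul_le_mul_of_nonneg_right h5 h6
        have h8 := mul_le_mul_of_nonneg_left hεTH (show 0 ≤ K by linarith)
        linarith
      rw [h2, h3] at h1
      linarith
    · have h1 := S.dsum_f₂_sub_fNeg_le Acc hu00
      have h2 := S.dsum_width_le Acc
      have h3 : (c.H : ℝ) * (dsum c (bon₁ c (D ω)) + dsum c (bon₂ c (D ω)) +
          4 * c.ε * (c.T * c.H)) ≤ c.H * (dsum c (bon₁ c (D ω)) + dsum c (bon₂ c (D ω)) + 1) := by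
        gcongr; linarith
      linarith
    · have := S.dsum_eluderD_le R (D ω) hσ₂ hσ₂' hη
      simpa only [σ₂, one_pow, dsum_const, one_mul] using this
    · exact S.dsum_eluderD_le R (D ω) hσ₁ hσ₁' hη
  have hθs : 0 < c.θsel := by rw [Config.θsel]; positivity
  refine sum_gaps_le hT hH hd hK hnd hSS (X := dsum c (xiSel M c (D ω)))
    ((S.dsum_gap_le Acc).trans (by linarith)) ?_ hB₁all hB₂bad
  have h1 := Gr.sel
  rw [dsum_mul, dsum_const] at h1
  refine le_of_mul_le_mul_left (h1.trans ?_) hθs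
  have h2 : √(c.T * c.H : ℝ) ^ 2 = c.T * c.H := Real.sq_sqrt (by positivity)
  have h3 : 0 < √(c.T * c.H : ℝ) := Real.sqrt_pos.2 (by positivity)
  have h4 : 4 * c.θsel ^ 2 * (c.T * c.H) = 1 / 4 := by
    rw [Config.θsel, div_pow, mul_pow, h2]; field_simp
  have h5 : c.θsel * (√(c.T * c.H) * (1 + 4 * K)) = 1 / 4 + K := by
    rw [Config.θsel]; field_simp
  rw [h4, h5]
  linarith [R.L_le]

end RunSetting


/-! ### Probability of the deviation bounds along a run. -/

section Variance

variable {X : Type*} [MeasurableSpace X] {ν : Measure X} [IsProbabilityMeasure ν]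

/-- The mean minimizes the mean square deviation, so the variance of the squared return may be
computed around the square of `Qopt` instead of its own mean. -/
theorem integral_sub_mean_sq_le_sub {Y : X → ℝ} (hY : Measurable Y) {b : ℝ} (hb : ∀ x, |Y x| ≤ b)
    (a : ℝ) : ∫ x, (Y x - ∫ y, Y y ∂ν) ^ 2 ∂ν ≤ ∫ x, (Y x - a) ^ 2 ∂ν := by
  have h1 : Integrable Y ν := integrable_of_bound hY hb
  have hb' : ∀ x, |Y x - a| ≤ b + |a| := fun x => (abs_sub _ _).trans (by linarith [hb x])
  have h2 : ∫ x, (Y x - a) ∂ν = ∫ x, Y x ∂ν - a := by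
    rw [integral_sub h1 (integrable_const _)]; simp
  have h3 := integral_sub_mean_sq_le (ν := ν) (hY.sub_const a) hb'
  rw [h2] at h3
  refine le_trans (le_of_eq ?_) h3
  congr 1
  ext x
  ring

end Variance

namespace RunSetting

variable {X A Ω : Type*} [MeasurableSpace X] [TopologicalSpace A] [PolishSpace A] [CompactSpace A]
  [MeasurableSpace A] [BorelSpace A] [mΩ : MeasurableSpace Ω] {d : ℕ} {M : MDP X A} {c : Config X A d}
  {Pr : Measure Ω} [IsProbabilityMeasure Pr] {D : Ω → Transcript X A} [Nonempty X] [Nonempty A]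
  {K L : ℝ}

theorem measurable_hist_prod {t h : ℕ} {f : Ω × X → ℝ}
    (hf : @Measurable _ _ ((histBefore c.H D t).prod inferInstance) _ f) :
    @Measurable _ _ ((hist c.H D t h).prod inferInstance) _ f :=
  Measurable.mono hf (sup_le_sup (MeasurableSpace.comap_mono (histBefore_le_hist _ _ _)) le_rfl)
    le_rfl

/-- `run_concentration` with the sign reversed, since `dev` is mean minus realization. -/
theorem run_dev (S : RunSetting M c Pr D) {Y : ℕ → ℕ → Ω → X → ℝ} {v : ℕ → ℕ → Ω → ℝ}
    (hY : ∀ t < c.T, ∀ h < c.H, @Measurable _ _ ((hist c.H D t h).prod inferInstance) _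
      (fun p : Ω × X => Y t h p.1 p.2))
    {b : ℝ} (hYb : ∀ t < c.T, ∀ h < c.H, ∀ ω x, |Y t h ω x| ≤ b) (hb : 2 * b ≤ 1)
    (hv : ∀ t < c.T, ∀ h < c.H, Measurable[hist c.H D t h] (v t h))
    (hYv : ∀ t < c.T, ∀ h < c.H, ∀ ω, ∫ x, (Y t h ω x -
      ∫ y, Y t h ω y ∂(M.P h ((D ω).z t h))) ^ 2 ∂(M.P h ((D ω).z t h)) ≤ v t h ω) (L : ℝ) :
    Pr {ω | ¬ dsum c (fun t h => dev M (D ω) t h (Y t h ω)) ≤ dsum c (fun t h => v t h ω) + L} ≤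
      ENNReal.ofReal (Real.exp (-L)) := by
  refine le_trans (measure_mono fun ω hω => ?_) (S.run_concentration (g := fun t h ω x => -Y t h ω x)
    (fun t ht h hh => (hY t ht h hh).neg) (b := b)
    (fun t ht h hh ω x => by rw [abs_neg]; exact hYb t ht h hh ω x) hb hv
    (fun t ht h hh ω => ?_) L)
  · simp only [Set.mem_setOf_eq, not_le] at hω ⊢
    have h1 : dsum c (fun t h => dev M (D ω) t h (Y t h ω) - v t h ω) =
        ∑ t ∈ Finset.range c.T, ∑ h ∈ Finset.range c.H, (-Y t h ω ((D ω).x t (h + 1)) -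
          ∫ y, -Y t h ω y ∂(M.P h ((D ω).z t h)) - v t h ω) :=
      Finset.sum_congr rfl fun t _ => Finset.sum_congr rfl fun h _ => by
        simp only [dev, integral_neg]; ring
    rw [← h1, dsum_sub]
    linarith
  · refine le_trans (le_of_eq ?_) (hYv t ht h hh ω)
    rw [integral_neg]
    congr 1
    ext x
    ring

theorem measurable_valSel (S : RunSetting M c Pr D) {t h : ℕ} (ht : t < c.T) (k : ℕ) :
    @Measurable _ _ ((hist c.H D t h).prod inferInstance) _
      (fun p : Ω × X => valSel c (D p.1) t h k p.2) :=
  @Measurable.ite _ _ _ _ ((hist c.H D t h).prod inferInstance) _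
    (fun p : Ω × X => (D p.1).GapSmall c t h) (Classical.decPred _)
    (@measurable_fst Ω X (hist c.H D t h) _ _ (S.measurableSet_gapSmall ht (h := h)))
    (measurable_hist_prod (S.measurable_val_prod 0 ht k))
    (measurable_hist_prod (S.measurable_val_prod 1 ht k))

theorem measurable_small (S : RunSetting M c Pr D) {t h : ℕ} (ht : t < c.T) :
    Measurable[hist c.H D t h] fun ω => small c (D ω) t h :=
  @Measurable.ite _ _ _ _ (hist c.H D t h) _ (fun ω => (D ω).GapSmall c t h)
    (Classical.decPred _)
    (S.measurableSet_gapSmall ht)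
    (@measurable_const _ _ _ (hist c.H D t h) _) (@measurable_const _ _ _ (hist c.H D t h) _)

theorem measurable_varOpt (S : RunSetting M c Pr D) {h : ℕ} (hh : h < c.H) :
    Measurable (varOpt M h) := by
  have hV := S.toLinSetting.measurable_Vopt (h + 1)
  refine Measurable.sub (measurable_integral_P h (f := fun z x => (M.r h z x + Vopt M (h + 1) x) ^ 2) ?_)
    ((S.toLinSetting.measurable_Qopt (S.horizon ▸ hh)).pow_const 2)
  exact ((M.measurable_r h).add (hV.comp measurable_snd)).pow_const 2

theorem measurable_r_add_Vopt (S : RunSetting M c Pr D) {t h : ℕ} (ht : t < c.T) (hh : h < c.H) :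
    @Measurable _ _ ((hist c.H D t h).prod inferInstance) _
      (fun p : Ω × X => M.r h ((D p.1).z t h) p.2 + Vopt M (h + 1) p.2) := by
  have h1 : @Measurable _ _ ((hist c.H D t h).prod inferInstance) _
      (fun p : Ω × X => ((D p.1).z t h, p.2)) :=
    @Measurable.prodMk _ ((hist c.H D t h).prod inferInstance) _ _ _ _ _ _
      ((S.measurable_z ht hh).comp (@measurable_fst Ω X (hist c.H D t h) _))
      (@measurable_snd Ω X (hist c.H D t h) _)
  exact ((M.measurable_r h).comp h1).add
    ((S.toLinSetting.measurable_Vopt (h + 1)).comp (@measurable_snd Ω X (hist c.H D t h) _))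

theorem abs_integral_sq_le {ν : Measure X} [IsProbabilityMeasure ν] {Y : X → ℝ} (hY : Measurable Y)
    {b : ℝ} (hb : ∀ x, |Y x| ≤ b) : ∫ x, (Y x - ∫ y, Y y ∂ν) ^ 2 ∂ν ≤ b ^ 2 :=
  (integral_sub_mean_sq_le hY hb).trans ((le_abs_self _).trans (abs_integral_le fun x => by
    rw [abs_pow]; exact pow_le_pow_left₀ (abs_nonneg _) (hb x) 2))

/-- Five exponential inequalities. The truncation by `clip` makes the increments bounded on all
outcomes, so no good event is presupposed; the conditions on the scales `θ` are those for increments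
of size at most one. -/
theorem measure_not_goodRun_le (S : RunSetting M c Pr D) {θ₁ θ₂ θ₃ : ℝ} (h₁ : 0 ≤ θ₁)
    (h₁' : 4 * θ₁ ≤ 1) (h₂ : 0 ≤ θ₂) (h₂' : 4 * θ₂ ≤ 1) (h₃ : 0 ≤ θ₃) (h₃' : 4 * (θ₃ * c.H) ≤ 1)
    (L : ℝ) : Pr {ω | ¬ GoodRun M c (D ω) L θ₁ θ₂ θ₃} ≤ 5 * ENNReal.ofReal (Real.exp (-L)) := by
  have hVo := fun h => S.toLinSetting.measurable_Vopt (h + 1)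
  have hVo' : ∀ t h, @Measurable _ _ ((hist c.H D t h).prod inferInstance) _
      (fun p : Ω × X => Vopt M (h + 1) p.2) := fun t h =>
    (hVo h).comp (@measurable_snd Ω X (hist c.H D t h) _)
  have hsel : ∀ t h ω x, |clip (valSel c (D ω) t h (h + 1) x) - Vopt M (h + 1) x| ≤ 2 :=
    fun t h ω x => by
      have h1 := clip_nonneg (valSel c (D ω) t h (h + 1) x)
      have h2 := clip_le_two (valSel c (D ω) t h (h + 1) x)
      have h3 := S.toLinSetting.Vopt_nonneg (h + 1) x
      have h4 := S.toLinSetting.Vopt_le_one (h + 1) x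
      rw [abs_le]; constructor <;> linarith
  have hselm : ∀ t < c.T, ∀ h < c.H, @Measurable _ _ ((hist c.H D t h).prod inferInstance) _
      (fun p : Ω × X => clip (valSel c (D p.1) t h (h + 1) p.2) - Vopt M (h + 1) p.2) :=
    fun t ht h _ => (measurable_clip.comp (S.measurable_valSel ht (h + 1))).sub (hVo' t h)
  have hdm : ∀ ω t h (a : ℝ) (Y : X → ℝ), dev M (D ω) t h (fun x => a * Y x) =
      a * dev M (D ω) t h Y := fun ω t h a Y => by
    rw [dev, dev, integral_const_mul]; ring
  have sect : ∀ (t h : ℕ) (f : Ω → X → ℝ), @Measurable _ _ ((hist c.H D t h).prod inferInstance) _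
      (fun p : Ω × X => f p.1 p.2) → ∀ ω, Measurable (f ω) := fun t h f hf ω => by
    have hp := @measurable_prodMk_left Ω X (hist c.H D t h) inferInstance ω
    simpa only [Function.comp_def] using hf.comp hp
  have e1 := S.run_dev (Y := fun t h ω x => θ₁ * (clip (valSel c (D ω) t h (h + 1) x) -
      Vopt M (h + 1) x)) (v := fun _ _ _ => 4 * θ₁ ^ 2)
    (fun t ht h hh => (hselm t ht h hh).const_mul θ₁) (b := 2 * θ₁)
    (fun t ht h hh ω x => by
      rw [abs_mul, abs_of_nonneg h₁]
      have := mul_le_mul_of_nonneg_left (hsel t h ω x) h₁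
      linarith) (by linarith) (fun t ht h hh => @measurable_const _ _ _ (hist c.H D t h) _)
    (fun t ht h hh ω => by
      have := M.isProbabilityMeasure_P h ((D ω).z t h)
      refine (abs_integral_sq_le (sect t h (fun ω x => θ₁ * (clip (valSel c (D ω) t h (h + 1) x) - Vopt M (h + 1) x))
        ((hselm t ht h hh).const_mul θ₁) ω) (b := 2 * θ₁)
        fun x => ?_).trans (le_of_eq (by ring))
      rw [abs_mul, abs_of_nonneg h₁]
      have := mul_le_mul_of_nonneg_left (hsel t h ω x) h₁
      linarith) L
  have hb2 : ∀ t h ω x, |(1 - small c (D ω) t h) * θ₂ * (clip (valSel c (D ω) t h (h + 1) x) -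
      Vopt M (h + 1) x)| ≤ (1 - small c (D ω) t h) * (2 * θ₂) := fun t h ω x => by
    have hs := sub_nonneg.2 (small_le_one (c := c) (D ω) t h)
    rw [abs_mul, abs_of_nonneg (mul_nonneg hs h₂)]
    have := mul_le_mul_of_nonneg_left (hsel t h ω x) (mul_nonneg hs h₂)
    linarith
  have hm2 : ∀ t < c.T, ∀ h < c.H, @Measurable _ _ ((hist c.H D t h).prod inferInstance) _
      (fun p : Ω × X => (1 - small c (D p.1) t h) * θ₂ *
        (clip (valSel c (D p.1) t h (h + 1) p.2) - Vopt M (h + 1) p.2)) := fun t ht h hh =>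
    ((((S.measurable_small ht).comp (@measurable_fst Ω X (hist c.H D t h) _)).const_sub 1).mul_const
      θ₂).mul (hselm t ht h hh)
  have e2 := S.run_dev (Y := fun t h ω x => (1 - small c (D ω) t h) * θ₂ *
      (clip (valSel c (D ω) t h (h + 1) x) - Vopt M (h + 1) x))
    (v := fun t h ω => (1 - small c (D ω) t h) * (4 * θ₂ ^ 2)) hm2 (b := 2 * θ₂)
    (fun t ht h hh ω x => (hb2 t h ω x).trans
      (mul_le_of_le_one_left (by linarith) (by linarith [small_nonneg (c := c) (D ω) t h])))
    (by linarith) (fun t ht h hh => ((S.measurable_small ht).const_sub 1).mul_const _)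
    (fun t ht h hh ω => by
      have := M.isProbabilityMeasure_P h ((D ω).z t h)
      refine (abs_integral_sq_le (sect t h (fun ω x => (1 - small c (D ω) t h) * θ₂ *
        (clip (valSel c (D ω) t h (h + 1) x) - Vopt M (h + 1) x))
        (hm2 t ht h hh) ω) (hb2 t h ω)).trans (le_of_eq ?_)
      rcases small_eq (c := c) (D ω) t h with ⟨-, h1⟩ | ⟨-, h1⟩ <;> rw [h1] <;> ring) L
  have hH : ∀ h < c.H, (h : ℝ) + 1 ≤ c.H := fun h hh => by exact_mod_cast hh
  have hb3 : ∀ t, ∀ h < c.H, ∀ ω x, |small c (D ω) t h * (θ₃ * (h + 1)) *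
      (clip (val c (D ω) 0 t (h + 1) x) - clip (val c (D ω) 2 t (h + 1) x))| ≤ 2 * (θ₃ * c.H) :=
    fun t h hh ω x => by
      have hs := small_nonneg (c := c) (D ω) t h
      have hs1 := small_le_one (c := c) (D ω) t h
      have h1 : 0 ≤ θ₃ * ((h : ℝ) + 1) := by positivity
      have h2 : |clip (val c (D ω) 0 t (h + 1) x) - clip (val c (D ω) 2 t (h + 1) x)| ≤ 2 := by
        have a1 := clip_nonneg (val c (D ω) 0 t (h + 1) x)
        have a2 := clip_le_two (val c (D ω) 0 t (h + 1) x)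
        have a3 := clip_nonneg (val c (D ω) 2 t (h + 1) x)
        have a4 := clip_le_two (val c (D ω) 2 t (h + 1) x)
        rw [abs_le]; constructor <;> linarith
      rw [abs_mul, abs_of_nonneg (mul_nonneg hs h1)]
      calc _ ≤ (1 * (θ₃ * c.H)) * 2 := by gcongr; exact hH h hh
        _ = _ := by ring
  have hm3 : ∀ t < c.T, ∀ h < c.H, @Measurable _ _ ((hist c.H D t h).prod inferInstance) _
      (fun p : Ω × X => small c (D p.1) t h * (θ₃ * (h + 1)) *
        (clip (val c (D p.1) 0 t (h + 1) p.2) - clip (val c (D p.1) 2 t (h + 1) p.2))) :=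
    fun t ht h hh =>
    (((S.measurable_small ht).comp (@measurable_fst Ω X (hist c.H D t h) _)).mul_const _).mul
      ((measurable_clip.comp (measurable_hist_prod (S.measurable_val_prod 0 ht (h + 1)))).sub
      (measurable_clip.comp (measurable_hist_prod (S.measurable_val_prod 2 ht (h + 1)))))
  have e3 := S.run_dev (Y := fun t h ω x => small c (D ω) t h * (θ₃ * (h + 1)) *
      (clip (val c (D ω) 0 t (h + 1) x) - clip (val c (D ω) 2 t (h + 1) x)))
    (v := fun _ _ _ => 4 * (θ₃ * c.H) ^ 2) hm3 (b := 2 * (θ₃ * c.H))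
    (fun t ht h hh ω x => hb3 t h hh ω x)
    (by linarith) (fun t ht h hh => @measurable_const _ _ _ (hist c.H D t h) _)
    (fun t ht h hh ω => by
      have := M.isProbabilityMeasure_P h ((D ω).z t h)
      exact (abs_integral_sq_le (sect t h (fun ω x => small c (D ω) t h * (θ₃ * (h + 1)) *
        (clip (val c (D ω) 0 t (h + 1) x) - clip (val c (D ω) 2 t (h + 1) x)))
        (hm3 t ht h hh) ω) (hb3 t h hh ω)).trans
        (le_of_eq (by ring))) L
  have hvm : ∀ t < c.T, ∀ h < c.H, Measurable[hist c.H D t h] fun ω => varOpt M h ((D ω).z t h) :=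
    fun t ht h hh => (S.measurable_varOpt hh).comp (S.measurable_z ht hh)
  have hrm := fun t ht h hh => S.measurable_r_add_Vopt (t := t) (h := h) ht hh
  have e4 := S.run_dev (Y := fun t h ω x => -(1 / 24) * (M.r h ((D ω).z t h) x + Vopt M (h + 1) x))
    (v := fun t h ω => (1 / 24) ^ 2 * varOpt M h ((D ω).z t h))
    (fun t ht h hh => (hrm t ht h hh).const_mul _) (b := 1 / 12)
    (fun t ht h hh ω x => by
      rw [abs_mul, abs_neg, abs_of_pos (by norm_num)]
      linarith [S.abs_r_add_Vopt_le h ((D ω).z t h) x])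
    (by norm_num) (fun t ht h hh => (hvm t ht h hh).const_mul _)
    (fun t ht h hh ω => by
      rw [← S.integral_sq_eq_varOpt, ← integral_const_mul, integral_const_mul]
      refine le_of_eq (integral_congr_ae (Filter.Eventually.of_forall fun x => ?_))
      dsimp only
      ring) L
  have e5 := S.run_dev (Y := fun t h ω x => 1 / 24 * (M.r h ((D ω).z t h) x + Vopt M (h + 1) x) ^ 2)
    (v := fun t h ω => (1 / 24) ^ 2 * (9 * varOpt M h ((D ω).z t h)))
    (fun t ht h hh => ((hrm t ht h hh).pow_const 2).const_mul _) (b := 1 / 6)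
    (fun t ht h hh ω x => by
      rw [abs_mul, abs_of_pos (by norm_num), abs_pow]
      have := pow_le_pow_left₀ (abs_nonneg _) (S.abs_r_add_Vopt_le h ((D ω).z t h) x) 2
      linarith)
    (by norm_num) (fun t ht h hh => ((hvm t ht h hh).const_mul _).const_mul _)
    (fun t ht h hh ω => by
      have hp := M.isProbabilityMeasure_P h ((D ω).z t h)
      set z := (D ω).z t h
      have hYm : Measurable fun x => M.r h z x + Vopt M (h + 1) x :=
        (M.measurable_r_apply h z).add (hVo h)
      have hYb := S.abs_r_add_Vopt_le h z
      refine (integral_sub_mean_sq_le_sub (b := 1 / 6) ((hYm.pow_const 2).const_mul _) (fun x => by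
        rw [abs_mul, abs_of_pos (by norm_num), abs_pow]
        have := pow_le_pow_left₀ (abs_nonneg _) (hYb x) 2
        linarith) (1 / 24 * Qopt M h z ^ 2)).trans ?_
      rw [← S.integral_sq_eq_varOpt, ← integral_const_mul, ← integral_const_mul]
      have hQ0 := S.toLinSetting.Qopt_nonneg h z
      have hQ1 := S.toLinSetting.Qopt_le_one (S.horizon ▸ hh) z
      change ∫ x, _ ∂_ ≤ ∫ x, (1 / 24) ^ 2 * (9 * (M.r h z x + Vopt M (h + 1) x - Qopt M h z) ^ 2) ∂_
      have hY0 : ∀ x, 0 ≤ M.r h z x + Vopt M (h + 1) x := fun x =>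
        add_nonneg (M.r_mem h z x).1 (S.toLinSetting.Vopt_nonneg (h + 1) x)
      have hY2 : ∀ x, M.r h z x + Vopt M (h + 1) x ≤ 2 := fun x => (le_abs_self _).trans (hYb x)
      -- The difference of squares has the factor `y + q ≤ 3`, which gives the `9` in the
      -- compensator.
      have hpt : ∀ x, (1 / 24 * (M.r h z x + Vopt M (h + 1) x) ^ 2 - 1 / 24 * Qopt M h z ^ 2) ^ 2 ≤
          (1 / 24) ^ 2 * (9 * (M.r h z x + Vopt M (h + 1) x - Qopt M h z) ^ 2) := fun x => by
        have a1 := hY0 x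
        have a2 := hY2 x
        set y := M.r h z x + Vopt M (h + 1) x
        set q := Qopt M h z
        have a3 : (y + q) ^ 2 ≤ 9 := by nlinarith
        have a4 := mul_le_mul_of_nonneg_right a3 (sq_nonneg (y - q))
        have a5 : (1 / 24 * y ^ 2 - 1 / 24 * q ^ 2) ^ 2 = (1 / 24) ^ 2 * ((y + q) ^ 2 * (y - q) ^ 2) := by
          ring
        rw [a5]
        linarith
      have hbound : ∀ x, |(1 / 24) ^ 2 * (9 * (M.r h z x + Vopt M (h + 1) x - Qopt M h z) ^ 2)| ≤ 1 :=
        fun x => by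
          have a1 := hY0 x
          have a2 := hY2 x
          set y := M.r h z x + Vopt M (h + 1) x
          set q := Qopt M h z
          have a3 : (y - q) ^ 2 ≤ 4 := by nlinarith
          rw [abs_of_nonneg (by positivity)]
          linarith
      refine integral_mono (integrable_of_bound (b := 1)
        ((((hYm.pow_const 2).const_mul _).sub_const _).pow_const 2) fun x => ?_)
        (integrable_of_bound ((((hYm.sub_const _).pow_const 2).const_mul _).const_mul _) hbound) hpt
      rw [abs_of_nonneg (sq_nonneg _)]
      exact (hpt x).trans ((le_abs_self _).trans (hbound x))) L
  refine (measure_mono fun ω hω => ?_).trans ((measure_union_le _ _).trans ((add_le_add e1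
    ((measure_union_le _ _).trans (add_le_add e2 ((measure_union_le _ _).trans (add_le_add e3
    ((measure_union_le _ _).trans (add_le_add e4 e5))))))).trans (le_of_eq (by ring))))
  by_contra hcon
  refine hω ?_
  simp only [Set.mem_union, Set.mem_setOf_eq, not_or, not_not, hdm] at hcon
  obtain ⟨a1, a2, a3, a4, a5⟩ := hcon
  exact ⟨a1, by simpa only [mul_assoc, xiSel] using a2, by simpa only [mul_assoc, xiWidth] using a3,
    (dsum_congr fun t _ h _ => by rw [dev, Qopt, bellman]; ring).trans_le a4, a5⟩

end RunSetting


/-! ### Union bounds for the regressions. -/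

theorem measure_not_forall_le {Ω ι : Type*} [MeasurableSpace Ω] {Pr : Measure Ω} (s : Finset ι)
    {n : ℕ} (hs : s.card ≤ n) {P : ι → Ω → Prop} {a : ℝ≥0∞}
    (h : ∀ i ∈ s, Pr {ω | ¬ P i ω} ≤ a) : Pr {ω | ¬ ∀ i ∈ s, P i ω} ≤ n * a := by
  have h1 : {ω | ¬ ∀ i ∈ s, P i ω} ⊆ ⋃ i ∈ s, {ω | ¬ P i ω} := fun ω hω => by
    simp only [Set.mem_setOf_eq, not_forall] at hω
    obtain ⟨i, hi, h2⟩ := hω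
    exact Set.mem_biUnion hi h2
  refine (measure_mono h1).trans ((measure_biUnion_finset_le s _).trans ?_)
  refine (Finset.sum_le_card_nsmul s _ a h).trans ?_
  rw [nsmul_eq_mul]
  gcongr

namespace RunSetting

variable {X A Ω : Type*} [MeasurableSpace X] [TopologicalSpace A] [PolishSpace A] [CompactSpace A]
  [MeasurableSpace A] [BorelSpace A] [mΩ : MeasurableSpace Ω] {d : ℕ} {M : MDP X A} {c : Config X A d}
  {Pr : Measure Ω} [IsProbabilityMeasure Pr] {D : Ω → Transcript X A} [Nonempty X] [Nonempty A]
  {L : ℝ}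

/-- A failure of `RegBound` includes its premise for every `s < n`, and then the switched sum of
`regression_concentration` is the full sum. -/
theorem measure_not_regBound_le (S : RunSetting M c Pr D) {h n : ℕ} (hh : h < c.H) (hn : n ≤ c.T)
    {σ : Ω → ℕ → ℝ} (hσ : ∀ s < n, Measurable[hist c.H D s h] fun ω => σ ω s) {e : X × A → ℝ}
    (he : Measurable e) {Y : X × A → X → ℝ} (hY : Measurable (Function.uncurry Y)) {b : ℝ}
    (hYb : ∀ z x, |Y z x| ≤ b) {ρ R θ : ℝ} (hρ : 0 ≤ ρ) (hR : 0 ≤ R) (hθ : 0 < θ)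
    (hθR : θ * R * (2 * b) ≤ 1) (L : ℝ) :
    Pr {ω | ¬ RegBound M (D ω) h n (σ ω) e Y ρ R θ L} ≤ ENNReal.ofReal (Real.exp (-L)) := by
  refine le_trans (measure_mono fun ω hω => ?_) (S.regression_concentration hh hn
    (σ := fun s ω => σ ω s) hσ he hY hYb hρ hR hθ hθR L)
  simp only [RegBound, Set.mem_setOf_eq, Classical.not_imp, not_le] at hω ⊢
  obtain ⟨h1, h2⟩ := hω
  rw [Finset.sum_congr rfl fun s hs => if_pos (h1 s (Finset.mem_range.1 hs))]
  exact h2.le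

/-- Union over levels, episodes, pairs of functions, the net (except for the fixed function `V⋆`),
and powers or dyadic scales. The hypothesis `√La ≤ ι²` bounds the increments of the second family by
one. -/
theorem measure_not_goodRegression_le (S : RunSetting M c Pr D) {𝒱 : ℕ → Finset (X → ℝ)}
    (h𝒱 : ∀ h, ∀ V ∈ 𝒱 h, Measurable V ∧ ∀ x, 0 ≤ V x ∧ V x ≤ 2) {nV : ℕ}
    (hcard : ∀ h, (𝒱 h).card ≤ nV) {N : ℕ} (hN : ∀ h < c.H, (c.F h).card ≤ N) (hι : 1 ≤ c.ι)
    {Lb La : ℝ} (hLa : 1 ≤ La) (hLaι : √La ≤ c.ι ^ 2) (K : ℕ) :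
    Pr {ω | ¬ GoodRegression M c (D ω) 𝒱 Lb La K} ≤
      c.H * (c.T * (N * (N * (nV * (2 * ENNReal.ofReal (Real.exp (-Lb))))))) +
      (c.H * (c.T * (N * (N * ((K + 1 : ℕ) * ENNReal.ofReal (Real.exp (-La)))))) +
      c.H * (c.T * (N * (N * (nV * ((K + 1 : ℕ) * ENNReal.ofReal (Real.exp (-Lb)))))))) := by
  have hB := S.two_le_B
  have hι2 : 1 ≤ c.ι ^ 2 := one_le_pow₀ hι
  have hF : ∀ h < c.H, ∀ f ∈ c.F h, ∀ f' ∈ c.F h, Measurable fun z => f z - f' z :=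
    fun h hh f hf f' hf' => (S.measurable_mem hh f hf).sub (S.measurable_mem hh f' hf')
  have hVo := fun h => S.toLinSetting.measurable_Vopt (h + 1)
  have hT : ∀ {P : ℕ → Ω → Prop} {a : ℝ≥0∞}, (∀ n < c.T, Pr {ω | ¬ P n ω} ≤ a) →
      Pr {ω | ¬ ∀ n < c.T, P n ω} ≤ c.T * a := fun {P a} h1 => by
    simpa only [Finset.mem_range] using measure_not_forall_le (Finset.range c.T)
      (Finset.card_range _).le (P := P) fun n hn => h1 n (Finset.mem_range.1 hn)
  have hH : ∀ {P : ℕ → Ω → Prop} {a : ℝ≥0∞}, (∀ n < c.H, Pr {ω | ¬ P n ω} ≤ a) →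
      Pr {ω | ¬ ∀ n < c.H, P n ω} ≤ c.H * a := fun {P a} h1 => by
    simpa only [Finset.mem_range] using measure_not_forall_le (Finset.range c.H)
      (Finset.card_range _).le (P := P) fun n hn => h1 n (Finset.mem_range.1 hn)
  have e1 := hH fun h hh => hT fun n hn => measure_not_forall_le (c.F h) (hN h hh) fun f hf =>
    measure_not_forall_le (c.F h) (hN h hh) fun f' hf' =>
    measure_not_forall_le (𝒱 (h + 1)) (hcard (h + 1)) fun V hV =>
    measure_not_forall_le ({1, 2} : Finset ℕ) (n := 2) (by simp) fun p hp =>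
    S.measure_not_regBound_le hh hn.le (σ := fun _ _ => 1) (e := fun z => f z - f' z)
      (Y := fun z x => (M.r h z x + V x) ^ p) (b := 9) (ρ := 81) (R := 2 * c.B)
      (θ := 1 / (324 * c.B))
      (fun s _ => @measurable_const _ _ _ (hist c.H D s h) _) (hF h hh f hf f' hf')
      (((M.measurable_r h).add ((h𝒱 _ V hV).1.comp measurable_snd)).pow_const p)
      (fun z x => by
        have h1 := (h𝒱 _ V hV).2 x
        have h2 := M.r_mem h z x
        have h3 : 0 ≤ M.r h z x + V x := by linarith [h2.1]
        have h4 : M.r h z x + V x ≤ 3 := by linarith [h2.2]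
        rw [abs_of_nonneg (pow_nonneg h3 _)]
        simp only [Finset.mem_insert, Finset.mem_singleton] at hp
        rcases hp with rfl | rfl
        · linarith
        · nlinarith) (by norm_num) (by linarith) (by positivity)
      (by
        have h1 : 1 / (324 * c.B) * (2 * c.B) * (2 * 9) = 1 / 9 := by field_simp; norm_num
        rw [h1]; norm_num) Lb
  have hσ : ∀ h < c.H, ∀ n < c.T, ∀ s < n, Measurable[hist c.H D s h]
      fun ω => (D ω).sigmaBar c h s := fun h hh n hn s hs => S.measurable_sigmaBar hh s (hs.trans hn)
  have e2 := hH fun h hh => hT fun n hn => measure_not_forall_le (c.F h) (hN h hh) fun f hf =>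
    measure_not_forall_le (c.F h) (hN h hh) fun f' hf' =>
    measure_not_forall_le (Finset.range (K + 1)) (Finset.card_range _).le fun k hk =>
    S.measure_not_regBound_le hh hn.le (σ := fun ω => (D ω).sigmaBar c h) (e := fun z => f z - f' z)
      (Y := fun z x => M.r h z x + Vopt M (h + 1) x) (b := 2) (ρ := 1) (R := 2 ^ k / (4 * c.ι ^ 2))
      (θ := √La / 2 ^ k) (hσ h hh n hn) (hF h hh f hf f' hf')
      ((M.measurable_r h).add ((hVo h).comp measurable_snd)) (S.abs_r_add_Vopt_le h)
      (by norm_num) (by positivity) (by positivity)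
      (by
        have h1 : √La / 2 ^ k * (2 ^ k / (4 * c.ι ^ 2)) * (2 * 2) = √La / c.ι ^ 2 := by
          field_simp; norm_num
        rw [h1]
        exact div_le_one_of_le₀ hLaι (by positivity)) La
  have e3 := hH fun h hh => hT fun n hn => measure_not_forall_le (c.F h) (hN h hh) fun f hf =>
    measure_not_forall_le (c.F h) (hN h hh) fun f' hf' =>
    measure_not_forall_le (𝒱 (h + 1)) (hcard (h + 1)) fun V hV =>
    measure_not_forall_le (Finset.range (K + 1)) (Finset.card_range _).le fun k hk =>
    S.measure_not_regBound_le hh hn.le (σ := fun ω => (D ω).sigmaBar c h) (e := fun z => f z - f' z)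
      (Y := fun _ x => V x - Vopt M (h + 1) x) (b := 2) (ρ := 2 / c.ι ^ 2)
      (R := 2 ^ k / (4 * c.ι ^ 2)) (θ := c.ι ^ 2 / 2 ^ k) (hσ h hh n hn) (hF h hh f hf f' hf')
      (((h𝒱 _ V hV).1.sub (hVo h)).comp measurable_snd)
      (fun z x => by
        have h1 := (h𝒱 _ V hV).2 x
        have h3 := S.toLinSetting.Vopt_nonneg (h + 1) x
        have h4 := S.toLinSetting.Vopt_le_one (h + 1) x
        rw [abs_le]; constructor <;> linarith)
      (by positivity) (by positivity) (by positivity)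
      (le_of_eq (by field_simp; norm_num)) Lb
  refine (measure_mono fun ω hω => ?_).trans ((measure_union_le _ _).trans (add_le_add e1
    ((measure_union_le _ _).trans (add_le_add e2 e3))))
  by_contra hcon
  simp only [Set.mem_union, Set.mem_setOf_eq, not_or, not_not] at hcon
  exact hω ⟨hcon.1, hcon.2.1, hcon.2.2⟩

end RunSetting


/-! ### Conditional expectations, and the passage from gaps to regret. -/

section CondExp

variable {Ω X : Type*} {m mΩ : MeasurableSpace Ω} [mX : MeasurableSpace X] {Pr : Measure Ω}
  [IsProbabilityMeasure Pr]

/-- The measures with densities `F` and its conditional expectation agree on `m`, hence so do the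
integrals of an `m`-measurable weight; no integrability of the product is needed. -/
theorem lintegral_mul_condExp (hm : m ≤ mΩ) {W : Ω → ℝ≥0∞} (hW : Measurable[m] W) {F : Ω → ℝ}
    (hF : Measurable F) (hFi : Integrable F Pr) (hF0 : ∀ ω, 0 ≤ F ω) :
    ∫⁻ ω, W ω * ENNReal.ofReal (F ω) ∂Pr =
      ∫⁻ ω, W ω * ENNReal.ofReal (condExp m Pr F ω) ∂Pr := by
  have hc : Measurable (condExp m Pr F) := (stronglyMeasurable_condExp.mono hm).measurable
  have hc0 : 0 ≤ᵐ[Pr] condExp m Pr F := condExp_nonneg (Filter.Eventually.of_forall hF0)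
  have key : ∀ (G : Ω → ℝ) (_ : Measurable G), ∫⁻ ω, W ω * ENNReal.ofReal (G ω) ∂Pr =
      ∫⁻ ω, W ω ∂((Pr.withDensity fun ω => ENNReal.ofReal (G ω)).trim hm) := fun G hG => by
    rw [lintegral_trim hm hW,
      lintegral_withDensity_eq_lintegral_mul Pr hG.ennreal_ofReal (hW.mono hm le_rfl)]
    simp only [Pi.mul_apply, mul_comm]
  rw [key F hF, key _ hc]
  congr 1
  refine @Measure.ext _ m _ _ fun s hs => ?_
  rw [trim_measurableSet_eq hm hs, trim_measurableSet_eq hm hs, withDensity_apply _ (hm s hs),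
    withDensity_apply _ (hm s hs),
    ← ofReal_integral_eq_lintegral_ofReal hFi.integrableOn (Filter.Eventually.of_forall hF0),
    ← ofReal_integral_eq_lintegral_ofReal integrable_condExp.integrableOn (ae_restrict_of_ae hc0),
    setIntegral_condExp hm hFi hs]

/-- The conditional expectation of a nonnegative function is a supermartingale compensator. -/
theorem expSuper_condExp (hm : m ≤ mΩ) {G : Ω → ℝ} (hG : Measurable G) (hG0 : ∀ ω, 0 ≤ G ω)
    (hG1 : ∀ ω, G ω ≤ 1 / 2) : ExpSuper Pr m fun ω => condExp m Pr G ω / 2 - G ω := by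
  intro Z hZ
  have hGi : Integrable G Pr := integrable_of_bound hG (b := 1) fun ω => by
    rw [abs_of_nonneg (hG0 ω)]; linarith [hG1 ω]
  have hg : Measurable[m] (condExp m Pr G) := stronglyMeasurable_condExp.measurable
  have hW : Measurable[m] fun ω => Z ω * ENNReal.ofReal (Real.exp (condExp m Pr G ω / 2)) :=
    hZ.mul (Real.measurable_exp.comp (hg.div_const 2)).ennreal_ofReal
  have hF : Measurable fun ω => 1 - G ω / 2 := (hG.div_const 2).const_sub 1
  have hce : condExp m Pr (fun ω => 1 - G ω / 2) =ᵐ[Pr] fun ω => 1 - condExp m Pr G ω / 2 := by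
    have h1 := condExp_sub (m := m) (integrable_const (μ := Pr) (1 : ℝ)) (hGi.div_const 2)
    have h2 := condExp_smul (m := m) (μ := Pr) (1 / 2 : ℝ) G
    have h3 : (fun ω => G ω / 2) = (1 / 2 : ℝ) • G := by
      ext ω; simp only [Pi.smul_apply, smul_eq_mul]; ring
    rw [← h3] at h2
    filter_upwards [h1, h2] with ω h4 h5
    have h6 : condExp m Pr (fun ω => 1 - G ω / 2) ω =
      condExp m Pr ((fun _ => (1 : ℝ)) - fun ω => G ω / 2) ω := rfl
    rw [h6, h4, Pi.sub_apply, h5, condExp_const hm]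
    simp only [Pi.smul_apply, smul_eq_mul]; ring
  calc ∫⁻ ω, Z ω * ENNReal.ofReal (Real.exp (condExp m Pr G ω / 2 - G ω)) ∂Pr
      ≤ ∫⁻ ω, Z ω * ENNReal.ofReal (Real.exp (condExp m Pr G ω / 2)) *
          ENNReal.ofReal (1 - G ω / 2) ∂Pr := by
        -- For `0 ≤ y ≤ 1/2` one has `e^(-y) ≤ 1 - y + y² ≤ 1 - y/2`. Given the past, the mean of `1
        -- - G/2` is at most the exponential of minus half the conditional mean of `G`.
        refine lintegral_mono fun ω => ?_
        rw [mul_assoc, ← ENNReal.ofReal_mul (Real.exp_pos _).le]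
        gcongr
        rw [sub_eq_add_neg, Real.exp_add]
        refine mul_le_mul_of_nonneg_left ?_ (Real.exp_pos _).le
        have h1 := hG0 ω
        have h2 := hG1 ω
        have h3 := abs_le.1 (Real.abs_exp_sub_one_sub_id_le (x := -G ω)
          (by rw [abs_neg, abs_of_nonneg h1]; linarith))
        nlinarith
    _ = ∫⁻ ω, Z ω * ENNReal.ofReal (Real.exp (condExp m Pr G ω / 2)) *
          ENNReal.ofReal (condExp m Pr (fun ω => 1 - G ω / 2) ω) ∂Pr :=
        lintegral_mul_condExp hm hW hF ((integrable_const 1).sub (hGi.div_const 2))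
          fun ω => by linarith [hG1 ω]
    _ ≤ ∫⁻ ω, Z ω ∂Pr := by
        refine lintegral_mono_ae ?_
        filter_upwards [hce] with ω h1
        rw [h1, mul_assoc, ← ENNReal.ofReal_mul (Real.exp_pos _).le]
        refine mul_le_of_le_one_right zero_le (ENNReal.ofReal_le_one.2 ?_)
        have h2 := Real.add_one_le_exp (-(condExp m Pr G ω / 2))
        calc _ ≤ Real.exp (condExp m Pr G ω / 2) * Real.exp (-(condExp m Pr G ω / 2)) :=
              mul_le_mul_of_nonneg_left (by linarith) (Real.exp_pos _).le
          _ = 1 := by rw [← Real.exp_add]; simp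

/-- After adding the bound `b` the integrands are nonnegative, and `lintegral_condLaw` computes the
integral over every past event. -/
theorem condExp_of_condLaw (hm : m ≤ mΩ) {ξ : Ω → X} (hξ : Measurable ξ) (κ : @Kernel Ω X m _)
    (hκ : @IsMarkovKernel Ω X m _ κ)
    (h : ∀ S, MeasurableSet S →
      condExp m Pr (fun ω => S.indicator (fun _ => (1 : ℝ)) (ξ ω)) =ᵐ[Pr] fun ω => (κ ω).real S)
    {g : Ω → X → ℝ} (hg : @Measurable _ _ (m.prod mX) _ (Function.uncurry g)) {b : ℝ}
    (hb : ∀ ω x, |g ω x| ≤ b)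
    (hgi : Measurable[m] fun ω => ∫ x, g ω x ∂κ ω) :
    condExp m Pr (fun ω => g ω (ξ ω)) =ᵐ[Pr] fun ω => ∫ x, g ω x ∂κ ω := by
  have hp : ∀ ω, IsProbabilityMeasure (κ ω) := fun ω => hκ.isProbabilityMeasure ω
  have hgω : ∀ ω, Measurable (g ω) := fun ω => by
    have h1 := @measurable_prodMk_left Ω X m mX ω
    exact hg.comp h1
  have hmk : @Measurable _ _ mΩ (m.prod mX) fun ω => (ω, ξ ω) :=
    @Measurable.prodMk _ mΩ _ _ m _ _ _ (measurable_id'' hm) hξ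
  have hgξ : Measurable fun ω => g ω (ξ ω) := hg.comp hmk
  have hgξi : Integrable (fun ω => g ω (ξ ω)) Pr := integrable_of_bound hgξ fun ω => hb _ _
  have hIb : ∀ ω, |∫ x, g ω x ∂κ ω| ≤ b := fun ω => RunSetting.abs_integral_le (hb ω)
  have hIi : Integrable (fun ω => ∫ x, g ω x ∂κ ω) Pr :=
    integrable_of_bound (hgi.mono hm le_rfl) hIb
  have hpos : ∀ ω x, 0 ≤ g ω x + b := fun ω x => by linarith [(abs_le.1 (hb ω x)).1]
  refine (ae_eq_condExp_of_forall_setIntegral_eq hm hgξi (fun s _ _ => hIi.integrableOn)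
    (fun s hs _ => ?_) hgi.stronglyMeasurable.aestronglyMeasurable).symm
  have hfst : @Measurable _ _ (m.prod mX) m (Prod.fst : Ω × X → Ω) := @measurable_fst _ _ m _
  have hmeas : @Measurable _ _ (m.prod mX) _ fun p : Ω × X =>
      (s.indicator (fun _ => (1 : ℝ≥0∞)) p.1) * ENNReal.ofReal (g p.1 p.2 + b) :=
    ((measurable_const.indicator hs).comp hfst).mul (hg.add_const b).ennreal_ofReal
  have h1 := lintegral_condLaw hm hξ κ hκ h hmeas
  have h2 : ∀ ω, ∫⁻ x, s.indicator (fun _ => (1 : ℝ≥0∞)) ω * ENNReal.ofReal (g ω x + b) ∂κ ω =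
      s.indicator (fun _ => (1 : ℝ≥0∞)) ω * ENNReal.ofReal (∫ x, g ω x ∂κ ω + b) := fun ω => by
    rw [lintegral_const_mul _ ((hgω ω).add_const b).ennreal_ofReal,
      ← ofReal_integral_eq_lintegral_ofReal (f := fun x => g ω x + b)
        ((integrable_of_bound (hgω ω) (hb ω)).add (integrable_const b))
        (Filter.Eventually.of_forall (hpos ω)),
      integral_add (integrable_of_bound (hgω ω) (hb ω)) (integrable_const b)]
    simp
  simp only [h2] at h1
  have h3 : ∀ F : Ω → ℝ, Integrable F Pr → (∀ ω, 0 ≤ F ω + b) →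
      ∫⁻ ω, s.indicator (fun _ => (1 : ℝ≥0∞)) ω * ENNReal.ofReal (F ω + b) ∂Pr =
        ENNReal.ofReal (∫ ω in s, (F ω + b) ∂Pr) := fun F hF h0 => by
    rw [ofReal_integral_eq_lintegral_ofReal (f := fun ω => F ω + b) (hF.add (integrable_const b)).integrableOn
      (Filter.Eventually.of_forall h0), ← lintegral_indicator (hm s hs)]
    refine lintegral_congr fun ω => ?_
    by_cases hω : ω ∈ s <;> simp [hω]
  have h0' : ∀ ω, 0 ≤ ∫ x, g ω x ∂κ ω + b := fun ω => by linarith [(abs_le.1 (hIb ω)).1]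
  rw [h3 _ hgξi fun ω => hpos _ _, h3 _ hIi h0', ENNReal.ofReal_eq_ofReal_iff
    (integral_nonneg fun ω => hpos _ _) (integral_nonneg h0'),
    integral_add hgξi.integrableOn (integrable_const b),
    integral_add hIi.integrableOn (integrable_const b)] at h1
  linarith

end CondExp

namespace RunSetting

variable {X A Ω : Type*} [MeasurableSpace X] [TopologicalSpace A] [PolishSpace A] [CompactSpace A]
  [MeasurableSpace A] [BorelSpace A] [mΩ : MeasurableSpace Ω] {d : ℕ} {M : MDP X A} {c : Config X A d}
  {Pr : Measure Ω} [IsProbabilityMeasure Pr] {D : Ω → Transcript X A} [Nonempty X] [Nonempty A]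

theorem measurable_reward (S : RunSetting M c Pr D) {t h : ℕ} (ht : t < c.T) (hh : h < c.H) :
    Measurable fun ω => M.r h ((D ω).z t h) ((D ω).x t (h + 1)) :=
  (M.measurable_r h).comp (((S.measurable_z ht hh).mono (S.hist_le ht hh.le) le_rfl).prodMk
    (S.run.measurable_x t ht (h + 1) hh))

theorem integrable_reward (S : RunSetting M c Pr D) {t h : ℕ} (ht : t < c.T) (hh : h < c.H) :
    Integrable (fun ω => M.r h ((D ω).z t h) ((D ω).x t (h + 1))) Pr :=
  integrable_of_bound (S.measurable_reward ht hh) (b := 1) fun ω => by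
    have h1 := M.r_mem h ((D ω).z t h) ((D ω).x t (h + 1))
    rw [abs_of_nonneg h1.1]; exact h1.2

theorem measurable_gap (S : RunSetting M c Pr D) {t h : ℕ} (ht : t < c.T) (hh : h < c.H) :
    Measurable[hist c.H D t h] fun ω => gap M (D ω) t h :=
  ((S.toLinSetting.measurable_Vopt h).comp (measurable_x_hist c.H t le_rfl)).sub
    ((S.toLinSetting.measurable_Qopt (S.horizon ▸ hh)).comp (S.measurable_z ht hh))

theorem gap_le_one (S : RunSetting M c Pr D) (ω : Ω) (h t : ℕ) : gap M (D ω) t h ≤ 1 := by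
  have h1 := S.toLinSetting.Vopt_le_one h ((D ω).x t h)
  have h2 := S.toLinSetting.Qopt_nonneg h ((D ω).z t h)
  rw [gap]; linarith

theorem condExp_surplus (S : RunSetting M c Pr D) {t h : ℕ} (ht : t < c.T) (hh : h < c.H) :
    condExp (histBefore c.H D t) Pr (fun ω => M.r h ((D ω).z t h) ((D ω).x t (h + 1)) +
      Vopt M (h + 1) ((D ω).x t (h + 1)) - Qopt M h ((D ω).z t h)) =ᵐ[Pr] 0 := by
  have hQ := (S.toLinSetting.measurable_Qopt (S.horizon ▸ hh)).comp (S.measurable_z ht hh)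
  have hg : @Measurable _ _ ((hist c.H D t h).prod inferInstance) _ (fun p : Ω × X =>
      M.r h ((D p.1).z t h) p.2 + Vopt M (h + 1) p.2 - Qopt M h ((D p.1).z t h)) :=
    (S.measurable_r_add_Vopt ht hh).sub (hQ.comp (@measurable_fst Ω X (hist c.H D t h) _))
  have hb : ∀ ω x, |M.r h ((D ω).z t h) x + Vopt M (h + 1) x - Qopt M h ((D ω).z t h)| ≤ 3 :=
    fun ω x => by
      have h1 := abs_le.1 (S.abs_r_add_Vopt_le h ((D ω).z t h) x)
      have h2 := S.toLinSetting.Qopt_nonneg h ((D ω).z t h)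
      have h3 := S.toLinSetting.Qopt_le_one (S.horizon ▸ hh) ((D ω).z t h)
      rw [abs_le]; constructor <;> linarith
  have h1 := condExp_of_condLaw (S.hist_le ht hh.le) (S.run.measurable_x t ht (h + 1) hh)
    (S.stepKernel ht hh) (S.isMarkovKernel_stepKernel ht hh) (S.run.transition t ht h hh)
    (g := fun ω x => M.r h ((D ω).z t h) x + Vopt M (h + 1) x - Qopt M h ((D ω).z t h)) hg hb
    (S.measurable_integral_step ht hh hg)
  have h2 : (fun ω => ∫ x, M.r h ((D ω).z t h) x + Vopt M (h + 1) x - Qopt M h ((D ω).z t h)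
      ∂(S.stepKernel ht hh ω)) = 0 := by
    ext ω
    have := M.isProbabilityMeasure_P h ((D ω).z t h)
    rw [stepKernel_apply, integral_sub (integrable_r_add h _ (S.toLinSetting.measurable_Vopt _)
      (S.toLinSetting.abs_Vopt_le _)) (integrable_const _), Qopt, bellman]
    simp
  rw [h2] at h1
  refine (condExp_condExp_of_le (histBefore_le_hist _ _ _) (S.hist_le ht hh.le)).symm.trans ?_
  exact (condExp_congr_ae h1).trans (by rw [condExp_zero])

theorem condExp_Vopt_initial (S : RunSetting M c Pr D) {t : ℕ} (ht : t < c.T) :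
    condExp (histBefore c.H D t) Pr (fun ω => Vopt M 0 ((D ω).x t 0)) =ᵐ[Pr]
      fun _ => ∫ x, Vopt M 0 x ∂M.init := by
  have hp := M.prob_init
  have hκ : @IsMarkovKernel Ω X (histBefore c.H D t) _
      (@Kernel.const Ω X (histBefore c.H D t) _ M.init) :=
    @IsMarkovKernel.mk Ω X (histBefore c.H D t) _ _ fun _ => hp
  exact condExp_of_condLaw (S.histBefore_le ht.le) (S.run.measurable_x t ht 0 (Nat.zero_le _))
    (@Kernel.const Ω X (histBefore c.H D t) _ M.init) hκ (S.run.initial t ht)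
    (g := fun _ x => Vopt M 0 x)
    ((S.toLinSetting.measurable_Vopt 0).comp (@measurable_snd Ω X (histBefore c.H D t) _))
    (fun _ x => S.toLinSetting.abs_Vopt_le 0 x)
    (show Measurable[histBefore c.H D t] fun _ : Ω => ∫ x, Vopt M 0 x ∂M.init from
      @measurable_const _ _ _ (histBefore c.H D t) _)

/-- The performance difference identity: the gaps of an episode sum to the initial optimal value
minus the collected reward plus terms `r + V⋆ - Q⋆`, each of conditional mean zero. -/
theorem condExp_sum_gap (S : RunSetting M c Pr D) {t : ℕ} (ht : t < c.T) :
    condExp (histBefore c.H D t) Pr (fun ω => ∑ h ∈ Finset.range c.H, gap M (D ω) t h) =ᵐ[Pr]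
      fun ω => ∫ x, Vopt M 0 x ∂M.init - condExp (histBefore c.H D t) Pr
        (fun ω => ∑ h ∈ Finset.range c.H, M.r h ((D ω).z t h) ((D ω).x t (h + 1))) ω := by
  have hV : ∀ h ≤ c.H, Integrable (fun ω => Vopt M h ((D ω).x t h)) Pr := fun h hh =>
    integrable_of_bound ((S.toLinSetting.measurable_Vopt h).comp (S.run.measurable_x t ht h hh))
      fun ω => S.toLinSetting.abs_Vopt_le h _
  have hQ : ∀ h < c.H, Integrable (fun ω => Qopt M h ((D ω).z t h)) Pr := fun h hh =>
    integrable_of_bound (((S.toLinSetting.measurable_Qopt (S.horizon ▸ hh)).comp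
      (S.measurable_z ht hh)).mono (S.hist_le ht hh.le) le_rfl) (b := 1) fun ω => by
        rw [abs_of_nonneg (S.toLinSetting.Qopt_nonneg h _)]
        exact S.toLinSetting.Qopt_le_one (S.horizon ▸ hh) _
  let N : ℕ → Ω → ℝ := fun h ω => M.r h ((D ω).z t h) ((D ω).x t (h + 1)) +
    Vopt M (h + 1) ((D ω).x t (h + 1)) - Qopt M h ((D ω).z t h)
  have hN : ∀ h ∈ Finset.range c.H, Integrable (N h) Pr := fun h hh => by
    rw [Finset.mem_range] at hh
    exact ((S.integrable_reward ht hh).add (hV (h + 1) hh)).sub (hQ h hh)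
  have hR : Integrable (fun ω => ∑ h ∈ Finset.range c.H,
      M.r h ((D ω).z t h) ((D ω).x t (h + 1))) Pr :=
    integrable_finset_sum _ fun h hh => S.integrable_reward ht (Finset.mem_range.1 hh)
  have hNs : condExp (histBefore c.H D t) Pr (∑ h ∈ Finset.range c.H, N h) =ᵐ[Pr] 0 := by
    refine (condExp_finset_sum hN _).trans ?_
    have h1 : ∀ᵐ ω ∂Pr, ∀ h ∈ Finset.range c.H, condExp (histBefore c.H D t) Pr (N h) ω = 0 :=
      (ae_ball_iff (Finset.range c.H).countable_toSet).2 fun h hh =>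
        S.condExp_surplus ht (Finset.mem_range.1 hh)
    filter_upwards [h1] with ω h2
    rw [Finset.sum_apply]
    exact Finset.sum_eq_zero h2
  have hsplit : (fun ω => ∑ h ∈ Finset.range c.H, gap M (D ω) t h) =
      (fun ω => Vopt M 0 ((D ω).x t 0)) - (fun ω => ∑ h ∈ Finset.range c.H,
        M.r h ((D ω).z t h) ((D ω).x t (h + 1))) + ∑ h ∈ Finset.range c.H, N h := by
    ext ω
    have h1 := Finset.sum_range_sub' (fun h => Vopt M h ((D ω).x t h)) c.H
    simp only [Vopt_of_le S.horizon.symm.le, sub_zero] at h1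
    simp only [Pi.add_apply, Pi.sub_apply, Finset.sum_apply, ← h1, N, ← Finset.sum_sub_distrib,
      ← Finset.sum_add_distrib]
    refine Finset.sum_congr rfl fun h _ => ?_
    rw [gap]; ring
  rw [hsplit]
  refine (condExp_add ((hV 0 (Nat.zero_le _)).sub hR) (integrable_finset_sum' _ hN) _).trans ?_
  filter_upwards [condExp_sub (hV 0 (Nat.zero_le _)) hR (histBefore c.H D t), hNs,
    S.condExp_Vopt_initial ht] with ω h1 h2 h3
  rw [Pi.add_apply, h1, h2, Pi.sub_apply, h3]
  simp

theorem regret_le_condExp_gap (S : RunSetting M c Pr D) : ∀ᵐ ω ∂Pr, regret M Pr D c.T ω ≤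
    ∑ t ∈ Finset.range c.T, condExp (histBefore c.H D t) Pr
      (fun ω => ∑ h ∈ Finset.range c.H, gap M (D ω) t h) ω := by
  have h1 : ∀ᵐ ω ∂Pr, ∀ t ∈ Finset.range c.T, condExp (histBefore c.H D t) Pr
      (fun ω => ∑ h ∈ Finset.range c.H, gap M (D ω) t h) ω = ∫ x, Vopt M 0 x ∂M.init -
        condExp (histBefore c.H D t) Pr
        (fun ω => ∑ h ∈ Finset.range c.H, M.r h ((D ω).z t h) ((D ω).x t (h + 1))) ω :=
    (ae_ball_iff (Finset.range c.T).countable_toSet).2 fun t ht =>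
      S.condExp_sum_gap (Finset.mem_range.1 ht)
  filter_upwards [h1] with ω h2
  rw [Finset.sum_congr rfl h2, regret, ← S.horizon]
  exact Finset.sum_le_sum fun t _ => sub_le_sub_right S.toLinSetting.integral_Vstar_le _

theorem measurable_sum_gap (S : RunSetting M c Pr D) {t : ℕ} (ht : t < c.T) :
    Measurable[histBefore c.H D (t + 1)] fun ω => ∑ h ∈ Finset.range c.H, gap M (D ω) t h :=
  Finset.measurable_sum _ fun h hh => (S.measurable_gap ht (Finset.mem_range.1 hh)).mono
    (hist_le_histBefore (Nat.lt_succ_self t) (Finset.mem_range.1 hh).le) le_rfl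

/-- The gaps are nonnegative and sum to at most `H` per episode, so after division by `2H` the
one-sided multiplicative inequality `expSuper_condExp` applies. It loses a factor two and the
additive term `4 H L`, but no factor `√T`. -/
theorem measure_regret_le (S : RunSetting M c Pr D) (L : ℝ) :
    Pr {ω | ¬ regret M Pr D c.T ω ≤ 2 * dsum c (gap M (D ω)) + 4 * c.H * L} ≤
      ENNReal.ofReal (Real.exp (-L)) := by
  obtain ⟨-, hH, -⟩ := S.TH_cast
  let G : ℕ → Ω → ℝ := fun t ω => 1 / (2 * c.H) * ∑ h ∈ Finset.range c.H, gap M (D ω) t h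
  have hG : ∀ t < c.T, Measurable[histBefore c.H D (t + 1)] (G t) := fun t ht =>
    (S.measurable_sum_gap ht).const_mul _
  have hG0 : ∀ t ω, 0 ≤ G t ω := fun t ω => mul_nonneg (by positivity)
    (Finset.sum_nonneg fun h hh => S.gap_nonneg ω (Finset.mem_range.1 hh) t)
  have hG1 : ∀ t ω, G t ω ≤ 1 / 2 := fun t ω => by
    have h1 : ∑ h ∈ Finset.range c.H, gap M (D ω) t h ≤ c.H := by
      simpa using Finset.sum_le_card_nsmul (Finset.range c.H) _ 1 fun h _ => S.gap_le_one ω h t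
    calc G t ω ≤ 1 / (2 * c.H) * c.H := mul_le_mul_of_nonneg_left h1 (by positivity)
      _ = 1 / 2 := by field_simp
  have hs := ExpSuper.sum (μ := Pr) (m := fun t => histBefore c.H D t)
    (Y := fun t ω => condExp (histBefore c.H D t) Pr (G t) ω / 2 - G t ω) c.T
    (fun t _ => histBefore_mono _ (Nat.le_succ t))
    (fun t ht => ((stronglyMeasurable_condExp.measurable.div_const 2).mono
      (histBefore_mono _ (Nat.le_succ t)) le_rfl).sub (hG t ht))
    (fun t ht => expSuper_condExp (S.histBefore_le ht.le)
      ((hG t ht).mono (S.histBefore_le ht) le_rfl) (hG0 t) (hG1 t))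
  have hc : ∀ᵐ ω ∂Pr, ∀ t ∈ Finset.range c.T, condExp (histBefore c.H D t) Pr (G t) ω =
      1 / (2 * c.H) * condExp (histBefore c.H D t) Pr
        (fun ω => ∑ h ∈ Finset.range c.H, gap M (D ω) t h) ω :=
    (ae_ball_iff (Finset.range c.T).countable_toSet).2 fun t _ =>
      condExp_smul (1 / (2 * c.H : ℝ)) (fun ω => ∑ h ∈ Finset.range c.H, gap M (D ω) t h) _
  refine le_trans (measure_mono_ae ?_) (ExpSuper.measure_le
    (hs.1.mono (S.histBefore_le le_rfl) le_rfl) hs.2.2 L)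
  filter_upwards [hc, S.regret_le_condExp_gap] with ω h1 h2 h3
  have h3' : ¬ regret M Pr D c.T ω ≤ 2 * dsum c (gap M (D ω)) + 4 * c.H * L := h3
  rw [not_le] at h3'
  change L ≤ ∑ t ∈ Finset.range c.T, (condExp (histBefore c.H D t) Pr (G t) ω / 2 - G t ω)
  rw [Finset.sum_sub_distrib, ← Finset.sum_div, Finset.sum_congr rfl h1, ← Finset.mul_sum,
    ← Finset.mul_sum]
  have h4 : L * (4 * c.H) ≤ _ := le_of_lt (show L * (4 * c.H) < (∑ t ∈ Finset.range c.T,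
    condExp (histBefore c.H D t) Pr (fun ω => ∑ h ∈ Finset.range c.H, gap M (D ω) t h) ω) -
      2 * dsum c (gap M (D ω)) by linarith)
  refine ((le_div_iff₀ (by positivity)).2 h4).trans (le_of_eq ?_)
  rw [dsum]
  field_simp
  ring

/-- The regret never exceeds `T`, almost surely, and the failure probability is at most `δ` with `δ
T ≤ 1`; failures thus add at most one to the expectation. -/
theorem regret_conclusion (S : RunSetting M c Pr D) {b : ℝ} (hb : 0 ≤ b)
    (h : Pr {ω | ¬ regret M Pr D c.T ω ≤ b} ≤ ENNReal.ofReal c.δ) :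
    ∫ ω, regret M Pr D c.T ω ∂Pr ≤ b + 1 ∧
      1 - c.δ ≤ Pr.real {ω | regret M Pr D c.T ω ≤ b + 1} := by
  obtain ⟨hT, hH, -⟩ := S.TH_cast
  have hp := M.prob_init
  have hterm : ∀ t < c.T, Measurable fun ω => condExp (histBefore M.H D t) Pr
      (fun ω' => ∑ h ∈ Finset.range M.H, M.r h ((D ω').z t h) ((D ω').x t (h + 1))) ω :=
    fun t ht => (stronglyMeasurable_condExp.mono (S.horizon ▸ S.histBefore_le ht.le)).measurable
  have hm : Measurable (regret M Pr D c.T) := Finset.measurable_sum _ fun t ht =>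
    (hterm t (Finset.mem_range.1 ht)).const_sub _
  have hi : Integrable (regret M Pr D c.T) Pr := integrable_finset_sum _ fun t _ =>
    (integrable_const _).sub integrable_condExp
  have hms : MeasurableSet {ω | ¬ regret M Pr D c.T ω ≤ b} :=
    (measurableSet_le hm measurable_const).compl
  have hreal : Pr.real {ω | ¬ regret M Pr D c.T ω ≤ b} ≤ c.δ :=
    ENNReal.toReal_le_of_le_ofReal S.δ_pos.le h
  have hV1 : ∫ x, Vstar M 0 x ∂M.init ≤ 1 := S.toLinSetting.integral_Vstar_le.trans
    ((le_abs_self _).trans (abs_integral_le (S.toLinSetting.abs_Vopt_le 0)))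
  have hT1 : ∀ᵐ ω ∂Pr, regret M Pr D c.T ω ≤ c.T := by
    have h1 : ∀ᵐ ω ∂Pr, ∀ t ∈ Finset.range c.T, 0 ≤ condExp (histBefore M.H D t) Pr
        (fun ω' => ∑ h ∈ Finset.range M.H, M.r h ((D ω').z t h) ((D ω').x t (h + 1))) ω :=
      (ae_ball_iff (Finset.range c.T).countable_toSet).2 fun t _ =>
        condExp_nonneg (Filter.Eventually.of_forall fun ω => Finset.sum_nonneg fun h _ =>
          (M.r_mem h _ _).1)
    filter_upwards [h1] with ω h2
    calc regret M Pr D c.T ω ≤ ∑ t ∈ Finset.range c.T, (1 : ℝ) :=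
          Finset.sum_le_sum fun t ht => by linarith [h2 t ht]
      _ = c.T := by simp
  have hTδ : c.T * c.δ ≤ 1 := by
    have h1 := S.δ_lt
    rw [lt_div_iff₀ (by positivity)] at h1
    nlinarith [S.δ_pos, mul_nonneg S.δ_pos.le (sq_nonneg (M.H : ℝ))]
  constructor
  · calc ∫ ω, regret M Pr D c.T ω ∂Pr ≤ ∫ ω, (b + {ω | ¬ regret M Pr D c.T ω ≤ b}.indicator
          (fun _ => (c.T : ℝ)) ω) ∂Pr := by
          refine integral_mono_ae hi ((integrable_const b).add
            ((integrable_const _).indicator hms)) ?_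
          filter_upwards [hT1] with ω h1
          by_cases h2 : regret M Pr D c.T ω ≤ b
          · have h3 : ω ∉ {ω | ¬ regret M Pr D c.T ω ≤ b} := fun h4 => h4 h2
            simp only [Set.indicator_of_notMem h3]; linarith
          · have h3 : ω ∈ {ω | ¬ regret M Pr D c.T ω ≤ b} := h2
            simp only [Set.indicator_of_mem h3]; linarith
      _ = b + Pr.real {ω | ¬ regret M Pr D c.T ω ≤ b} * c.T := by
          rw [integral_add (integrable_const b) ((integrable_const _).indicator hms),
            integral_indicator hms]
          simp
      _ ≤ b + 1 := by nlinarith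
  · have h1 := prob_compl_eq_one_sub (μ := Pr) hms
    have h2 : Pr.real {ω | ¬ regret M Pr D c.T ω ≤ b}ᶜ = 1 - _ := probReal_compl_eq_one_sub hms
    have h3 : Pr.real {ω | ¬ regret M Pr D c.T ω ≤ b}ᶜ ≤
        Pr.real {ω | regret M Pr D c.T ω ≤ b + 1} := measureReal_mono fun ω hω => by
      have h4 : regret M Pr D c.T ω ≤ b := not_not.1 hω
      exact h4.trans (by linarith)
    linarith

end RunSetting


/-! ### The regret bound from bounds on the parameters. -/

namespace RunSetting

variable {X A Ω : Type*} [MeasurableSpace X] [TopologicalSpace A] [PolishSpace A] [CompactSpace A]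
  [MeasurableSpace A] [BorelSpace A] [mΩ : MeasurableSpace Ω] {d : ℕ} {M : MDP X A} {c : Config X A d}
  {Pr : Measure Ω} [IsProbabilityMeasure Pr] {D : Ω → Transcript X A} [Nonempty X] [Nonempty A]

theorem uMin_nonneg (S : RunSetting M c Pr D) {K L : ℝ} (R : Rates c K L) : 0 ≤ c.uMin :=
  (S.u_bounds R).1.le

/-- The regret bound, from bounds for the parameters and for the probability of failure. -/
theorem regret_le_of_rates (S : RunSetting M c Pr D) {ε' La K L η : ℝ} {K₀ k : ℕ}
    (P : Tuned c ε' (c.ι ^ 2) La 1 K₀) (R : Rates c K L) (hLa : √La ≤ c.ι ^ 2) (hη : 0 < η)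
    (hk : ∀ h < c.H, 4 * c.Bh h ^ 2 / η + 1 ≤ k) (hN : 1 ≤ c.N)
    (hε' : √(η * d) * (2 * √(c.β₁ ^ 2 + 1) + √(c.β₂ ^ 2 + 1)) ≤ ε')
    (hprob : c.H * (c.T * (c.N * (c.N * ((K₀ + 3) *
      (3 * c.N * (2 * k + 1) ^ (2 * d ^ 2) * Real.exp (-c.ι ^ 2)))))) +
      c.H * (c.T * (c.N * (c.N * ((K₀ + 1) * Real.exp (-La))))) + 6 * Real.exp (-L) ≤ c.δ) :
    ∫ ω, regret M Pr D c.T ω ∂Pr ≤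
      6005 * K ^ 6 * (d * √(c.H * c.T) + (d : ℝ) ^ 6 * (c.H : ℝ) ^ 5) ∧
    1 - c.δ ≤ Pr.real {ω | regret M Pr D c.T ω ≤
      6005 * K ^ 6 * (d * √(c.H * c.T) + (d : ℝ) ^ 6 * (c.H : ℝ) ^ 5)} := by
  obtain ⟨hT, hH, -⟩ := S.TH_cast
  have hd : (1 : ℝ) ≤ d := by exact_mod_cast S.toLinSetting.one_le_d
  have hK := R.one_le_K
  choose 𝒱 hcard hspec hclose using fun h => S.exists_cover hη hk hN h
  set Nn : ℕ := (Finset.range c.H).sup fun h => (c.F h).card with hNn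
  have hNc : c.N = (Nn : ℝ) := rfl
  set v : ℝ := 3 * c.N * (2 * k + 1) ^ (2 * d ^ 2) with hv
  have hcard' : ∀ h, (𝒱 h).card ≤ ⌊v⌋₊ := fun h => Nat.le_floor (hcard h)
  have hv0 : 0 ≤ v := by positivity
  have hvf : (⌊v⌋₊ : ℝ) ≤ v := Nat.floor_le hv0
  have e1 := S.measure_not_goodRegression_le hspec hcard' (N := Nn)
    (fun h hh => Finset.le_sup (f := fun h => (c.F h).card) (Finset.mem_range.2 hh))
    P.one_le_ι (Lb := c.ι ^ 2) P.one_le_La hLa K₀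
  have hsqTH : 1 ≤ √((c.T : ℝ) * c.H) := by
    rw [Real.one_le_sqrt]; nlinarith
  have hsel0 : 0 ≤ c.θsel := by rw [Config.θsel]; positivity
  have hwid0 : 0 ≤ c.θwidth := by rw [Config.θwidth]; positivity
  have hbad0 : 0 ≤ c.θbad :=
    le_min (div_nonneg (S.uMin_nonneg R) (by positivity)) (by norm_num)
  have hsel1 : 4 * c.θsel ≤ 1 := by
    rw [Config.θsel, mul_one_div, div_le_one (by positivity)]; linarith
  have hbad1 : 4 * c.θbad ≤ 1 := by
    have : c.θbad ≤ 1 / 8 := min_le_right _ _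
    linarith
  have hwid1 : 4 * (c.θwidth * c.H) ≤ 1 := by
    have h1 : (1 : ℝ) ≤ d ^ 2 := one_le_pow₀ hd
    have h2 : (c.H : ℝ) ≤ c.H ^ 3 := by
      calc (c.H : ℝ) = c.H ^ 1 := (pow_one _).symm
        _ ≤ _ := pow_le_pow_right₀ hH (by norm_num)
    have h3 : (c.H : ℝ) ≤ d ^ 2 * c.H ^ 3 := by nlinarith
    have h4 : 4 * (c.θwidth * c.H) = (4 * c.H) / (16 * d ^ 2 * (c.H : ℝ) ^ 3) := by
      rw [Config.θwidth]; ring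
    rw [h4, div_le_one (by positivity)]
    linarith
  have e2 := S.measure_not_goodRun_le hsel0 hsel1 hbad0 hbad1 hwid0 hwid1 L
  have e3 := S.measure_regret_le L
  set Q : ℝ := d * √(c.H * c.T) + (d : ℝ) ^ 6 * (c.H : ℝ) ^ 5 with hQ
  have hHQ : (c.H : ℝ) ≤ Q := by
    have h1 : (c.H : ℝ) ≤ c.H ^ 5 := by
      calc (c.H : ℝ) = c.H ^ 1 := (pow_one _).symm
        _ ≤ _ := pow_le_pow_right₀ hH (by norm_num)
    have h2 : (1 : ℝ) ≤ d ^ 6 := one_le_pow₀ hd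
    have h3 : (0 : ℝ) ≤ d * √(c.H * c.T) := by positivity
    nlinarith
  have hK6 : K ≤ K ^ 6 := by
    calc K = K ^ 1 := (pow_one _).symm
      _ ≤ _ := pow_le_pow_right₀ hK (by norm_num)
  have hQ1 : 1 ≤ K ^ 6 * Q := one_le_mul_of_one_le_of_one_le (one_le_pow₀ hK) (hH.trans hHQ)
  -- Twice the bound `3000 K⁶` for the gaps plus `4 H L`; the passage to expectations adds one more.
  have hmain : Pr {ω | ¬ regret M Pr D c.T ω ≤ 6004 * K ^ 6 * Q} ≤ ENNReal.ofReal c.δ := by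
    refine (measure_mono fun ω hω => ?_).trans ((measure_union_le _ _).trans ((add_le_add e1
      ((measure_union_le _ _).trans (add_le_add e2 e3))).trans ?_))
    · by_contra hcon
      simp only [Set.mem_union, Set.mem_setOf_eq, not_or, not_not] at hcon
      obtain ⟨a1, a2, a3⟩ := hcon
      refine hω (a3.trans ?_)
      have G : GoodEvent M c (D ω) 𝒱 ε' (c.ι ^ 2) La K₀ := { a1 with
        net_spec := hspec
        net_close := fun h t ht j => by
          obtain ⟨V, hV, hVx⟩ := hclose h ω t ht j
          exact ⟨V, hV, fun x => (hVx x).trans hε'⟩ }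
      have h1 := S.dsum_gap_le_of_goodRun R (S.accurate P G) a2
      have h2 : 4 * c.H * L ≤ 4 * (K ^ 6 * Q) := by
        have h3 : c.H * L ≤ Q * K := mul_le_mul hHQ R.L_le R.L_nonneg (by linarith)
        have h4 : Q * K ≤ Q * K ^ 6 := mul_le_mul_of_nonneg_left hK6 (by linarith)
        linarith
      linarith
    · have hc : ∀ (n : ℕ) (x : ℝ), (n : ℝ≥0∞) * ENNReal.ofReal x = ENNReal.ofReal (n * x) :=
        fun n x => by rw [ENNReal.ofReal_mul (Nat.cast_nonneg _), ENNReal.ofReal_natCast]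
      have hc2 : ∀ x : ℝ, (2 : ℝ≥0∞) * ENNReal.ofReal x = ENNReal.ofReal (2 * x) := fun x => by
        simpa using hc 2 x
      have hc5 : ∀ x : ℝ, (5 : ℝ≥0∞) * ENNReal.ofReal x = ENNReal.ofReal (5 * x) := fun x => by
        simpa using hc 5 x
      simp only [hc, hc2, hc5]
      rw [← ENNReal.ofReal_add (by positivity) (by positivity),
        ← ENNReal.ofReal_add (by positivity) (by positivity),
        ← ENNReal.ofReal_add (by positivity) (by positivity),
        ← ENNReal.ofReal_add (by positivity) (by positivity)]
      refine ENNReal.ofReal_le_ofReal (le_trans ?_ hprob)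
      -- The factor `K₀ + 3` collects the two powers of the unweighted family and the `K₀ + 1`
      -- scales of the excess family, both at the level `ι²`.
      have h1 : (⌊v⌋₊ : ℝ) * Real.exp (-c.ι ^ 2) ≤ v * Real.exp (-c.ι ^ 2) :=
        mul_le_mul_of_nonneg_right hvf (Real.exp_pos _).le
      have h2 : (c.H : ℝ) * (c.T * (Nn * (Nn * ((K₀ + 3) * (⌊v⌋₊ * Real.exp (-c.ι ^ 2)))))) ≤
          c.H * (c.T * (Nn * (Nn * ((K₀ + 3) * (v * Real.exp (-c.ι ^ 2)))))) := by gcongr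
      rw [hNc]
      push_cast
      linarith
  obtain ⟨h1, h2⟩ := S.regret_conclusion (by positivity) hmain
  have h3 : 6004 * K ^ 6 * Q + 1 ≤ 6005 * K ^ 6 * Q := by linarith
  refine ⟨h1.trans h3, h2.trans (measureReal_mono fun ω hω => le_trans hω h3)⟩

end RunSetting


/-! ### Sizes of the parameters. -/

/-- A logarithmic count, as it appears in the confidence radii. -/
theorem log_count_bounds {y w : ℝ} (hy : 1 ≤ y) (hw : 1 ≤ w) :
    1 ≤ (2 * Real.log y + 2) * (Real.log w + 2) ∧
    Real.log ((2 * Real.log y + 2) * (Real.log w + 2)) ≤ Real.log 4 + Real.log y + Real.log w := by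
  have h1 := Real.log_nonneg hy
  have h2 := Real.log_nonneg hw
  have h3 := Real.log_le_sub_one_of_pos (zero_lt_one.trans_le hy)
  have h4 := Real.log_le_sub_one_of_pos (zero_lt_one.trans_le hw)
  refine ⟨by nlinarith [mul_nonneg h1 h2], ?_⟩
  rw [← Real.log_mul (by norm_num) (by positivity), ← Real.log_mul (by positivity) (by positivity)]
  refine Real.log_le_log (by positivity) ?_
  calc _ ≤ (2 * y) * (2 * w) := mul_le_mul (by linarith) (by linarith) (by linarith) (by linarith)
    _ = _ := by ring

/-- The sizes of the logarithmic quantities in the parameters: `n = log 𝒩`, the logarithms `a`, `a₁`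
and `a₂` of the logarithmic counts, and `g = log (1 / δ')`. -/
structure LogBounds {X A : Type*} {d : ℕ} (c : Config X A d) (C n a a₁ a₂ g : ℝ) : Prop where
  one_le_d : (1 : ℝ) ≤ d
  one_le_T : (1 : ℝ) ≤ c.T
  one_le_H : (1 : ℝ) ≤ c.H
  two_le_B : 2 ≤ c.B
  one_le_maxB : 1 ≤ c.maxB
  δ_pos : 0 < c.δ
  C_nonneg : 0 ≤ C
  four_le_ℓ : 4 ≤ c.logFactor
  sum_log_le : Real.log d + 3 * Real.log c.T + 2 * Real.log c.H + Real.log c.maxB +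
    Real.log (1 / c.δ) + 2 ≤ c.logFactor
  two_le_logδ : 2 ≤ Real.log (1 / c.δ)
  N_eq : c.N = Real.exp n
  n_nonneg : 0 ≤ n
  n_le : n ≤ 2 * C * (d * c.logFactor)
  a_nonneg : 0 ≤ a
  a_le : a ≤ (Real.log (4096 * c.B ^ 2) + 1) * c.logFactor
  a₁_nonneg : 0 ≤ a₁
  a₁_le : a₁ ≤ (Real.log (4096 * c.B ^ 2) + 1) * c.logFactor
  a₂_nonneg : 0 ≤ a₂
  a₂_le : a₂ ≤ (Real.log (4096 * c.B ^ 2) + 1) * c.logFactor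
  two_le_g : 2 ≤ g
  log_le_g : Real.log c.T + Real.log c.H + Real.log (1 / c.δ) ≤ g
  g_le : g ≤ c.logFactor
  υ_sq : 0 ≤ c.κ → c.υ ^ 2 = 2 * n + a + g
  ι_sq : 0 ≤ c.κ → c.ι ^ 2 = 9 * (n + c.κ * (d ^ 2 * c.logFactor) + a + g)
  β₁_ge : 0 ≤ c.κ → 162 * c.κ ^ 2 * (2 * n + a + g) ≤ c.β₁ ^ 2
  β₁_le : 0 ≤ c.κ → c.β₁ ^ 2 ≤ 2 * c.κ ^ 2 * (162 * (2 * n + a + g) + c.B)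
  β₂_ge : 0 ≤ c.κ →
    96 * c.B * c.κ ^ 2 * (n + c.κ * (d ^ 2 * c.logFactor) + a₁ + g) ≤ c.β₂ ^ 2
  β₂_le : 0 ≤ c.κ → c.β₂ ^ 2 ≤
    c.κ ^ 2 * (4 * (24 * c.B + 21) * (n + c.κ * (d ^ 2 * c.logFactor) + a₁ + g) + 3 * c.B)
  βbar_ge : 0 ≤ c.κ →
    96 * c.B * c.κ ^ 2 * (n + c.κ * (d ^ 2 * c.logFactor) + a₂ + g) ≤ c.βbar ^ 2
  βbar_le : 0 ≤ c.κ → c.βbar ^ 2 ≤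
    c.κ ^ 2 * (16 * (11 * c.B + 9) * (n + c.κ * (d ^ 2 * c.logFactor) + a₂ + g) + 4 * c.B)

-- The logarithms of `d`, `T`, `H`, the largest radius, `1/δ` and `1/ε` together are at most `ℓ`.
-- Since `1/ε ≥ 8 H T²`, the last of them pays for further multiples of `log T` and `log H` and for
-- constants. The error terms with `ε` in the radii are at most of order `B` for the same reason.
set_option maxHeartbeats 1000000 in
theorem exists_logBounds {X A : Type*} [MeasurableSpace X] [TopologicalSpace A]
    [MeasurableSpace A] {d : ℕ} {M : MDP X A} {c : Config X A d} [Nonempty X] [Nonempty A]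
    (S : LinSetting M c) {C : ℝ} (hC : 0 ≤ C)
    (hcard : ∀ h < M.H, Real.log (c.F h).card ≤ C * d * Real.log (1 + c.Bh h / c.ε)) :
    ∃ n a a₁ a₂ g, LogBounds c C n a a₁ a₂ g := by
  have hT : (1 : ℝ) ≤ c.T := by exact_mod_cast S.T_pos
  have hH : (1 : ℝ) ≤ c.H := by rw [S.horizon]; exact_mod_cast S.H_pos
  have hd : (1 : ℝ) ≤ d := by exact_mod_cast S.one_le_d
  have hB := S.two_le_B
  have hδ := S.δ_pos
  have hε := S.ε_pos
  have hHpos : 0 < c.H := S.horizon ▸ S.H_pos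
  have hBh : ∀ h < c.H, c.Bh h ≤ c.maxB := fun h hh =>
    le_ciSup (f := fun h : Fin c.H => c.Bh h) (Set.finite_range _).bddAbove ⟨h, hh⟩
  have hm : 1 ≤ c.maxB := (S.one_le_Bh (S.horizon ▸ hHpos)).trans (hBh 0 hHpos)
  have hε8 : 8 * (c.H * c.T ^ 2) ≤ 1 / c.ε := by
    have h1 := S.ε_le
    rw [← S.horizon] at h1
    rw [le_div_iff₀ (by positivity)] at h1 ⊢
    linarith
  have hδ12 : 12 ≤ 1 / c.δ := by
    have h1 := S.δ_lt
    rw [lt_div_iff₀ (by positivity)] at h1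
    rw [le_div_iff₀ hδ]
    nlinarith [mul_nonneg hδ.le (sq_nonneg (M.H : ℝ)), mul_le_mul_of_nonneg_left hT hδ.le]
  have hlogε : Real.log 8 + Real.log c.H + 2 * Real.log c.T ≤ Real.log (1 / c.ε) := by
    have h1 := Real.log_le_log (by positivity) hε8
    rw [Real.log_mul (by norm_num) (by positivity), Real.log_mul (by positivity) (by positivity),
      Real.log_pow] at h1
    push_cast at h1
    linarith
  have hlog2 := Real.log_two_gt_d9
  have hlog8 : Real.log 8 = 3 * Real.log 2 := by
    rw [show (8 : ℝ) = 2 ^ 3 by norm_num, Real.log_pow]; norm_num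
  have hlog4 : Real.log 4 = 2 * Real.log 2 := by
    rw [show (4 : ℝ) = 2 ^ 2 by norm_num, Real.log_pow]; norm_num
  have hlogδ : 2 ≤ Real.log (1 / c.δ) := by
    have h1 : Real.log 8 ≤ Real.log (1 / c.δ) := Real.log_le_log (by norm_num) (by linarith)
    linarith
  have hld := Real.log_nonneg hd
  have hlT := Real.log_nonneg hT
  have hlH := Real.log_nonneg hH
  have hlm := Real.log_nonneg hm
  set ℓ := c.logFactor with hℓ
  have hsum : Real.log d + Real.log c.T + Real.log c.H + Real.log c.maxB + Real.log (1 / c.δ) +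
      Real.log (1 / c.ε) ≤ ℓ := by
    rw [← Real.log_mul (by positivity) (by positivity),
      ← Real.log_mul (by positivity) (by positivity),
      ← Real.log_mul (by positivity) (by positivity),
      ← Real.log_mul (by positivity) (by positivity),
      ← Real.log_mul (by positivity) (by positivity), hℓ, Config.logFactor]
    refine Real.log_le_log (by positivity) ?_
    have h1 : (d : ℝ) * c.T * c.H * c.maxB * (1 / c.δ) * (1 / c.ε) =
      (d * c.T * c.H : ℝ) * c.maxB / (c.δ * c.ε) := by field_simp
    rw [h1]; linarith
  have hℓ4 : 4 ≤ ℓ := by linarith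
  have hℓ0 : 0 < ℓ := by linarith
  -- the cardinality of the classes
  have hF1 : ∀ h < c.H, 1 ≤ (c.F h).card := fun h hh => by
    obtain ⟨f, hf, -⟩ := S.exists_cover_bellman (S.horizon ▸ hh) (V := fun _ => 0) measurable_const
      (by simp) (by simp)
    exact Finset.card_pos.2 ⟨f, hf⟩
  have hcard' : ∀ h < c.H, Real.log (c.F h).card ≤ 2 * C * (d * ℓ) := fun h hh => by
    have h0 := S.one_le_Bh (S.horizon ▸ hh)
    have h1 : 1 ≤ 1 / c.ε := by nlinarith [one_le_pow₀ hT (n := 2)]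
    have h2 : 1 + c.Bh h / c.ε ≤ 2 * (c.maxB * (1 / c.ε)) := by
      have h3 : c.Bh h / c.ε = c.Bh h * (1 / c.ε) := by ring
      have h4 := mul_le_mul_of_nonneg_right (hBh h hh) (by positivity : 0 ≤ 1 / c.ε)
      nlinarith
    have h3 : Real.log (1 + c.Bh h / c.ε) ≤ 2 * ℓ := by
      refine (Real.log_le_log (by positivity) h2).trans ?_
      rw [Real.log_mul (by norm_num) (by positivity), Real.log_mul (by positivity) (by positivity)]
      linarith
    calc _ ≤ C * d * Real.log (1 + c.Bh h / c.ε) := hcard h (S.horizon ▸ hh)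
      _ ≤ C * d * (2 * ℓ) := mul_le_mul_of_nonneg_left h3 (by positivity)
      _ = _ := by ring
  obtain ⟨h₀, hh₀, hNh⟩ := Finset.exists_mem_eq_sup (Finset.range c.H)
    ⟨0, Finset.mem_range.2 hHpos⟩ fun h => (c.F h).card
  rw [Finset.mem_range] at hh₀
  have hNeq : c.N = (c.F h₀).card := congrArg Nat.cast hNh
  have hN1 : 1 ≤ c.N := by rw [hNeq]; exact_mod_cast hF1 h₀ hh₀
  have hNpos : 0 < c.N := by linarith
  set n := Real.log c.N with hn
  have hN : c.N = Real.exp n := (Real.exp_log hNpos).symm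
  -- the logarithmic counts
  have hα2 : c.α ^ 2 = 1 / (c.T * c.H) := by rw [Config.α, Real.sq_sqrt (by positivity)]
  have hα0 : 0 < c.α := by rw [Config.α]; positivity
  have hα1 : c.α ≤ 1 := by
    rw [Config.α]
    refine Real.sqrt_le_one.2 ?_
    rw [div_le_one (by positivity)]
    exact one_le_mul_of_one_le_of_one_le hT hH
  have hlα : Real.log c.α = -((Real.log c.T + Real.log c.H) / 2) := by
    have h1 : 2 * Real.log c.α = -(Real.log c.T + Real.log c.H) := by
      rw [← Real.log_mul (by positivity) (by positivity), ← Real.log_inv, ← one_div, ← hα2,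
        Real.log_pow]
      norm_num
    linarith
  have hlB : Real.log (4096 * c.B ^ 2) = 12 * Real.log 2 + 2 * Real.log c.B := by
    rw [Real.log_mul (by norm_num) (by positivity), Real.log_pow,
      show (4096 : ℝ) = 2 ^ 12 by norm_num, Real.log_pow]
    norm_num
  have hlB0 : 0 ≤ Real.log c.B := Real.log_nonneg (by linarith)
  have hlog32 : Real.log 32 = 5 * Real.log 2 := by
    rw [show (32 : ℝ) = 2 ^ 5 by norm_num, Real.log_pow]; norm_num
  have hfin : ∀ {x : ℝ}, x ≤ Real.log (4096 * c.B ^ 2) + ℓ →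
      x ≤ (Real.log (4096 * c.B ^ 2) + 1) * ℓ := fun {x} hx => by
    have : 0 ≤ Real.log (4096 * c.B ^ 2) := by rw [hlB]; linarith
    nlinarith
  have hBT : 1 ≤ c.B * c.T := one_le_mul_of_one_le_of_one_le (by linarith) hT
  have hT4 : 1 ≤ 4 * c.B * c.T / c.α := by
    rw [le_div_iff₀ hα0]; linarith
  have hα8 : 1 ≤ 8 * c.B / c.α ^ 2 := by
    rw [le_div_iff₀ (by positivity)]; linarith [pow_le_one₀ hα0.le hα1 (n := 2)]
  obtain ⟨ha1, ha2⟩ := log_count_bounds hT4 hα8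
  obtain ⟨hb1, hb2⟩ := log_count_bounds (show 1 ≤ 18 * c.B * c.T by linarith)
    (show 1 ≤ 18 * c.B by linarith)
  obtain ⟨hc1, hc2⟩ := log_count_bounds (show 1 ≤ 32 * c.B * c.T by linarith)
    (show 1 ≤ 32 * c.B by linarith)
  have hl18 : Real.log 18 ≤ Real.log 32 := Real.log_le_log (by norm_num) (by norm_num)
  have hprod3 : ∀ x : ℝ, 0 < x → Real.log (x * c.B * c.T) =
      Real.log x + Real.log c.B + Real.log c.T := fun x hx => by
    rw [Real.log_mul (by positivity) (by positivity), Real.log_mul hx.ne' (by positivity)]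
  have hprod2 : ∀ x : ℝ, 0 < x → Real.log (x * c.B) = Real.log x + Real.log c.B := fun x hx =>
    Real.log_mul hx.ne' (by positivity)
  have hlT4 : Real.log (4 * c.B * c.T / c.α) = Real.log 4 + Real.log c.B + Real.log c.T +
      (Real.log c.T + Real.log c.H) / 2 := by
    rw [Real.log_div (by positivity) hα0.ne', hprod3 4 (by norm_num), hlα]; ring
  have hlα8 : Real.log (8 * c.B / c.α ^ 2) = Real.log 8 + Real.log c.B +
      (Real.log c.T + Real.log c.H) := by
    rw [Real.log_div (by positivity) (by positivity), hprod2 8 (by norm_num), Real.log_pow, hlα]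
    push_cast; ring
  have e18 := hprod2 18 (by norm_num)
  have e18' := hprod3 18 (by norm_num)
  have e32 := hprod2 32 (by norm_num)
  have e32' := hprod3 32 (by norm_num)
  -- the confidence level
  have hg1 : (0 : ℝ) < (c.T + 1) * (c.H + 1) / c.δ := by positivity
  have hgT : Real.log c.T ≤ Real.log (c.T + 1) := Real.log_le_log (by positivity) (by linarith)
  have hgH : Real.log c.H ≤ Real.log (c.H + 1) := Real.log_le_log (by positivity) (by linarith)
  have hgT' : Real.log (c.T + 1) ≤ Real.log 2 + Real.log c.T := by
    rw [← Real.log_mul (by norm_num) (by positivity)]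
    exact Real.log_le_log (by positivity) (by linarith)
  have hgH' : Real.log (c.H + 1) ≤ Real.log 2 + Real.log c.H := by
    rw [← Real.log_mul (by norm_num) (by positivity)]
    exact Real.log_le_log (by positivity) (by linarith)
  have hg : Real.log (1 / c.δ') = Real.log (c.T + 1) + Real.log (c.H + 1) + Real.log (1 / c.δ) := by
    rw [Config.δ', one_div_div, ← Real.log_mul (by positivity) (by positivity),
      ← Real.log_mul (by positivity) (by positivity)]
    congr 1; ring
  have hδ'0 : 0 < c.δ' := by rw [Config.δ']; positivity
  have hδ'ne := hδ'0.ne'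
  set g := Real.log (1 / c.δ') with hgdef
  have hlδ' : Real.log c.δ' = -g := by rw [hgdef, one_div, Real.log_inv, neg_neg]
  set La := (2 * Real.log (4 * c.B * c.T / c.α) + 2) * (Real.log (8 * c.B / c.α ^ 2) + 2) with hLa
  set L₁ := (2 * Real.log (18 * c.B * c.T) + 2) * (Real.log (18 * c.B) + 2) with hL₁
  set L₂ := (2 * Real.log (32 * c.B * c.T) + 2) * (Real.log (32 * c.B) + 2) with hL₂
  have hla0 := Real.log_nonneg ha1
  have hl10 := Real.log_nonneg hb1
  have hl20 := Real.log_nonneg hc1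
  have hNb : Real.log c.Nb = c.κ * (d ^ 2 * ℓ) := by rw [Config.Nb, Real.log_exp]; ring
  have hNb0 : 0 < c.Nb := Real.exp_pos _
  have hn0 : 0 ≤ n := Real.log_nonneg hN1
  have hg2 : 2 ≤ g := by linarith
  have hY0 : 0 ≤ (d : ℝ) ^ 2 * ℓ := by positivity
  have hυlog : Real.log (c.N ^ 2 * La / c.δ') = 2 * n + Real.log La + g := by
    rw [Real.log_div (by positivity) hδ'ne, Real.log_mul (by positivity) (by positivity),
      Real.log_pow, hlδ', ← hn]
    push_cast; ring
  have hιlog : ∀ x : ℝ, 1 ≤ x → Real.log (c.N * c.Nb * x / c.δ') =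
      n + c.κ * (d ^ 2 * ℓ) + Real.log x + g := fun x hx => by
    rw [Real.log_div (by positivity) hδ'ne, Real.log_mul (by positivity) (by positivity),
      Real.log_mul (by positivity) (by positivity), hlδ', hNb, ← hn]
    ring
  have hιdot : 0 ≤ c.κ → c.ιdot ^ 2 = 2 * (n + c.κ * (d ^ 2 * ℓ) + Real.log L₁ + g) := fun hκ => by
    rw [Config.ιdot, mul_assoc (c.N * c.Nb), ← hL₁, hιlog _ hb1, Real.sq_sqrt]
    positivity
  have hιsq : 0 ≤ c.κ → c.ιsq ^ 2 = 2 * (n + c.κ * (d ^ 2 * ℓ) + Real.log L₂ + g) := fun hκ => by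
    rw [Config.ιsq, mul_assoc (c.N * c.Nb), ← hL₂, hιlog _ hc1, Real.sq_sqrt]
    positivity
  have hTε : c.T * c.ε ≤ 1 / 8 := by
    rw [le_div_iff₀ hε] at hε8
    have h1 : (c.T : ℝ) ≤ c.H * c.T ^ 2 := (le_self_pow₀ hT (by norm_num)).trans
      (le_mul_of_one_le_left (by positivity) hH)
    have h2 := mul_le_mul_of_nonneg_right h1 hε.le
    linarith
  have hTBε : c.T * c.B * c.ε ≤ c.B / 8 := by
    have h1 := mul_le_mul_of_nonneg_left hTε (by linarith : 0 ≤ c.B)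
    linarith
  have hTε0 : 0 ≤ c.T * c.ε := by positivity
  have hs : 8 * c.T * c.B / c.α ^ 2 * c.ε ≤ c.B := by
    rw [hα2]
    rw [le_div_iff₀ hε] at hε8
    have h1 : 8 * c.T * c.B / (1 / (c.T * c.H)) * c.ε = c.B * (8 * (c.H * c.T ^ 2) * c.ε) := by
      field_simp
    rw [h1]; exact mul_le_of_le_one_right (by linarith) hε8
  have hU0 : 0 ≤ 2 * n + Real.log La + g := by positivity
  have hβ₁ : c.β₁ = c.κ * (√162 * √(2 * n + Real.log La + g) +
      √(8 * c.T * c.B / c.α ^ 2 * c.ε)) := by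
    have h1 : c.N ^ 2 * (c.T + 1) * (c.H + 1) * (2 * Real.log (4 * c.B * c.T / c.α) + 2) *
        (Real.log (8 * c.B / c.α ^ 2) + 2) / c.δ = c.N ^ 2 * La / c.δ' := by
      rw [Config.δ', hLa]; field_simp
    rw [Config.β₁, h1, hυlog, Config.lam, Real.sqrt_one]
    norm_num
  have hsqa : (√162 * √(2 * n + Real.log La + g)) ^ 2 = 162 * (2 * n + Real.log La + g) := by
    rw [mul_pow, Real.sq_sqrt (by norm_num), Real.sq_sqrt hU0]
  have hsqb : √(8 * c.T * c.B / c.α ^ 2 * c.ε) ^ 2 ≤ c.B := by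
    rw [Real.sq_sqrt (by positivity)]; exact hs
  have hpa : 0 ≤ √162 * √(2 * n + Real.log La + g) := by positivity
  have hpb : 0 ≤ √(8 * c.T * c.B / c.α ^ 2 * c.ε) := by positivity
  refine ⟨n, Real.log La, Real.log L₁, Real.log L₂, g, hd, hT, hH, hB, hm, hδ, hC, hℓ4,
    by linarith, hlogδ, hN, hn0, ?_, hla0, hfin (by linarith), hl10, hfin (by linarith), hl20,
    hfin (by linarith), hg2, by linarith, by linarith, fun _ => ?_, fun hκ => ?_, fun _ => ?_,
    fun _ => ?_, fun hκ => ?_, fun hκ => ?_, fun hκ => ?_, fun hκ => ?_⟩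
  · rw [hn, hNeq]; exact hcard' h₀ hh₀
  · rw [Config.υ, mul_assoc (c.N ^ 2), ← hLa, hυlog, Real.sq_sqrt hU0]
  · rw [Config.ι, mul_assoc (c.N * c.Nb), ← hLa, hιlog _ ha1, mul_pow, Real.sq_sqrt (by positivity)]
    ring
  · rw [hβ₁, mul_pow]
    have h1 : 162 * (2 * n + Real.log La + g) ≤ (√162 * √(2 * n + Real.log La + g) +
        √(8 * c.T * c.B / c.α ^ 2 * c.ε)) ^ 2 := by
      rw [← hsqa]; exact pow_le_pow_left₀ hpa (by linarith) 2
    exact le_trans (le_of_eq (by ring)) (mul_le_mul_of_nonneg_left h1 (sq_nonneg c.κ))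
  · rw [hβ₁, mul_pow]
    have h1 : (√162 * √(2 * n + Real.log La + g) + √(8 * c.T * c.B / c.α ^ 2 * c.ε)) ^ 2 ≤
        2 * (162 * (2 * n + Real.log La + g) + c.B) := by
      have := add_sq_le (a := √162 * √(2 * n + Real.log La + g))
        (b := √(8 * c.T * c.B / c.α ^ 2 * c.ε))
      linarith
    exact le_trans (mul_le_mul_of_nonneg_left h1 (sq_nonneg c.κ)) (le_of_eq (by ring))
  · rw [Config.β₂, mul_pow, hιdot hκ, Real.sq_sqrt (by positivity)]
    set Z := n + c.κ * (d ^ 2 * ℓ) + Real.log L₁ + g with hZ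
    have hZ0 : 0 ≤ Z := by positivity
    have h1 : 96 * c.B * Z ≤ 2 * (24 * c.B + 21) * (2 * Z) + 20 * c.T * c.B * c.ε := by
      have : 0 ≤ 20 * c.T * c.B * c.ε := by positivity
      linarith
    exact le_trans (le_of_eq (by ring)) (mul_le_mul_of_nonneg_left h1 (sq_nonneg c.κ))
  · rw [Config.β₂, mul_pow, hιdot hκ, Real.sq_sqrt (by positivity)]
    set Z := n + c.κ * (d ^ 2 * ℓ) + Real.log L₁ + g with hZ
    have h1 : 2 * (24 * c.B + 21) * (2 * Z) + 20 * c.T * c.B * c.ε ≤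
        4 * (24 * c.B + 21) * Z + 3 * c.B := by linarith
    exact mul_le_mul_of_nonneg_left h1 (sq_nonneg c.κ)
  · rw [Config.βbar, mul_pow, hιsq hκ, Real.sq_sqrt (by positivity)]
    set Z := n + c.κ * (d ^ 2 * ℓ) + Real.log L₂ + g with hZ
    have hZ0 : 0 ≤ Z := by positivity
    have h1 : 96 * c.B * Z ≤ 8 * (11 * c.B + 9) * (2 * Z) + 32 * c.T * c.B * c.ε := by
      have h2 : 0 ≤ 32 * c.T * c.B * c.ε := by positivity
      have h3 : 0 ≤ c.B * Z := by positivity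
      linarith
    exact le_trans (le_of_eq (by ring)) (mul_le_mul_of_nonneg_left h1 (sq_nonneg c.κ))
  · rw [Config.βbar, mul_pow, hιsq hκ, Real.sq_sqrt (by positivity)]
    set Z := n + c.κ * (d ^ 2 * ℓ) + Real.log L₂ + g with hZ
    have h1 : 8 * (11 * c.B + 9) * (2 * Z) + 32 * c.T * c.B * c.ε ≤
        16 * (11 * c.B + 9) * Z + 4 * c.B := by linarith
    exact mul_le_mul_of_nonneg_left h1 (sq_nonneg c.κ)


theorem add_one_le_of_le_sq_mul {p κ Y W m x : ℝ} (hp : 1 ≤ p) (hκ : 0 ≤ κ) (hY : 1 ≤ Y)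
    (hm : 0 ≤ m) (hW : W ≤ p * (1 + κ) * Y) (hx : x ≤ κ ^ 2 * (m * p * W + 4 * p)) :
    x + 1 ≤ (m + 5) * (p ^ 2 * (1 + κ) ^ 3 * Y) := by
  have h1 : (1 : ℝ) ≤ 1 + κ := by linarith
  have h2 : 1 ≤ p * (1 + κ) * Y :=
    one_le_mul_of_one_le_of_one_le (one_le_mul_of_one_le_of_one_le hp h1) hY
  have h3 : m * p * W + 4 * p ≤ (m + 4) * (p * (p * (1 + κ) * Y)) := by
    have h4 : m * p * W ≤ m * p * (p * (1 + κ) * Y) :=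
      mul_le_mul_of_nonneg_left hW (by positivity)
    have h5 : p * 1 ≤ p * (p * (1 + κ) * Y) := mul_le_mul_of_nonneg_left h2 (by linarith)
    linarith
  have h6 : x ≤ (1 + κ) ^ 2 * ((m + 4) * (p * (p * (1 + κ) * Y))) :=
    hx.trans ((mul_le_mul_of_nonneg_left h3 (sq_nonneg κ)).trans
      (mul_le_mul_of_nonneg_right (pow_le_pow_left₀ hκ (by linarith) 2) (by positivity)))
  have h7 : 1 ≤ p ^ 2 * (1 + κ) ^ 3 * Y := one_le_mul_of_one_le_of_one_le
    (one_le_mul_of_one_le_of_one_le (one_le_pow₀ hp) (one_le_pow₀ h1)) hY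
  calc x + 1 ≤ (1 + κ) ^ 2 * ((m + 4) * (p * (p * (1 + κ) * Y))) + p ^ 2 * (1 + κ) ^ 3 * Y :=
        add_le_add h6 h7
    _ = _ := by ring

/-- A common bound, up to powers of the dimension and logarithms, for the squared radii. -/
noncomputable def sizeConst (B C κ : ℝ) : ℝ :=
  700 * ((2 * C + (Real.log (4096 * B ^ 2) + 1) + 1 + B) ^ 2 * (1 + κ) ^ 3)

namespace LogBounds

variable {X A : Type*} {d : ℕ} {c : Config X A d} {C n a a₁ a₂ g : ℝ}

theorem ℓ_le (P : LogBounds c C n a a₁ a₂ g) :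
    c.logFactor ≤ d * c.logFactor ∧ d * c.logFactor ≤ d ^ 2 * c.logFactor := by
  have hd := P.one_le_d
  have hℓ := P.four_le_ℓ
  constructor
  · exact le_mul_of_one_le_left (by linarith) hd
  · exact mul_le_mul_of_nonneg_right (le_self_pow₀ hd (by norm_num)) (by linarith)

theorem log_B_nonneg (P : LogBounds c C n a a₁ a₂ g) :
    0 ≤ Real.log (4096 * c.B ^ 2) ∧ 0 ≤ Real.log (5 * c.B ^ 2) := by
  have hB := P.two_le_B
  have h1 : 1 ≤ c.B ^ 2 := one_le_pow₀ (by linarith)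
  exact ⟨Real.log_nonneg (by linarith), Real.log_nonneg (by linarith)⟩

/-- Only the weighted radius avoids `log 𝒩_b`, so its square is of order `d ℓ`; the squares of the
others, and `ι²`, are of order `d² ℓ`. -/
theorem radii_le (P : LogBounds c C n a a₁ a₂ g) (hκ : 0 ≤ c.κ) :
    1 ≤ sizeConst c.B C c.κ ∧ c.ι ^ 2 ≤ sizeConst c.B C c.κ * (d ^ 2 * c.logFactor) ∧
    c.β₁ ^ 2 + 1 ≤ sizeConst c.B C c.κ * (d * c.logFactor) ∧
    c.β₂ ^ 2 + 1 ≤ sizeConst c.B C c.κ * (d ^ 2 * c.logFactor) ∧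
    c.βbar ^ 2 + 1 ≤ sizeConst c.B C c.κ * (d ^ 2 * c.logFactor) := by
  have hB := P.two_le_B
  have hC := P.C_nonneg
  obtain ⟨hlB, -⟩ := P.log_B_nonneg
  have hℓ := P.four_le_ℓ
  obtain ⟨hD, hY⟩ := P.ℓ_le
  set ℓ := c.logFactor
  set D := d * ℓ with hDdef
  set Y := (d : ℝ) ^ 2 * ℓ with hYdef
  set b := Real.log (4096 * c.B ^ 2) + 1 with hb
  set p := 2 * C + b + 1 + c.B with hp
  have hp1 : 1 ≤ p := by linarith
  have hκ1 : (1 : ℝ) ≤ 1 + c.κ := by linarith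
  have hA : sizeConst c.B C c.κ = 700 * (p ^ 2 * (1 + c.κ) ^ 3) := rfl
  have hq : 1 ≤ p ^ 2 * (1 + c.κ) ^ 3 :=
    one_le_mul_of_one_le_of_one_le (one_le_pow₀ hp1) (one_le_pow₀ hκ1)
  have hb0 : 0 ≤ b := by linarith
  have hn : n ≤ 2 * C * D := P.n_le
  have hg := P.g_le
  have hCD : 2 * C * D ≤ 2 * C * Y := mul_le_mul_of_nonneg_left hY (by linarith)
  have hbY : b * ℓ ≤ b * Y := mul_le_mul_of_nonneg_left (hD.trans hY) hb0
  have hbD : b * ℓ ≤ b * D := mul_le_mul_of_nonneg_left hD hb0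
  have hpκ : (p + c.κ) * Y ≤ p * (1 + c.κ) * Y :=
    mul_le_mul_of_nonneg_right (by nlinarith) (by linarith)
  have hBY : 0 ≤ c.B * Y := mul_nonneg (by linarith) (by linarith)
  have hW : ∀ x, x ≤ b * ℓ → n + c.κ * Y + x + g ≤ p * (1 + c.κ) * Y := fun x hx => by
    have h1 : (p + c.κ) * Y = 2 * C * Y + b * Y + Y + c.B * Y + c.κ * Y := by rw [hp]; ring
    linarith
  have hW0 : ∀ x, 0 ≤ x → 0 ≤ n + c.κ * Y + x + g := fun x hx => by
    have := P.n_nonneg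
    have := P.two_le_g
    have : 0 ≤ c.κ * Y := mul_nonneg hκ (by linarith)
    linarith
  have hU : (2 * n + a + g) / 2 ≤ p * (1 + c.κ) * D := by
    have h1 : p * D ≤ p * (1 + c.κ) * D := by
      have : 0 ≤ p * c.κ * D := mul_nonneg (mul_nonneg (by linarith) hκ) (by linarith)
      linarith
    have h2 : p * D = 2 * C * D + b * D + D + c.B * D := by rw [hp]; ring
    have h3 : 0 ≤ c.B * D := mul_nonneg (by linarith) (by linarith)
    have h4 : 0 ≤ b * D := mul_nonneg hb0 (by linarith)
    have := P.a_le
    linarith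
  have hU0 : 0 ≤ 2 * n + a + g := by linarith [P.n_nonneg, P.a_nonneg, P.two_le_g]
  have hBp : c.B ≤ p := by linarith
  have hfin : ∀ {x m y : ℝ}, x ≤ (m + 5) * (p ^ 2 * (1 + c.κ) ^ 3 * y) → m ≤ 695 → 0 ≤ y →
      x ≤ sizeConst c.B C c.κ * y := fun {x m y} hx hm hy => by
    rw [hA]
    refine hx.trans ((mul_le_mul_of_nonneg_right (show m + 5 ≤ 700 by linarith)
      (mul_nonneg (by linarith) hy)).trans (le_of_eq (by ring)))
  refine ⟨by rw [hA]; linarith, ?_, ?_, ?_, ?_⟩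
  · rw [P.ι_sq hκ, hA]
    have h1 := hW a P.a_le
    have h2 : p * (1 + c.κ) * Y ≤ p ^ 2 * (1 + c.κ) ^ 3 * Y := by
      refine mul_le_mul_of_nonneg_right ?_ (by linarith)
      exact mul_le_mul (le_self_pow₀ hp1 (by norm_num)) (le_self_pow₀ hκ1 (by norm_num))
        (by linarith) (by positivity)
    have h3 := hW0 a P.a_nonneg
    linarith
  · refine hfin (add_one_le_of_le_sq_mul hp1 hκ (by linarith) (m := 648) (by norm_num) hU
      ((P.β₁_le hκ).trans ?_)) (by norm_num) (by linarith)
    have h1 : 1 * (2 * n + a + g) ≤ p * (2 * n + a + g) := mul_le_mul_of_nonneg_right hp1 hU0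
    have h2 : 2 * (162 * (2 * n + a + g) + c.B) ≤ 648 * p * ((2 * n + a + g) / 2) + 4 * p := by
      linarith
    exact le_trans (le_of_eq (by ring)) (mul_le_mul_of_nonneg_left h2 (sq_nonneg c.κ))
  · refine hfin (add_one_le_of_le_sq_mul hp1 hκ (by linarith) (m := 138) (by norm_num)
      (hW a₁ P.a₁_le) ((P.β₂_le hκ).trans (mul_le_mul_of_nonneg_left ?_ (sq_nonneg c.κ))))
      (by norm_num) (by linarith)
    have h1 : 4 * (24 * c.B + 21) ≤ 138 * p := by linarith
    have h2 := mul_le_mul_of_nonneg_right h1 (hW0 a₁ P.a₁_nonneg)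
    linarith
  · refine hfin (add_one_le_of_le_sq_mul hp1 hκ (by linarith) (m := 248) (by norm_num)
      (hW a₂ P.a₂_le) ((P.βbar_le hκ).trans (mul_le_mul_of_nonneg_left ?_ (sq_nonneg c.κ))))
      (by norm_num) (by linarith)
    have h1 : 16 * (11 * c.B + 9) ≤ 248 * p := by linarith
    have h2 := mul_le_mul_of_nonneg_right h1 (hW0 a₂ P.a₂_nonneg)
    linarith

theorem ι_nonneg (_ : LogBounds c C n a a₁ a₂ g) : 0 ≤ c.ι := by rw [Config.ι]; positivity

theorem ι_sq_ge (P : LogBounds c C n a a₁ a₂ g) (hκ : 0 ≤ c.κ) :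
    9 * (c.κ * (d ^ 2 * c.logFactor)) + 18 ≤ c.ι ^ 2 := by
  rw [P.ι_sq hκ]
  linarith [P.n_nonneg, P.a_nonneg, P.two_le_g]

theorem υ_le (P : LogBounds c C n a a₁ a₂ g) (hκ : 0 ≤ c.κ) :
    2 ≤ c.υ ^ 2 ∧ c.υ ^ 2 ≤ c.ι ^ 2 ∧ c.υ ≤ c.υ ^ 2 := by
  have hY : 0 ≤ c.κ * ((d : ℝ) ^ 2 * c.logFactor) :=
    mul_nonneg hκ (by have := P.four_le_ℓ; positivity)
  have h0 : 0 ≤ c.υ := Real.sqrt_nonneg _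
  have h1 : 2 ≤ c.υ ^ 2 := by
    rw [P.υ_sq hκ]; linarith [P.n_nonneg, P.a_nonneg, P.two_le_g]
  refine ⟨h1, ?_, by nlinarith⟩
  rw [P.υ_sq hκ, P.ι_sq hκ]
  linarith [P.n_nonneg, P.a_nonneg, P.two_le_g]

/-- The common factor `K` is a constant times `ℓ`, so the sixth power of `K` in the regret bound
becomes `ℓ⁶`. -/
theorem rates (P : LogBounds c C n a a₁ a₂ g) (hκ : 0 ≤ c.κ) (hκu : 1 ≤ c.κu)
    (hBh : ∀ h < c.H, 1 ≤ c.Bh h ∧ c.Bh h ≤ c.maxB) :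
    Rates c ((32 * (1 + c.B) * sizeConst c.B C c.κ + 14 + c.κu) * c.logFactor)
      (2 * c.logFactor) := by
  obtain ⟨hA, hι, hβ₁, hβ₂, hβbar⟩ := P.radii_le hκ
  obtain ⟨hυ2, hυι, hυ⟩ := P.υ_le hκ
  have hι0 := P.ι_nonneg
  have hB := P.two_le_B
  have hℓ := P.four_le_ℓ
  have hd := P.one_le_d
  obtain ⟨hD, hY⟩ := P.ℓ_le
  set ℓ := c.logFactor
  set A := sizeConst c.B C c.κ
  set Z := 32 * (1 + c.B) * A + 14 + c.κu with hZ
  have hBA : 0 ≤ c.B * A := by positivity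
  have hAZ : A ≤ Z := by linarith
  have hBA' : c.B ≤ c.B * A := le_mul_of_one_le_right (by linarith) hA
  have hZ1 : 1 ≤ Z := by linarith
  have hZℓ : Z * 1 ≤ Z * ℓ := mul_le_mul_of_nonneg_left (by linarith) (by linarith)
  have hY0 : 0 ≤ (d : ℝ) ^ 2 * ℓ := by linarith
  have hD0 : 0 ≤ d * ℓ := by linarith
  have hAD : A * (d * ℓ) ≤ Z * ℓ * d := by
    have := mul_le_mul_of_nonneg_right hAZ hD0
    linarith
  have hAY : A * (d ^ 2 * ℓ) ≤ Z * ℓ * d ^ 2 := by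
    have := mul_le_mul_of_nonneg_right hAZ hY0
    linarith
  have hsq : ∀ x : ℝ, x ≤ A * (d ^ 2 * ℓ) → √x ≤ A * (d * ℓ) := fun x hx => by
    refine Real.sqrt_le_iff.2 ⟨by positivity, hx.trans ?_⟩
    have h1 : A * ℓ ≤ (A * ℓ) ^ 2 :=
      le_self_pow₀ (one_le_mul_of_one_le_of_one_le hA (by linarith)) (by norm_num)
    calc A * ((d : ℝ) ^ 2 * ℓ) = (A * ℓ) * d ^ 2 := by ring
      _ ≤ (A * ℓ) ^ 2 * d ^ 2 := mul_le_mul_of_nonneg_right h1 (by positivity)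
      _ = _ := by ring
  have hAYpos : (d : ℝ) ^ 2 * ℓ ≤ A * (d ^ 2 * ℓ) := le_mul_of_one_le_left hY0 hA
  refine ⟨by linarith, by linarith, ?_, by linarith, hβ₁.trans hAD, hβ₂.trans hAY, ?_, hι0, ?_, ?_,
    fun h hh => ?_, ?_, ?_⟩
  · exact mul_le_mul_of_nonneg_right (by linarith) (by linarith)
  · have h1 := hsq _ hβbar
    have h2 := mul_le_mul_of_nonneg_left (hsq _ hβ₂) (by linarith : 0 ≤ 2 * c.B)
    have h3 : (1 + 2 * c.B) * A * (d * ℓ) ≤ Z * (d * ℓ) :=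
      mul_le_mul_of_nonneg_right (by linarith) hD0
    linarith
  · have h3 : 3 * A * (d ^ 2 * ℓ) ≤ Z * (d ^ 2 * ℓ) :=
      mul_le_mul_of_nonneg_right (by linarith) hY0
    linarith
  · have h1 : (√c.υ + c.ι) ^ 2 ≤ 4 * c.ι ^ 2 := by
      have h2 := add_sq_le (a := √c.υ) (b := c.ι)
      rw [Real.sq_sqrt (show 0 ≤ c.υ from Real.sqrt_nonneg _)] at h2
      linarith
    have h3 : 32 * c.B * A * (d ^ 2 * ℓ) ≤ Z * (d ^ 2 * ℓ) :=
      mul_le_mul_of_nonneg_right (by linarith) hY0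
    have h4 := mul_le_mul_of_nonneg_left (h1.trans (mul_le_mul_of_nonneg_left hι (by norm_num)))
      (by linarith : 0 ≤ 8 * c.B)
    linarith
  · obtain ⟨hb1, hbm⟩ := hBh h hh
    have hT := P.one_le_T
    have hH := P.one_le_H
    have hm := P.one_le_maxB
    have h1 : (d : ℝ) + c.T * (c.T * c.H) / (1 / (4 * c.Bh h ^ 2)) ≤
        5 * (d * (c.T ^ 2 * (c.H * c.maxB ^ 2))) := by
      have e1 : (c.T : ℝ) * (c.T * c.H) / (1 / (4 * c.Bh h ^ 2)) =
        4 * (c.T ^ 2 * (c.H * c.Bh h ^ 2)) := by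
          have : c.Bh h ≠ 0 := by linarith
          field_simp
      have e2 : (c.T : ℝ) ^ 2 * (c.H * c.Bh h ^ 2) ≤ c.T ^ 2 * (c.H * c.maxB ^ 2) := by gcongr
      have e3 : 1 ≤ (c.T : ℝ) ^ 2 * (c.H * c.maxB ^ 2) :=
        one_le_mul_of_one_le_of_one_le (one_le_pow₀ hT)
          (one_le_mul_of_one_le_of_one_le hH (one_le_pow₀ hm))
      have e4 : (c.T : ℝ) ^ 2 * (c.H * c.maxB ^ 2) ≤ d * (c.T ^ 2 * (c.H * c.maxB ^ 2)) :=
        le_mul_of_one_le_left (by linarith) hd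
      have e5 : (d : ℝ) ≤ d * (c.T ^ 2 * (c.H * c.maxB ^ 2)) :=
        le_mul_of_one_le_right (by linarith) e3
      rw [e1]; linarith
    have hlog5 : Real.log 5 ≤ 4 := (Real.log_le_sub_one_of_pos (by norm_num)).trans (by norm_num)
    have h2 : Real.log (d + c.T * (c.T * c.H) / (1 / (4 * c.Bh h ^ 2))) ≤ 7 * ℓ := by
      refine (Real.log_le_log (by positivity) h1).trans ?_
      rw [Real.log_mul (by norm_num) (by positivity), Real.log_mul (by positivity) (by positivity),
        Real.log_mul (by positivity) (by positivity), Real.log_mul (by positivity) (by positivity),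
        Real.log_pow, Real.log_pow]
      push_cast
      have := P.sum_log_le
      have := P.two_le_logδ
      have := Real.log_nonneg hT
      have := Real.log_nonneg hH
      have := Real.log_nonneg hm
      have := Real.log_nonneg hd
      linarith
    have h3 := mul_le_mul_of_nonneg_left h2 (by linarith : 0 ≤ (d : ℝ))
    have h4 : 14 * (d * ℓ) ≤ Z * (d * ℓ) := mul_le_mul_of_nonneg_right (by linarith) hD0
    linarith
  · exact one_le_mul_of_one_le_of_one_le hκu (one_le_pow₀ (by linarith))
  · rw [mul_pow]
    refine mul_le_mul_of_nonneg_right ?_ (sq_nonneg _)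
    have h1 : Z ≤ Z ^ 2 := le_self_pow₀ hZ1 (by norm_num)
    linarith

end LogBounds


/-! ### Choice of `κ`, of the nets and of the confidence levels. -/

/-- How large `κ` has to be. -/
structure KappaLarge (B C κ : ℝ) : Prop where
  ge_const : 14 ≤ κ
  ge_count : Real.log (4096 * B ^ 2) + 1 ≤ κ
  ge_radius : 196 * (6 + Real.log (5 * B ^ 2)) + 2 * B + 2 ≤ κ
  ge_cover : 60 + 6 * C + Real.log (5 * B ^ 2) + 6 * Real.log (sizeConst B C κ) ≤ 9 * κ

/-- The fineness of the net depends on the radii and hence on `κ`, so `κ` occurs on both sides of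
`ge_cover`; but on the left only through a logarithm. For `B < 2` no admissible situation exists and
nothing is claimed. -/
theorem exists_kappaLarge (B C : ℝ) (hC : 0 ≤ C) :
    ∃ κ₀, ∀ κ ≥ κ₀, 2 ≤ B → KappaLarge B C κ := by
  by_cases hB : 2 ≤ B
  swap
  · exact ⟨0, fun κ _ h => absurd h hB⟩
  have hB2 : 1 ≤ B ^ 2 := one_le_pow₀ (by linarith)
  have hl5 : 0 ≤ Real.log (5 * B ^ 2) := Real.log_nonneg (by linarith)
  have hl4 : 0 ≤ Real.log (4096 * B ^ 2) := Real.log_nonneg (by linarith)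
  set p := 2 * C + (Real.log (4096 * B ^ 2) + 1) + 1 + B with hp
  have hp1 : 1 ≤ p := by linarith
  have hlp : 0 ≤ Real.log (700 * p ^ 2) := Real.log_nonneg (by nlinarith)
  have hl18 : 0 ≤ Real.log 18 := Real.log_nonneg (by norm_num)
  refine ⟨14 + (Real.log (4096 * B ^ 2) + 1) + (196 * (6 + Real.log (5 * B ^ 2)) + 2 * B + 2) +
    (61 + 6 * C + Real.log (5 * B ^ 2) + 6 * Real.log (700 * p ^ 2) + 18 * Real.log 18),
    fun κ hκ _ => ⟨by linarith, by linarith, by linarith, ?_⟩⟩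
  have h1 : sizeConst B C κ = 700 * p ^ 2 * (1 + κ) ^ 3 := by rw [sizeConst]; ring
  have hκ1 : 0 < 1 + κ := by linarith
  -- In `ge_cover` this logarithm has the factor `6 · 3 = 18`, so it costs `1 + κ` plus a constant,
  -- against `9 κ`.
  have h2 : Real.log (1 + κ) ≤ (1 + κ) / 18 + Real.log 18 := by
    have h3 := Real.log_le_sub_one_of_pos (show 0 < (1 + κ) / 18 by positivity)
    rw [Real.log_div hκ1.ne' (by norm_num)] at h3
    linarith
  have h4 : Real.log (700 * p ^ 2 * (1 + κ) ^ 3) = Real.log (700 * p ^ 2) + 3 * Real.log (1 + κ) := by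
    rw [Real.log_mul (by positivity) (by positivity), Real.log_pow]
    norm_num
  rw [h1, h4]
  linarith

namespace LogBounds

variable {X A : Type*} {d : ℕ} {c : Config X A d} {C n a a₁ a₂ g : ℝ}

theorem exp_bounds (P : LogBounds c C n a a₁ a₂ g) :
    (c.T : ℝ) ^ 2 * c.H ≤ Real.exp c.logFactor ∧ (c.T : ℝ) * c.H ≤ Real.exp c.logFactor ∧
    (d : ℝ) ≤ Real.exp c.logFactor ∧ c.maxB ≤ Real.exp c.logFactor ∧
    (d : ℝ) ^ 2 * c.logFactor ≤ Real.exp c.logFactor ^ 3 ∧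
    18 * Real.exp (-(2 * c.logFactor)) ≤ c.δ := by
  have hT := P.one_le_T
  have hH := P.one_le_H
  have hd := P.one_le_d
  have hm := P.one_le_maxB
  have hδ := P.δ_pos
  have lT := Real.log_nonneg hT
  have lH := Real.log_nonneg hH
  have ld := Real.log_nonneg hd
  have lm := Real.log_nonneg hm
  have hs := P.sum_log_le
  have hl := P.two_le_logδ
  have hℓ := P.four_le_ℓ
  have key : ∀ {x : ℝ}, 0 < x → Real.log x ≤ c.logFactor → x ≤ Real.exp c.logFactor :=
    fun hx h => (Real.log_le_iff_le_exp hx).1 h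
  have hde : (d : ℝ) ≤ Real.exp c.logFactor := key (by linarith) (by linarith)
  refine ⟨key (by positivity) ?_, key (by positivity) ?_, hde, key (by linarith) (by linarith), ?_,
    ?_⟩
  · rw [Real.log_mul (by positivity) (by positivity), Real.log_pow]; push_cast; linarith
  · rw [Real.log_mul (by positivity) (by positivity)]; linarith
  · have h1 : c.logFactor ≤ Real.exp c.logFactor := by
      linarith [Real.add_one_le_exp c.logFactor]
    calc (d : ℝ) ^ 2 * c.logFactor ≤ Real.exp c.logFactor ^ 2 * Real.exp c.logFactor := by gcongr
      _ = _ := by ring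
  · have h1 : 1 / c.δ ≤ Real.exp c.logFactor := key (by positivity) (by linarith)
    have h2 : Real.exp (-(2 * c.logFactor)) =
        (1 / Real.exp c.logFactor) * (1 / Real.exp c.logFactor) := by
      rw [one_div, ← Real.exp_neg, ← Real.exp_add]; congr 1; ring
    have h3 : 1 / Real.exp c.logFactor ≤ c.δ := by
      rw [div_le_iff₀ (Real.exp_pos _)]
      rw [div_le_iff₀ hδ] at h1
      linarith
    have h4 : 18 * (1 / Real.exp c.logFactor) ≤ 1 := by
      rw [mul_one_div, div_le_one (Real.exp_pos _)]
      have h5 : Real.exp 4 ≤ Real.exp c.logFactor := Real.exp_le_exp.2 hℓ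
      have h6 : Real.exp 4 = Real.exp 1 ^ 4 := by rw [← Real.exp_nat_mul]; norm_num
      have h7 : (2.7 : ℝ) ^ 4 ≤ Real.exp 1 ^ 4 :=
        pow_le_pow_left₀ (by norm_num) (by linarith [Real.exp_one_gt_d9]) 4
      norm_num at h7
      linarith
    rw [h2]
    calc 18 * (1 / Real.exp c.logFactor * (1 / Real.exp c.logFactor)) =
        18 * (1 / Real.exp c.logFactor) * (1 / Real.exp c.logFactor) := by ring
      _ ≤ 1 * c.δ := mul_le_mul h4 h3 (by positivity) (by norm_num)
      _ = c.δ := one_mul _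

/-- The number of dyadic scales. -/
theorem exists_scales (P : LogBounds c C n a a₁ a₂ g) :
    ∃ K₀ : ℕ, 4 * c.B ^ 2 * (c.T ^ 2 * c.H) + 1 ≤ (4 : ℝ) ^ K₀ ∧
      (K₀ : ℝ) ≤ Real.log (5 * c.B ^ 2) + 2 * Real.log c.T + Real.log c.H + 1 := by
  have hT := P.one_le_T
  have hH := P.one_le_H
  have hB : 1 ≤ c.B ^ 2 := one_le_pow₀ (by linarith [P.two_le_B])
  have h1 : 1 ≤ c.B ^ 2 * (c.T ^ 2 * c.H) := one_le_mul_of_one_le_of_one_le hB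
    (one_le_mul_of_one_le_of_one_le (one_le_pow₀ hT) hH)
  set x := 4 * c.B ^ 2 * (c.T ^ 2 * c.H) + 1 with hx
  have hx1 : 1 ≤ x := by linarith
  refine ⟨⌈Real.log x⌉₊, ?_, ?_⟩
  · have h2 : Real.log x ≤ ⌈Real.log x⌉₊ := Nat.le_ceil _
    calc x = Real.exp (Real.log x) := (Real.exp_log (by linarith)).symm
      _ ≤ Real.exp (⌈Real.log x⌉₊ * 1) := Real.exp_le_exp.2 (by linarith)
      _ = Real.exp 1 ^ ⌈Real.log x⌉₊ := Real.exp_nat_mul _ _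
      _ ≤ 4 ^ ⌈Real.log x⌉₊ :=
        pow_le_pow_left₀ (Real.exp_pos _).le (by linarith [Real.exp_one_lt_d9]) _
  · have h2 := (Nat.ceil_lt_add_one (Real.log_nonneg hx1)).le
    have h3 : Real.log x ≤ Real.log (5 * c.B ^ 2 * (c.T ^ 2 * c.H)) :=
      Real.log_le_log (by linarith) (by linarith)
    have h4 : Real.log (5 * c.B ^ 2 * (c.T ^ 2 * c.H)) =
        Real.log (5 * c.B ^ 2) + (2 * Real.log c.T + Real.log c.H) := by
      rw [Real.log_mul (show 5 * c.B ^ 2 ≠ 0 by positivity) (by positivity),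
        Real.log_mul (show (c.T : ℝ) ^ 2 ≠ 0 by positivity) (by positivity), Real.log_pow]
      norm_num
    linarith

/-- The resolution of the nets of value functions. -/
noncomputable def netError (c : Config X A d) (C : ℝ) : ℝ :=
  1 / (16 * sizeConst c.B C c.κ * Real.exp c.logFactor ^ 3)

/-- The resolution of the nets of Gram matrices. -/
noncomputable def gramError (c : Config X A d) (C : ℝ) : ℝ :=
  1 / (2304 * sizeConst c.B C c.κ ^ 3 * Real.exp c.logFactor ^ 10)

/-- Both squared radii plus one are at most `A e³`, and `d ≤ e`, where `e` is the exponential of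
`ℓ`. The constant is `2304 = 48²`, and the three square roots add up to `3/48 = 1/16`. -/
theorem netError_ge (P : LogBounds c C n a a₁ a₂ g) (hκ : 0 ≤ c.κ) :
    √(gramError c C * d) * (2 * √(c.β₁ ^ 2 + 1) + √(c.β₂ ^ 2 + 1)) ≤ netError c C := by
  obtain ⟨hA, -, hβ₁, hβ₂, -⟩ := P.radii_le hκ
  obtain ⟨-, -, hde, -, hYe, -⟩ := P.exp_bounds
  obtain ⟨-, hDY⟩ := P.ℓ_le
  rw [gramError, netError]
  set A := sizeConst c.B C c.κ
  set e := Real.exp c.logFactor with he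
  have he0 : 0 < e := Real.exp_pos _
  have hAe : A * (d ^ 2 * c.logFactor) ≤ A * e ^ 3 := mul_le_mul_of_nonneg_left hYe (by linarith)
  have h1 : √(c.β₁ ^ 2 + 1) ≤ √(A * e ^ 3) := Real.sqrt_le_sqrt
    (hβ₁.trans ((mul_le_mul_of_nonneg_left hDY (by linarith)).trans hAe))
  have h2 : √(c.β₂ ^ 2 + 1) ≤ √(A * e ^ 3) := Real.sqrt_le_sqrt (hβ₂.trans hAe)
  have h3 : √(1 / (2304 * A ^ 3 * e ^ 10) * d) ≤ √(1 / (2304 * A ^ 3 * e ^ 10) * e) :=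
    Real.sqrt_le_sqrt (mul_le_mul_of_nonneg_left hde (by positivity))
  have h4 : √(1 / (2304 * A ^ 3 * e ^ 10) * e) * √(A * e ^ 3) = 1 / (48 * A * e ^ 3) := by
    rw [← Real.sqrt_mul (by positivity), Real.sqrt_eq_iff_mul_self_eq (by positivity) (by positivity)]
    field_simp
    norm_num
  calc _ ≤ √(1 / (2304 * A ^ 3 * e ^ 10) * e) * (2 * √(A * e ^ 3) + √(A * e ^ 3)) := by gcongr
    _ = 3 * (√(1 / (2304 * A ^ 3 * e ^ 10) * e) * √(A * e ^ 3)) := by ring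
    _ = _ := by rw [h4]; field_simp; norm_num

theorem exists_net_size (P : LogBounds c C n a a₁ a₂ g) (hκ : 0 ≤ c.κ)
    (hBh : ∀ h < c.H, 1 ≤ c.Bh h ∧ c.Bh h ≤ c.maxB) :
    ∃ k : ℕ, (∀ h < c.H, 4 * c.Bh h ^ 2 / gramError c C + 1 ≤ k) ∧
      Real.log (2 * k + 1) ≤ (22 + 3 * Real.log (sizeConst c.B C c.κ)) * c.logFactor := by
  obtain ⟨hA, -⟩ := P.radii_le hκ
  obtain ⟨-, -, -, hme, -⟩ := P.exp_bounds
  have hm := P.one_le_maxB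
  have hℓ := P.four_le_ℓ
  have hη : gramError c C = 1 / (2304 * sizeConst c.B C c.κ ^ 3 * Real.exp c.logFactor ^ 10) := rfl
  set A := sizeConst c.B C c.κ
  set e := Real.exp c.logFactor with he
  have he0 : 0 < e := Real.exp_pos _
  have he1 : 1 ≤ e := Real.one_le_exp (by linarith)
  have hη0 : 0 < gramError c C := by rw [hη]; positivity
  refine ⟨⌈4 * c.maxB ^ 2 / gramError c C + 1⌉₊, fun h hh => ?_, ?_⟩
  · refine le_trans ?_ (Nat.le_ceil _)
    have := hBh h hh
    gcongr
    · linarith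
    · exact this.2
  · have h1 := (Nat.ceil_lt_add_one (show 0 ≤ 4 * c.maxB ^ 2 / gramError c C + 1 by positivity)).le
    set k : ℝ := (⌈4 * c.maxB ^ 2 / gramError c C + 1⌉₊ : ℝ)
    have hk0 : 0 ≤ k := by positivity
    have h2 : 4 * c.maxB ^ 2 / gramError c C ≤ 9216 * (A ^ 3 * e ^ 12) := by
      have h3 : 4 * c.maxB ^ 2 / gramError c C = 4 * c.maxB ^ 2 * (2304 * A ^ 3 * e ^ 10) := by
        rw [hη, div_div_eq_mul_div, div_one]
      rw [h3]
      calc _ ≤ 4 * e ^ 2 * (2304 * A ^ 3 * e ^ 10) := by gcongr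
        _ = _ := by ring
    have h4 : 1 ≤ A ^ 3 * e ^ 12 :=
      one_le_mul_of_one_le_of_one_le (one_le_pow₀ hA) (one_le_pow₀ he1)
    -- With `x = A³ e¹² ≥ 1`, rounding up gives `k ≤ 9216 x + 2`, and `2 · 9216 + 5 = 18437`.
    have h5 : 2 * k + 1 ≤ Real.exp 10 * (A ^ 3 * e ^ 12) := by
      have h6 : Real.exp 10 = Real.exp 1 ^ 10 := by rw [← Real.exp_nat_mul]; norm_num
      have h7 : (2.7 : ℝ) ^ 10 ≤ Real.exp 1 ^ 10 :=
        pow_le_pow_left₀ (by norm_num) (by linarith [Real.exp_one_gt_d9]) 10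
      have h8 : (18437 : ℝ) ≤ Real.exp 10 := by
        rw [h6]; refine le_trans (by norm_num) h7
      have h9 := mul_le_mul_of_nonneg_right h8 (by linarith : 0 ≤ A ^ 3 * e ^ 12)
      linarith
    refine (Real.log_le_log (by positivity) h5).trans ?_
    rw [Real.log_mul (by positivity) (by positivity), Real.log_mul (by positivity) (by positivity),
      Real.log_exp, Real.log_pow, Real.log_pow, he, Real.log_exp]
    push_cast
    have h6 : 0 ≤ Real.log A := Real.log_nonneg hA
    have h7 := mul_le_mul_of_nonneg_left hℓ h6
    linarith

/-- With `Lb = ι²` and `cb = 1` the factor in the weighted radius is `14² = 196`. The net error is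
so small that even multiplied by `T² H`, or squared and multiplied by `ι² T H`, it stays below the
required constants. -/
theorem tuned (P : LogBounds c C n a a₁ a₂ g) (hκ : KappaLarge c.B C c.κ) {K₀ : ℕ}
    (hK₀ : 4 * c.B ^ 2 * (c.T ^ 2 * c.H) + 1 ≤ (4 : ℝ) ^ K₀) :
    Tuned c (netError c C) (c.ι ^ 2) ((6 + Real.log (5 * c.B ^ 2)) * c.υ ^ 2) 1 K₀ := by
  have hκ14 := hκ.ge_const
  have hκ0 : 0 ≤ c.κ := by linarith
  obtain ⟨hA, hιA, -, -, -⟩ := P.radii_le hκ0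
  obtain ⟨hT2H, hTH, -, -, hYe, -⟩ := P.exp_bounds
  obtain ⟨hυ2, hυι, -⟩ := P.υ_le hκ0
  have hιge := P.ι_sq_ge hκ0
  have hι0 := P.ι_nonneg
  have hB := P.two_le_B
  have hℓ := P.four_le_ℓ
  have hT := P.one_le_T
  have hH := P.one_le_H
  obtain ⟨hlB4, hlB5⟩ := P.log_B_nonneg
  obtain ⟨hD, hDY⟩ := P.ℓ_le
  have hκY : c.κ * c.logFactor ≤ c.κ * (d ^ 2 * c.logFactor) :=
    mul_le_mul_of_nonneg_left (hD.trans hDY) hκ0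
  have hκY0 : 0 ≤ c.κ * c.logFactor := mul_nonneg hκ0 (by linarith)
  have haY : a ≤ c.κ * (d ^ 2 * c.logFactor) := P.a_le.trans
    ((mul_le_mul_of_nonneg_right hκ.ge_count (by linarith)).trans hκY)
  have hκ2 : c.κ ≤ c.κ ^ 2 := le_self_pow₀ (by linarith) (by norm_num)
  have hκ196 : 196 ≤ c.κ ^ 2 := by nlinarith
  have hι1 : 1 ≤ c.ι ^ 2 := by linarith
  set A := sizeConst c.B C c.κ with hAdef
  set e := Real.exp c.logFactor with he
  have he0 : 0 < e := Real.exp_pos _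
  have he1 : 1 ≤ e := Real.one_le_exp (by linarith)
  have hee : e ≤ e ^ 3 := le_self_pow₀ he1 (by norm_num)
  have hε' : netError c C = 1 / (16 * A * e ^ 3) := rfl
  have hAe : e ^ 3 ≤ A * e ^ 3 := le_mul_of_one_le_left (by positivity) hA
  have hι9 : ∀ x, 0 ≤ x → c.ι ^ 2 ≤ 18 * (n + c.κ * (d ^ 2 * c.logFactor) + x + g) := fun x hx => by
    rw [P.ι_sq hκ0]; linarith [P.n_nonneg, P.two_le_g]
  have hβ : ∀ {x b : ℝ}, 0 ≤ x →
      96 * c.B * c.κ ^ 2 * (n + c.κ * (d ^ 2 * c.logFactor) + x + g) ≤ b →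
      1000 * c.B * c.ι ^ 2 ≤ b := fun {x b} hx hb => by
    refine le_trans ?_ hb
    have h0 : 0 ≤ n + c.κ * (d ^ 2 * c.logFactor) + x + g := by
      linarith [P.n_nonneg, P.two_le_g]
    have h1 := mul_le_mul_of_nonneg_left (hι9 x hx) (by linarith : 0 ≤ 1000 * c.B)
    have h2 := mul_le_mul_of_nonneg_right (mul_le_mul_of_nonneg_left hκ196
      (by linarith : 0 ≤ 96 * c.B)) h0
    have h3 : 0 ≤ c.B * (n + c.κ * (d ^ 2 * c.logFactor) + x + g) := mul_nonneg (by linarith) h0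
    linarith
  refine ⟨by rw [hε']; positivity, hι1, ?_, le_rfl, ?_, ?_, ?_, by linarith,
    hK₀, ?_, hβ P.a₁_nonneg (P.β₂_ge hκ0), hβ P.a₂_nonneg (P.βbar_ge hκ0)⟩
  · nlinarith
  · exact (one_le_sq_iff₀ hι0).1 hι1
  · rw [hε']
    have h1 : 16 * (1 / (16 * A * e ^ 3)) * (c.T ^ 2 * c.H) = (c.T ^ 2 * c.H) / (A * e ^ 3) := by
      field_simp
    rw [h1, div_le_one (by positivity)]
    linarith
  · have hα : c.α ^ 2 = 1 / (c.T * c.H) := by rw [Config.α, Real.sq_sqrt (by positivity)]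
    rw [hα, hε', le_div_iff₀ (by positivity)]
    have h1 : c.ι ^ 2 ≤ A * e ^ 3 :=
      hιA.trans (mul_le_mul_of_nonneg_left hYe (by linarith))
    calc 2 * (1 / (16 * A * e ^ 3)) ^ 2 * c.ι ^ 2 * (c.T * c.H) ≤
        2 * (1 / (16 * A * e ^ 3)) ^ 2 * (A * e ^ 3) * (A * e ^ 3) := by
          have h2 : (c.T : ℝ) * c.H ≤ A * e ^ 3 := by linarith
          have h3 : 2 * (1 / (16 * A * e ^ 3)) ^ 2 * c.ι ^ 2 ≤
              2 * (1 / (16 * A * e ^ 3)) ^ 2 * (A * e ^ 3) :=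
            mul_le_mul_of_nonneg_left h1 (by positivity)
          exact mul_le_mul h3 h2 (by positivity) (by positivity)
      _ = 1 / 128 := by field_simp; norm_num
      _ ≤ 1 := by norm_num
  · refine le_trans ?_ (P.β₁_ge hκ0)
    rw [← P.υ_sq hκ0]
    have h1 : 196 * (6 + Real.log (5 * c.B ^ 2)) + 2 * c.B + 2 ≤ 162 * c.κ ^ 2 := by
      linarith [hκ.ge_radius]
    have h2 := mul_le_mul_of_nonneg_right h1 (sq_nonneg c.υ)
    have h3 : (2 * c.B + 2) * 1 ≤ (2 * c.B + 2) * c.υ ^ 2 :=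
      mul_le_mul_of_nonneg_left (by linarith) (by linarith)
    linarith

theorem sqrt_La_le (P : LogBounds c C n a a₁ a₂ g) (hκ : KappaLarge c.B C c.κ) :
    √((6 + Real.log (5 * c.B ^ 2)) * c.υ ^ 2) ≤ c.ι ^ 2 := by
  have hκ14 := hκ.ge_const
  have hκ0 : 0 ≤ c.κ := by linarith
  obtain ⟨hυ2, hυι, -⟩ := P.υ_le hκ0
  have hιge := P.ι_sq_ge hκ0
  have hB := P.two_le_B
  have hℓ := P.four_le_ℓ
  obtain ⟨-, hlB5⟩ := P.log_B_nonneg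
  obtain ⟨hD, hDY⟩ := P.ℓ_le
  have hκY : c.κ * 1 ≤ c.κ * (d ^ 2 * c.logFactor) :=
    mul_le_mul_of_nonneg_left (by linarith) hκ0
  refine Real.sqrt_le_iff.2 ⟨sq_nonneg _, ?_⟩
  rw [sq (c.ι ^ 2)]
  exact mul_le_mul (by linarith [hκ.ge_radius]) hυι (sq_nonneg _) (sq_nonneg _)

/-- Each of the three terms is at most `δ / 3`. In the first, the size of the net is `e` to a
multiple of `d² ℓ`, which `ι² ≥ 9 κ d² ℓ` outweighs by `ge_cover`. In the second there is no net,
and a multiple of `υ²`, which contains `2 log 𝒩`, suffices. -/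
theorem failure_le (P : LogBounds c C n a a₁ a₂ g) (hκ : KappaLarge c.B C c.κ) {K₀ k : ℕ}
    (hK₀ : (K₀ : ℝ) ≤ Real.log (5 * c.B ^ 2) + 2 * Real.log c.T + Real.log c.H + 1)
    (hk : Real.log (2 * k + 1) ≤ (22 + 3 * Real.log (sizeConst c.B C c.κ)) * c.logFactor) :
    c.H * (c.T * (c.N * (c.N * ((K₀ + 3) *
      (3 * c.N * (2 * k + 1) ^ (2 * d ^ 2) * Real.exp (-c.ι ^ 2)))))) +
      c.H * (c.T * (c.N * (c.N * ((K₀ + 1) *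
      Real.exp (-((6 + Real.log (5 * c.B ^ 2)) * c.υ ^ 2)))))) +
      6 * Real.exp (-(2 * c.logFactor)) ≤ c.δ := by
  have hκ0 : 0 ≤ c.κ := by linarith [hκ.ge_const]
  obtain ⟨hA, -⟩ := P.radii_le hκ0
  obtain ⟨-, -, -, -, -, hδ3⟩ := P.exp_bounds
  obtain ⟨hυ2, hυι, -⟩ := P.υ_le hκ0
  have hυeq := P.υ_sq hκ0
  have hιge := P.ι_sq_ge hκ0
  have hℓ := P.four_le_ℓ
  have hT := P.one_le_T
  have hH := P.one_le_H
  have hd := P.one_le_d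
  have hδ := P.δ_pos
  have hs := P.sum_log_le
  have hg := P.log_le_g
  have lT := Real.log_nonneg hT
  have lH := Real.log_nonneg hH
  have ld := Real.log_nonneg hd
  have lm := Real.log_nonneg P.one_le_maxB
  obtain ⟨hlB4, hlB5⟩ := P.log_B_nonneg
  obtain ⟨hD, hDY⟩ := P.ℓ_le
  have lA : 0 ≤ Real.log (sizeConst c.B C c.κ) := Real.log_nonneg hA
  have eT : (c.T : ℝ) = Real.exp (Real.log c.T) := (Real.exp_log (by linarith)).symm
  have eH : (c.H : ℝ) = Real.exp (Real.log c.H) := (Real.exp_log (by linarith)).symm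
  have eδ : c.δ = Real.exp (-Real.log (1 / c.δ)) := by
    rw [one_div, Real.log_inv, neg_neg, Real.exp_log hδ]
  have h3 : (3 : ℝ) ≤ Real.exp 2 := by linarith [Real.add_one_le_exp (2 : ℝ)]
  have hK3 : (K₀ : ℝ) + 3 ≤ Real.exp (K₀ + 2) := by linarith [Real.add_one_le_exp ((K₀ : ℝ) + 2)]
  have hK1 : (K₀ : ℝ) + 1 ≤ Real.exp K₀ := Real.add_one_le_exp _
  have hpow : (2 * (k : ℝ) + 1) ^ (2 * d ^ 2) = Real.exp (2 * d ^ 2 * Real.log (2 * k + 1)) := by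
    rw [← Real.rpow_natCast, Real.rpow_def_of_pos (by positivity)]
    push_cast; ring_nf
  have hδ' : ∀ x : ℝ, x + Real.log (1 / c.δ) + 2 ≤ 0 → 3 * Real.exp x ≤ c.δ := fun x hx => by
    calc 3 * Real.exp x ≤ Real.exp 2 * Real.exp x :=
          mul_le_mul_of_nonneg_right h3 (Real.exp_pos _).le
      _ = Real.exp (2 + x) := (Real.exp_add _ _).symm
      _ ≤ Real.exp (-Real.log (1 / c.δ)) := Real.exp_le_exp.2 (by linarith)
      _ = c.δ := eδ.symm
  have hX1 : 3 * (c.H * (c.T * (c.N * (c.N * ((K₀ + 3) *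
      (3 * c.N * (2 * k + 1) ^ (2 * d ^ 2) * Real.exp (-c.ι ^ 2))))))) ≤ c.δ := by
    have h4 : c.H * (c.T * (c.N * (c.N * ((K₀ + 3) *
        (3 * c.N * (2 * k + 1) ^ (2 * d ^ 2) * Real.exp (-c.ι ^ 2)))))) ≤
        Real.exp (Real.log c.H + (Real.log c.T + (n + (n + ((K₀ + 2) +
        (2 + n + 2 * d ^ 2 * Real.log (2 * k + 1) + -c.ι ^ 2)))))) := by
      simp only [Real.exp_add (Real.log c.H), Real.exp_add (Real.log c.T), Real.exp_add n]
      rw [← eT, ← eH, P.N_eq, hpow, Real.exp_add ((K₀ : ℝ) + 2), Real.exp_add _ (-c.ι ^ 2),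
        Real.exp_add (2 + n), Real.exp_add 2 n]
      gcongr
    refine (mul_le_mul_of_nonneg_left h4 (by norm_num)).trans (hδ' _ ?_)
    have h5 : 2 * d ^ 2 * Real.log (2 * k + 1) ≤
        2 * d ^ 2 * ((22 + 3 * Real.log (sizeConst c.B C c.κ)) * c.logFactor) :=
      mul_le_mul_of_nonneg_left hk (by positivity)
    have h6 := mul_le_mul_of_nonneg_right hκ.ge_cover (show 0 ≤ (d : ℝ) ^ 2 * c.logFactor by linarith)
    have h7 : 6 * C * (d * c.logFactor) ≤ 6 * C * (d ^ 2 * c.logFactor) :=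
      mul_le_mul_of_nonneg_left hDY (by linarith [P.C_nonneg])
    have h8 : Real.log (5 * c.B ^ 2) * 1 ≤ Real.log (5 * c.B ^ 2) * (d ^ 2 * c.logFactor) :=
      mul_le_mul_of_nonneg_left (by linarith) hlB5
    have := P.n_le
    linarith
  have hX2 : 3 * (c.H * (c.T * (c.N * (c.N * ((K₀ + 1) *
      Real.exp (-((6 + Real.log (5 * c.B ^ 2)) * c.υ ^ 2))))))) ≤ c.δ := by
    have h4 : c.H * (c.T * (c.N * (c.N * ((K₀ + 1) *
        Real.exp (-((6 + Real.log (5 * c.B ^ 2)) * c.υ ^ 2)))))) ≤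
        Real.exp (Real.log c.H + (Real.log c.T + (n + (n + (K₀ +
        -((6 + Real.log (5 * c.B ^ 2)) * c.υ ^ 2)))))) := by
      simp only [Real.exp_add (Real.log c.H), Real.exp_add (Real.log c.T), Real.exp_add n]
      rw [← eT, ← eH, P.N_eq, Real.exp_add (K₀ : ℝ)]
      gcongr
    refine (mul_le_mul_of_nonneg_left h4 (by norm_num)).trans (hδ' _ ?_)
    have h5 : Real.log (5 * c.B ^ 2) * 1 ≤ Real.log (5 * c.B ^ 2) * c.υ ^ 2 :=
      mul_le_mul_of_nonneg_left (by linarith) hlB5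
    linarith [P.a_nonneg, P.n_nonneg, P.two_le_g, P.two_le_logδ]
  linarith

end LogBounds


/-! ### Conclusion. -/

/-- The constant of the regret bound. -/
noncomputable def regretConst (B C κ κu : ℝ) : ℝ :=
  6005 * (32 * (1 + B) * sizeConst B C κ + 14 + κu) ^ 6

theorem LogBounds.gramError_pos {X A : Type*} {d : ℕ} {c : Config X A d} {C n a a₁ a₂ g : ℝ}
    (P : LogBounds c C n a a₁ a₂ g) (hκ : 0 ≤ c.κ) : 0 < gramError c C := by
  obtain ⟨hA, -⟩ := P.radii_le hκ
  have h0 : 0 < sizeConst c.B C c.κ := by linarith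
  rw [gramError]
  positivity

/-- The regret of VOQL when its constants are large enough. -/
theorem RunSetting.regret_le {X A Ω : Type*} [MeasurableSpace X] [TopologicalSpace A]
    [PolishSpace A] [CompactSpace A] [MeasurableSpace A] [BorelSpace A] [MeasurableSpace Ω]
    {d : ℕ} {M : MDP X A} {c : Config X A d} {Pr : Measure Ω} [IsProbabilityMeasure Pr]
    {D : Ω → Transcript X A} [Nonempty X] [Nonempty A] (S : RunSetting M c Pr D) {C : ℝ}
    (hC : 0 ≤ C)
    (hcard : ∀ h < M.H, Real.log (c.F h).card ≤ C * d * Real.log (1 + c.Bh h / c.ε))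
    (hκ : 2 ≤ c.B → KappaLarge c.B C c.κ) (hκu : 1 ≤ c.κu) :
    ∫ ω, regret M Pr D c.T ω ∂Pr ≤ regretConst c.B C c.κ c.κu * c.logFactor ^ 6 *
      (d * √(M.H * c.T) + (d : ℝ) ^ 6 * (M.H : ℝ) ^ 5) ∧
    1 - c.δ ≤ Pr.real {ω | regret M Pr D c.T ω ≤ regretConst c.B C c.κ c.κu * c.logFactor ^ 6 *
      (d * √(M.H * c.T) + (d : ℝ) ^ 6 * (M.H : ℝ) ^ 5)} := by
  obtain ⟨n, a, a₁, a₂, g, P⟩ := exists_logBounds S.toLinSetting hC hcard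
  have hκL := hκ P.two_le_B
  have hκ0 : 0 ≤ c.κ := by linarith [hκL.ge_const]
  have hBh : ∀ h < c.H, 1 ≤ c.Bh h ∧ c.Bh h ≤ c.maxB := fun h hh =>
    ⟨S.one_le_Bh (S.horizon ▸ hh),
      le_ciSup (f := fun h : Fin c.H => c.Bh h) (Set.finite_range _).bddAbove ⟨h, hh⟩⟩
  obtain ⟨K₀, hK₀, hK₀'⟩ := P.exists_scales
  obtain ⟨k, hk, hk'⟩ := P.exists_net_size hκ0 hBh
  have h := S.regret_le_of_rates (P.tuned hκL hK₀) (P.rates hκ0 hκu hBh) (P.sqrt_La_le hκL)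
    (P.gramError_pos hκ0) hk (P.N_eq ▸ Real.one_le_exp P.n_nonneg) (P.netError_ge hκ0)
    (P.failure_le hκL hK₀' hk')
  rwa [mul_pow, ← mul_assoc, ← regretConst, S.horizon] at h

end VOQL

theorem mainTheorem2 :
    ∃ k : ℕ, ∀ B C₀ : ℝ, ∃ κ₀ : ℝ, ∀ κ ≥ κ₀, ∃ κ₁ : ℝ, ∀ κu ≥ κ₁, ∃ C : ℝ,
      ∀ (X A Ω : Type*) [MeasurableSpace X]
        [TopologicalSpace A] [CompactSpace A] [PolishSpace A] [MeasurableSpace A] [BorelSpace A]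
        [MeasurableSpace Ω] (Pr : MeasureTheory.Measure Ω) [MeasureTheory.IsProbabilityMeasure Pr]
        (M : VOQL.MDP X A) (d : ℕ) (c : VOQL.Config X A d) (D : Ω → VOQL.Transcript X A),
      -- the MDP is linear and its linear classes are bounded by `B` and complete
      VOQL.IsLinear M c.φ c.Bh →
      VOQL.Complete M (VOQL.linClass c.φ c.Bh) 0 →
      (∀ h < M.H, ∀ f ∈ VOQL.linClass c.φ c.Bh h, ∀ z, |f z| ≤ B) →
      -- the algorithm works with covers of the linear classes
      (∀ h < M.H, VOQL.IsCover (VOQL.linClass c.φ c.Bh h) c.ε (c.F h) ∧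
        Real.log (c.F h).card ≤ C₀ * d * Real.log (1 + c.Bh h / c.ε)) →
      -- the parameters
      1 ≤ c.T → 1 ≤ M.H → c.B = B → c.κ = κ → c.κu = κu →
      0 < c.ε → c.ε ≤ 1 / (8 * M.H * c.T ^ 2) →
      0 < c.δ → c.δ < 1 / (c.T + M.H ^ 2 + 11) →
      -- the run and its regret
      VOQL.IsRun M c Pr D →
      (∫ ω, VOQL.regret M Pr D c.T ω ∂Pr
        ≤ C * c.logFactor ^ k *
          (d * Real.sqrt (M.H * c.T) + d ^ 6 * M.H ^ 5)) ∧
      1 - c.δ ≤ Pr.real {ω | VOQL.regret M Pr D c.T ω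
        ≤ C * c.logFactor ^ k *
          (d * Real.sqrt (M.H * c.T) + d ^ 6 * M.H ^ 5)} := by
  refine ⟨6, fun B C₀ => ?_⟩
  -- `C₀` is an arbitrary real number; its positive part also bounds the logarithmic cardinalities.
  obtain ⟨κ₀, hκ₀⟩ := VOQL.exists_kappaLarge B (max C₀ 0) (le_max_right _ _)
  refine ⟨κ₀, fun κ hκ => ⟨1, fun κu hκu => ⟨VOQL.regretConst B (max C₀ 0) κ κu, ?_⟩⟩⟩
  intro X A Ω _ _ _ _ _ _ _ Pr _ M d c D hlin hcomp hbound hcover hT hH hB hcκ hcκu hε hε' hδ hδ' hrun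
  -- A probability space has a point, and the transcript there provides a state and an action.
  obtain ⟨ω₀⟩ := MeasureTheory.nonempty_of_isProbabilityMeasure Pr
  have : Nonempty X := ⟨(D ω₀).x 0 0⟩
  have : Nonempty A := ⟨(D ω₀).a 0 0⟩
  subst hB hcκ hcκu
  have S : VOQL.RunSetting M c Pr D :=
    { horizon := hrun.horizon
      lin := hlin
      complete := hcomp
      bound := hbound
      cover := fun h hh => (hcover h hh).1
      T_pos := hT
      H_pos := hH
      ε_pos := hε
      ε_le := hε'
      δ_pos := hδ
      δ_lt := hδ'
      run := hrun }
  refine S.regret_le (le_max_right _ _) (fun h hh => (hcover h hh).2.trans ?_) (hκ₀ _ hκ) hκu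
  have h1 := S.one_le_Bh hh
  have h2 : 0 ≤ Real.log (1 + c.Bh h / c.ε) :=
    Real.log_nonneg (le_add_of_nonneg_right (div_nonneg (by linarith) hε.le))
  gcongr
  exact le_max_left _ _
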